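/- Let $n\ge 1$. For $i=1,2$ let $\Sigma_i$ be a compact smooth $2n$-manifold with boundary and $\beta_i$ a smooth $1$-form on $\Sigma_i$ such that $d\beta_i$ is symplectic and the boundary is convex, i.e. the Liouville vector field $X_i$ defined by $d\beta_i(X_i,\cdot)=\beta_i$ points strictly outwards along $\partial\Sigma_i$. Let $\phi_i\in\mathrm{Exact}(\Sigma_i,\partial\Sigma_i,d\beta_i)$, i.e. $\phi_i$ is a diffeomorphism of $\Sigma_i$ that is the identity near $\partial\Sigma_i$ and $\phi_i^*\beta_i-\beta_i=dh_i$ for a smooth function $h_i$. Suppose that $\Sigma_1,\Sigma_2$ have the same convex boundary: there are a closed smooth $(2n-1)$-manifold $Y$ and collars $c_i:Y\times[0,1)\to\Sigma_i$ (diffeomorphisms onto open neighbourhoods of $\partial \Sigma_i$ with $c_i(Y\times\{0\})=\partial\Sigma_i$) such that, for $j_i=c_i(\cdot,0)$, the co-oriented contact structures $\ker(j_1^*\beta_1)$ and $\ker(j_2^*\beta_2)$ on $Y$ coincide, i.e. $j_2^*\beta_2$ is a positive multiple of $j_1^*\beta_1$ at each point. The folded sum $\mathcal M$ of the contact mapping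 tori $\mathcal M(\Sigma_i,\phi_i)=\Sigma_i\times\mathbb R/\big((x,t)\sim(\phi_i(x),t+1)\big)$ is the quotient space obtained from their disjoint union by identifying $[j_1(y),t]$ with $[j_2(y),t]$ for $y\in Y$, $t\in\mathbb R$, with the projection $\pi:\mathcal M\to S^1=\mathbb R/\mathbb Z$, $[x,t]\mapsto t$. Its smooth structure is the one obtained by gluing along the collars: the natural maps $\operatorname{int}\Sigma_i\times\mathbb R\to\mathcal M$ are local diffeomorphisms, and so is the two-sided collar $C: Y\times(-1,1)\times\mathbb R\to\mathcal M$, $C(y,t,s)=[c_1(y,-t),s]$ for $t\le 0$ and $C(y,t,s)=[c_2(y,t),s]$ for $t\geq0$. The fibers of $\pi$ are the closed $2n$-manifolds $\Sigma_1\cup_Y\overline{\Sigma}_2$. Then $\mathcal M$ carries a contact form $\sigma$ (so a co-oriented contact structure $\eta=\ker\sigma$) that is compatible with $\pi$: for every $\theta\in S^1$, $\omega_\theta:=d\sigma|_{\pi^{-1}(\theta)}$ is a folded exact symplectic form on the submanifold $\pi^{-1}(\theta)$, that is, $\omega_\theta$ is exact, $\omega_\theta^n$ is transverse to the zero section of the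 bundle of top-degree forms, and the restriction of $\omega_\theta$ to the hypersurface (fold) $\{\omega_\theta^n=0\}$ has maximal rank $2n-2$. Moreover this fold is exactly the copy of $Y$ in $\pi^{-1}(\theta)$. In addition, for every $\kappa\in(0,1)$, $\sigma$ can be chosen with the following properties. (a) There are $K>0$ and bundle contact forms $\lambda_{\beta_1}+K\,d\theta$ on $\mathcal M(\Sigma_1,\phi_1)$ and $\lambda_{\beta_2}-K\,d\theta$ on $\mathcal M(\Sigma_2,\phi_2)$ which agree with $\sigma$ on the points $[x,t]$ with $x\in\Sigma_i\setminus c_i(Y\times[0,\kappa))$. Here, on $\Sigma_i\times\mathbb R$, $\lambda_{\beta_i}=\sum_{k\in\mathbb Z}a_i(t+k)\,(\phi_i^k)^*\beta_i$ for a smooth compactly supported function $a_i\ge 0$ on $\mathbb R$ with $\sum_{k}a_i(t+k)=1$ for all $t$. (b) There are $\delta\in(0,\kappa)$ and smooth functions $f,g:\mathbb R\to\mathbb R$, $f$ even and $g$ odd, such that, for $|t|<\delta$, $f>0$, $f'g-fg'>0$, and $f'(t)=0$ if and only if $t=0$, and such that $C^*\sigma=f(t)\,\alpha+g(t)\,d\theta$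 on $Y\times(-\delta,\delta)\times\mathbb R$, where $\alpha=j_1^*\beta_1$ and $\theta$ is the last coordinate. -/

import Mathlib

open Set Manifold Topology
open scoped ContDiff

noncomputable section

namespace FoldedContact

/-! ### Differential forms on manifolds (possibly with boundary) -/

section Forms

variable {E : Type*} [NormedAddCommGroup E] [NormedSpace ℝ E]
  {H : Type*} [TopologicalSpace H] (I : ModelWithCorners ℝ E H)
  {M : Type*} [TopologicalSpace M] [ChartedSpace H M]
  {E' : Type*} [NormedAddCommGroup E'] [NormedSpace ℝ E']
  {H' : Type*} [TopologicalSpace H'] (I' : ModelWithCorners ℝ E' H')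
  {N : Type*} [TopologicalSpace N] [ChartedSpace H' N]
  {k : ℕ}

/-- A (not necessarily smooth) differential `k`-form on `M`. -/
abbrev DForm (M : Type*) [TopologicalSpace M] [ChartedSpace H M] (k : ℕ) : Type _ :=
  ∀ x : M, TangentSpace I x [⋀^Fin k]→L[ℝ] ℝ

/-- The expression of a form in the preferred chart at `p`, i.e. its pullback under the inverse of
that chart. -/
def inChart (ζ : DForm I M k) (p : M) : E → E [⋀^Fin k]→L[ℝ] ℝ := fun u =>
  (ζ ((extChartAt I p).symm u)).compContinuousLinearMap
    (mfderivWithin 𝓘(ℝ, E) I (extChartAt I p).symm (range I) u)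

/-- A form is smooth if its expressions in charts are. -/
def IsSmoothForm (ζ : DForm I M k) : Prop :=
  ∀ p : M, ContDiffOn ℝ ∞ (inChart I ζ p) (extChartAt I p).target

/-- The exterior derivative, computed in the preferred chart at each point. -/
def extD (ζ : DForm I M k) : DForm I M (k + 1) := fun p =>
  (extDerivWithin (inChart I ζ p) (range I) (extChartAt I p p)).compContinuousLinearMap
    (mfderiv I 𝓘(ℝ, E) (extChartAt I p) p)

/-- The pullback of a form on `M` under a map `F : N → M`. -/
def pullback (F : N → M) (ζ : DForm I M k) : DForm I' N k := fun x =>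
  (ζ (F x)).compContinuousLinearMap (mfderiv I' I F x)

/-- The differential of a function, as a `1`-form. -/
def dFun (h : M → ℝ) : DForm I M 1 := fun x =>
  ContinuousAlternatingMap.ofSubsingleton ℝ (TangentSpace I x) ℝ (0 : Fin 1) (mvfderiv I h x)

/-- A contact form: a smooth nowhere vanishing `1`-form `σ` such that `dσ` is nondegenerate on the
hyperplane field `Ker σ` (on a manifold of dimension `2n + 1`: `σ ∧ (dσ)ⁿ` vanishes nowhere). -/
structure IsContactForm (σ : DForm I M 1) : Prop where
  smooth : IsSmoothForm I σ
  ne_zero : ∀ x, σ x ≠ 0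
  nondegenerate : ∀ (x : M) (v : TangentSpace I x), σ x ![v] = 0 →
    (∀ w : TangentSpace I x, σ x ![w] = 0 → extD I σ x ![v, w] = 0) → v = 0

end Forms

/-- The `n`-th wedge power `ζ ∧ ⋯ ∧ ζ` of an alternating `2`-form, evaluated at `2n` vectors (indexed
by `n` pairs). -/
def wedgePow {V : Type*} [AddCommGroup V] [Module ℝ V] [TopologicalSpace V] (n : ℕ)
    (ζ : V [⋀^Fin 2]→L[ℝ] ℝ) (v : Fin n × Fin 2 → V) : ℝ :=
  (2 ^ n : ℝ)⁻¹ * ∑ τ : Equiv.Perm (Fin n × Fin 2),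
    ((Equiv.Perm.sign τ : ℤ) : ℝ) * ∏ i : Fin n, ζ ![v (τ (i, 0)), v (τ (i, 1))]

/-! ### Folded symplectic forms -/

section Folded

variable (n : ℕ) {N : Type*} [TopologicalSpace N] [ChartedSpace (EuclideanSpace ℝ (Fin (2 * n))) N]

/-- The locus where the top power `ζⁿ` of a `2`-form on a `2n`-manifold vanishes. -/
def foldLocus (ζ : DForm (𝓡 (2 * n)) N 2) : Set N :=
  {p | ∀ v : Fin n × Fin 2 → TangentSpace (𝓡 (2 * n)) p, wedgePow n (ζ p) v = 0}

/-- The derivative at `p`, in the direction `w`, of the top power `ζⁿ` in the chart at `p`, evaluated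
on constant vectors `v`. -/
def topPowDeriv (ζ : DForm (𝓡 (2 * n)) N 2) (p : N) (w : EuclideanSpace ℝ (Fin (2 * n)))
    (v : Fin n × Fin 2 → EuclideanSpace ℝ (Fin (2 * n))) : ℝ :=
  fderiv ℝ (fun u => wedgePow n (inChart (𝓡 (2 * n)) ζ p u) v) (extChartAt (𝓡 (2 * n)) p p) w

/-- A folded exact symplectic form on a `2n`-manifold: an exact `2`-form `ζ` such that `ζⁿ` is
transverse to the zero section of the line bundle of top forms, and such that the restriction of
`ζ` to the hypersurface `Z = {ζⁿ = 0}` has the maximal possible rank `2n - 2`. At a point of `Z`, the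
tangent space of `Z` consists of the directions in which the derivative of `ζⁿ` is zero. -/
structure IsFoldedExactSymplectic (ζ : DForm (𝓡 (2 * n)) N 2) : Prop where
  exact : ∃ lam : DForm (𝓡 (2 * n)) N 1,
    IsSmoothForm (𝓡 (2 * n)) lam ∧ ∀ p, ζ p = extD (𝓡 (2 * n)) lam p
  transverse : ∀ p ∈ foldLocus n ζ, ∃ w v, topPowDeriv n ζ p w v ≠ 0
  max_rank : ∀ p ∈ foldLocus n ζ,
    ∃ z : Fin (n - 1) × Fin 2 → EuclideanSpace ℝ (Fin (2 * n)),
      (∀ i v, topPowDeriv n ζ p (z i) v = 0) ∧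
      wedgePow (n - 1) (inChart (𝓡 (2 * n)) ζ p (extChartAt (𝓡 (2 * n)) p p)) z ≠ 0

end Folded

/-- `dσ` restricts to a folded exact symplectic form with fold `F ∩ Z` on the subset `F` of a
`(2n + 1)`-manifold, where `F` carries its structure of an embedded `2n`-dimensional submanifold
(the smooth structure for which the inclusion is a smooth embedding). -/
def RestrictsToFolded (n : ℕ) {M : Type*} [TopologicalSpace M]
    [ChartedSpace (EuclideanSpace ℝ (Fin (2 * n + 1))) M]
    (σ : DForm (𝓡 (2 * n + 1)) M 1) (F Z : Set M) : Prop :=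
  ∀ [ChartedSpace (EuclideanSpace ℝ (Fin (2 * n))) F] [IsManifold (𝓡 (2 * n)) ∞ F],
    IsSmoothEmbedding (𝓡 (2 * n)) (𝓡 (2 * n + 1)) ∞ (Subtype.val : F → M) →
    IsFoldedExactSymplectic n
      (pullback (𝓡 (2 * n + 1)) (𝓡 (2 * n)) (Subtype.val : F → M) (extD (𝓡 (2 * n + 1)) σ)) ∧
    foldLocus n
      (pullback (𝓡 (2 * n + 1)) (𝓡 (2 * n)) (Subtype.val : F → M) (extD (𝓡 (2 * n + 1)) σ)) =
      Subtype.val ⁻¹' Z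

/-! ### Exact symplectic fibers with convex boundary -/

section Fiber

variable (n : ℕ) [NeZero n] {S : Type*} [TopologicalSpace S]
  [ChartedSpace (EuclideanHalfSpace (2 * n)) S]
  {Y : Type*} [TopologicalSpace Y] [ChartedSpace (EuclideanSpace ℝ (Fin (2 * n - 1))) Y]

/-- `dβ` is an exact symplectic form for which the boundary is convex: along the boundary the
Liouville vector field `X`, given by `dβ(X, ·) = β`, points strictly outwards. (The half space is
`{x | 0 ≤ x 0}`.) -/
structure IsConvexExactSymplectic (β : DForm (𝓡∂ (2 * n)) S 1) : Prop where
  smooth : IsSmoothForm (𝓡∂ (2 * n)) β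
  nondegenerate : ∀ (x : S) (v : TangentSpace (𝓡∂ (2 * n)) x),
    (∀ w : TangentSpace (𝓡∂ (2 * n)) x, extD (𝓡∂ (2 * n)) β x ![v, w] = 0) → v = 0
  outward : ∀ x ∈ (𝓡∂ (2 * n)).boundary S, ∀ X : TangentSpace (𝓡∂ (2 * n)) x,
    (∀ w : TangentSpace (𝓡∂ (2 * n)) x, extD (𝓡∂ (2 * n)) β x ![X, w] = β x ![w]) →
    mvfderiv (𝓡∂ (2 * n)) (extChartAt (𝓡∂ (2 * n)) x) x X 0 < 0

/-- `φ` belongs to `Exact(S, ∂S, dβ)`: it is the identity near the boundary and `φ*β - β` is the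
differential of a function. -/
structure IsExactMonodromy (β : DForm (𝓡∂ (2 * n)) S 1)
    (φ : S ≃ₘ^∞⟮𝓡∂ (2 * n), 𝓡∂ (2 * n)⟯ S) : Prop where
  id_near_boundary : ∀ᶠ x in 𝓝ˢ ((𝓡∂ (2 * n)).boundary S), φ x = x
  exact : ∃ h : S → ℝ, ContMDiff (𝓡∂ (2 * n)) 𝓘(ℝ, ℝ) ∞ h ∧
    ∀ x, pullback (𝓡∂ (2 * n)) (𝓡∂ (2 * n)) φ β x = β x + dFun (𝓡∂ (2 * n)) h x

/-- `c` restricts to a collar `Y × [0, 1) → S` of the boundary: a diffeomorphism onto an open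
neighbourhood of `∂S` that identifies `Y × {0}` with `∂S`. -/
structure IsCollar (c : Y × ℝ → S) : Prop where
  smooth : ContMDiffOn ((𝓡 (2 * n - 1)).prod 𝓘(ℝ, ℝ)) (𝓡∂ (2 * n)) ∞ c (univ ×ˢ Ico 0 1)
  injOn : InjOn c (univ ×ˢ Ico 0 1)
  bijective_deriv : ∀ p ∈ (univ : Set Y) ×ˢ Ico (0 : ℝ) 1, Function.Bijective
    (mfderivWithin ((𝓡 (2 * n - 1)).prod 𝓘(ℝ, ℝ)) (𝓡∂ (2 * n)) c (univ ×ˢ Ico 0 1) p)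
  isOpen_image : IsOpen (c '' (univ ×ˢ Ico 0 1))
  boundary_eq : range (fun y => c (y, 0)) = (𝓡∂ (2 * n)).boundary S

/-- The form `λ_β + K dθ` of the mapping torus of `φ`, written on its infinite cyclic cover `S × ℝ`:
`∑ₖ a(t + k) (φᵏ)*β + K dt`. The function `a` stands for a partition of unity on the circle that is
subordinate to a trivializing cover: `(x, t)` and `(φᵏ x, t + k)` are the same point of the mapping
torus, and `φᵏ x` is its fiber coordinate over the arc that corresponds to the values of `t + k`. -/
def bundleForm (β : DForm (𝓡∂ (2 * n)) S 1) (φ : S ≃ₘ^∞⟮𝓡∂ (2 * n), 𝓡∂ (2 * n)⟯ S)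
    (a : ℝ → ℝ) (K : ℝ) : DForm ((𝓡∂ (2 * n)).prod 𝓘(ℝ, ℝ)) (S × ℝ) 1 := fun p =>
  (∑ᶠ k : ℤ, a (p.2 + k) •
    pullback (𝓡∂ (2 * n)) ((𝓡∂ (2 * n)).prod 𝓘(ℝ, ℝ))
      (fun q : S × ℝ => ((φ.toEquiv : Equiv.Perm S) ^ k) q.1) β p) +
  K • dFun ((𝓡∂ (2 * n)).prod 𝓘(ℝ, ℝ)) (fun q : S × ℝ => q.2) p

/-- A smooth weight whose integer translates form a partition of unity on `ℝ`. -/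
structure IsPeriodicWeight (a : ℝ → ℝ) : Prop where
  smooth : ContDiff ℝ ∞ a
  compact : HasCompactSupport a
  nonneg : ∀ t, 0 ≤ a t
  sum_eq_one : ∀ t, ∑ᶠ k : ℤ, a (t + k) = 1

/-- The form `f(t) α + g(t) dθ` on `Y × ℝ × ℝ`, with coordinates `(y, t, θ)`. -/
def interpForm (α : DForm (𝓡 (2 * n - 1)) Y 1) (f g : ℝ → ℝ) :
    DForm ((𝓡 (2 * n - 1)).prod (𝓘(ℝ, ℝ).prod 𝓘(ℝ, ℝ))) (Y × ℝ × ℝ) 1 := fun p =>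
  f p.2.1 • pullback (𝓡 (2 * n - 1)) ((𝓡 (2 * n - 1)).prod (𝓘(ℝ, ℝ).prod 𝓘(ℝ, ℝ)))
    (Prod.fst : Y × ℝ × ℝ → Y) α p +
  g p.2.1 • dFun ((𝓡 (2 * n - 1)).prod (𝓘(ℝ, ℝ).prod 𝓘(ℝ, ℝ))) (fun q : Y × ℝ × ℝ => q.2.2) p

end Fiber

/-! ### The folded sum -/

section Sum

variable {S₁ S₂ Y : Type*}

/-- The identifications that define the folded sum: `(x, t) ∼ (φᵢ x, t + 1)` on `Sᵢ × ℝ`, and the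
boundaries of the two mapping tori are glued along `Y`. -/
inductive FoldedSumRel (φ₁ : S₁ → S₁) (φ₂ : S₂ → S₂) (j₁ : Y → S₁) (j₂ : Y → S₂) :
    (S₁ × ℝ) ⊕ (S₂ × ℝ) → (S₁ × ℝ) ⊕ (S₂ × ℝ) → Prop
  | monodromy₁ (x : S₁) (t : ℝ) :
      FoldedSumRel φ₁ φ₂ j₁ j₂ (Sum.inl (x, t)) (Sum.inl (φ₁ x, t + 1))
  | monodromy₂ (x : S₂) (t : ℝ) :
      FoldedSumRel φ₁ φ₂ j₁ j₂ (Sum.inr (x, t)) (Sum.inr (φ₂ x, t + 1))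
  | glue (y : Y) (t : ℝ) :
      FoldedSumRel φ₁ φ₂ j₁ j₂ (Sum.inl (j₁ y, t)) (Sum.inr (j₂ y, t))

/-- The total space of the folded sum. -/
def FoldedSum (φ₁ : S₁ → S₁) (φ₂ : S₂ → S₂) (j₁ : Y → S₁) (j₂ : Y → S₂) : Type _ :=
  Quot (FoldedSumRel φ₁ φ₂ j₁ j₂)

namespace FoldedSum

variable (φ₁ : S₁ → S₁) (φ₂ : S₂ → S₂) (j₁ : Y → S₁) (j₂ : Y → S₂)

instance [TopologicalSpace S₁] [TopologicalSpace S₂] :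
    TopologicalSpace (FoldedSum φ₁ φ₂ j₁ j₂) :=
  inferInstanceAs (TopologicalSpace (Quot (FoldedSumRel φ₁ φ₂ j₁ j₂)))

/-- The map from `S₁ × ℝ`, the infinite cyclic cover of the first mapping torus. -/
def incl₁ (p : S₁ × ℝ) : FoldedSum φ₁ φ₂ j₁ j₂ := Quot.mk _ (Sum.inl p)

/-- The map from `S₂ × ℝ`, the infinite cyclic cover of the second mapping torus. -/
def incl₂ (p : S₂ × ℝ) : FoldedSum φ₁ φ₂ j₁ j₂ := Quot.mk _ (Sum.inr p)

/-- The projection `π` to the circle `ℝ / ℤ`. -/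
def proj : FoldedSum φ₁ φ₂ j₁ j₂ → AddCircle (1 : ℝ) :=
  Quot.lift (Sum.elim (fun p => (p.2 : AddCircle (1 : ℝ))) (fun p => (p.2 : AddCircle (1 : ℝ)))) <| by
    rintro _ _ (⟨x, t⟩ | ⟨x, t⟩ | ⟨y, t⟩)
    · exact (AddCircle.coe_add_period 1 t).symm
    · exact (AddCircle.coe_add_period 1 t).symm
    · rfl

/-- The hypersurface `Y × S¹` along which the mapping tori are glued. -/
def fold : Set (FoldedSum φ₁ φ₂ j₁ j₂) :=
  {m | ∃ (y : Y) (t : ℝ), m = incl₁ φ₁ φ₂ j₁ j₂ (j₁ y, t)}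

end FoldedSum

/-- The folded sum of two mapping tori whose fibers have collars `c₁`, `c₂` with common base `Y`. -/
abbrev FoldedSumC (φ₁ : S₁ → S₁) (φ₂ : S₂ → S₂) (c₁ : Y × ℝ → S₁) (c₂ : Y × ℝ → S₂) : Type _ :=
  FoldedSum φ₁ φ₂ (fun y => c₁ (y, 0)) (fun y => c₂ (y, 0))

/-- The union of the two collars: the two-sided collar `(y, t, s) ↦ C(y, t, s)`, for `|t| < 1`, of
`Y × S¹` in the folded sum, with `t < 0` on the first side. -/
def collar (φ₁ : S₁ → S₁) (φ₂ : S₂ → S₂) (c₁ : Y × ℝ → S₁) (c₂ : Y × ℝ → S₂) (p : Y × ℝ × ℝ) :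
    FoldedSumC φ₁ φ₂ c₁ c₂ :=
  if p.2.1 ≤ 0 then FoldedSum.incl₁ φ₁ φ₂ _ _ (c₁ (p.1, -p.2.1), p.2.2)
  else FoldedSum.incl₂ φ₁ φ₂ _ _ (c₂ (p.1, p.2.1), p.2.2)

/-- The smooth structure on the folded sum is the one obtained by gluing along the collars: the
interiors of the two mapping tori and the two-sided collar are smooth open pieces of it. -/
structure IsCollarGluing (n : ℕ) [NeZero n]
    [TopologicalSpace S₁] [ChartedSpace (EuclideanHalfSpace (2 * n)) S₁]
    [TopologicalSpace S₂] [ChartedSpace (EuclideanHalfSpace (2 * n)) S₂]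
    [TopologicalSpace Y] [ChartedSpace (EuclideanSpace ℝ (Fin (2 * n - 1))) Y]
    (φ₁ : S₁ → S₁) (φ₂ : S₂ → S₂) (c₁ : Y × ℝ → S₁) (c₂ : Y × ℝ → S₂)
    [ChartedSpace (EuclideanSpace ℝ (Fin (2 * n + 1))) (FoldedSumC φ₁ φ₂ c₁ c₂)] : Prop where
  incl₁ : ∀ x ∈ (𝓡∂ (2 * n)).interior S₁, ∀ t : ℝ,
    IsLocalDiffeomorphAt ((𝓡∂ (2 * n)).prod 𝓘(ℝ, ℝ)) (𝓡 (2 * n + 1)) ∞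
      (FoldedSum.incl₁ φ₁ φ₂ (fun y => c₁ (y, 0)) (fun y => c₂ (y, 0))) (x, t)
  incl₂ : ∀ x ∈ (𝓡∂ (2 * n)).interior S₂, ∀ t : ℝ,
    IsLocalDiffeomorphAt ((𝓡∂ (2 * n)).prod 𝓘(ℝ, ℝ)) (𝓡 (2 * n + 1)) ∞
      (FoldedSum.incl₂ φ₁ φ₂ (fun y => c₁ (y, 0)) (fun y => c₂ (y, 0))) (x, t)
  collar : ∀ (y : Y), ∀ t ∈ Ioo (-1 : ℝ) 1, ∀ s : ℝ,
    IsLocalDiffeomorphAt ((𝓡 (2 * n - 1)).prod (𝓘(ℝ, ℝ).prod 𝓘(ℝ, ℝ))) (𝓡 (2 * n + 1)) ∞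
      (collar φ₁ φ₂ c₁ c₂) (y, t, s)

end Sum

end FoldedContact

end

open Set Manifold Topology
open scoped ContDiff

noncomputable section

/-! Let `α` be the form on `Y` induced by `β₁`. Convexity makes it contact, and `β₂` induces `h α`
with `h > 0`. On the two-sided collar the form is sought as `τ + g(t) dθ`, where `τ` does not
involve `θ`. On the rest of the mapping tori it is the bundle form with constant `K` on the first
side and `-K` on the second. Near the boundaries the monodromies are the identity, so there the
bundle forms are `cᵢ*βᵢ ± K dθ`, and `τ` has to pass from `f(t) α` at the fold to `cᵢ*βᵢ`.

Near the fold, `f = C - t²` and `g` is odd and decreases from `K` to `-K`. The form `f α + g dθ` is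
contact because `f'g - fg'` does not vanish (`contactPt_of_wronskian`, `wronskian_pos`). On a fiber
its differential is `f' dt ∧ α + f dα`, whose top power is `f'` times a nonvanishing factor. As `f'
= -2t`, the top power vanishes transversally and exactly at `t = 0`, where the restriction to `Y` is
`C dα`, of rank `2n - 2` (`fold_point`).

Away from the fold `g` is a nonzero constant, and it suffices that `dτ` is symplectic on the fibers
(`contactPt_of_nondegenerate`). The critical region is where `τ = (1 - ρ) f α + ρ c*β`, with a
cutoff `ρ` of the distance `t` from the boundary. On a slice `t = const` the form `dτ` is
nondegenerate on `ker α` for small `t`, since `dα` and `dβ` are positive multiples of each other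
there at `t = 0`. So it has a kernel line spanned by some `R` with `α(R) > 0`, and `dτ` is
symplectic as soon as `(1 - ρ) f' α(R) + ρ dβ(∂t, R) + ρ' (β(R) - f α(R)) < 0`. The first term is
nonpositive since `f' < 0` for `t > 0`. In the third, the factor of `ρ'` is negative since `C`
exceeds both `1` and `h`. The second has a definite sign only for `ρ` near `1`, where `R` is almost
the kernel direction of `dβ` on the boundary and the outward Liouville field makes the term negative
(`boundary_reeb_neg`). So the cutoff must satisfy `ρ' ≥ L ρ` or `ρ ≥ 1 - 1/L` for a large `L`
(`eventually_interpTwo_nondegenerate`). The smooth transition function satisfies `s' ≥ s (1 - s)`,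
and squeezing it into an interval of length `δ ≤ 1/L²` gives the required alternative
(`smoothTransition_mul_le_deriv`, `cut_dichotomy`).

On the mapping tori, exactness of the monodromies gives `dλ = dβ + dθ ∧ ν`, so that `λ ± K dθ` is
contact for large `K`, by compactness of the fiber and invariance under deck transformations
(`eventually_isContactForm_bundleForm`).

The pieces are assembled pointwise: an explicit description of the identifications
(`sumEqv_of_mk_eq`) shows that the forms prescribed on the collar and on the two tori push forward
to the same covectors wherever their images meet (`exists_isGlued`). Contactness and the fold
condition are local and are read off in these parametrizations. -/

namespace FoldedContact

/-! ### Differential forms on manifolds with boundary: charts, naturality of `d`, algebra of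
`1`-forms. -/

section Calculus

open Filter

variable {E : Type*} [NormedAddCommGroup E] [NormedSpace ℝ E]
  {H : Type*} [TopologicalSpace H] {I : ModelWithCorners ℝ E H}
  {M : Type*} [TopologicalSpace M] [ChartedSpace H M]
  {E' : Type*} [NormedAddCommGroup E'] [NormedSpace ℝ E']
  {H' : Type*} [TopologicalSpace H'] {I' : ModelWithCorners ℝ E' H'}
  {N : Type*} [TopologicalSpace N] [ChartedSpace H' N]
  {E'' : Type*} [NormedAddCommGroup E''] [NormedSpace ℝ E'']
  {H'' : Type*} [TopologicalSpace H''] {I'' : ModelWithCorners ℝ E'' H''}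
  {P : Type*} [TopologicalSpace P] [ChartedSpace H'' P]
  {k : ℕ}

/-- The value of a form at a point, as an alternating map on the model space. -/
def fval (ζ : DForm I M k) (x : M) : E [⋀^Fin k]→L[ℝ] ℝ := ζ x

/-- The derivative of a map between manifolds, as a map between the model spaces. -/
def tder (I' : ModelWithCorners ℝ E' H') (I : ModelWithCorners ℝ E H) (F : N → M) (x : N) : E' →L[ℝ] E := mfderiv I' I F x

variable (I) in
/-- The derivative of the inverse of the preferred chart at `p`. -/
def cder (p : M) (u : E) : E →L[ℝ] E :=
  mfderivWithin 𝓘(ℝ, E) I (extChartAt I p).symm (range I) u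

/-- The expression of a map in the preferred charts at `p` and `q`. -/
abbrev inCharts (I' : ModelWithCorners ℝ E' H') (I : ModelWithCorners ℝ E H)
    (p : N) (q : M) (F : N → M) : E' → E :=
  extChartAt I q ∘ F ∘ (extChartAt I' p).symm

theorem inChart_eq (ζ : DForm I M k) (p : M) (u : E) :
    inChart I ζ p u = (fval ζ ((extChartAt I p).symm u)).compContinuousLinearMap (cder I p u) :=
  rfl

theorem fval_pullback (F : N → M) (ζ : DForm I M k) (x : N) :
    fval (pullback I I' F ζ) x = (fval ζ (F x)).compContinuousLinearMap (tder I' I F x) := rfl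

theorem fval_ext {ζ ζ' : DForm I M k} {x : M} (h : fval ζ x = fval ζ' x) : ζ x = ζ' x := h

/-- The preferred chart at `p` has identity derivative at `p` in the model coordinates of the
tangent space, so the final pullback in `extD` does nothing. -/
theorem fval_extD [IsManifold I ∞ M] (ζ : DForm I M k) (p : M) :
    fval (extD I ζ) p = extDerivWithin (inChart I ζ p) (range I) (extChartAt I p p) := by
  have : IsManifold I 1 M := .of_le (n := ∞) (by simp)
  have h : (extD I ζ p) = (extDerivWithin (inChart I ζ p) (range I)
    (extChartAt I p p)).compContinuousLinearMap (mfderiv I 𝓘(ℝ, E) (extChartAt I p) p) := rfl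
  rw [mfderiv_extChartAt_self] at h
  rw [fval, h]
  ext v
  rfl

theorem tder_comp {G : M → P} {F : N → M} {x : N} (hG : MDifferentiableAt I I'' G (F x))
    (hF : MDifferentiableAt I' I F x) :
    tder I' I'' (G ∘ F) x = tder I I'' G (F x) ∘L tder I' I F x :=
  mfderiv_comp x hG hF

theorem tder_id (x : M) : tder I I (id : M → M) x = ContinuousLinearMap.id ℝ E := mfderiv_id

theorem tder_congr {F G : N → M} {x : N} (h : F =ᶠ[𝓝 x] G) : tder I' I F x = tder I' I G x :=
  h.mfderiv_eq

theorem cder_self [IsManifold I ∞ M] (p : M) :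
    cder I p (extChartAt I p p) = ContinuousLinearMap.id ℝ E := by
  have : IsManifold I 1 M := .of_le (n := ∞) (by simp)
  exact mfderivWithin_range_extChartAt_symm

theorem isInvertible_cder [IsManifold I ∞ M] (p : M) {u : E} (hu : u ∈ (extChartAt I p).target) :
    (cder I p u).IsInvertible := by
  have : IsManifold I 1 M := .of_le (n := ∞) (by simp)
  exact isInvertible_mfderivWithin_extChartAt_symm hu

theorem differentiableWithinAt_inCharts [IsManifold I ∞ M] [IsManifold I' ∞ N]
    {F : N → M} {p : N} {q : M} {u : E'} (hu : u ∈ (extChartAt I' p).target)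
    (hF : MDifferentiableAt I' I F ((extChartAt I' p).symm u))
    (hq : F ((extChartAt I' p).symm u) ∈ (extChartAt I q).source) :
    DifferentiableWithinAt ℝ (inCharts I' I p q F) (range I') u := by
  have : IsManifold I 1 M := .of_le (n := ∞) (by simp)
  have : IsManifold I' 1 N := .of_le (n := ∞) (by simp)
  rw [← mdifferentiableWithinAt_iff_differentiableWithinAt]
  refine (mdifferentiableAt_extChartAt (by simpa using hq)).comp_mdifferentiableWithinAt u
    (hF.comp_mdifferentiableWithinAt u (mdifferentiableWithinAt_extChartAt_symm hu))

/-- Chain rule applied twice: near `u`, the inverse chart at `q` after `inCharts` is the same map as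
`F` after the inverse chart at `p`. -/
theorem cder_comp_fderivWithin_inCharts [IsManifold I ∞ M] [IsManifold I' ∞ N]
    {F : N → M} {p : N} {q : M} {u : E'} (hu : u ∈ (extChartAt I' p).target)
    (hF : MDifferentiableAt I' I F ((extChartAt I' p).symm u))
    (hq : F ((extChartAt I' p).symm u) ∈ (extChartAt I q).source) :
    cder I q (extChartAt I q (F ((extChartAt I' p).symm u))) ∘L
      fderivWithin ℝ (inCharts I' I p q F) (range I') u =
    tder I' I F ((extChartAt I' p).symm u) ∘L cder I' p u := by
  have : IsManifold I 1 M := .of_le (n := ∞) (by simp)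
  have : IsManifold I' 1 N := .of_le (n := ∞) (by simp)
  have hur : u ∈ range I' := extChartAt_target_subset_range p hu
  have hun : UniqueMDiffWithinAt 𝓘(ℝ, E') (range I') u := by
    exact I'.uniqueMDiffOn u hur
  have h1 : mfderivWithin 𝓘(ℝ, E') I (F ∘ (extChartAt I' p).symm) (range I') u =
      (mfderiv I' I F ((extChartAt I' p).symm u)).comp
        (mfderivWithin 𝓘(ℝ, E') I' (extChartAt I' p).symm (range I') u) :=
    mfderiv_comp_mfderivWithin u hF (mdifferentiableWithinAt_extChartAt_symm hu) hun
  have h2 : mfderivWithin 𝓘(ℝ, E') I ((extChartAt I q).symm ∘ (inCharts I' I p q F)) (range I') u =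
      (mfderivWithin 𝓘(ℝ, E) I (extChartAt I q).symm (range I) (inCharts I' I p q F u)).comp
        (mfderivWithin 𝓘(ℝ, E') 𝓘(ℝ, E) (inCharts I' I p q F) (range I') u) := by
    refine mfderivWithin_comp u (u := range I)
      (mdifferentiableWithinAt_extChartAt_symm ((extChartAt I q).map_source hq))
      (differentiableWithinAt_inCharts hu hF hq).mdifferentiableWithinAt (fun z _ => ?_) hun
    simp [inCharts]
  have h3 : mfderivWithin 𝓘(ℝ, E') I ((extChartAt I q).symm ∘ (inCharts I' I p q F)) (range I') u =
      mfderivWithin 𝓘(ℝ, E') I (F ∘ (extChartAt I' p).symm) (range I') u := by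
    refine Filter.EventuallyEq.mfderivWithin_eq ?_ ?_
    · have hc : ContinuousWithinAt (F ∘ (extChartAt I' p).symm) (range I') u :=
        hF.continuousAt.comp_continuousWithinAt
          (mdifferentiableWithinAt_extChartAt_symm hu).continuousWithinAt
      filter_upwards [hc (extChartAt_source_mem_nhds' (I := I) hq)] with z hz
      exact (extChartAt I q).left_inv hz
    · exact (extChartAt I q).left_inv hq
  have h4 := h2.symm.trans (h3.trans h1)
  rw [mfderivWithin_eq_fderivWithin] at h4
  exact h4

/-- The expression of a pullback in charts is the pullback of the expression in charts. -/
theorem inChart_pullback [IsManifold I ∞ M] [IsManifold I' ∞ N]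
    {F : N → M} {p : N} {q : M} {u : E'} (ζ : DForm I M k) (hu : u ∈ (extChartAt I' p).target)
    (hF : MDifferentiableAt I' I F ((extChartAt I' p).symm u))
    (hq : F ((extChartAt I' p).symm u) ∈ (extChartAt I q).source) :
    inChart I' (pullback I I' F ζ) p u =
      (inChart I ζ q (inCharts I' I p q F u)).compContinuousLinearMap
        (fderivWithin ℝ (inCharts I' I p q F) (range I') u) := by
  have h := cder_comp_fderivWithin_inCharts hu hF hq
  rw [inChart_eq, inChart_eq, fval_pullback]
  have hl : (extChartAt I q).symm (inCharts I' I p q F u) = F ((extChartAt I' p).symm u) :=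
    (extChartAt I q).left_inv hq
  rw [hl]
  ext v
  have h' : ∀ w, cder I q (inCharts I' I p q F u)
      (fderivWithin ℝ (inCharts I' I p q F) (range I') u w) =
      tder I' I F ((extChartAt I' p).symm u) (cder I' p u w) := fun w => DFunLike.congr_fun h w
  exact congrArg _ (funext fun i => (h' (v i)).symm)

theorem pullback_id (ζ : DForm I M k) : pullback I I id ζ = ζ := by
  funext x
  refine fval_ext ?_
  rw [fval_pullback, tder_id]
  ext v
  rfl

/-! ### Smoothness of `1`-forms at a point -/

/-- A `1`-form is smooth at `x` if its expression in the preferred chart at `x` is. -/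
def SmoothAt (ζ : DForm I M 1) (x : M) : Prop :=
  ContDiffWithinAt ℝ ∞ (inChart I ζ x) (range I) (extChartAt I x x)

/-- For `1`-forms the pullback is composition of continuous linear maps, after identifying
alternating `1`-forms with the dual space isometrically. -/
theorem contDiffWithinAt_compContinuousLinearMap {G : Type*} [NormedAddCommGroup G]
    [NormedSpace ℝ G] {ξ : G → E [⋀^Fin 1]→L[ℝ] ℝ} {L : G → E' →L[ℝ] E} {s : Set G} {u : G}
    (hξ : ContDiffWithinAt ℝ ∞ ξ s u) (hL : ContDiffWithinAt ℝ ∞ L s u) :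
    ContDiffWithinAt ℝ ∞ (fun z => (ξ z).compContinuousLinearMap (L z)) s u := by
  let e : (E →L[ℝ] ℝ) ≃ₗᵢ[ℝ] (E [⋀^Fin 1]→L[ℝ] ℝ) :=
    ContinuousAlternatingMap.ofSubsingletonLIE (𝕜 := ℝ) (E := E) (F := ℝ) (0 : Fin 1)
  let e' : (E' →L[ℝ] ℝ) ≃ₗᵢ[ℝ] (E' [⋀^Fin 1]→L[ℝ] ℝ) :=
    ContinuousAlternatingMap.ofSubsingletonLIE (𝕜 := ℝ) (E := E') (F := ℝ) (0 : Fin 1)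
  have h1 : ContDiffWithinAt ℝ ∞ (fun z => e' ((e.symm (ξ z)).comp (L z))) s u :=
    e'.contDiff.contDiffAt.comp_contDiffWithinAt u
      ((e.symm.contDiff.contDiffAt.comp_contDiffWithinAt u hξ).clm_comp hL)
  have h2 : ∀ z, (ξ z).compContinuousLinearMap (L z) = e' ((e.symm (ξ z)).comp (L z)) := by
    intro z
    obtain ⟨l, hl⟩ := e.surjective (ξ z)
    rw [← hl, e.symm_apply_apply]
    rfl
  simpa only [h2] using h1

theorem mapsTo_inCharts_range (p : N) (q : M) (F : N → M) (s : Set E') :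
    MapsTo (inCharts I' I p q F) s (range I) := fun z _ => by simp [inCharts]

theorem contDiffWithinAt_inCharts [IsManifold I ∞ M] [IsManifold I' ∞ N]
    {F : N → M} {p : N} {q : M} {u : E'} (hu : u ∈ (extChartAt I' p).target)
    (hF : ContMDiffAt I' I ∞ F ((extChartAt I' p).symm u))
    (hq : F ((extChartAt I' p).symm u) ∈ (extChartAt I q).source) :
    ContDiffWithinAt ℝ ∞ (inCharts I' I p q F) (range I') u := by
  have h := (contMDiffAt_iff_of_mem_source (x := p) (y := q)
    (by simpa using (extChartAt I' p).map_target hu) (by simpa using hq)).1 hF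
  have h2 := h.2
  rw [(extChartAt I' p).right_inv hu] at h2
  exact h2

theorem eventually_inChart_pullback [IsManifold I ∞ M] [IsManifold I' ∞ N]
    {F : N → M} {p : N} {q : M} {u : E'} (ζ : DForm I M k) (hu : u ∈ (extChartAt I' p).target)
    (hF : ContMDiffAt I' I ∞ F ((extChartAt I' p).symm u))
    (hq : F ((extChartAt I' p).symm u) ∈ (extChartAt I q).source) :
    inChart I' (pullback I I' F ζ) p =ᶠ[𝓝[range I'] u] fun z =>
      (inChart I ζ q (inCharts I' I p q F z)).compContinuousLinearMap
        (fderivWithin ℝ (inCharts I' I p q F) (range I') z) := by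
  have : IsManifold I 1 M := .of_le (n := ∞) (by simp)
  have : IsManifold I' 1 N := .of_le (n := ∞) (by simp)
  have hc := (mdifferentiableWithinAt_extChartAt_symm hu).continuousWithinAt
  have h1 : ∀ᶠ y in 𝓝 ((extChartAt I' p).symm u), ContMDiffAt I' I 1 F y :=
    contMDiffAt_iff_contMDiffAt_nhds (by simp) |>.1 (hF.of_le (by norm_cast))
  have h2 : ∀ᶠ y in 𝓝 ((extChartAt I' p).symm u), F y ∈ (extChartAt I q).source :=
    hF.continuousAt (extChartAt_source_mem_nhds' (I := I) hq)
  filter_upwards [hc.eventually h1, hc.eventually h2, extChartAt_target_mem_nhdsWithin_of_mem hu]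
    with z hz1 hz2 hz3
  exact inChart_pullback ζ hz3 (hz1.mdifferentiableAt (by simp)) hz2

theorem contDiffWithinAt_inChart_pullback [IsManifold I ∞ M] [IsManifold I' ∞ N]
    {F : N → M} {p : N} {q : M} {u : E'} {ζ : DForm I M 1} (hu : u ∈ (extChartAt I' p).target)
    (hF : ContMDiffAt I' I ∞ F ((extChartAt I' p).symm u))
    (hq : F ((extChartAt I' p).symm u) ∈ (extChartAt I q).source)
    (hζ : ContDiffWithinAt ℝ ∞ (inChart I ζ q) (range I)
      (extChartAt I q (F ((extChartAt I' p).symm u)))) :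
    ContDiffWithinAt ℝ ∞ (inChart I' (pullback I I' F ζ) p) (range I') u := by
  have hur : u ∈ range I' := extChartAt_target_subset_range p hu
  refine ContDiffWithinAt.congr_of_eventuallyEq ?_ (eventually_inChart_pullback ζ hu hF hq)
    (inChart_pullback ζ hu (hF.mdifferentiableAt (by simp)) hq)
  have hc := contDiffWithinAt_inCharts hu hF hq
  refine contDiffWithinAt_compContinuousLinearMap ?_ ?_
  · exact ContDiffWithinAt.comp u hζ hc (mapsTo_inCharts_range p q F _)
  · exact hc.fderivWithin_right I'.uniqueDiffOn (by simp) hur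

theorem extDerivWithin_inChart_pullback [IsManifold I ∞ M] [IsManifold I' ∞ N]
    {F : N → M} {p : N} {q : M} {u : E'} {ζ : DForm I M 1} (hu : u ∈ (extChartAt I' p).target)
    (hF : ContMDiffAt I' I ∞ F ((extChartAt I' p).symm u))
    (hq : F ((extChartAt I' p).symm u) ∈ (extChartAt I q).source)
    (hζ : ContDiffWithinAt ℝ ∞ (inChart I ζ q) (range I)
      (extChartAt I q (F ((extChartAt I' p).symm u)))) :
    extDerivWithin (inChart I' (pullback I I' F ζ) p) (range I') u =
      (extDerivWithin (inChart I ζ q) (range I) (inCharts I' I p q F u)).compContinuousLinearMap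
        (fderivWithin ℝ (inCharts I' I p q F) (range I') u) := by
  have hur : u ∈ range I' := extChartAt_target_subset_range p hu
  rw [(eventually_inChart_pullback ζ hu hF hq).extDerivWithin_eq_of_mem hur]
  exact extDerivWithin_pullback (r := ∞) (hζ.differentiableWithinAt (by simp))
    (contDiffWithinAt_inCharts hu hF hq) (by simp; norm_cast) I'.uniqueDiffOn
    (I'.range_subset_closure_interior hur) hur (mapsTo_inCharts_range p q F _)

/-- Smoothness can be tested in any preferred chart around the point. -/
theorem smoothAt_iff [IsManifold I ∞ M] {ζ : DForm I M 1} {p x : M}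
    (hx : x ∈ (extChartAt I p).source) :
    SmoothAt ζ x ↔ ContDiffWithinAt ℝ ∞ (inChart I ζ p) (range I) (extChartAt I p x) := by
  constructor
  · intro h
    -- A change of charts is a pullback under the identity, read in two different charts.
    rw [← pullback_id ζ]
    refine contDiffWithinAt_inChart_pullback (q := x) ((extChartAt I p).map_source hx)
      contMDiffAt_id ?_ ?_
    · rw [(extChartAt I p).left_inv hx]; exact mem_extChartAt_source x
    · rw [(extChartAt I p).left_inv hx]; exact h
  · intro h
    rw [SmoothAt, ← pullback_id ζ]
    refine contDiffWithinAt_inChart_pullback (q := p) (mem_extChartAt_target x)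
      contMDiffAt_id ?_ ?_
    · rw [extChartAt_to_inv x]; exact hx
    · rw [extChartAt_to_inv x]; exact h

theorem isSmoothForm_iff [IsManifold I ∞ M] {ζ : DForm I M 1} :
    IsSmoothForm I ζ ↔ ∀ x, SmoothAt ζ x := by
  constructor
  · intro h x
    exact (h x _ (mem_extChartAt_target x)).mono_of_mem_nhdsWithin
      (extChartAt_target_mem_nhdsWithin x)
  · intro h p u hu
    have h1 := (smoothAt_iff ((extChartAt I p).map_target hu)).1 (h ((extChartAt I p).symm u))
    rw [(extChartAt I p).right_inv hu] at h1
    exact h1.mono (extChartAt_target_subset_range p)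

theorem SmoothAt.pullback [IsManifold I ∞ M] [IsManifold I' ∞ N] {F : N → M} {x : N}
    {ζ : DForm I M 1} (hζ : SmoothAt ζ (F x)) (hF : ContMDiffAt I' I ∞ F x) :
    SmoothAt (pullback I I' F ζ) x := by
  refine contDiffWithinAt_inChart_pullback (q := F x) (mem_extChartAt_target x) ?_ ?_ ?_ <;>
    rw [extChartAt_to_inv x]
  exacts [hF, mem_extChartAt_source _, hζ]

/-- `extD` uses a different chart at each point. Naturality for the identity, between the charts at
`p` and at the point of coordinate `u`, shows that a single chart computes it on its whole target;
this is what makes `dζ` continuous and differentiable in charts. -/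
theorem inChart_extD [IsManifold I ∞ M] {ζ : DForm I M 1} {p : M} {u : E}
    (hu : u ∈ (extChartAt I p).target) (hζ : SmoothAt ζ ((extChartAt I p).symm u)) :
    inChart I (extD I ζ) p u = extDerivWithin (inChart I ζ p) (range I) u := by
  set x := (extChartAt I p).symm u with hx
  have h1 := extDerivWithin_inChart_pullback (F := (id : M → M)) (q := x) (ζ := ζ) hu
    contMDiffAt_id (mem_extChartAt_source x) hζ
  have h2 := cder_comp_fderivWithin_inCharts (I := I) (I' := I) (F := (id : M → M)) (q := x) hu
    mdifferentiableAt_id (mem_extChartAt_source x)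
  rw [pullback_id] at h1
  rw [tder_id] at h2
  simp only [id_eq, ← hx, cder_self, ContinuousLinearMap.id_comp] at h2
  rw [h1, h2, inChart_eq, fval_extD]
  rfl

/-- The exterior derivative commutes with pullbacks. -/
theorem fval_extD_pullback [IsManifold I ∞ M] [IsManifold I' ∞ N] {F : N → M} {x : N}
    {ζ : DForm I M 1} (hζ : SmoothAt ζ (F x)) (hF : ContMDiffAt I' I ∞ F x) :
    fval (extD I' (FoldedContact.pullback I I' F ζ)) x =
      (fval (extD I ζ) (F x)).compContinuousLinearMap (tder I' I F x) := by
  have h0 := extChartAt_to_inv (I := I') x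
  have h1 := extDerivWithin_inChart_pullback (F := F) (p := x) (q := F x) (ζ := ζ)
    (mem_extChartAt_target x) (by rwa [h0]) (by rw [h0]; exact mem_extChartAt_source _)
    (by rwa [h0])
  have h2 := cder_comp_fderivWithin_inCharts (F := F) (p := x) (q := F x)
    (mem_extChartAt_target x) (by rw [h0]; exact hF.mdifferentiableAt (by simp))
    (by rw [h0]; exact mem_extChartAt_source (I := I) _)
  simp only [h0, cder_self, ContinuousLinearMap.id_comp, ContinuousLinearMap.comp_id] at h2
  rw [fval_extD, h1, h2, fval_extD]
  simp [inCharts]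

/-! ### Operations on `1`-forms -/

theorem eventually_inChart_congr [IsManifold I ∞ M] {ζ ζ' : DForm I M k} {x : M}
    (h : ∀ᶠ y in 𝓝 x, fval ζ y = fval ζ' y) :
    inChart I ζ x =ᶠ[𝓝[range I] (extChartAt I x x)] inChart I ζ' x := by
  have : IsManifold I 1 M := .of_le (n := ∞) (by simp)
  have hc := (mdifferentiableWithinAt_extChartAt_symm (mem_extChartAt_target
    (I := I) x)).continuousWithinAt
  rw [ContinuousWithinAt, extChartAt_to_inv] at hc
  filter_upwards [hc.eventually h] with z hz
  rw [inChart_eq, inChart_eq, hz]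

theorem SmoothAt.congr [IsManifold I ∞ M] {ζ ζ' : DForm I M 1} {x : M} (hζ : SmoothAt ζ' x)
    (h : ∀ᶠ y in 𝓝 x, fval ζ y = fval ζ' y) : SmoothAt ζ x :=
  ContDiffWithinAt.congr_of_eventuallyEq_of_mem hζ (eventually_inChart_congr h) (by simp)

theorem fval_extD_congr [IsManifold I ∞ M] {ζ ζ' : DForm I M k} {x : M}
    (h : ∀ᶠ y in 𝓝 x, fval ζ y = fval ζ' y) : fval (extD I ζ) x = fval (extD I ζ') x := by
  rw [fval_extD, fval_extD]
  exact (eventually_inChart_congr h).extDerivWithin_eq_of_mem (by simp)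

theorem SmoothAt.differentiableWithinAt {ζ : DForm I M 1} {x : M} (hζ : SmoothAt ζ x) :
    DifferentiableWithinAt ℝ (inChart I ζ x) (range I) (extChartAt I x x) :=
  ContDiffWithinAt.differentiableWithinAt hζ (by simp)

theorem SmoothAt.add {ζ ζ' : DForm I M 1} {x : M} (hζ : SmoothAt ζ x) (hζ' : SmoothAt ζ' x) :
    SmoothAt (I := I) (fun y => ζ y + ζ' y) x :=
  ContDiffWithinAt.add hζ hζ'

theorem fval_extD_add [IsManifold I ∞ M] {ζ ζ' : DForm I M 1} {x : M} (hζ : SmoothAt ζ x)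
    (hζ' : SmoothAt ζ' x) :
    fval (extD I (fun y => ζ y + ζ' y)) x = fval (extD I ζ) x + fval (extD I ζ') x := by
  rw [fval_extD, fval_extD, fval_extD]
  exact extDerivWithin_add (I.uniqueDiffOn _ (by simp)) hζ.differentiableWithinAt
    hζ'.differentiableWithinAt

theorem contDiffWithinAt_comp_extChartAt_symm [IsManifold I ∞ M] {f : M → E'} {x : M}
    (hf : ContMDiffAt I 𝓘(ℝ, E') ∞ f x) :
    ContDiffWithinAt ℝ ∞ (fun z => f ((extChartAt I x).symm z)) (range I) (extChartAt I x x) :=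
  (contMDiffAt_iff.1 hf).2

theorem fderivWithin_comp_extChartAt_symm [IsManifold I ∞ M] {f : M → E'} {x : M}
    (hf : MDifferentiableAt I 𝓘(ℝ, E') f x) :
    fderivWithin ℝ (fun z => f ((extChartAt I x).symm z)) (range I) (extChartAt I x x) =
      tder I 𝓘(ℝ, E') f x := by
  rw [tder, hf.mfderiv]
  rfl

theorem SmoothAt.fsmul [IsManifold I ∞ M] {f : M → ℝ} {ζ : DForm I M 1} {x : M}
    (hf : ContMDiffAt I 𝓘(ℝ, ℝ) ∞ f x) (hζ : SmoothAt ζ x) :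
    SmoothAt (I := I) (fun y => f y • ζ y) x :=
  ContDiffWithinAt.smul (contDiffWithinAt_comp_extChartAt_symm hf) hζ

theorem extDerivWithin_apply_two {ξ : E → E [⋀^Fin 1]→L[ℝ] ℝ} {s : Set E} {u : E} (v w : E) :
    extDerivWithin ξ s u ![v, w] =
      fderivWithin ℝ ξ s u v ![w] - fderivWithin ℝ ξ s u w ![v] := by
  rw [extDerivWithin, ContinuousAlternatingMap.alternatizeUncurryFin_apply, Fin.sum_univ_two]
  have h1 : Fin.removeNth (α := fun _ => E) 0 ![v, w] = ![w] := by
    ext i; fin_cases i; rfl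
  have h2 : Fin.removeNth (α := fun _ => E) 1 ![v, w] = ![v] := by
    ext i; fin_cases i; rfl
  rw [h1, h2]
  simp [sub_eq_add_neg]

theorem extDerivWithin_fsmul_apply {f : E → ℝ} {ξ : E → E [⋀^Fin 1]→L[ℝ] ℝ} {s : Set E} {u : E}
    (hs : UniqueDiffWithinAt ℝ s u) (hf : DifferentiableWithinAt ℝ f s u)
    (hξ : DifferentiableWithinAt ℝ ξ s u) (v w : E) :
    extDerivWithin (fun z => f z • ξ z) s u ![v, w] =
      fderivWithin ℝ f s u v * ξ u ![w] - fderivWithin ℝ f s u w * ξ u ![v] +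
        f u * extDerivWithin ξ s u ![v, w] := by
  rw [extDerivWithin_apply_two, extDerivWithin_apply_two, fderivWithin_fun_smul hs hf hξ]
  simp
  ring

theorem fval_extD_fsmul [IsManifold I ∞ M] {f : M → ℝ} {ζ : DForm I M 1} {x : M}
    (hf : ContMDiffAt I 𝓘(ℝ, ℝ) ∞ f x) (hζ : SmoothAt ζ x) (v w : E) :
    fval (extD I (fun y => f y • ζ y)) x ![v, w] =
      tder I 𝓘(ℝ, ℝ) f x v * fval ζ x ![w] - tder I 𝓘(ℝ, ℝ) f x w * fval ζ x ![v] +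
        f x * fval (extD I ζ) x ![v, w] := by
  have h1 : inChart I ζ x (extChartAt I x x) = fval ζ x := by
    rw [inChart_eq, cder_self, extChartAt_to_inv]
    rfl
  have h2 := extDerivWithin_fsmul_apply (I.uniqueDiffOn _ (by simp))
    ((contDiffWithinAt_comp_extChartAt_symm hf).differentiableWithinAt (by simp))
    hζ.differentiableWithinAt v w
  rw [fderivWithin_comp_extChartAt_symm (hf.mdifferentiableAt (by simp)), h1, extChartAt_to_inv,
    ← fval_extD] at h2
  rw [← h2, fval_extD]
  rfl

theorem fval_dFun (h : M → ℝ) (x : M) (v : E) :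
    fval (dFun I h) x ![v] = tder I 𝓘(ℝ, ℝ) h x v := rfl

/-- Reading `h` as a `0`-form in the chart presents `dh` as an exterior derivative, so that `d(dh) =
0` reduces to the vector space identity. -/
theorem eventually_inChart_dFun [IsManifold I ∞ M] {h : M → ℝ} {x : M}
    (hh : ContMDiffAt I 𝓘(ℝ, ℝ) ∞ h x) :
    inChart I (dFun I h) x =ᶠ[𝓝[range I] (extChartAt I x x)]
      extDerivWithin (fun z => ContinuousAlternatingMap.constOfIsEmpty ℝ E (Fin 0)
        (h ((extChartAt I x).symm z))) (range I) := by
  have : IsManifold I 1 M := .of_le (n := ∞) (by simp)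
  have hc := (mdifferentiableWithinAt_extChartAt_symm (mem_extChartAt_target
    (I := I) x)).continuousWithinAt
  rw [ContinuousWithinAt, extChartAt_to_inv] at hc
  have h1 : ∀ᶠ y in 𝓝 x, ContMDiffAt I 𝓘(ℝ, ℝ) 1 h y :=
    contMDiffAt_iff_contMDiffAt_nhds (by simp) |>.1 (hh.of_le (by norm_cast))
  filter_upwards [hc.eventually h1, extChartAt_target_mem_nhdsWithin x] with u hu1 hu
  have hur := extChartAt_target_subset_range x hu
  rw [extDerivWithin_constOfIsEmpty _ (I.uniqueDiffOn _ hur)]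
  have h3 := mfderiv_comp_mfderivWithin u (hu1.mdifferentiableAt (by simp))
    (mdifferentiableWithinAt_extChartAt_symm hu) (I.uniqueMDiffOn u hur)
  rw [mfderivWithin_eq_fderivWithin] at h3
  have h4 : ∀ v, fderivWithin ℝ (h ∘ (extChartAt I x).symm) (range I) u v =
    tder I 𝓘(ℝ, ℝ) h ((extChartAt I x).symm u) (cder I x u v) := fun v => DFunLike.congr_fun h3 v
  ext v
  exact (h4 (v 0)).symm

theorem smoothAt_dFun [IsManifold I ∞ M] {h : M → ℝ} {x : M}
    (hh : ContMDiffAt I 𝓘(ℝ, ℝ) ∞ h x) : SmoothAt (dFun I h) x := by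
  refine ContDiffWithinAt.congr_of_eventuallyEq_of_mem ?_ (eventually_inChart_dFun hh) (by simp)
  have h1 : ContDiffWithinAt ℝ ∞ (fun z => ContinuousAlternatingMap.ofSubsingletonLIE (𝕜 := ℝ)
      (E := E) (F := ℝ) (0 : Fin 1)
      (fderivWithin ℝ (fun z => h ((extChartAt I x).symm z)) (range I) z)) (range I)
      (extChartAt I x x) :=
    (LinearIsometryEquiv.contDiff _).contDiffAt.comp_contDiffWithinAt _
      ((contDiffWithinAt_comp_extChartAt_symm hh).fderivWithin_right I.uniqueDiffOn
        (by simp) (by simp))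
  refine h1.congr_of_eventuallyEq_of_mem ?_ (by simp)
  filter_upwards [self_mem_nhdsWithin] with z hz
  rw [extDerivWithin_constOfIsEmpty _ (I.uniqueDiffOn _ hz)]
  rfl

theorem fval_extD_dFun [IsManifold I ∞ M] {h : M → ℝ} {x : M}
    (hh : ContMDiffAt I 𝓘(ℝ, ℝ) ∞ h x) : fval (extD I (dFun I h)) x = 0 := by
  rw [fval_extD, (eventually_inChart_dFun hh).extDerivWithin_eq_of_mem (by simp)]
  refine extDerivWithin_extDerivWithin_apply (r := ∞) ?_ (by simp; norm_cast) I.uniqueDiffOn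
    (I.range_subset_closure_interior (by simp)) (by simp)
  exact (ContinuousAlternatingMap.constOfIsEmptyLIE ℝ E ℝ (Fin 0)).contDiff.contDiffAt.comp_contDiffWithinAt _
    (contDiffWithinAt_comp_extChartAt_symm hh)

theorem smoothAt_zero (x : M) : SmoothAt (I := I) (fun _ => 0 : DForm I M 1) x :=
  contDiffWithinAt_const (c := (0 : E [⋀^Fin 1]→L[ℝ] ℝ))

theorem fval_extD_zero [IsManifold I ∞ M] (x : M) :
    fval (extD I (fun _ => 0 : DForm I M 1)) x = 0 := by
  rw [fval_extD]
  have : inChart I (fun _ => 0 : DForm I M 1) x = fun _ => (0 : E [⋀^Fin 1]→L[ℝ] ℝ) := rfl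
  rw [this, extDerivWithin, fderivWithin_fun_const]
  exact (ContinuousAlternatingMap.alternatizeUncurryFinCLM ℝ E ℝ).map_zero

theorem SmoothAt.sum [IsManifold I ∞ M] {ι : Type*} (s : Finset ι) {ζ : ι → DForm I M 1} {x : M}
    (h : ∀ i ∈ s, SmoothAt (ζ i) x) : SmoothAt (I := I) (fun y => ∑ i ∈ s, ζ i y) x := by
  classical
  induction s using Finset.induction_on with
  | empty => exact smoothAt_zero x
  | insert i s hi ih =>
    simp only [Finset.sum_insert hi]
    exact (h i (by simp)).add (ih fun j hj => h j (by simp [hj]))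

theorem fval_extD_sum [IsManifold I ∞ M] {ι : Type*} (s : Finset ι) {ζ : ι → DForm I M 1} {x : M}
    (h : ∀ i ∈ s, SmoothAt (ζ i) x) :
    fval (extD I (fun y => ∑ i ∈ s, ζ i y)) x = ∑ i ∈ s, fval (extD I (ζ i)) x := by
  classical
  induction s using Finset.induction_on with
  | empty => exact fval_extD_zero x
  | insert i s hi ih =>
    have hs : ∀ j ∈ s, SmoothAt (ζ j) x := fun j hj => h j (by simp [hj])
    simp only [Finset.sum_insert hi]
    rw [fval_extD_add (h i (by simp)) (SmoothAt.sum s hs), ih hs]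

/-! ### Contact forms and local diffeomorphisms -/

/-- The pointwise contact condition for the values of `σ` and `dσ`. -/
def ContactPt (a : E [⋀^Fin 1]→L[ℝ] ℝ) (b : E [⋀^Fin 2]→L[ℝ] ℝ) : Prop :=
  a ≠ 0 ∧ ∀ v, a ![v] = 0 → (∀ w, a ![w] = 0 → b ![v, w] = 0) → v = 0

theorem isContactForm_iff [IsManifold I ∞ M] {σ : DForm I M 1} :
    IsContactForm I σ ↔
      ∀ x, SmoothAt σ x ∧ ContactPt (fval σ x) (fval (extD I σ) x) := by
  constructor
  · intro h x
    exact ⟨isSmoothForm_iff.1 h.smooth x, h.ne_zero x, h.nondegenerate x⟩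
  · intro h
    exact ⟨isSmoothForm_iff.2 fun x => (h x).1, fun x => (h x).2.1, fun x => (h x).2.2⟩

theorem comp_apply_one (a : E [⋀^Fin 1]→L[ℝ] ℝ) (L : E' →L[ℝ] E) (v : E') :
    a.compContinuousLinearMap L ![v] = a ![L v] := by
  rw [ContinuousAlternatingMap.compContinuousLinearMap_apply]
  congr 1
  ext i
  fin_cases i
  rfl

theorem comp_apply_two (b : E [⋀^Fin 2]→L[ℝ] ℝ) (L : E' →L[ℝ] E) (v w : E') :
    b.compContinuousLinearMap L ![v, w] = b ![L v, L w] := by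
  rw [ContinuousAlternatingMap.compContinuousLinearMap_apply]
  congr 1
  ext i
  fin_cases i <;> rfl

theorem contactPt_comp_iff {a : E [⋀^Fin 1]→L[ℝ] ℝ} {b : E [⋀^Fin 2]→L[ℝ] ℝ} {L : E' →L[ℝ] E}
    (hL : Function.Bijective L) :
    ContactPt (a.compContinuousLinearMap L) (b.compContinuousLinearMap L) ↔ ContactPt a b := by
  have h0 : a.compContinuousLinearMap L = 0 ↔ a = 0 := by
    constructor
    · intro h
      ext v
      obtain ⟨w, hw⟩ := hL.2 (v 0)
      have := DFunLike.congr_fun h ![w]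
      rw [comp_apply_one, hw] at this
      have hv : v = ![v 0] := by ext i; fin_cases i; rfl
      rw [hv]
      exact this
    · rintro rfl
      rfl
  simp only [ContactPt, ne_eq, h0, comp_apply_one, comp_apply_two]
  refine and_congr Iff.rfl ⟨fun h v hv hw => ?_, fun h v hv hw => ?_⟩
  · obtain ⟨v, rfl⟩ := hL.2 v
    rw [h v hv fun w hw' => hw _ hw', map_zero]
  · refine hL.1 ?_
    rw [h (L v) hv fun w hw' => ?_, map_zero]
    obtain ⟨w, rfl⟩ := hL.2 w
    exact hw w hw'

theorem _root_.IsLocalDiffeomorphAt.tder_bijective {F : N → M} {x : N}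
    (hF : IsLocalDiffeomorphAt I' I ∞ F x) : Function.Bijective (tder I' I F x) :=
  (hF.mfderivToContinuousLinearEquiv (by simp)).bijective

theorem _root_.IsLocalDiffeomorphAt.eventually {F : N → M} {x : N}
    (hF : IsLocalDiffeomorphAt I' I ∞ F x) : ∀ᶠ y in 𝓝 x, IsLocalDiffeomorphAt I' I ∞ F y := by
  obtain ⟨Φ, hx, h⟩ := hF
  filter_upwards [Φ.open_source.mem_nhds hx] with y hy
  exact ⟨Φ, hy, h⟩

/-- A form whose pullback under a local diffeomorphism is smooth is smooth. -/
theorem smoothAt_of_pullback [IsManifold I ∞ M] [IsManifold I' ∞ N] {F : N → M} {x : N}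
    (hF : IsLocalDiffeomorphAt I' I ∞ F x) {σ : DForm I M 1} {τ : DForm I' N 1}
    (h : ∀ᶠ y in 𝓝 x, fval (pullback I I' F σ) y = fval τ y) (hτ : SmoothAt τ x) :
    SmoothAt σ (F x) := by
  have hx : hF.localInverse (F x) = x := hF.localInverse_left_inv hF.localInverse_mem_target
  -- Near `F x` the form `σ` is the pullback of `τ` under the local inverse, which is smooth.
  have h1 : SmoothAt (pullback I' I hF.localInverse τ) (F x) :=
    SmoothAt.pullback (by rwa [hx]) hF.localInverse_contMDiffAt
  refine h1.congr ?_
  have hc : ContinuousAt hF.localInverse (F x) := hF.localInverse_contMDiffAt.continuousAt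
  have h2 : ∀ᶠ m in 𝓝 (F x), fval (pullback I I' F σ) (hF.localInverse m) =
      fval τ (hF.localInverse m) := hc.eventually (by rwa [hx])
  have h3 : ∀ᶠ m in 𝓝 (F x), IsLocalDiffeomorphAt I' I ∞ F (hF.localInverse m) :=
    hc.eventually (by rw [hx]; exact hF.eventually)
  have h5 := hF.localInverse_isLocalDiffeomorphAt.eventually
  filter_upwards [h2, h3, h5, hF.localInverse_eventuallyEq_right.eventually_nhds] with m hm hm3 hm5 hm4
  rw [fval_pullback, ← hm, fval_pullback]
  have h6 : tder I' I F (hF.localInverse m) ∘L tder I I' hF.localInverse m =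
      ContinuousLinearMap.id ℝ E := by
    rw [← tder_comp (hm3.mdifferentiableAt (by simp)) (hm5.mdifferentiableAt (by simp)),
      tder_congr hm4, tder_id]
  have h7 : F (hF.localInverse m) = m := hm4.self_of_nhds
  rw [h7]
  ext v
  simp only [ContinuousAlternatingMap.compContinuousLinearMap_apply, Function.comp_def]
  exact congrArg _ (funext fun i => (DFunLike.congr_fun h6 (v i)).symm)

theorem fval_extD_of_pullback [IsManifold I ∞ M] [IsManifold I' ∞ N] {F : N → M} {x : N}
    (hF : ContMDiffAt I' I ∞ F x) {σ : DForm I M 1} {τ : DForm I' N 1}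
    (h : ∀ᶠ y in 𝓝 x, fval (pullback I I' F σ) y = fval τ y) (hσ : SmoothAt σ (F x)) :
    fval (extD I' τ) x = (fval (extD I σ) (F x)).compContinuousLinearMap (tder I' I F x) := by
  rw [← fval_extD_pullback hσ hF, fval_extD_congr h]

/-- Since `d` commutes with the pullback and `F` has bijective derivative at `x`, the contact
condition is a matter of one linear isomorphism. It lets contactness on the quotient be checked
upstairs. -/
theorem contactPt_iff_of_pullback [IsManifold I ∞ M] [IsManifold I' ∞ N] {F : N → M} {x : N}
    (hF : IsLocalDiffeomorphAt I' I ∞ F x) {σ : DForm I M 1} {τ : DForm I' N 1}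
    (h : ∀ᶠ y in 𝓝 x, fval (pullback I I' F σ) y = fval τ y) (hσ : SmoothAt σ (F x)) :
    ContactPt (fval τ x) (fval (extD I' τ) x) ↔
      ContactPt (fval σ (F x)) (fval (extD I σ) (F x)) := by
  rw [fval_extD_of_pullback hF.contMDiffAt h hσ, ← h.self_of_nhds, fval_pullback]
  exact contactPt_comp_iff hF.tder_bijective

end Calculus

/-! ### Top powers of alternating 2-forms and symplectic bases. -/

section Wedge

variable {V : Type*} [NormedAddCommGroup V] [NormedSpace ℝ V]

theorem two_add_left (b : V [⋀^Fin 2]→L[ℝ] ℝ) (x y w : V) :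
    b ![x + y, w] = b ![x, w] + b ![y, w] := b.vecCons_add ![w] x y

theorem two_smul_left (b : V [⋀^Fin 2]→L[ℝ] ℝ) (c : ℝ) (x w : V) :
    b ![c • x, w] = c * b ![x, w] := b.vecCons_smul ![w] c x

theorem two_swap (b : V [⋀^Fin 2]→L[ℝ] ℝ) (x w : V) : b ![x, w] = -b ![w, x] := by
  have h := b.toAlternatingMap.map_swap ![w, x] (show (0 : Fin 2) ≠ 1 by simp)
  have h2 : (![w, x] ∘ Equiv.swap (0 : Fin 2) 1) = ![x, w] := by
    ext i; fin_cases i <;> simp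
  rw [h2] at h
  exact h

theorem two_add_right (b : V [⋀^Fin 2]→L[ℝ] ℝ) (x w w' : V) :
    b ![x, w + w'] = b ![x, w] + b ![x, w'] := by
  rw [two_swap, two_add_left, two_swap b x w, two_swap b x w']; ring

theorem two_smul_right (b : V [⋀^Fin 2]→L[ℝ] ℝ) (c : ℝ) (x w : V) :
    b ![x, c • w] = c * b ![x, w] := by
  rw [two_swap, two_smul_left, two_swap b x w]; ring

theorem two_self (b : V [⋀^Fin 2]→L[ℝ] ℝ) (x : V) : b ![x, x] = 0 := by
  have := two_swap b x x
  linarith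

theorem one_add (a : V [⋀^Fin 1]→L[ℝ] ℝ) (x y : V) : a ![x + y] = a ![x] + a ![y] :=
  a.vecCons_add ![] x y

theorem one_smul' (a : V [⋀^Fin 1]→L[ℝ] ℝ) (c : ℝ) (x : V) : a ![c • x] = c * a ![x] :=
  a.vecCons_smul ![] c x

/-- The bilinear form of an alternating `2`-form. -/
def toBilin (b : V [⋀^Fin 2]→L[ℝ] ℝ) : V →ₗ[ℝ] V →ₗ[ℝ] ℝ :=
  LinearMap.mk₂ ℝ (fun v w => b ![v, w]) (two_add_left b) (two_smul_left b)
    (two_add_right b) (two_smul_right b)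

/-- The linear form of a `1`-form. -/
def toLin (a : V [⋀^Fin 1]→L[ℝ] ℝ) : V →ₗ[ℝ] ℝ where
  toFun v := a ![v]
  map_add' := one_add a
  map_smul' := one_smul' a

/-- `v ↦ ∏ᵢ b(vᵢ₀, vᵢ₁)` as a multilinear map. -/
def pairProd (n : ℕ) (b : V [⋀^Fin 2]→L[ℝ] ℝ) :
    MultilinearMap ℝ (fun _ : Fin n × Fin 2 => V) ℝ where
  toFun v := ∏ i, b ![v (i, 0), v (i, 1)]
  map_update_add' := by
    intro inst m p x y
    obtain ⟨j, e⟩ := p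
    have hne : ∀ (z : V) (i : Fin n), i ∈ Finset.univ.erase j →
        b ![Function.update m (j, e) z (i, 0), Function.update m (j, e) z (i, 1)] =
          b ![m (i, 0), m (i, 1)] := by
      intro z i hi
      have : i ≠ j := Finset.ne_of_mem_erase hi
      rw [Function.update_of_ne (by simp [this]), Function.update_of_ne (by simp [this])]
    rw [← Finset.mul_prod_erase _ _ (Finset.mem_univ j),
      ← Finset.mul_prod_erase _ _ (Finset.mem_univ j),
      ← Finset.mul_prod_erase _ _ (Finset.mem_univ j),
      Finset.prod_congr rfl (hne _), Finset.prod_congr rfl (hne x), Finset.prod_congr rfl (hne y),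
      ← add_mul]
    congr 1
    fin_cases e <;> simp [two_add_left, two_add_right]
  map_update_smul' := by
    intro inst m p c x
    obtain ⟨j, e⟩ := p
    have hne : ∀ (z : V) (i : Fin n), i ∈ Finset.univ.erase j →
        b ![Function.update m (j, e) z (i, 0), Function.update m (j, e) z (i, 1)] =
          b ![m (i, 0), m (i, 1)] := by
      intro z i hi
      have : i ≠ j := Finset.ne_of_mem_erase hi
      rw [Function.update_of_ne (by simp [this]), Function.update_of_ne (by simp [this])]
    rw [← Finset.mul_prod_erase _ _ (Finset.mem_univ j),
      ← Finset.mul_prod_erase _ _ (Finset.mem_univ j),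
      Finset.prod_congr rfl (hne _), Finset.prod_congr rfl (hne x), smul_eq_mul, ← mul_assoc]
    congr 1
    fin_cases e <;> simp [two_smul_left, two_smul_right]

/-- The wedge power as an alternating map. -/
def wedgeAlt (n : ℕ) (b : V [⋀^Fin 2]→L[ℝ] ℝ) : V [⋀^(Fin n × Fin 2)]→ₗ[ℝ] ℝ :=
  (2 ^ n : ℝ)⁻¹ • MultilinearMap.alternatization (pairProd n b)

theorem wedgeAlt_apply (n : ℕ) (b : V [⋀^Fin 2]→L[ℝ] ℝ) (v : Fin n × Fin 2 → V) :
    wedgeAlt n b v = wedgePow n b v := by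
  rw [wedgeAlt, AlternatingMap.smul_apply, MultilinearMap.alternatization_apply, wedgePow,
    smul_eq_mul]
  congr 1
  refine Finset.sum_congr rfl fun τ _ => ?_
  rw [MultilinearMap.domDomCongr_apply, Units.smul_def, zsmul_eq_mul]
  rfl

/-- The top power is an alternating map in as many arguments as the dimension, hence a multiple of a
basis determinant. -/
theorem wedgePow_comp_det [FiniteDimensional ℝ V] {n : ℕ} (hV : Module.finrank ℝ V = 2 * n)
    (b : V [⋀^Fin 2]→L[ℝ] ℝ) (L : V →ₗ[ℝ] V) (v : Fin n × Fin 2 → V) :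
    wedgePow n b (fun i => L (v i)) = LinearMap.det L * wedgePow n b v := by
  let e : Module.Basis (Fin n × Fin 2) ℝ V :=
    (Module.finBasisOfFinrankEq ℝ V hV).reindex
      (Fintype.equivOfCardEq (by simp [mul_comm]))
  rw [← wedgeAlt_apply, ← wedgeAlt_apply, (wedgeAlt n b).eq_smul_basis_det e]
  simp only [AlternatingMap.smul_apply, smul_eq_mul]
  have := e.det_comp L v
  simp only [Function.comp_def] at this
  rw [this]
  ring

theorem wedgePow_comp {W : Type*} [NormedAddCommGroup W] [NormedSpace ℝ W] (n : ℕ)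
    (b : V [⋀^Fin 2]→L[ℝ] ℝ) (L : W →L[ℝ] V) (v : Fin n × Fin 2 → W) :
    wedgePow n (b.compContinuousLinearMap L) v = wedgePow n b (fun i => L (v i)) := by
  simp only [wedgePow, comp_apply_two]

/-- A symplectic basis of a nondegenerate alternating form. -/
theorem exists_symplectic_family (n : ℕ) : ∀ {V : Type*} [AddCommGroup V] [Module ℝ V]
    [FiniteDimensional ℝ V] (B : V →ₗ[ℝ] V →ₗ[ℝ] ℝ) (_ : ∀ v, B v v = 0)
    (_ : ∀ v, (∀ w, B v w = 0) → v = 0) (_ : Module.finrank ℝ V = 2 * n),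
    ∃ v : Fin n × Fin 2 → V, ∀ i j, B (v (i, 0)) (v (j, 1)) = (if i = j then 1 else 0) ∧
      B (v (i, 0)) (v (j, 0)) = 0 ∧ B (v (i, 1)) (v (j, 1)) = 0 := by
  induction n with
  | zero => intro V _ _ _ B _ _ _; exact ⟨fun i => i.1.elim0, fun i => i.elim0⟩
  | succ n ih =>
    intro V _ _ _ B halt hnd hV
    have hsk : ∀ v w, B v w = -B w v := by
      intro v w
      have := halt (v + w)
      simp only [map_add, LinearMap.add_apply, halt] at this
      linarith
    have hpos : 0 < Module.finrank ℝ V := by omega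
    have : Nontrivial V := Module.nontrivial_of_finrank_pos hpos
    obtain ⟨e, he⟩ := exists_ne (0 : V)
    obtain ⟨f', hf'⟩ : ∃ w, B e w ≠ 0 := by
      by_contra! h
      exact he (hnd e h)
    set f := (B e f')⁻¹ • f' with hf
    have hef : B e f = 1 := by simp [hf, hf']
    have hfe : B f e = -1 := by rw [hsk, hef]
    let T : V →ₗ[ℝ] ℝ × ℝ := (B e).prod (B f)
    have hT : LinearMap.range T = ⊤ := by
      rw [LinearMap.range_eq_top]
      rintro ⟨a, b⟩
      refine ⟨a • f - b • e, ?_⟩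
      simp [T, hef, hfe, halt]
    have hW : Module.finrank ℝ (LinearMap.ker T) = 2 * n := by
      have := LinearMap.finrank_range_add_finrank_ker T
      rw [hT, finrank_top] at this
      simp at this
      omega
    have hmem : ∀ x : LinearMap.ker T, B e x = 0 ∧ B f x = 0 := by
      intro x
      exact Prod.ext_iff.1 (LinearMap.mem_ker.1 x.2)
    obtain ⟨v, hv⟩ := ih (B.compl₁₂ (LinearMap.ker T).subtype (LinearMap.ker T).subtype)
      (fun x => halt x) (fun x hx => by
        refine Subtype.ext (hnd x fun w => ?_)
        -- The projection of `w` to the complement along the plane. Vectors of the complement do not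
        -- see the part that is removed, so the form stays nondegenerate.
        have h1 : w - (B e w) • f + (B f w) • e ∈ LinearMap.ker T := by
          rw [LinearMap.mem_ker]
          simp [T, hef, hfe, halt]
        have h2 := hx ⟨_, h1⟩
        have h3 := hmem x
        simp only [LinearMap.compl₁₂_apply, Submodule.subtype_apply, map_add, map_sub,
          map_smul, smul_eq_mul] at h2
        rw [hsk (x : V) f, hsk (x : V) e, h3.1, h3.2] at h2
        simpa using h2) hW
    refine ⟨fun p => Fin.cons (α := fun _ => V) (if p.2 = 0 then e else f) (fun i => (v (i, p.2) : V)) p.1, ?_⟩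
    intro i j
    have hx := fun (x : LinearMap.ker T) => (hmem x)
    have hx' : ∀ (x : LinearMap.ker T), B x e = 0 ∧ B x f = 0 := fun x => by
      rw [hsk _ e, hsk _ f, (hx x).1, (hx x).2]; simp
    refine Fin.cases ?_ (fun i => ?_) i <;> refine Fin.cases ?_ (fun j => ?_) j
    · simp [hef, halt]
    · simp [hx, (Fin.succ_ne_zero _).symm]
    · simp [hx', Fin.succ_ne_zero]
    · simpa using hv i j

/-- No summand is negative. A permutation contributes only if it maps pairs to pairs. It is then a
permutation of the pairs, which is even as it moves two copies of `Fin n` simultaneously, combined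
with swaps inside some pairs. Each such swap contributes a sign both to `sign τ` and to the
corresponding factor of the product, so the summand is a square. The identity contributes `1`. -/
theorem wedgePow_pos_of_symplectic {n : ℕ} (b : V [⋀^Fin 2]→L[ℝ] ℝ) (v : Fin n × Fin 2 → V)
    (hv : ∀ i j, b ![v (i, 0), v (j, 1)] = (if i = j then 1 else 0) ∧
      b ![v (i, 0), v (j, 0)] = 0 ∧ b ![v (i, 1), v (j, 1)] = 0) : 0 < wedgePow n b v := by
  have hpair : ∀ p q : Fin n × Fin 2, b ![v p, v q] ≠ 0 →
      p.1 = q.1 ∧ ((p.2 = 0 ∧ q.2 = 1 ∧ b ![v p, v q] = 1) ∨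
        (p.2 = 1 ∧ q.2 = 0 ∧ b ![v p, v q] = -1)) := by
    rintro ⟨i, e⟩ ⟨j, e'⟩ h
    have h10 : b ![v (i, 1), v (j, 0)] = -(if i = j then 1 else 0) := by
      rw [two_swap, (hv j i).1]
      simp [eq_comm]
    fin_cases e <;> fin_cases e' <;> simp_all
  refine mul_pos (by positivity) ?_
  refine Finset.sum_pos' (fun τ _ => ?_) ⟨1, Finset.mem_univ _, ?_⟩
  · by_cases h0 : ∏ i, b ![v (τ (i, 0)), v (τ (i, 1))] = 0
    · rw [h0, mul_zero]
    have hne : ∀ i, b ![v (τ (i, 0)), v (τ (i, 1))] ≠ 0 := fun i =>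
      Finset.prod_ne_zero_iff.1 h0 i (Finset.mem_univ i)
    have hp := fun i => hpair _ _ (hne i)
    classical
    -- The swaps that undo the reversals inside pairs: after them `τ` preserves the second index.
    let s : Fin n → Equiv.Perm (Fin 2) := fun i => if (τ (i, 0)).2 = 0 then 1 else Equiv.swap 0 1
    let κ : Equiv.Perm (Fin n × Fin 2) := Equiv.prodCongrRight s
    have hτ' : ∀ i e, (τ * κ) (i, e) = ((τ (i, 0)).1, e) := by
      intro i e
      obtain ⟨h1, h2⟩ := hp i
      simp only [Equiv.Perm.mul_apply, κ, Equiv.prodCongrRight_apply, s]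
      rcases h2 with ⟨h2, h3, -⟩ | ⟨h2, h3, -⟩
      · rw [if_pos h2]
        fin_cases e
        · exact Prod.ext rfl h2
        · exact Prod.ext h1.symm h3
      · rw [if_neg (by simp [h2])]
        fin_cases e
        · exact Prod.ext (by simpa using h1.symm) (by simpa using h3)
        · exact Prod.ext (by simp) (by simpa using h2)
    have hinj : Function.Injective fun i : Fin n => (τ (i, 0)).1 := by
      intro i j hij
      have : (τ * κ) (i, 0) = (τ * κ) (j, 0) := by rw [hτ', hτ']; simpa using hij
      simpa using (τ * κ).injective this
    let π : Equiv.Perm (Fin n) := Equiv.ofBijective _ (Finite.injective_iff_bijective.1 hinj)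
    have hπ : τ * κ = Equiv.prodCongrLeft (fun _ : Fin 2 => π) := by
      ext1 ⟨i, e⟩
      rw [hτ']
      rfl
    have hsign : Equiv.Perm.sign τ = ∏ i, Equiv.Perm.sign (s i) := by
      have h1 := congrArg Equiv.Perm.sign hπ
      rw [Equiv.Perm.sign_mul, Equiv.Perm.sign_prodCongrLeft, Equiv.Perm.sign_prodCongrRight,
        Fin.prod_univ_two, Int.units_mul_self] at h1
      exact (eq_inv_of_mul_eq_one_left h1).trans (Int.units_inv_eq_self _)
    have hs : ∀ i, (((Equiv.Perm.sign (s i) : ℤˣ) : ℤ) : ℝ) =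
        b ![v (τ (i, 0)), v (τ (i, 1))] := by
      intro i
      rcases (hp i).2 with ⟨h2, h3, h4⟩ | ⟨h2, h3, h4⟩
      · simp [s, h2, h4]
      · simp [s, h2, h4]
    rw [hsign]
    push_cast
    rw [Finset.prod_congr rfl fun i _ => hs i]
    exact mul_self_nonneg _
  · simp [hv]

/-- The top power of a nondegenerate `2`-form does not vanish. -/
theorem exists_wedgePow_ne_zero [FiniteDimensional ℝ V] {n : ℕ} (hV : Module.finrank ℝ V = 2 * n)
    (b : V [⋀^Fin 2]→L[ℝ] ℝ) (hb : ∀ v, (∀ w, b ![v, w] = 0) → v = 0) :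
    ∃ v, wedgePow n b v ≠ 0 := by
  obtain ⟨v, hv⟩ := exists_symplectic_family n (toBilin b) (two_self b) hb hV
  exact ⟨v, (wedgePow_pos_of_symplectic b v hv).ne'⟩

/-- A `2`-form that is nondegenerate on a subspace of dimension `2m` has a nonvanishing `m`-th power
there. -/
theorem exists_wedgePow_ne_zero_of_subspace [FiniteDimensional ℝ V] {m : ℕ} (W : Submodule ℝ V)
    (hW : Module.finrank ℝ W = 2 * m) (b : V [⋀^Fin 2]→L[ℝ] ℝ)
    (hb : ∀ v ∈ W, (∀ w ∈ W, b ![v, w] = 0) → v = 0) :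
    ∃ v : Fin m × Fin 2 → V, (∀ i, v i ∈ W) ∧ wedgePow m b v ≠ 0 := by
  obtain ⟨v, hv⟩ := exists_symplectic_family m ((toBilin b).compl₁₂ W.subtype W.subtype)
    (fun x => two_self b x) (fun x hx => Subtype.ext (hb x x.2 fun w hw => hx ⟨w, hw⟩)) hW
  exact ⟨fun i => v i, fun i => (v i).2, (wedgePow_pos_of_symplectic b _ hv).ne'⟩

end Wedge

/-! ### Pointwise linear algebra: convex boundaries, large circle forms, the interpolation. -/

section LinearAlgebra

open Filter

/-- The tube lemma for an arbitrary parameter filter. It turns limits at single points, as `t → 0⁺`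
or `L, K → ∞`, into thresholds that are uniform over a compact set. -/
theorem eventually_forall_of_isCompact {X Z : Type*} [TopologicalSpace X] {K : Set X}
    (hK : IsCompact K) {l : Filter Z} {p : X → Z → Prop}
    (h : ∀ x ∈ K, ∀ᶠ q in 𝓝 x ×ˢ l, p q.1 q.2) : ∀ᶠ z in l, ∀ x ∈ K, p x z := by
  refine hK.induction_on (p := fun s => ∀ᶠ z in l, ∀ x ∈ s, p x z) (by simp) ?_ ?_ ?_
  · intro s t hst ht
    filter_upwards [ht] with z hz x hx using hz x (hst hx)
  · intro s t hs ht
    filter_upwards [hs, ht] with z hzs hzt x hx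
    exact hx.elim (hzs x) (hzt x)
  · intro x hx
    obtain ⟨u, hu, v, hv, huv⟩ := Filter.eventually_prod_iff.1 (h x hx)
    refine ⟨{y | u y}, mem_nhdsWithin_of_mem_nhds hu, ?_⟩
    filter_upwards [hv] with z hz y hy
    exact huv hy hz

theorem tendsto_one_apply {ι V : Type*} [NormedAddCommGroup V] [NormedSpace ℝ V] {l : Filter ι}
    {a : ι → V [⋀^Fin 1]→L[ℝ] ℝ} {a₀ : V [⋀^Fin 1]→L[ℝ] ℝ} {v : ι → V} {v₀ : V}
    (ha : Tendsto a l (𝓝 a₀)) (hv : Tendsto v l (𝓝 v₀)) :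
    Tendsto (fun i => a i ![v i]) l (𝓝 (a₀ ![v₀])) :=
  ha.eval (hv.matrixVecCons tendsto_const_nhds)

theorem tendsto_two_apply {ι V : Type*} [NormedAddCommGroup V] [NormedSpace ℝ V] {l : Filter ι}
    {a : ι → V [⋀^Fin 2]→L[ℝ] ℝ} {a₀ : V [⋀^Fin 2]→L[ℝ] ℝ} {v w : ι → V} {v₀ w₀ : V}
    (ha : Tendsto a l (𝓝 a₀)) (hv : Tendsto v l (𝓝 v₀)) (hw : Tendsto w l (𝓝 w₀)) :
    Tendsto (fun i => a i ![v i, w i]) l (𝓝 (a₀ ![v₀, w₀])) :=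
  ha.eval (hv.matrixVecCons (hw.matrixVecCons tendsto_const_nhds))

variable {E : Type*} [NormedAddCommGroup E] [NormedSpace ℝ E]

/-! ### The boundary of a convex domain -/

theorem two_prod (B : (E × ℝ) [⋀^Fin 2]→L[ℝ] ℝ) (v : E) (s : ℝ) (w : E × ℝ) :
    B ![(v, s), w] = B ![(v, 0), w] + s * B ![(0, 1), w] := by
  rw [← two_smul_left, ← two_add_left]
  simp

/-- Evaluate `B(X, ·) = b` on `R`. The tangential part of `X` pairs to zero with `R`, leaving `X.2 *
B(∂t, R) = h α(R) > 0`, and the outward field has `X.2 < 0` because `t` grows inwards. -/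
theorem boundary_reeb_neg {α : E [⋀^Fin 1]→L[ℝ] ℝ} {b : (E × ℝ) [⋀^Fin 1]→L[ℝ] ℝ}
    {B : (E × ℝ) [⋀^Fin 2]→L[ℝ] ℝ} {h : ℝ} (hh : 0 < h)
    (hb : ∀ v, b ![(v, 0)] = h * α ![v]) {X : E × ℝ} (hX : ∀ w, B ![X, w] = b ![w])
    (hX2 : X.2 < 0) {R : E} (hR : 0 < α ![R]) (hR' : ∀ w, B ![(R, 0), (w, 0)] = 0) :
    B ![(0, 1), (R, 0)] < 0 := by
  have h1 := hX (R, 0)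
  rw [hb, show X = (X.1, X.2) from rfl, two_prod, two_swap, hR'] at h1
  have h2 : 0 < h * α ![R] := by positivity
  nlinarith

/-- A hypersurface transverse to a Liouville field is of contact type. As `X.2 ≠ 0`, every vector is
tangential plus a multiple of `X`, and `b(X) = B(X, X) = 0`. If `α(v) = 0` and `A(v, ·)` vanishes on
`ker α`, then `A(v, ·) = c α`, so that `v - c X` lies in the kernel of `B` and vanishes; its
`t`-component forces `c = 0`. -/
theorem boundary_contact {α : E [⋀^Fin 1]→L[ℝ] ℝ} {A : E [⋀^Fin 2]→L[ℝ] ℝ}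
    {b : (E × ℝ) [⋀^Fin 1]→L[ℝ] ℝ} {B : (E × ℝ) [⋀^Fin 2]→L[ℝ] ℝ}
    (hb : ∀ v, b ![(v, 0)] = α ![v])
    (hB : ∀ v w, B ![(v, 0), (w, 0)] = A ![v, w])
    {X : E × ℝ} (hX : ∀ w, B ![X, w] = b ![w]) (hX2 : X.2 < 0)
    (hnd : ∀ v, (∀ w, B ![v, w] = 0) → v = 0) : ContactPt α A := by
  have hbX : b ![X] = 0 := by rw [← hX, two_self]
  have hdec : ∀ W : E × ℝ, W = (W.1 - (W.2 / X.2) • X.1, 0) + (W.2 / X.2) • X := by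
    intro W
    refine Prod.ext (by simp) ?_
    simp [hX2.ne]
  constructor
  · intro h0
    have : X = 0 := by
      refine hnd X fun W => ?_
      rw [hX, hdec W, one_add, hb, one_smul', hbX, h0]
      simp
    rw [this] at hX2
    simp at hX2
  · intro v hv hw
    by_cases hα : ∀ w, α ![w] = 0
    · have hz : (v, (0 : ℝ)) = 0 := by
        refine hnd _ fun W => ?_
        rw [hdec W, two_add_right, hB, two_smul_right, two_swap B _ X, hX, hb, hv, hw _ (hα _)]
        simp
      simpa using hz
    push Not at hα
    obtain ⟨R, hR⟩ := hα
    set c := A ![v, R] / α ![R] with hc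
    have key : ∀ w, A ![v, w] = c * α ![w] := by
      intro w
      have h1 : α ![w + (-(α ![w] / α ![R])) • R] = 0 := by
        rw [one_add, one_smul']; field_simp; ring
      have h2 := hw _ h1
      rw [two_add_right, two_smul_right] at h2
      rw [hc]
      field_simp at h2 ⊢
      linarith
    have hz : (v, (0 : ℝ)) + (-c) • X = 0 := by
      refine hnd _ fun W => ?_
      rw [two_add_left, two_smul_left, hX]
      conv_lhs => rw [hdec W]
      rw [two_add_right, hB, two_smul_right, two_swap B _ X, hX, hb, hv, one_add, one_smul', hbX,
        hb, key]
      ring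
    have h1 := congrArg Prod.snd hz
    have h2 := congrArg Prod.fst hz
    simp only [Prod.snd_add, Prod.smul_snd, Prod.snd_zero, smul_eq_mul, zero_add] at h1
    have hc0 : c = 0 := by
      rcases mul_eq_zero.1 h1 with h | h
      · linarith
      · exact absurd h hX2.ne
    simpa [hc0] using h2

/-! ### Large multiples of the circle form -/

/-- The correction terms carry the factor `1/κ` and die in the limit, leaving the nondegenerate
`B₀`; compactness of the unit sphere makes this uniform in `v`. Both signs are treated together
because the two mapping tori use `K` and `-K`. -/
theorem eventually_contactPt_add_large [FiniteDimensional ℝ E] {ι : Type*} {l : Filter ι}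
    {lam nu : ι → E [⋀^Fin 1]→L[ℝ] ℝ} {lam₀ nu₀ : E [⋀^Fin 1]→L[ℝ] ℝ}
    {B : ι → E [⋀^Fin 2]→L[ℝ] ℝ} {B₀ : E [⋀^Fin 2]→L[ℝ] ℝ}
    (hlam : Tendsto lam l (𝓝 lam₀)) (hnu : Tendsto nu l (𝓝 nu₀)) (hB : Tendsto B l (𝓝 B₀))
    (hnd : ∀ v, (∀ w, B₀ ![v, w] = 0) → v = 0) :
    ∀ᶠ z in l ×ˢ (atTop : Filter ℝ), ∀ v : E,
      ((∀ w, B z.1 ![v, w] - z.2⁻¹ * (lam z.1 ![v] * nu z.1 ![w] - lam z.1 ![w] * nu z.1 ![v]) = 0)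
        → v = 0) ∧
      ((∀ w, B z.1 ![v, w] + z.2⁻¹ * (lam z.1 ![v] * nu z.1 ![w] - lam z.1 ![w] * nu z.1 ![v]) = 0)
        → v = 0) := by
  have key : ∀ᶠ z in l ×ˢ (atTop : Filter ℝ), ∀ v ∈ Metric.sphere (0 : E) 1,
      (∃ w, B z.1 ![v, w] - z.2⁻¹ * (lam z.1 ![v] * nu z.1 ![w] - lam z.1 ![w] * nu z.1 ![v]) ≠ 0) ∧
      (∃ w, B z.1 ![v, w] + z.2⁻¹ * (lam z.1 ![v] * nu z.1 ![w] - lam z.1 ![w] * nu z.1 ![v]) ≠ 0) := by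
    refine eventually_forall_of_isCompact (isCompact_sphere 0 1) fun u hu => ?_
    have hu0 : u ≠ 0 := by rintro rfl; simp at hu
    obtain ⟨w, hw⟩ : ∃ w, B₀ ![u, w] ≠ 0 := by
      by_contra! h
      exact hu0 (hnd u h)
    have t1 : Tendsto (fun q : E × ι × ℝ => q.1) (𝓝 u ×ˢ (l ×ˢ atTop)) (𝓝 u) := tendsto_fst
    have t2 : Tendsto (fun q : E × ι × ℝ => q.2.1) (𝓝 u ×ˢ (l ×ˢ atTop)) l :=
      tendsto_fst.comp tendsto_snd
    have t3 : Tendsto (fun q : E × ι × ℝ => q.2.2⁻¹) (𝓝 u ×ˢ (l ×ˢ atTop)) (𝓝 0) :=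
      tendsto_inv_atTop_zero.comp (tendsto_snd.comp tendsto_snd)
    have tw : Tendsto (fun _ : E × ι × ℝ => w) (𝓝 u ×ˢ (l ×ˢ atTop)) (𝓝 w) := tendsto_const_nhds
    have s1 := tendsto_two_apply (hB.comp t2) t1 tw
    have s2 := t3.mul (((tendsto_one_apply (hlam.comp t2) t1).mul
      (tendsto_one_apply (hnu.comp t2) tw)).sub
      ((tendsto_one_apply (hlam.comp t2) tw).mul (tendsto_one_apply (hnu.comp t2) t1)))
    rw [zero_mul] at s2
    have s3 := s1.sub s2
    have s4 := s1.add s2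
    rw [sub_zero] at s3
    rw [add_zero] at s4
    filter_upwards [s3.eventually_ne hw, s4.eventually_ne hw] with q h3 h4
    exact ⟨⟨w, h3⟩, ⟨w, h4⟩⟩
  filter_upwards [key] with z hz v
  have hn : v ≠ 0 → ‖v‖⁻¹ • v ∈ Metric.sphere (0 : E) 1 := by
    intro hv
    simp [norm_smul, hv]
  constructor <;> intro h <;> by_contra hv
  · obtain ⟨w, hw⟩ := (hz _ (hn hv)).1
    apply hw
    rw [two_smul_left, one_smul', one_smul']
    linear_combination ‖v‖⁻¹ * h w
  · obtain ⟨w, hw⟩ := (hz _ (hn hv)).2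
    apply hw
    rw [two_smul_left, one_smul', one_smul']
    linear_combination ‖v‖⁻¹ * h w

/-- `λ + κ dθ` is contact for the derivative `B + dθ ∧ ν`, if `1/κ` is small. -/
theorem contact_add_large {lam nu : E [⋀^Fin 1]→L[ℝ] ℝ} {B : E [⋀^Fin 2]→L[ℝ] ℝ} {κ : ℝ}
    (hκ : κ ≠ 0) (hnd : ∀ v, (∀ w, B ![v, w] -
      κ⁻¹ * (lam ![v] * nu ![w] - lam ![w] * nu ![v]) = 0) → v = 0)
    {a : (E × ℝ) [⋀^Fin 1]→L[ℝ] ℝ} {Ω : (E × ℝ) [⋀^Fin 2]→L[ℝ] ℝ}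
    (ha : ∀ v, a ![v] = lam ![v.1] + κ * v.2)
    (hΩ : ∀ v w, Ω ![v, w] = B ![v.1, w.1] + v.2 * nu ![w.1] - w.2 * nu ![v.1]) :
    ContactPt a Ω := by
  constructor
  · intro h
    have h1 := ha (0, 1)
    rw [h] at h1
    have h2 : lam ![(0 : E)] = 0 := (toLin lam).map_zero
    simp [h2] at h1
    exact hκ h1.symm
  · rintro ⟨v, r⟩ hv hw
    rw [ha] at hv
    -- The hyperplane `ker a` is the graph of `-κ⁻¹ λ` over `E`, and on this graph `Ω` becomes `B -
    -- κ⁻¹ λ ∧ ν`.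
    have hr : r = -κ⁻¹ * lam ![v] := by
      field_simp
      simp only at hv
      linarith
    have hv0 : v = 0 := by
      refine hnd v fun w => ?_
      have := hw (w, -κ⁻¹ * lam ![w]) (by rw [ha]; simp only; field_simp; ring)
      rw [hΩ] at this
      simp only [hr] at this
      linear_combination this
    subst hv0
    have h2 : lam ![(0 : E)] = 0 := (toLin lam).map_zero
    rw [h2] at hr
    simp [hr]

/-! ### Nondegeneracy of the interpolation between a contact form and a Liouville form -/

/-- The derivative of `(1 - ρ) f α + ρ b`, where `q = -f'` and `p = ρ'`. -/
def interpTwo (α : E [⋀^Fin 1]→L[ℝ] ℝ) (A : E [⋀^Fin 2]→L[ℝ] ℝ)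
    (b : (E × ℝ) [⋀^Fin 1]→L[ℝ] ℝ) (B : (E × ℝ) [⋀^Fin 2]→L[ℝ] ℝ) (f q ρ p : ℝ)
    (v w : E × ℝ) : ℝ :=
  (1 - ρ) * f * A ![v.1, w.1] + (-(1 - ρ) * q - p * f) * (v.2 * α ![w.1] - w.2 * α ![v.1]) +
    ρ * B ![v, w] + p * (v.2 * b ![w] - w.2 * b ![v])

/-- By `h1` the restriction `Aw` of the form to the slice is nondegenerate on the hyperplane `ker
α`, so its kernel is a line spanned by some `R` with `α(R) = 1`. By `h2` the pairing of `∂t` with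
`R` is negative. Testing a kernel vector against `R` removes its `t`-component, and testing what
remains, a multiple of `R`, against `∂t` removes the rest. The hypotheses concern unit vectors only,
so that they can be established by compactness. -/
theorem interpTwo_nondegenerate [FiniteDimensional ℝ E] {α : E [⋀^Fin 1]→L[ℝ] ℝ}
    {A : E [⋀^Fin 2]→L[ℝ] ℝ} {b : (E × ℝ) [⋀^Fin 1]→L[ℝ] ℝ} {B : (E × ℝ) [⋀^Fin 2]→L[ℝ] ℝ}
    {f q ρ p : ℝ} {S : E} (hS : α ![S] ≠ 0)
    (h1 : ∀ u ∈ Metric.sphere (0 : E) 1, α ![u] = 0 → ∃ w, α ![w] = 0 ∧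
      (1 - ρ) * f * A ![u, w] + ρ * B ![(u, 0), (w, 0)] ≠ 0)
    (h2 : ∀ u ∈ Metric.sphere (0 : E) 1,
      (∀ w, (1 - ρ) * f * A ![u, w] + ρ * B ![(u, 0), (w, 0)] = 0) → 0 < α ![u] →
      -(1 - ρ) * q * α ![u] + ρ * B ![(0, 1), (u, 0)] + p * (b ![(u, 0)] - f * α ![u]) < 0)
    (v : E × ℝ) (hv : ∀ w, interpTwo α A b B f q ρ p v w = 0) : v = 0 := by
  let T : E →L[ℝ] E × ℝ := ContinuousLinearMap.inl ℝ E ℝ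
  let Aw : E [⋀^Fin 2]→L[ℝ] ℝ := ((1 - ρ) * f) • A + ρ • B.compContinuousLinearMap T
  have hAw : ∀ u w, Aw ![u, w] = (1 - ρ) * f * A ![u, w] + ρ * B ![(u, 0), (w, 0)] := by
    intro u w
    simp only [Aw, ContinuousAlternatingMap.add_apply, ContinuousAlternatingMap.smul_apply,
      comp_apply_two, smul_eq_mul]
    rfl
  simp only [← hAw] at h1 h2
  have hn : ∀ u : E, u ≠ 0 → ‖u‖⁻¹ • u ∈ Metric.sphere (0 : E) 1 := by
    intro u hu
    simp [norm_smul, hu]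
  have h1' : ∀ u, α ![u] = 0 → (∀ w, α ![w] = 0 → Aw ![u, w] = 0) → u = 0 := by
    intro u hu hw
    by_contra hne
    obtain ⟨w, hw1, hw2⟩ := h1 _ (hn u hne) (by rw [one_smul', hu, mul_zero])
    rw [two_smul_left, hw w hw1, mul_zero] at hw2
    exact hw2 rfl
  -- the kernel of `Aw`
  obtain ⟨R, hR1, hR2⟩ : ∃ R, α ![R] = 1 ∧ ∀ w, Aw ![R, w] = 0 := by
    let W := LinearMap.ker (toLin α)
    let Φ : W →ₗ[ℝ] Module.Dual ℝ W := (toBilin Aw).compl₁₂ W.subtype W.subtype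
    have hΦ : Function.Injective Φ := by
      rw [injective_iff_map_eq_zero]
      intro x hx
      refine Subtype.ext (h1' x x.2 fun w hw => ?_)
      exact DFunLike.congr_fun hx (⟨w, hw⟩ : W)
    have hΦs : Function.Surjective Φ := by
      refine (LinearMap.injective_iff_surjective_of_finrank_eq_finrank ?_).1 hΦ
      exact (Subspace.dual_finrank_eq).symm
    set S' := (α ![S])⁻¹ • S with hS'
    have hS1 : α ![S'] = 1 := by rw [hS', one_smul']; field_simp
    obtain ⟨u, hu⟩ := hΦs (-((toBilin Aw S').comp W.subtype))
    have hu0 : α ![(u : E)] = 0 := u.2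
    refine ⟨S' + u, by rw [one_add, hS1, hu0, add_zero], ?_⟩
    have hk : ∀ w, α ![w] = 0 → Aw ![S' + u, w] = 0 := by
      intro w hw
      have := DFunLike.congr_fun hu (⟨w, hw⟩ : W)
      have h3 : Aw ![(u : E), w] = -Aw ![S', w] := this
      rw [two_add_left, h3]
      ring
    intro w
    have h4 : α ![w + (-α ![w]) • (S' + u)] = 0 := by
      rw [one_add, one_smul', one_add, hS1, hu0]; ring
    have h5 := hk _ h4
    rw [two_add_right, two_smul_right, two_self] at h5
    linarith
  have hR0 : R ≠ 0 := by
    rintro rfl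
    have h3 : α ![(0 : E)] = 0 := (toLin α).map_zero
    rw [h3] at hR1
    exact zero_ne_one hR1
  have hη : -(1 - ρ) * q + ρ * B ![(0, 1), (R, 0)] + p * (b ![(R, 0)] - f) < 0 := by
    have hpos : 0 < ‖R‖⁻¹ := by positivity
    have h3 := h2 _ (hn R hR0) (fun w => by rw [two_smul_left, hR2, mul_zero])
      (by rw [one_smul', hR1]; linarith)
    have e1 : ((‖R‖⁻¹ • R, (0 : ℝ)) : E × ℝ) = ‖R‖⁻¹ • ((R, 0) : E × ℝ) := by simp
    rw [e1, one_smul', hR1, two_smul_right, one_smul'] at h3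
    have : ‖R‖⁻¹ * (-(1 - ρ) * q + ρ * B ![(0, 1), (R, 0)] + p * (b ![(R, 0)] - f)) < 0 := by
      linarith
    by_contra hcon
    push Not at hcon
    have := mul_nonneg hpos.le hcon
    linarith
  obtain ⟨x, s⟩ := v
  have hs : s = 0 := by
    have h3 := hv (R, 0)
    simp only [interpTwo] at h3
    rw [hR1, two_prod] at h3
    have h4 : (1 - ρ) * f * A ![x, R] + ρ * B ![(x, 0), (R, 0)] = 0 := by
      rw [← hAw, two_swap, hR2, neg_zero]
    have h5 : s * (-(1 - ρ) * q + ρ * B ![(0, 1), (R, 0)] + p * (b ![(R, 0)] - f)) = 0 := by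
      linear_combination h3 - h4
    rcases mul_eq_zero.1 h5 with h | h
    · exact h
    · exact absurd h hη.ne
  subst hs
  have hx : ∀ w, Aw ![x, w] = 0 := by
    intro w
    have h3 := hv (w, 0)
    simp only [interpTwo] at h3
    rw [hAw]
    linear_combination h3
  have hxR : x = α ![x] • R := by
    have h3 : x + (-α ![x]) • R = 0 := by
      refine h1' _ (by rw [one_add, one_smul', hR1]; ring) fun w _ => ?_
      rw [two_add_left, two_smul_left, hx, hR2]
      ring
    rw [neg_smul] at h3
    exact eq_of_sub_eq_zero (by rwa [sub_eq_add_neg])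
  have h3 := hv (0, 1)
  simp only [interpTwo] at h3
  have e1 : ((x, (0 : ℝ)) : E × ℝ) = α ![x] • ((R, 0) : E × ℝ) := by
    conv_lhs => rw [hxR]
    simp
  have e2 : A ![x, (0 : E)] = 0 := (toBilin A x).map_zero
  rw [e2, e1, two_smul_left, one_smul', two_swap] at h3
  have h5 : α ![x] * (-(1 - ρ) * q + ρ * B ![(0, 1), (R, 0)] + p * (b ![(R, 0)] - f)) = 0 := by
    linear_combination -h3
  have h6 : α ![x] = 0 := (mul_eq_zero.1 h5).resolve_right hη.ne
  rw [hxR, h6]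
  simp

/-- The analytic heart of the interpolation: the two hypotheses of `interpTwo_nondegenerate` hold
uniformly for `ρ` in `[0, 1]` and unit vectors `u`, close to the boundary and for large `L`. On `ker
α₀` the limit form is `(1 - ρ) C + ρ h > 0` times `A₀`. For the sign condition only the directions
`u` in the limiting kernel matter, and the restriction on `p` decides which term is responsible for
negativity. -/
theorem eventually_interpTwo_nondegenerate [FiniteDimensional ℝ E] {ι : Type*} {l : Filter ι}
    {α : ι → E [⋀^Fin 1]→L[ℝ] ℝ} {A : ι → E [⋀^Fin 2]→L[ℝ] ℝ}
    {b : ι → (E × ℝ) [⋀^Fin 1]→L[ℝ] ℝ} {B : ι → (E × ℝ) [⋀^Fin 2]→L[ℝ] ℝ} {f q : ι → ℝ}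
    {α₀ : E [⋀^Fin 1]→L[ℝ] ℝ} {A₀ : E [⋀^Fin 2]→L[ℝ] ℝ}
    {b₀ : (E × ℝ) [⋀^Fin 1]→L[ℝ] ℝ} {B₀ : (E × ℝ) [⋀^Fin 2]→L[ℝ] ℝ} {C h : ℝ}
    (hα : Tendsto α l (𝓝 α₀)) (hA : Tendsto A l (𝓝 A₀)) (hb : Tendsto b l (𝓝 b₀))
    (hB : Tendsto B l (𝓝 B₀)) (hf : Tendsto f l (𝓝 C)) (hq : ∀ᶠ i in l, 0 < q i)
    (hh : 0 < h) (hC : h < C) (hcont : ContactPt α₀ A₀)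
    (hb₀ : ∀ v, b₀ ![(v, 0)] = h * α₀ ![v])
    (hB₀ : ∀ v w, α₀ ![v] = 0 → α₀ ![w] = 0 → B₀ ![(v, 0), (w, 0)] = h * A₀ ![v, w])
    (hR : ∀ R, 0 < α₀ ![R] → (∀ w, B₀ ![(R, 0), (w, 0)] = 0) → B₀ ![(0, 1), (R, 0)] < 0) :
    ∀ᶠ z in l ×ˢ (atTop : Filter ℝ), ∀ ρ ∈ Icc (0 : ℝ) 1, ∀ p, 0 ≤ p →
      (z.2 * ρ ≤ p ∨ 1 - z.2⁻¹ ≤ ρ) → ∀ v,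
      (∀ w, interpTwo (α z.1) (A z.1) (b z.1) (B z.1) (f z.1) (q z.1) ρ p v w = 0) → v = 0 := by
  obtain ⟨S, hS⟩ : ∃ S, α₀ ![S] ≠ 0 := by
    by_contra! h0
    refine hcont.1 ?_
    ext v
    have : v = ![v 0] := by ext i; fin_cases i; rfl
    rw [this]
    exact h0 _
  -- the form on the boundary
  have hlim : ∀ ρ ∈ Icc (0 : ℝ) 1, ∀ u, α₀ ![u] = 0 → u ≠ 0 → ∃ w, α₀ ![w] = 0 ∧
      (1 - ρ) * C * A₀ ![u, w] + ρ * B₀ ![(u, 0), (w, 0)] ≠ 0 := by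
    intro ρ hρ u hu hu0
    by_contra! hcon
    refine hu0 (hcont.2 u hu fun w hw => ?_)
    have h1 := hcon w hw
    rw [hB₀ u w hu hw] at h1
    have h2 : ((1 - ρ) * C + ρ * h) * A₀ ![u, w] = 0 := by linear_combination h1
    refine (mul_eq_zero.1 h2).resolve_left (ne_of_gt ?_)
    have h3 : (1 - ρ) * h ≤ (1 - ρ) * C := mul_le_mul_of_nonneg_left hC.le (by linarith [hρ.2])
    linarith
  have key : ∀ᶠ z in l ×ˢ (atTop : Filter ℝ), ∀ x ∈ Icc (0 : ℝ) 1 ×ˢ Metric.sphere (0 : E) 1,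
      ((α z.1 ![x.2] = 0 → ∃ w, α z.1 ![w] = 0 ∧
        (1 - x.1) * f z.1 * A z.1 ![x.2, w] + x.1 * B z.1 ![(x.2, 0), (w, 0)] ≠ 0) ∧
      ((∀ w, (1 - x.1) * f z.1 * A z.1 ![x.2, w] + x.1 * B z.1 ![(x.2, 0), (w, 0)] = 0) →
        0 < α z.1 ![x.2] → ∀ p, 0 ≤ p → (z.2 * x.1 ≤ p ∨ 1 - z.2⁻¹ ≤ x.1) → x.1 ∈ Icc (0 : ℝ) 1 →
        -(1 - x.1) * q z.1 * α z.1 ![x.2] + x.1 * B z.1 ![(0, 1), (x.2, 0)] +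
          p * (b z.1 ![(x.2, 0)] - f z.1 * α z.1 ![x.2]) < 0)) := by
    refine eventually_forall_of_isCompact (isCompact_Icc.prod (isCompact_sphere 0 1)) ?_
    rintro ⟨ρ₀, u₀⟩ ⟨hρ₀, hu₀⟩
    simp only at hρ₀ hu₀
    have hu0 : u₀ ≠ 0 := by rintro rfl; simp at hu₀
    set 𝓕 := 𝓝 ((ρ₀, u₀) : ℝ × E) ×ˢ (l ×ˢ (atTop : Filter ℝ)) with h𝓕
    have tρ : Tendsto (fun x : (ℝ × E) × ι × ℝ => x.1.1) 𝓕 (𝓝 ρ₀) :=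
      (continuous_fst.tendsto (ρ₀, u₀)).comp tendsto_fst
    have tu : Tendsto (fun x : (ℝ × E) × ι × ℝ => x.1.2) 𝓕 (𝓝 u₀) :=
      (continuous_snd.tendsto (ρ₀, u₀)).comp tendsto_fst
    have ti : Tendsto (fun x : (ℝ × E) × ι × ℝ => x.2.1) 𝓕 l := tendsto_fst.comp tendsto_snd
    have tL : Tendsto (fun x : (ℝ × E) × ι × ℝ => x.2.2) 𝓕 atTop := tendsto_snd.comp tendsto_snd
    have tu' : Tendsto (fun x : (ℝ × E) × ι × ℝ => ((x.1.2, 0) : E × ℝ)) 𝓕 (𝓝 (u₀, 0)) :=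
      tu.prodMk_nhds tendsto_const_nhds
    have tαu := tendsto_one_apply (hα.comp ti) tu
    have tAw : ∀ {w : (ℝ × E) × ι × ℝ → E} {w₀ : E}, Tendsto w 𝓕 (𝓝 w₀) →
        Tendsto (fun x => (1 - x.1.1) * f x.2.1 * A x.2.1 ![x.1.2, w x] +
          x.1.1 * B x.2.1 ![(x.1.2, 0), (w x, 0)]) 𝓕
          (𝓝 ((1 - ρ₀) * C * A₀ ![u₀, w₀] + ρ₀ * B₀ ![(u₀, 0), (w₀, 0)])) := fun hw =>
      (((tendsto_const_nhds.sub tρ).mul (hf.comp ti)).mul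
        (tendsto_two_apply (hA.comp ti) tu hw)).add
        (tρ.mul (tendsto_two_apply (hB.comp ti) tu' (hw.prodMk_nhds tendsto_const_nhds)))
    refine Eventually.and ?_ ?_
    · by_cases h0 : α₀ ![u₀] = 0
      · obtain ⟨w₀, hw₀, hne⟩ := hlim ρ₀ hρ₀ u₀ h0 hu0
        -- The limiting witness `w₀` is moved along `S` to stay in the kernel of the varying form
        -- `α`; the correction tends to zero.
        let w : (ℝ × E) × ι × ℝ → E := fun x =>
          w₀ + (-(α x.2.1 ![w₀] / α x.2.1 ![S])) • S
        have hαS : Tendsto (fun x : (ℝ × E) × ι × ℝ => α x.2.1 ![S]) 𝓕 (𝓝 (α₀ ![S])) :=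
          tendsto_one_apply (hα.comp ti) tendsto_const_nhds
        have tw : Tendsto w 𝓕 (𝓝 w₀) := by
          have h1 : Tendsto (fun x : (ℝ × E) × ι × ℝ => α x.2.1 ![w₀]) 𝓕 (𝓝 (α₀ ![w₀])) :=
            tendsto_one_apply (hα.comp ti) tendsto_const_nhds
          have h2 := (tendsto_const_nhds (x := w₀)).add
            (((h1.div hαS hS).neg).smul (tendsto_const_nhds (x := S)))
          rw [hw₀, zero_div, neg_zero, zero_smul, add_zero] at h2
          exact h2
        filter_upwards [(tAw tw).eventually_ne hne, hαS.eventually_ne hS] with x hx hxS _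
        refine ⟨w x, ?_, hx⟩
        simp only [w]
        rw [one_add, one_smul']
        field_simp
        ring
      · filter_upwards [tαu.eventually_ne h0] with x hx hx'
        exact absurd hx' hx
    · by_cases hker : ∀ w, (1 - ρ₀) * C * A₀ ![u₀, w] + ρ₀ * B₀ ![(u₀, 0), (w, 0)] = 0
      swap
      · push Not at hker
        obtain ⟨w, hw⟩ := hker
        filter_upwards [(tAw (tendsto_const_nhds (x := w))).eventually_ne hw] with x hx hx'
        exact absurd (hx' w) hx
      have hα0 : α₀ ![u₀] ≠ 0 := by
        intro h0
        obtain ⟨w, -, hw⟩ := hlim ρ₀ hρ₀ u₀ h0 hu0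
        exact hw (hker w)
      rcases lt_or_gt_of_ne hα0 with hneg | hpos
      · filter_upwards [tαu.eventually_lt_const hneg] with x hx _ hx'
        exact absurd hx' (not_lt.2 hx.le)
      have tB : Tendsto (fun x : (ℝ × E) × ι × ℝ => B x.2.1 ![(0, 1), (x.1.2, 0)]) 𝓕
          (𝓝 (B₀ ![(0, 1), (u₀, 0)])) := tendsto_two_apply (hB.comp ti) tendsto_const_nhds tu'
      have tbf : Tendsto (fun x : (ℝ × E) × ι × ℝ => b x.2.1 ![(x.1.2, 0)] -
          f x.2.1 * α x.2.1 ![x.1.2]) 𝓕 (𝓝 (b₀ ![(u₀, 0)] - C * α₀ ![u₀])) :=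
        (tendsto_one_apply (hb.comp ti) tu').sub ((hf.comp ti).mul tαu)
      have hbf : b₀ ![(u₀, 0)] - C * α₀ ![u₀] < 0 := by
        rw [hb₀]
        nlinarith
      obtain ⟨c, hc1, hc2⟩ := exists_between hbf
      -- If `ρ₀ < 1`, the alternative `ρ ≥ 1 - 1/L` fails for large `L`, so `p ≥ L ρ` and the
      -- negative term `p (b - f α)` outweighs `ρ B(∂t, u)`, which has no sign. If `ρ₀ = 1`, then
      -- `u₀` is in the kernel of `B₀` along the boundary and `B(∂t, u)` is itself negative.
      rcases lt_or_eq_of_le hρ₀.2 with hlt | heq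
      · obtain ⟨ρ₁, hρ1, hρ2⟩ := exists_between hlt
        have hM : B₀ ![(0, 1), (u₀, 0)] < B₀ ![(0, 1), (u₀, 0)] + 1 := by linarith
        have tLi : Tendsto (fun x : (ℝ × E) × ι × ℝ => 1 - x.2.2⁻¹) 𝓕 (𝓝 1) := by
          simpa using (tendsto_const_nhds (x := (1 : ℝ))).sub (tendsto_inv_atTop_zero.comp tL)
        filter_upwards [tB.eventually_lt_const hM, tbf.eventually_lt_const hc1,
          tρ.eventually_lt_const hρ1, tLi.eventually_const_lt hρ2,
          tL.eventually_ge_atTop ((B₀ ![(0, 1), (u₀, 0)] + 1) / (-c)), ti.eventually hq]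
          with x h1 h2 h3 h4 h5 h6 _ h7 p hp h8 hρ
        have h9 : x.2.2 * x.1.1 ≤ p := h8.resolve_right (by linarith)
        have hc' : 0 < -c := by linarith
        rw [div_le_iff₀ hc'] at h5
        have h10 : p * (b x.2.1 ![(x.1.2, 0)] - f x.2.1 * α x.2.1 ![x.1.2]) ≤ p * c :=
          mul_le_mul_of_nonneg_left h2.le hp
        have h11 : p * c ≤ x.2.2 * x.1.1 * c := by nlinarith
        -- For `ρ = 0` the other terms may all vanish; strictness comes from `q > 0`, the fact that
        -- `f` really decreases.
        rcases hρ.1.eq_or_lt with h12 | h12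
        · rw [← h12] at *
          have : 0 < q x.2.1 * α x.2.1 ![x.1.2] := mul_pos h6 h7
          nlinarith
        · have h13 : 0 ≤ (1 - x.1.1) * (q x.2.1 * α x.2.1 ![x.1.2]) :=
            mul_nonneg (by linarith [hρ.2]) (mul_pos h6 h7).le
          have h14 : x.1.1 * B x.2.1 ![(0, 1), (x.1.2, 0)] < x.1.1 * (x.2.2 * (-c)) :=
            mul_lt_mul_of_pos_left (by linarith) h12
          nlinarith
      · have hneg : B₀ ![(0, 1), (u₀, 0)] < 0 := by
          refine hR u₀ hpos fun w => ?_
          have := hker w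
          rw [heq] at this
          simpa using this
        filter_upwards [tB.eventually_lt_const hneg, tbf.eventually_lt_const hbf,
          tρ.eventually_const_lt (show (1 / 2 : ℝ) < ρ₀ by rw [heq]; norm_num), ti.eventually hq]
          with x h1 h2 h3 h6 _ h7 p hp _ hρ
        have h13 : 0 ≤ (1 - x.1.1) * (q x.2.1 * α x.2.1 ![x.1.2]) :=
            mul_nonneg (by linarith [hρ.2]) (mul_pos h6 h7).le
        have h14 : x.1.1 * B x.2.1 ![(0, 1), (x.1.2, 0)] < 0 :=
          mul_neg_of_pos_of_neg (by linarith) h1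
        have h15 : p * (b x.2.1 ![(x.1.2, 0)] - f x.2.1 * α x.2.1 ![x.1.2]) ≤ 0 :=
          mul_nonpos_of_nonneg_of_nonpos hp h2.le
        nlinarith
  have hαS : Tendsto (fun z : ι × ℝ => α z.1 ![S]) (l ×ˢ (atTop : Filter ℝ)) (𝓝 (α₀ ![S])) :=
    tendsto_one_apply (hα.comp tendsto_fst) tendsto_const_nhds
  filter_upwards [key, hαS.eventually_ne hS] with z hz hzS ρ hρ p hp hpρ v hv
  exact interpTwo_nondegenerate hzS (fun u hu => (hz (ρ, u) ⟨hρ, hu⟩).1)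
    (fun u hu hw hu' => (hz (ρ, u) ⟨hρ, hu⟩).2 hw hu' p hp hpρ hρ) v hv

end LinearAlgebra

/-! ### The smooth transition function and a periodic partition of unity. -/

section Weights

open Filter Real

theorem smoothTransition_one_sub (x : ℝ) :
    smoothTransition (1 - x) = 1 - smoothTransition x := by
  have h := smoothTransition.pos_denom x
  simp only [smoothTransition, sub_sub_cancel]
  rw [add_comm (expNegInvGlue (1 - x)), eq_sub_iff_add_eq, ← add_div, add_comm, div_self h.ne']

/-- On `(0, 1)` the function is `s = 1 / (1 + exp (1/x - 1/(1 - x)))`, whose derivative is `s (1 -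
s) (1/x² + 1/(1 - x)²)`, and `1/x² ≥ 1`. Outside of `(0, 1)` the left side vanishes. -/
theorem smoothTransition_mul_le_deriv (x : ℝ) :
    smoothTransition x * (1 - smoothTransition x) ≤ deriv smoothTransition x := by
  have hd : 0 ≤ deriv smoothTransition x := smoothTransition.monotone.deriv_nonneg
  rcases le_or_gt x 0 with h0 | h0
  · rw [smoothTransition.zero_of_nonpos h0]
    simpa using hd
  rcases le_or_gt 1 x with h1 | h1
  · rw [smoothTransition.one_of_one_le h1]
    simpa using hd
  have hform : ∀ y ∈ Ioo (0 : ℝ) 1,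
      smoothTransition y = (1 + exp (y⁻¹ - (1 - y)⁻¹))⁻¹ := by
    rintro y ⟨hy0, hy1⟩
    have : expNegInvGlue y ≠ 0 := (expNegInvGlue.pos_of_pos hy0).ne'
    rw [smoothTransition, show expNegInvGlue y / (expNegInvGlue y + expNegInvGlue (1 - y)) =
      (1 + expNegInvGlue (1 - y) / expNegInvGlue y)⁻¹ by field_simp]
    have h2 : ¬ (1 - y ≤ 0) := by linarith
    rw [expNegInvGlue, expNegInvGlue, if_neg h2, if_neg (not_le.2 hy0), ← exp_sub]
    congr 3
    ring
  have hx0 : x ≠ 0 := h0.ne'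
  have hx1 : 1 - x ≠ 0 := by linarith
  set e := exp (x⁻¹ - (1 - x)⁻¹) with he
  have hepos : 0 < e := exp_pos _
  have hder : HasDerivAt (fun y : ℝ => (1 + exp (y⁻¹ - (1 - y)⁻¹))⁻¹)
      (-(e * (-(x ^ 2)⁻¹ - (((1 - x) ^ 2)⁻¹))) / (1 + e) ^ 2) x := by
    have d1 : HasDerivAt (fun y : ℝ => (1 - y)⁻¹) (((1 - x) ^ 2)⁻¹) x := by
      have h := ((hasDerivAt_id x).const_sub 1).fun_inv hx1
      rwa [neg_neg, one_div] at h
    have d2 := ((((hasDerivAt_inv hx0).sub d1).exp).const_add 1).inv (by positivity)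
    exact d2
  have heq : smoothTransition =ᶠ[𝓝 x] fun y => (1 + exp (y⁻¹ - (1 - y)⁻¹))⁻¹ :=
    Filter.eventuallyEq_of_mem (Ioo_mem_nhds h0 h1) hform
  rw [heq.deriv_eq, hder.deriv, hform x ⟨h0, h1⟩, ← he]
  have h3 : (1 + e)⁻¹ * (1 - (1 + e)⁻¹) = e / (1 + e) ^ 2 := by
    field_simp
    ring
  rw [h3]
  gcongr
  have h4 : 1 ≤ (x ^ 2)⁻¹ := (one_le_inv₀ (by positivity)).2 (by nlinarith)
  have h5 : 0 ≤ ((1 - x) ^ 2)⁻¹ := by positivity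
  nlinarith

/-- A weight whose integer translates form a partition of unity. -/
def stepWeight (t : ℝ) : ℝ := smoothTransition t - smoothTransition (t - 1)

/-- The translates telescope. The weight lives on `[0, 2]`, so at `t` only the indices `-⌊t⌋` and `1
- ⌊t⌋` can contribute. -/
theorem isPeriodicWeight_stepWeight : IsPeriodicWeight stepWeight where
  smooth := by
    unfold stepWeight
    exact smoothTransition.contDiff.sub (smoothTransition.contDiff.comp (contDiff_id.sub contDiff_const))
  compact := by
    refine HasCompactSupport.intro (isCompact_Icc (a := (0 : ℝ)) (b := 2)) fun t ht => ?_
    rw [mem_Icc, not_and_or, not_le, not_le] at ht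
    rcases ht with ht | ht
    · rw [stepWeight, smoothTransition.zero_of_nonpos (by linarith),
        smoothTransition.zero_of_nonpos (by linarith), sub_zero]
    · rw [stepWeight, smoothTransition.one_of_one_le (by linarith),
        smoothTransition.one_of_one_le (by linarith), sub_self]
  nonneg t := sub_nonneg.2 (smoothTransition.monotone (by linarith))
  sum_eq_one t := by
    have hsupp : Function.support (fun k : ℤ => stepWeight (t + k)) ⊆
        (({-⌊t⌋, 1 - ⌊t⌋} : Finset ℤ) : Set ℤ) := by
      intro k hk
      rw [Function.mem_support] at hk
      have h1 : 0 < t + k := by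
        by_contra! h
        apply hk
        rw [stepWeight, smoothTransition.zero_of_nonpos (by linarith),
          smoothTransition.zero_of_nonpos (by linarith), sub_zero]
      have h2 : t + k < 2 := by
        by_contra! h
        apply hk
        rw [stepWeight, smoothTransition.one_of_one_le (by linarith),
          smoothTransition.one_of_one_le (by linarith), sub_self]
      have h3 : -k ≤ ⌊t⌋ := Int.le_floor.2 (by push_cast; linarith)
      have h4 : ⌊t⌋ < 2 - k := Int.floor_lt.2 (by push_cast; linarith)
      simp only [Finset.coe_insert, Finset.coe_singleton, mem_insert_iff, mem_singleton_iff]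
      omega
    rw [finsum_eq_sum_of_support_subset _ hsupp, Finset.sum_pair (by omega)]
    push_cast
    have h1 := Int.floor_le t
    have h2 := Int.lt_floor_add_one t
    rw [stepWeight, stepWeight, smoothTransition.zero_of_nonpos (x := t + -(⌊t⌋ : ℝ) - 1) (by linarith),
      smoothTransition.one_of_one_le (x := t + (1 - (⌊t⌋ : ℝ))) (by linarith),
      show t + (1 - (⌊t⌋ : ℝ)) - 1 = t + -(⌊t⌋ : ℝ) by ring]
    ring

end Weights

/-! ### Derivatives of projections and of real functions. -/

section Product

variable {E : Type*} [NormedAddCommGroup E] [NormedSpace ℝ E]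
  {H : Type*} [TopologicalSpace H] {I : ModelWithCorners ℝ E H}
  {M : Type*} [TopologicalSpace M] [ChartedSpace H M]
  {E' : Type*} [NormedAddCommGroup E'] [NormedSpace ℝ E']
  {H' : Type*} [TopologicalSpace H'] {I' : ModelWithCorners ℝ E' H'}
  {N : Type*} [TopologicalSpace N] [ChartedSpace H' N]

theorem tder_fst (p : M × N) :
    tder (I.prod I') I (Prod.fst : M × N → M) p = ContinuousLinearMap.fst ℝ E E' := mfderiv_fst

theorem tder_snd (p : M × N) :
    tder (I.prod I') I' (Prod.snd : M × N → N) p = ContinuousLinearMap.snd ℝ E E' := mfderiv_snd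

theorem tder_real (f : ℝ → ℝ) (t : ℝ) : tder 𝓘(ℝ, ℝ) 𝓘(ℝ, ℝ) f t = fderiv ℝ f t :=
  mfderiv_eq_fderiv

theorem tder_const (c : N) (p : M) : tder I I' (fun _ : M => c) p = 0 := mfderiv_const

end Product

/-! ### Limits of forms in a fixed chart. -/

section Charts

open Filter

variable {E : Type*} [NormedAddCommGroup E] [NormedSpace ℝ E]
  {H : Type*} [TopologicalSpace H] {I : ModelWithCorners ℝ E H}
  {M : Type*} [TopologicalSpace M] [ChartedSpace H M]
  {E' : Type*} [NormedAddCommGroup E'] [NormedSpace ℝ E']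
  {H' : Type*} [TopologicalSpace H'] {I' : ModelWithCorners ℝ E' H'}
  {N : Type*} [TopologicalSpace N] [ChartedSpace H' N]
  {E'' : Type*} [NormedAddCommGroup E''] [NormedSpace ℝ E'']
  {H'' : Type*} [TopologicalSpace H''] {I'' : ModelWithCorners ℝ E'' H''}
  {P : Type*} [TopologicalSpace P] [ChartedSpace H'' P]
  {k : ℕ}

theorem one_ext {a b : E [⋀^Fin 1]→L[ℝ] ℝ} (h : ∀ v, a ![v] = b ![v]) : a = b := by
  ext v
  rw [show v = ![v 0] by ext i; fin_cases i; rfl]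
  exact h _

theorem two_ext {a b : E [⋀^Fin 2]→L[ℝ] ℝ} (h : ∀ v w, a ![v, w] = b ![v, w]) : a = b := by
  ext v
  rw [show v = ![v 0, v 1] by ext i; fin_cases i <;> rfl]
  exact h _ _

theorem fval_pullback_comp {G : M → P} {F : N → M} {x : N} (ζ : DForm I'' P k)
    (hG : MDifferentiableAt I I'' G (F x)) (hF : MDifferentiableAt I' I F x) :
    fval (pullback I'' I' (G ∘ F) ζ) x = fval (pullback I I' F (pullback I'' I G ζ)) x := by
  rw [fval_pullback, fval_pullback, fval_pullback, tder_comp hG hF]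
  rfl

theorem inChart_extChartAt (ζ : DForm I M k) {p x : M} (hx : x ∈ (extChartAt I p).source) :
    inChart I ζ p (extChartAt I p x) =
      (fval ζ x).compContinuousLinearMap (cder I p (extChartAt I p x)) := by
  rw [inChart_eq, (extChartAt I p).left_inv hx]

theorem inChart_self [IsManifold I ∞ M] (ζ : DForm I M k) (p : M) :
    inChart I ζ p (extChartAt I p p) = fval ζ p := by
  rw [inChart_eq, cder_self, extChartAt_to_inv]
  rfl

theorem tendsto_extChartAt_nhdsWithin_range (x : M) :
    Tendsto (extChartAt I x) (𝓝 x) (𝓝[range I] (extChartAt I x x)) :=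
  tendsto_nhdsWithin_iff.2 ⟨(continuousAt_extChartAt x),
    Filter.Eventually.of_forall fun y => by simp⟩

/-- The values `fval ζ y` refer to the preferred chart at `y` and need not vary continuously with
`y`. Limits are therefore taken of the expression in the chart at the limit point. -/
theorem SmoothAt.tendsto_inChart [IsManifold I ∞ M] {ζ : DForm I M 1} {x : M}
    (hζ : SmoothAt ζ x) :
    Tendsto (inChart I ζ x) (𝓝[range I] (extChartAt I x x)) (𝓝 (fval ζ x)) := by
  have h := ContDiffWithinAt.continuousWithinAt hζ
  rwa [ContinuousWithinAt, inChart_self] at h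

theorem tendsto_inChart_extD [IsManifold I ∞ M] {ζ : DForm I M 1} {x : M}
    (hζ : ∀ y, SmoothAt ζ y) :
    Tendsto (inChart I (extD I ζ) x) (𝓝[range I] (extChartAt I x x)) (𝓝 (fval (extD I ζ) x)) := by
  have h1 : ContDiffWithinAt ℝ ∞ (fderivWithin ℝ (inChart I ζ x) (range I)) (range I)
      (extChartAt I x x) :=
    ContDiffWithinAt.fderivWithin_right (n := ∞) (hζ x) I.uniqueDiffOn (by norm_cast) (by simp)
  have h2 : Tendsto (extDerivWithin (inChart I ζ x) (range I)) (𝓝[range I] (extChartAt I x x))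
      (𝓝 (fval (extD I ζ) x)) := by
    rw [fval_extD]
    exact ((ContinuousAlternatingMap.alternatizeUncurryFinCLM ℝ E ℝ).continuous.tendsto _).comp
      h1.continuousWithinAt
  refine h2.congr' ?_
  filter_upwards [extChartAt_target_mem_nhdsWithin (I := I) x] with u hu
  rw [inChart_extD hu (hζ _)]

end Charts

/-! ### Bundle contact forms on the infinite cyclic cover of a mapping torus. -/

section Bundle

set_option linter.unusedSectionVars false

open Filter

variable {n : ℕ} [NeZero n] {S : Type*} [TopologicalSpace S]
  [ChartedSpace (EuclideanHalfSpace (2 * n)) S] [IsManifold (𝓡∂ (2 * n)) ∞ S]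
  {β : DForm (𝓡∂ (2 * n)) S 1} {φ : S ≃ₘ^∞⟮𝓡∂ (2 * n), 𝓡∂ (2 * n)⟯ S}

/-- The powers of a diffeomorphism. -/
abbrev dpow (φ : S ≃ₘ^∞⟮𝓡∂ (2 * n), 𝓡∂ (2 * n)⟯ S) (k : ℤ) : Equiv.Perm S :=
  (φ.toEquiv : Equiv.Perm S) ^ k

/-- `F` is smooth and preserves the differential of `β`. -/
def PreservesD (β : DForm (𝓡∂ (2 * n)) S 1) (F : S → S) : Prop :=
  ContMDiff (𝓡∂ (2 * n)) (𝓡∂ (2 * n)) ∞ F ∧ ∀ x,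
    (fval (extD (𝓡∂ (2 * n)) β) (F x)).compContinuousLinearMap
      (tder (𝓡∂ (2 * n)) (𝓡∂ (2 * n)) F x) = fval (extD (𝓡∂ (2 * n)) β) x

theorem PreservesD.comp {F G : S → S} (hF : PreservesD β F) (hG : PreservesD β G) :
    PreservesD β (F ∘ G) := by
  refine ⟨hF.1.comp hG.1, fun x => ?_⟩
  rw [tder_comp (hF.1.mdifferentiable (by simp) _) (hG.1.mdifferentiable (by simp) _),
    ← hG.2 x, ← hF.2 (G x)]
  rfl

theorem PreservesD.inverse {F G : S → S} (hF : PreservesD β F)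
    (hG : ContMDiff (𝓡∂ (2 * n)) (𝓡∂ (2 * n)) ∞ G) (h : F ∘ G = id) : PreservesD β G := by
  refine ⟨hG, fun x => ?_⟩
  have h2 := tder_comp (hF.1.mdifferentiable (by simp) (G x)) (hG.mdifferentiable (by simp) x)
  have h3 : F (G x) = x := congrFun h x
  rw [h, tder_id] at h2
  rw [← hF.2 (G x), h3]
  refine two_ext fun v w => ?_
  rw [comp_apply_two, comp_apply_two, ← ContinuousLinearMap.comp_apply,
    ← ContinuousLinearMap.comp_apply, ← h2]
  rfl

/-- Only this consequence of exactness is used later: `φ*β` and `β` differ by `dh`, and `d(dh) = 0`.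
-/
theorem preservesD_of_exact (hβ : ∀ x, SmoothAt β x) (hφ : IsExactMonodromy n β φ) :
    PreservesD β φ := by
  refine ⟨φ.contMDiff, fun x => ?_⟩
  obtain ⟨h, hh, he⟩ := hφ.exact
  rw [← fval_extD_pullback (hβ _) φ.contMDiff.contMDiffAt]
  have h1 : pullback (𝓡∂ (2 * n)) (𝓡∂ (2 * n)) φ β = fun x => β x + dFun (𝓡∂ (2 * n)) h x :=
    funext he
  rw [h1, fval_extD_add (hβ x) (smoothAt_dFun hh.contMDiffAt), fval_extD_dFun hh.contMDiffAt,
    add_zero]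

theorem preservesD_dpow (hβ : ∀ x, SmoothAt β x) (hφ : IsExactMonodromy n β φ) (k : ℤ) :
    PreservesD β (dpow φ k) := by
  have h1 := preservesD_of_exact hβ hφ
  have h2 : PreservesD β φ.symm :=
    h1.inverse φ.symm.contMDiff (funext fun x => φ.apply_symm_apply x)
  induction k using Int.induction_on with
  | zero =>
    refine ⟨contMDiff_id, fun x => ?_⟩
    have : (dpow φ 0 : S → S) = id := by ext; simp
    rw [this, tder_id]
    rfl
  | succ k ih =>
    have : (dpow φ (k + 1) : S → S) = dpow φ k ∘ φ := by
      ext x; rw [dpow, zpow_add_one]; rfl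
    rw [this]
    exact ih.comp h1
  | pred k ih =>
    have : (dpow φ (-k - 1) : S → S) = dpow φ (-k) ∘ φ.symm := by
      ext x; rw [dpow, zpow_sub_one]; rfl
    rw [this]
    exact ih.comp h2

/-- One finite index set serves a whole neighbourhood of `t₀`, so the infinite sum can be
differentiated term by term. -/
theorem exists_finset_weight {a : ℝ → ℝ} (ha : HasCompactSupport a) (t₀ : ℝ) :
    ∃ F : Finset ℤ, ∀ t, |t - t₀| < 1 → ∀ k ∉ F, a (t + k) = 0 := by
  obtain ⟨R, hR⟩ := ha.isCompact.isBounded.subset_closedBall 0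
  refine ⟨Finset.Icc ⌊-R - t₀ - 1⌋ ⌈R - t₀ + 1⌉, fun t ht k hk => ?_⟩
  by_contra h
  have h1 : t + k ∈ Metric.closedBall (0 : ℝ) R := hR (subset_tsupport _ h)
  rw [mem_closedBall_zero_iff, Real.norm_eq_abs, abs_le] at h1
  rw [abs_lt] at ht
  apply hk
  rw [Finset.mem_Icc]
  constructor
  · have := Int.floor_le (-R - t₀ - 1)
    exact_mod_cast (show ((⌊-R - t₀ - 1⌋ : ℤ) : ℝ) ≤ k by linarith [h1.1, ht.2])
  · have := Int.le_ceil (R - t₀ + 1)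
    exact_mod_cast (show (k : ℝ) ≤ (⌈R - t₀ + 1⌉ : ℤ) by linarith [h1.2, ht.1])

/-- The pullback of `β` under a power of the monodromy. -/
abbrev powForm (β : DForm (𝓡∂ (2 * n)) S 1) (φ : S ≃ₘ^∞⟮𝓡∂ (2 * n), 𝓡∂ (2 * n)⟯ S) (k : ℤ) :
    DForm (𝓡∂ (2 * n)) S 1 :=
  pullback (𝓡∂ (2 * n)) (𝓡∂ (2 * n)) (dpow φ k) β

/-- The finite sums that represent the weighted sum of the forms `(φᵏ)*β`. -/
def weightSum (β : DForm (𝓡∂ (2 * n)) S 1) (φ : S ≃ₘ^∞⟮𝓡∂ (2 * n), 𝓡∂ (2 * n)⟯ S)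
    (a : ℝ → ℝ) (F : Finset ℤ) (p : S × ℝ) : EuclideanSpace ℝ (Fin (2 * n)) [⋀^Fin 1]→L[ℝ] ℝ :=
  ∑ k ∈ F, a (p.2 + k) • fval (powForm β φ k) p.1

theorem fval_pullback_dpow_fst (hp : ∀ k, PreservesD β (dpow φ k)) (k : ℤ) (p : S × ℝ) :
    fval (pullback (𝓡∂ (2 * n)) ((𝓡∂ (2 * n)).prod 𝓘(ℝ, ℝ))
      (fun q : S × ℝ => ((φ.toEquiv : Equiv.Perm S) ^ k) q.1) β) p =
    (fval (powForm β φ k) p.1).compContinuousLinearMap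
      (ContinuousLinearMap.fst ℝ (EuclideanSpace ℝ (Fin (2 * n))) ℝ) := by
  have := fval_pullback_comp (I' := (𝓡∂ (2 * n)).prod 𝓘(ℝ, ℝ)) (G := dpow φ k)
    (F := (Prod.fst : S × ℝ → S)) (x := p) β ((hp k).1.mdifferentiable (by simp) _)
    mdifferentiableAt_fst
  rw [fval_pullback Prod.fst, tder_fst] at this
  exact this

theorem fval_bundleForm {a : ℝ → ℝ} {K : ℝ} {F : Finset ℤ} {p : S × ℝ}
    (hF : ∀ k ∉ F, a (p.2 + k) = 0) :
    fval (bundleForm n β φ a K) p =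
      fval (fun p => (∑ k ∈ F, a (p.2 + k) •
        pullback (𝓡∂ (2 * n)) ((𝓡∂ (2 * n)).prod 𝓘(ℝ, ℝ))
          (fun q : S × ℝ => ((φ.toEquiv : Equiv.Perm S) ^ k) q.1) β p) +
        K • dFun ((𝓡∂ (2 * n)).prod 𝓘(ℝ, ℝ)) (fun q : S × ℝ => q.2) p :
          DForm ((𝓡∂ (2 * n)).prod 𝓘(ℝ, ℝ)) (S × ℝ) 1) p := by
  have h := finsum_eq_sum_of_support_subset (fun k : ℤ => a (p.2 + k) •
        pullback (𝓡∂ (2 * n)) ((𝓡∂ (2 * n)).prod 𝓘(ℝ, ℝ))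
          (fun q : S × ℝ => ((φ.toEquiv : Equiv.Perm S) ^ k) q.1) β p) (s := F) (by
    intro k hk
    by_contra hkF
    exact hk (by simp only [hF k hkF, zero_smul]))
  rw [fval, bundleForm, h]
  rfl

theorem tder_snd_apply (p : S × ℝ) (v : EuclideanSpace ℝ (Fin (2 * n)) × ℝ) :
    tder ((𝓡∂ (2 * n)).prod 𝓘(ℝ, ℝ)) 𝓘(ℝ, ℝ) (fun q : S × ℝ => q.2) p v = v.2 := by
  have := tder_snd (I := 𝓡∂ (2 * n)) (I' := 𝓘(ℝ, ℝ)) p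
  exact DFunLike.congr_fun this v

theorem fval_bundleForm_apply (hp : ∀ k, PreservesD β (dpow φ k)) {a : ℝ → ℝ} {K : ℝ}
    {F : Finset ℤ} {p : S × ℝ} (hF : ∀ k ∉ F, a (p.2 + k) = 0)
    (v : EuclideanSpace ℝ (Fin (2 * n)) × ℝ) :
    fval (bundleForm n β φ a K) p ![v] = weightSum β φ a F p ![v.1] + K * v.2 := by
  rw [fval_bundleForm hF]
  have h1 : ∀ k : ℤ, (pullback (𝓡∂ (2 * n)) ((𝓡∂ (2 * n)).prod 𝓘(ℝ, ℝ))
          (fun q : S × ℝ => ((φ.toEquiv : Equiv.Perm S) ^ k) q.1) β p) = _ :=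
    fun k => fval_pullback_dpow_fst hp k p
  have h2 := fval_dFun (I := (𝓡∂ (2 * n)).prod 𝓘(ℝ, ℝ)) (fun q : S × ℝ => q.2) p v
  rw [tder_snd_apply] at h2
  simp only [fval] at h2 ⊢
  simp only [h1]
  rw [weightSum]
  erw [ContinuousAlternatingMap.add_apply, ContinuousAlternatingMap.smul_apply, h2,
    ContinuousAlternatingMap.sum_apply, ContinuousAlternatingMap.sum_apply]
  congr 1
  refine Finset.sum_congr rfl fun k _ => ?_
  erw [ContinuousAlternatingMap.smul_apply, ContinuousAlternatingMap.smul_apply, comp_apply_one]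
  rfl

theorem smoothAt_powForm (hβ : ∀ x, SmoothAt β x) (hp : ∀ k, PreservesD β (dpow φ k)) (k : ℤ)
    (x : S) : SmoothAt (powForm β φ k) x :=
  SmoothAt.pullback (hβ _) (hp k).1.contMDiffAt

theorem fval_extD_powForm (hβ : ∀ x, SmoothAt β x) (hp : ∀ k, PreservesD β (dpow φ k)) (k : ℤ)
    (x : S) : fval (extD (𝓡∂ (2 * n)) (powForm β φ k)) x = fval (extD (𝓡∂ (2 * n)) β) x := by
  rw [fval_extD_pullback (hβ _) (hp k).1.contMDiffAt, (hp k).2]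

theorem sum_weight {a : ℝ → ℝ} (ha : IsPeriodicWeight a) {F : Finset ℤ} {t : ℝ}
    (hF : ∀ k ∉ F, a (t + k) = 0) : ∑ k ∈ F, a (t + k) = 1 := by
  rw [← ha.sum_eq_one t, finsum_eq_sum_of_support_subset]
  intro k hk
  by_contra hkF
  exact hk (hF k hkF)

theorem contMDiff_weight {a : ℝ → ℝ} (ha : ContDiff ℝ ∞ a) (k : ℤ) :
    ContMDiff ((𝓡∂ (2 * n)).prod 𝓘(ℝ, ℝ)) 𝓘(ℝ, ℝ) ∞ (fun p : S × ℝ => a (p.2 + k)) :=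
  (ha.comp (contDiff_id.add contDiff_const)).contMDiff.comp contMDiff_snd

theorem tder_weight {a : ℝ → ℝ} (ha : ContDiff ℝ ∞ a) (k : ℤ) (p : S × ℝ)
    (v : EuclideanSpace ℝ (Fin (2 * n)) × ℝ) :
    tder ((𝓡∂ (2 * n)).prod 𝓘(ℝ, ℝ)) 𝓘(ℝ, ℝ) (fun p : S × ℝ => a (p.2 + k)) p v =
      deriv a (p.2 + k) * v.2 := by
  have hd : ContDiff ℝ ∞ (fun s : ℝ => a (s + k)) := ha.comp (contDiff_id.add contDiff_const)
  have := tder_comp (I' := (𝓡∂ (2 * n)).prod 𝓘(ℝ, ℝ)) (I := 𝓘(ℝ, ℝ)) (I'' := 𝓘(ℝ, ℝ))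
    (G := fun s : ℝ => a (s + k)) (F := (Prod.snd : S × ℝ → ℝ)) (x := p)
    (hd.contMDiff.mdifferentiable (by simp) _) mdifferentiableAt_snd
  rw [tder_snd, tder_real] at this
  have h2 := DFunLike.congr_fun this v
  refine h2.trans ?_
  rw [ContinuousLinearMap.comp_apply, ContinuousLinearMap.coe_snd', fderiv_eq_smul_deriv,
    deriv_comp_add_const, smul_eq_mul, mul_comm]

/-- All forms `(φᵏ)*β` have the differential `dβ` and the weights add up to `1`. So `dλ = dβ + dt ∧
ν`, where `ν` is the same weighted sum with `a` replaced by its derivative. -/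
theorem bundleForm_local (hβ : ∀ x, SmoothAt β x) (hp : ∀ k, PreservesD β (dpow φ k))
    {a : ℝ → ℝ} (ha : IsPeriodicWeight a) {K : ℝ} {F : Finset ℤ} {p : S × ℝ}
    (hF : ∀ t, |t - p.2| < 1 → ∀ k ∉ F, a (t + k) = 0) :
    SmoothAt (bundleForm n β φ a K) p ∧ ∀ v w : EuclideanSpace ℝ (Fin (2 * n)) × ℝ,
      fval (extD ((𝓡∂ (2 * n)).prod 𝓘(ℝ, ℝ)) (bundleForm n β φ a K)) p ![v, w] =
        fval (extD (𝓡∂ (2 * n)) β) p.1 ![v.1, w.1] + v.2 * weightSum β φ (deriv a) F p ![w.1] -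
          w.2 * weightSum β φ (deriv a) F p ![v.1] := by
  have hev : ∀ᶠ q : S × ℝ in 𝓝 p, |q.2 - p.2| < 1 := by
    have : ContinuousAt (fun q : S × ℝ => |q.2 - p.2|) p := by fun_prop
    exact this.eventually (Iio_mem_nhds (by simp))
  let ζ : ℤ → DForm ((𝓡∂ (2 * n)).prod 𝓘(ℝ, ℝ)) (S × ℝ) 1 := fun k =>
    pullback (𝓡∂ (2 * n)) ((𝓡∂ (2 * n)).prod 𝓘(ℝ, ℝ))
      (fun q : S × ℝ => ((φ.toEquiv : Equiv.Perm S) ^ k) q.1) β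
  have hmap : ∀ k : ℤ, ContMDiffAt ((𝓡∂ (2 * n)).prod 𝓘(ℝ, ℝ)) (𝓡∂ (2 * n)) ∞
      (fun q : S × ℝ => ((φ.toEquiv : Equiv.Perm S) ^ k) q.1) p := fun k =>
    ((hp k).1.comp contMDiff_fst).contMDiffAt
  have hζ : ∀ k, SmoothAt (ζ k) p := fun k => SmoothAt.pullback (hβ _) (hmap k)
  have hdζ : ∀ k v w, fval (extD ((𝓡∂ (2 * n)).prod 𝓘(ℝ, ℝ)) (ζ k)) p ![v, w] =
      fval (extD (𝓡∂ (2 * n)) β) p.1 ![v.1, w.1] := by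
    intro k v w
    have h1 : fval (extD ((𝓡∂ (2 * n)).prod 𝓘(ℝ, ℝ)) (ζ k)) p =
        fval (extD ((𝓡∂ (2 * n)).prod 𝓘(ℝ, ℝ)) (pullback (𝓡∂ (2 * n))
          ((𝓡∂ (2 * n)).prod 𝓘(ℝ, ℝ)) (Prod.fst : S × ℝ → S) (powForm β φ k))) p := by
      refine fval_extD_congr (Filter.Eventually.of_forall fun q => ?_)
      rw [fval_pullback_dpow_fst hp, fval_pullback _ _ q, tder_fst]
    rw [h1, fval_extD_pullback (smoothAt_powForm hβ hp k _) contMDiffAt_fst, tder_fst,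
      fval_extD_powForm hβ hp, comp_apply_two]
    rfl
  have hw : ∀ k : ℤ, ContMDiffAt ((𝓡∂ (2 * n)).prod 𝓘(ℝ, ℝ)) 𝓘(ℝ, ℝ) ∞
    (fun p : S × ℝ => a (p.2 + k)) p := fun k => (contMDiff_weight ha.smooth k).contMDiffAt
  have hs1 : SmoothAt (I := (𝓡∂ (2 * n)).prod 𝓘(ℝ, ℝ))
      (fun p => (∑ k ∈ F, a (p.2 + k) • ζ k p)) p :=
    SmoothAt.sum F fun k _ => (hζ k).fsmul (hw k)
  have hs0 : SmoothAt (dFun ((𝓡∂ (2 * n)).prod 𝓘(ℝ, ℝ)) (fun q : S × ℝ => q.2)) p :=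
    smoothAt_dFun contMDiffAt_snd
  have hs2 : SmoothAt (I := (𝓡∂ (2 * n)).prod 𝓘(ℝ, ℝ))
      (fun p => K • dFun ((𝓡∂ (2 * n)).prod 𝓘(ℝ, ℝ)) (fun q : S × ℝ => q.2) p) p :=
    hs0.fsmul (f := fun _ => K) contMDiffAt_const
  have hcongr : ∀ᶠ q in 𝓝 p, fval (bundleForm n β φ a K) q = fval (fun p =>
      (∑ k ∈ F, a (p.2 + k) • ζ k p) +
        K • dFun ((𝓡∂ (2 * n)).prod 𝓘(ℝ, ℝ)) (fun q : S × ℝ => q.2) p :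
          DForm ((𝓡∂ (2 * n)).prod 𝓘(ℝ, ℝ)) (S × ℝ) 1) q := by
    filter_upwards [hev] with q hq
    exact fval_bundleForm (hF _ hq)
  refine ⟨(hs1.add hs2).congr hcongr, fun v w => ?_⟩
  rw [fval_extD_congr hcongr, fval_extD_add hs1 hs2,
    fval_extD_sum F (fun k _ => (hζ k).fsmul (hw k)), ContinuousAlternatingMap.add_apply,
    ContinuousAlternatingMap.sum_apply]
  rw [fval_extD_fsmul (f := fun _ => K) contMDiffAt_const hs0, fval_extD_dFun contMDiffAt_snd,
    tder_const]
  have h3 : ∀ k ∈ F, fval (extD ((𝓡∂ (2 * n)).prod 𝓘(ℝ, ℝ))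
      (fun p => a (p.2 + k) • ζ k p)) p ![v, w] =
      v.2 * (deriv a (p.2 + k) * fval (powForm β φ k) p.1 ![w.1]) -
      w.2 * (deriv a (p.2 + k) * fval (powForm β φ k) p.1 ![v.1]) +
      a (p.2 + k) * fval (extD (𝓡∂ (2 * n)) β) p.1 ![v.1, w.1] := by
    intro k _
    have h4 : ∀ v, fval (ζ k) p ![v] = fval (powForm β φ k) p.1 ![v.1] := fun v => by
      rw [fval_pullback_dpow_fst hp, comp_apply_one]; rfl
    rw [fval_extD_fsmul (hw k) (hζ k), tder_weight ha.smooth, tder_weight ha.smooth, hdζ, h4, h4]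
    ring
  rw [Finset.sum_congr rfl h3, Finset.sum_add_distrib, Finset.sum_sub_distrib, ← Finset.mul_sum,
    ← Finset.mul_sum, ← Finset.sum_mul, sum_weight ha (hF p.2 (by simp)), weightSum,
    ContinuousAlternatingMap.sum_apply, ContinuousAlternatingMap.sum_apply]
  simp only [ContinuousAlternatingMap.smul_apply, smul_eq_mul, zero_apply]
  have h5 : (0 : (EuclideanSpace ℝ (Fin (2 * n)) × ℝ) [⋀^Fin 2]→L[ℝ] ℝ) ![v, w] = 0 := rfl
  rw [h5]
  ring

theorem weightSum_inChart_tendsto (hβ : ∀ x, SmoothAt β x) (hp : ∀ k, PreservesD β (dpow φ k))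
    {a : ℝ → ℝ} (ha : Continuous a) (F : Finset ℤ) (p : S × ℝ) :
    Tendsto (fun q : S × ℝ => (weightSum β φ a F q).compContinuousLinearMap
      (cder (𝓡∂ (2 * n)) p.1 (extChartAt (𝓡∂ (2 * n)) p.1 q.1))) (𝓝 p)
      (𝓝 (weightSum β φ a F p)) := by
  have h1 : Tendsto (fun q : S × ℝ => ∑ k ∈ F, a (q.2 + k) •
      inChart (𝓡∂ (2 * n)) (powForm β φ k) p.1 (extChartAt (𝓡∂ (2 * n)) p.1 q.1)) (𝓝 p)
      (𝓝 (weightSum β φ a F p)) := by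
    refine tendsto_finsetSum F fun k _ => Tendsto.smul ?_ ?_
    · have : Continuous fun q : S × ℝ => a (q.2 + k) := by fun_prop
      exact this.tendsto p
    · exact (smoothAt_powForm hβ hp k p.1).tendsto_inChart.comp
        ((tendsto_extChartAt_nhdsWithin_range p.1).comp continuousAt_fst)
  refine h1.congr' ?_
  have h2 : ∀ᶠ q : S × ℝ in 𝓝 p, q.1 ∈ (extChartAt (𝓡∂ (2 * n)) p.1).source :=
    continuousAt_fst.eventually (extChartAt_source_mem_nhds p.1)
  filter_upwards [h2] with q hq
  refine one_ext fun v => ?_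
  rw [comp_apply_one, weightSum, ContinuousAlternatingMap.sum_apply,
    ContinuousAlternatingMap.sum_apply]
  refine Finset.sum_congr rfl fun k _ => ?_
  rw [ContinuousAlternatingMap.smul_apply, ContinuousAlternatingMap.smul_apply,
    inChart_extChartAt _ hq, comp_apply_one]

/-- The linear statement `eventually_contactPt_add_large` is applied to the expressions in the chart
at `p.1`, and its conclusion is carried back to the actual tangent spaces by the invertible
derivative of that chart. -/
theorem eventually_contactPt_bundleForm (hβ : ∀ x, SmoothAt β x)
    (hp : ∀ k, PreservesD β (dpow φ k))
    (hnd : ∀ (x : S) v, (∀ w, fval (extD (𝓡∂ (2 * n)) β) x ![v, w] = 0) → v = 0)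
    {a : ℝ → ℝ} (ha : IsPeriodicWeight a) (p : S × ℝ) :
    ∀ᶠ z in 𝓝 p ×ˢ (atTop : Filter ℝ),
      ContactPt (fval (bundleForm n β φ a z.2) z.1)
        (fval (extD ((𝓡∂ (2 * n)).prod 𝓘(ℝ, ℝ)) (bundleForm n β φ a z.2)) z.1) ∧
      ContactPt (fval (bundleForm n β φ a (-z.2)) z.1)
        (fval (extD ((𝓡∂ (2 * n)).prod 𝓘(ℝ, ℝ)) (bundleForm n β φ a (-z.2))) z.1) := by
  obtain ⟨F, hF⟩ := exists_finset_weight ha.compact p.2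
  -- A common index set for all base points `q` near `p`: the times involved lie within distance `2`
  -- of `p.2`, which three unit neighbourhoods cover.
  obtain ⟨F', hF'⟩ : ∃ F' : Finset ℤ, ∀ q : S × ℝ, |q.2 - p.2| < 1 → ∀ t, |t - q.2| < 1 →
      ∀ k ∉ F', a (t + k) = 0 := by
    obtain ⟨F₁, h1⟩ := exists_finset_weight ha.compact (p.2 - 1)
    obtain ⟨F₂, h2⟩ := exists_finset_weight ha.compact (p.2 + 1)
    classical
    refine ⟨F ∪ F₁ ∪ F₂, fun q hq t ht k hk => ?_⟩
    simp only [Finset.mem_union, not_or] at hk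
    rw [abs_lt] at hq ht
    rcases lt_trichotomy t p.2 with h | h | h
    · by_cases h' : p.2 - 1 < t
      · exact hF t (abs_lt.2 ⟨by linarith, by linarith⟩) k hk.1.1
      · exact h1 t (abs_lt.2 ⟨by linarith, by linarith⟩) k hk.1.2
    · exact hF t (by simp [h]) k hk.1.1
    · by_cases h' : t < p.2 + 1
      · exact hF t (abs_lt.2 ⟨by linarith, by linarith⟩) k hk.1.1
      · exact h2 t (abs_lt.2 ⟨by linarith, by linarith⟩) k hk.2
  have hda : Continuous (deriv a) := ha.smooth.continuous_deriv (by simp)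
  have hB : Tendsto (fun q : S × ℝ => inChart (𝓡∂ (2 * n)) (extD (𝓡∂ (2 * n)) β) p.1
      (extChartAt (𝓡∂ (2 * n)) p.1 q.1)) (𝓝 p) (𝓝 (fval (extD (𝓡∂ (2 * n)) β) p.1)) :=
    (tendsto_inChart_extD hβ).comp
      ((tendsto_extChartAt_nhdsWithin_range p.1).comp continuousAt_fst)
  have hev : ∀ᶠ q : S × ℝ in 𝓝 p, |q.2 - p.2| < 1 := by
    have : ContinuousAt (fun q : S × ℝ => |q.2 - p.2|) p := by fun_prop
    exact this.eventually (Iio_mem_nhds (by simp))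
  have h2 : ∀ᶠ q : S × ℝ in 𝓝 p, q.1 ∈ (extChartAt (𝓡∂ (2 * n)) p.1).source :=
    continuousAt_fst.eventually (extChartAt_source_mem_nhds p.1)
  filter_upwards [eventually_contactPt_add_large
    (weightSum_inChart_tendsto hβ hp ha.smooth.continuous F' p)
    (weightSum_inChart_tendsto hβ hp hda F' p) hB (hnd p.1), (hev.and h2).prod_inl atTop,
    (eventually_gt_atTop (0 : ℝ)).prod_inr (𝓝 p)] with z hz hz1 hz2
  obtain ⟨⟨x, t⟩, K⟩ := z
  obtain ⟨ht, hx⟩ := hz1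
  obtain ⟨L, hL⟩ := isInvertible_cder p.1 ((extChartAt (𝓡∂ (2 * n)) p.1).map_source hx)
  have hK : K ≠ 0 := ne_of_gt hz2
  have hloc : ∀ κ : ℝ, κ ≠ 0 → (∀ v, (∀ w, fval (extD (𝓡∂ (2 * n)) β) x ![v, w] -
      κ⁻¹ * (weightSum β φ a F' (x, t) ![v] * weightSum β φ (deriv a) F' (x, t) ![w] -
        weightSum β φ a F' (x, t) ![w] * weightSum β φ (deriv a) F' (x, t) ![v]) = 0) → v = 0) →
      ContactPt (fval (bundleForm n β φ a κ) (x, t))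
        (fval (extD ((𝓡∂ (2 * n)).prod 𝓘(ℝ, ℝ)) (bundleForm n β φ a κ)) (x, t)) := by
    intro κ hκ h
    exact contact_add_large hκ h (fval_bundleForm_apply hp (hF' (x, t) ht t (by simp)))
      (bundleForm_local hβ hp ha (hF' (x, t) ht)).2
  have hLv : ∀ v, cder (𝓡∂ (2 * n)) p.1 (extChartAt (𝓡∂ (2 * n)) p.1 x) (L.symm v) = v := by
    intro v
    rw [← hL]
    exact L.apply_symm_apply v
  refine ⟨hloc K hK fun v hv => ?_, hloc (-K) (neg_ne_zero.2 hK) fun v hv => ?_⟩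
  · have h0 := (hz (L.symm v)).1 fun w => by
      dsimp only
      rw [inChart_extChartAt _ hx, comp_apply_two, comp_apply_one, comp_apply_one, comp_apply_one,
        comp_apply_one, hLv]
      exact hv _
    simpa using h0
  · have h0 := (hz (L.symm v)).2 fun w => by
      dsimp only
      rw [inChart_extChartAt _ hx, comp_apply_two, comp_apply_one, comp_apply_one, comp_apply_one,
        comp_apply_one, hLv]
      have := hv (cder (𝓡∂ (2 * n)) p.1 (extChartAt (𝓡∂ (2 * n)) p.1 x) w)
      rw [inv_neg] at this
      linarith
    simpa using h0

theorem contMDiff_deck (hp : ∀ k, PreservesD β (dpow φ k)) (k : ℤ) :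
    ContMDiff ((𝓡∂ (2 * n)).prod 𝓘(ℝ, ℝ)) ((𝓡∂ (2 * n)).prod 𝓘(ℝ, ℝ)) ∞
      (fun p : S × ℝ => (dpow φ k p.1, p.2 + k)) :=
  ((hp k).1.comp contMDiff_fst).prodMk
    ((contDiff_id.add contDiff_const).contMDiff.comp contMDiff_snd)

/-- The deck transformations of the infinite cyclic cover of the mapping torus. -/
def deck (hp : ∀ k, PreservesD β (dpow φ k)) (k : ℤ) :
    (S × ℝ) ≃ₘ^∞⟮(𝓡∂ (2 * n)).prod 𝓘(ℝ, ℝ), (𝓡∂ (2 * n)).prod 𝓘(ℝ, ℝ)⟯ (S × ℝ) where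
  toFun p := (dpow φ k p.1, p.2 + k)
  invFun p := (dpow φ (-k) p.1, p.2 + (-k : ℤ))
  left_inv p := by simp [dpow]
  right_inv p := by simp [dpow]
  contMDiff_toFun := contMDiff_deck hp k
  contMDiff_invFun := contMDiff_deck hp (-k)

theorem deck_apply (hp : ∀ k, PreservesD β (dpow φ k)) (k : ℤ) (p : S × ℝ) :
    deck hp k p = (dpow φ k p.1, p.2 + k) := rfl

theorem fval_bundleForm_finsum (hp : ∀ k, PreservesD β (dpow φ k)) {a : ℝ → ℝ}
    (ha : HasCompactSupport a) (K : ℝ) (p : S × ℝ) (v : EuclideanSpace ℝ (Fin (2 * n)) × ℝ) :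
    fval (bundleForm n β φ a K) p ![v] =
      ∑ᶠ k : ℤ, a (p.2 + k) * fval (powForm β φ k) p.1 ![v.1] + K * v.2 := by
  obtain ⟨F, hF⟩ := exists_finset_weight ha p.2
  rw [fval_bundleForm_apply hp (hF p.2 (by simp)), weightSum, ContinuousAlternatingMap.sum_apply,
    finsum_eq_sum_of_support_subset (s := F)]
  · rfl
  · intro k hk
    by_contra hkF
    exact hk (by simp only [hF p.2 (by simp) k hkF, zero_mul])

/-- A deck transformation shifts the index of the sum by `k`. This invariance makes the form descend
to the mapping torus and reduces questions about it to one period. -/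
theorem fval_pullback_deck (hp : ∀ k, PreservesD β (dpow φ k)) {a : ℝ → ℝ}
    (ha : HasCompactSupport a) (K : ℝ) (k : ℤ) (p : S × ℝ) :
    fval (pullback ((𝓡∂ (2 * n)).prod 𝓘(ℝ, ℝ)) ((𝓡∂ (2 * n)).prod 𝓘(ℝ, ℝ)) (deck hp k)
      (bundleForm n β φ a K)) p = fval (bundleForm n β φ a K) p := by
  refine one_ext fun v => ?_
  have hd : MDifferentiableAt ((𝓡∂ (2 * n)).prod 𝓘(ℝ, ℝ)) ((𝓡∂ (2 * n)).prod 𝓘(ℝ, ℝ))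
      (deck hp k) p := (deck hp k).contMDiff.mdifferentiable (by simp) p
  have hφ : MDifferentiableAt (𝓡∂ (2 * n)) (𝓡∂ (2 * n)) (dpow φ k) p.1 :=
    (hp k).1.mdifferentiable (by simp) _
  have h1 : (tder ((𝓡∂ (2 * n)).prod 𝓘(ℝ, ℝ)) ((𝓡∂ (2 * n)).prod 𝓘(ℝ, ℝ)) (deck hp k) p v).1 =
      tder (𝓡∂ (2 * n)) (𝓡∂ (2 * n)) (dpow φ k) p.1 v.1 := by
    have e1 := tder_comp (I := (𝓡∂ (2 * n)).prod 𝓘(ℝ, ℝ)) (I'' := 𝓡∂ (2 * n))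
      (G := (Prod.fst : S × ℝ → S)) mdifferentiableAt_fst hd
    have e2 := tder_comp (I' := (𝓡∂ (2 * n)).prod 𝓘(ℝ, ℝ)) (F := (Prod.fst : S × ℝ → S))
      hφ mdifferentiableAt_fst
    rw [tder_fst] at e1 e2
    exact DFunLike.congr_fun (e1.symm.trans e2) v
  have h2 : (tder ((𝓡∂ (2 * n)).prod 𝓘(ℝ, ℝ)) ((𝓡∂ (2 * n)).prod 𝓘(ℝ, ℝ)) (deck hp k) p v).2 =
      v.2 := by
    have e1 := tder_comp (I := (𝓡∂ (2 * n)).prod 𝓘(ℝ, ℝ)) (I'' := 𝓘(ℝ, ℝ))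
      (G := (Prod.snd : S × ℝ → ℝ)) mdifferentiableAt_snd hd
    have e2 := tder_weight (S := S) (n := n) contDiff_id k p v
    rw [tder_snd] at e1
    rw [deriv_id, one_mul] at e2
    exact (DFunLike.congr_fun e1.symm v).trans e2
  rw [fval_pullback, comp_apply_one, fval_bundleForm_finsum hp ha, fval_bundleForm_finsum hp ha,
    h2, h1, ← finsum_comp_equiv (Equiv.addLeft k) (f := fun j : ℤ => a (p.2 + j) * _)]
  congr 1
  refine finsum_congr fun j => ?_
  have h3 : (dpow φ (k + j) : S → S) = dpow φ j ∘ dpow φ k := by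
    ext x; rw [dpow, add_comm, zpow_add]; rfl
  have h4 := fval_pullback_comp (x := p.1) β ((hp j).1.mdifferentiable (by simp) _) hφ
  rw [← h3] at h4
  rw [Equiv.coe_addLeft]
  change _ = _ * fval (pullback (𝓡∂ (2 * n)) (𝓡∂ (2 * n)) (dpow φ (k + j)) β) p.1 ![v.1]
  rw [h4, fval_pullback (dpow φ k), comp_apply_one, deck_apply]
  push_cast
  rw [add_assoc]

theorem bundleForm_smoothAt (hβ : ∀ x, SmoothAt β x) (hp : ∀ k, PreservesD β (dpow φ k))
    {a : ℝ → ℝ} (ha : IsPeriodicWeight a) (K : ℝ) (p : S × ℝ) :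
    SmoothAt (bundleForm n β φ a K) p := by
  obtain ⟨F, hF⟩ := exists_finset_weight ha.compact p.2
  exact (bundleForm_local hβ hp ha hF).1

/-- Compactness of `S × [0, 1]` yields a uniform threshold for `K` there, and every point of `S × ℝ`
is a deck translate of a point of this set. -/
theorem eventually_isContactForm_bundleForm [CompactSpace S] (hβ : ∀ x, SmoothAt β x)
    (hp : ∀ k, PreservesD β (dpow φ k))
    (hnd : ∀ (x : S) v, (∀ w, fval (extD (𝓡∂ (2 * n)) β) x ![v, w] = 0) → v = 0)
    {a : ℝ → ℝ} (ha : IsPeriodicWeight a) :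
    ∀ᶠ K in (atTop : Filter ℝ),
      IsContactForm ((𝓡∂ (2 * n)).prod 𝓘(ℝ, ℝ)) (bundleForm n β φ a K) ∧
      IsContactForm ((𝓡∂ (2 * n)).prod 𝓘(ℝ, ℝ)) (bundleForm n β φ a (-K)) := by
  have hcomp : IsCompact ((univ : Set S) ×ˢ Icc (0 : ℝ) 1) := isCompact_univ.prod isCompact_Icc
  filter_upwards [eventually_forall_of_isCompact hcomp (p := fun q K =>
      ContactPt (fval (bundleForm n β φ a K) q)
        (fval (extD ((𝓡∂ (2 * n)).prod 𝓘(ℝ, ℝ)) (bundleForm n β φ a K)) q) ∧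
      ContactPt (fval (bundleForm n β φ a (-K)) q)
        (fval (extD ((𝓡∂ (2 * n)).prod 𝓘(ℝ, ℝ)) (bundleForm n β φ a (-K))) q))
    fun p _ => eventually_contactPt_bundleForm hβ hp hnd ha p] with K hK
  have key : ∀ κ : ℝ, (∀ p ∈ (univ : Set S) ×ˢ Icc (0 : ℝ) 1,
      ContactPt (fval (bundleForm n β φ a κ) p)
        (fval (extD ((𝓡∂ (2 * n)).prod 𝓘(ℝ, ℝ)) (bundleForm n β φ a κ)) p)) →
      IsContactForm ((𝓡∂ (2 * n)).prod 𝓘(ℝ, ℝ)) (bundleForm n β φ a κ) := by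
    intro κ hκ
    refine isContactForm_iff.2 fun p => ⟨bundleForm_smoothAt hβ hp ha κ p, ?_⟩
    refine (contactPt_iff_of_pullback (F := deck hp (-⌊p.2⌋)) (x := p)
      ((deck hp (-⌊p.2⌋)).isLocalDiffeomorph p)
      (Filter.Eventually.of_forall fun q => fval_pullback_deck hp ha.compact κ _ q)
      (bundleForm_smoothAt hβ hp ha κ _)).2 (hκ _ ⟨mem_univ _, ?_⟩)
    rw [deck_apply]
    have h1 := Int.floor_le p.2
    have h2 := Int.lt_floor_add_one p.2
    constructor <;> push_cast <;> linarith
  exact ⟨key K fun p hp => (hK p hp).1, key (-K) fun p hp => (hK p hp).2⟩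

theorem dpow_eq_self {x : S} (hx : φ x = x) (k : ℤ) : dpow φ k x = x := by
  induction k using Int.induction_on with
  | zero => simp
  | succ k ih => rw [dpow, zpow_add_one, Equiv.Perm.mul_apply]; erw [hx]; exact ih
  | pred k ih =>
    rw [dpow, zpow_sub_one, Equiv.Perm.mul_apply]
    have : (φ.toEquiv : Equiv.Perm S)⁻¹ x = x := by
      rw [Equiv.Perm.inv_eq_iff_eq]; exact hx.symm
    rw [this]; exact ih

/-- Where the monodromy is locally the identity all pullbacks are `β` and the weights add up to `1`.
Hence near the boundary the bundle form does not depend on the weight. -/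
theorem fval_bundleForm_of_id (hp : ∀ k, PreservesD β (dpow φ k)) {a : ℝ → ℝ}
    (ha : IsPeriodicWeight a) (K : ℝ) {p : S × ℝ} (hid : ∀ᶠ x in 𝓝 p.1, φ x = x)
    (v : EuclideanSpace ℝ (Fin (2 * n)) × ℝ) :
    fval (bundleForm n β φ a K) p ![v] = fval β p.1 ![v.1] + K * v.2 := by
  obtain ⟨F, hF⟩ := exists_finset_weight ha.compact p.2
  rw [fval_bundleForm_apply hp (hF p.2 (by simp))]
  congr 1
  have h1 : ∀ k, fval (powForm β φ k) p.1 = fval β p.1 := by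
    intro k
    have hk : (dpow φ k : S → S) =ᶠ[𝓝 p.1] id := by
      filter_upwards [hid] with x hx using dpow_eq_self hx k
    rw [fval_pullback, tder_congr hk, tder_id, hk.self_of_nhds]
    rfl
  simp only [weightSum, h1]
  rw [← Finset.sum_smul, sum_weight ha (hF p.2 (by simp)), one_smul]

end Bundle

/-! ### Collars in charts and one-sided limits at the boundary. -/

section CollarCharts

set_option linter.unusedSectionVars false

open Filter

variable {n : ℕ} [NeZero n] {S : Type*} [TopologicalSpace S]
  [ChartedSpace (EuclideanHalfSpace (2 * n)) S] [IsManifold (𝓡∂ (2 * n)) ∞ S]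
  {Y : Type*} [TopologicalSpace Y] [ChartedSpace (EuclideanSpace ℝ (Fin (2 * n - 1))) Y]
  [IsManifold (𝓡 (2 * n - 1)) ∞ Y] {c : Y × ℝ → S}

/-- The domain of the coordinate expression of a collar. -/
abbrev colDom (n : ℕ) : Set (EuclideanSpace ℝ (Fin (2 * n - 1)) × ℝ) := univ ×ˢ Ico 0 1

/-- A collar in the preferred charts at a boundary point. -/
abbrev colMap (n : ℕ) [NeZero n] [ChartedSpace (EuclideanHalfSpace (2 * n)) S]
    [ChartedSpace (EuclideanSpace ℝ (Fin (2 * n - 1))) Y] (c : Y × ℝ → S) (y₀ : Y) : EuclideanSpace ℝ (Fin (2 * n - 1)) × ℝ →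
    EuclideanSpace ℝ (Fin (2 * n)) :=
  inCharts ((𝓡 (2 * n - 1)).prod 𝓘(ℝ, ℝ)) (𝓡∂ (2 * n)) (y₀, (0 : ℝ)) (c (y₀, 0)) c

/-- The one-sided derivative of a collar at a boundary point. -/
abbrev colDer (n : ℕ) [NeZero n] [ChartedSpace (EuclideanHalfSpace (2 * n)) S]
    [ChartedSpace (EuclideanSpace ℝ (Fin (2 * n - 1))) Y] (c : Y × ℝ → S) (y₀ : Y) : EuclideanSpace ℝ (Fin (2 * n - 1)) × ℝ →L[ℝ]
    EuclideanSpace ℝ (Fin (2 * n)) :=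
  fderivWithin ℝ (colMap n c y₀) (colDom n) (extChartAt (𝓡 (2 * n - 1)) y₀ y₀, 0)

theorem uniqueDiffOn_colDom : UniqueDiffOn ℝ (colDom n) :=
  uniqueDiffOn_univ.prod (uniqueDiffOn_Ico 0 1)

theorem mem_colDom (u : EuclideanSpace ℝ (Fin (2 * n - 1))) : (u, (0 : ℝ)) ∈ colDom n :=
  ⟨mem_univ _, by simp⟩

theorem extChartAt_prod_real_symm (y₀ : Y) (r t : ℝ) (u : EuclideanSpace ℝ (Fin (2 * n - 1))) :
    (extChartAt ((𝓡 (2 * n - 1)).prod 𝓘(ℝ, ℝ)) (y₀, r)).symm (u, t) =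
      ((extChartAt (𝓡 (2 * n - 1)) y₀).symm u, t) := by
  rw [extChartAt_prod]
  rfl

theorem preimage_colDom (y₀ : Y) :
    (extChartAt ((𝓡 (2 * n - 1)).prod 𝓘(ℝ, ℝ)) (y₀, (0 : ℝ))).symm ⁻¹' (univ ×ˢ Ico 0 1) ∩
      range ((𝓡 (2 * n - 1)).prod 𝓘(ℝ, ℝ)) = colDom n := by
  ext ⟨u, t⟩
  rw [mem_inter_iff, mem_preimage, extChartAt_prod_real_symm]
  simp

theorem extChartAt_prod_real (y₀ y : Y) (r t : ℝ) :
    extChartAt ((𝓡 (2 * n - 1)).prod 𝓘(ℝ, ℝ)) (y₀, r) (y, t) =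
      (extChartAt (𝓡 (2 * n - 1)) y₀ y, t) := by
  rw [extChartAt_prod]
  rfl

theorem contDiffWithinAt_colMap (hc : IsCollar n c) (y₀ : Y) :
    ContDiffWithinAt ℝ ∞ (colMap n c y₀) (colDom n) (extChartAt (𝓡 (2 * n - 1)) y₀ y₀, 0) := by
  have h := (contMDiffWithinAt_iff.1 (hc.smooth (y₀, 0) ⟨mem_univ _, by simp⟩)).2
  rwa [preimage_colDom, extChartAt_prod_real] at h

theorem bijective_colDer (hc : IsCollar n c) (y₀ : Y) : Function.Bijective (colDer n c y₀) := by
  have h := hc.bijective_deriv (y₀, 0) ⟨mem_univ _, by simp⟩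
  rw [((hc.smooth (y₀, 0) ⟨mem_univ _, by simp⟩).mdifferentiableWithinAt
    (by simp)).mfderivWithin, preimage_colDom] at h
  rw [extChartAt_prod_real] at h
  exact h

theorem hasFDerivWithinAt_colMap (hc : IsCollar n c) (y₀ : Y) :
    HasFDerivWithinAt (colMap n c y₀) (colDer n c y₀) (colDom n)
      (extChartAt (𝓡 (2 * n - 1)) y₀ y₀, 0) :=
  ((contDiffWithinAt_colMap hc y₀).differentiableWithinAt (by simp)).hasFDerivWithinAt

theorem contMDiff_collar_zero (hc : IsCollar n c) :
    ContMDiff (𝓡 (2 * n - 1)) (𝓡∂ (2 * n)) ∞ (fun y => c (y, 0)) := by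
  rw [← contMDiffOn_univ]
  exact hc.smooth.comp (contMDiff_id.prodMk contMDiff_const).contMDiffOn
    fun y _ => ⟨mem_univ _, by simp⟩

theorem tder_collar_zero (hc : IsCollar n c) (y₀ : Y) (v : EuclideanSpace ℝ (Fin (2 * n - 1))) :
    tder (𝓡 (2 * n - 1)) (𝓡∂ (2 * n)) (fun y => c (y, 0)) y₀ v = colDer n c y₀ (v, 0) := by
  have h1 : HasFDerivWithinAt (fun u : EuclideanSpace ℝ (Fin (2 * n - 1)) => (u, (0 : ℝ)))
      (ContinuousLinearMap.inl ℝ _ ℝ) (range (𝓡 (2 * n - 1)))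
      (extChartAt (𝓡 (2 * n - 1)) y₀ y₀) :=
    (ContinuousLinearMap.inl ℝ (EuclideanSpace ℝ (Fin (2 * n - 1))) ℝ).hasFDerivWithinAt
  have h2 := (hasFDerivWithinAt_colMap hc y₀).comp (extChartAt (𝓡 (2 * n - 1)) y₀ y₀) h1
    (fun u _ => mem_colDom u)
  rw [tder, ((contMDiff_collar_zero hc).mdifferentiable (by simp) y₀).mfderiv]
  have h3 : writtenInExtChartAt (𝓡 (2 * n - 1)) (𝓡∂ (2 * n)) y₀ (fun y => c (y, 0)) =
      colMap n c y₀ ∘ fun u => (u, (0 : ℝ)) := by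
    funext u
    simp only [colMap, inCharts, Function.comp_apply, extChartAt_prod_real_symm]
    rfl
  rw [h3, h2.fderivWithin ((𝓡 (2 * n - 1)).uniqueDiffOn _ (by simp))]
  rfl

theorem colMap_nonneg (y₀ : Y) (z : EuclideanSpace ℝ (Fin (2 * n - 1)) × ℝ) :
    0 ≤ colMap n c y₀ z 0 := by
  have : colMap n c y₀ z ∈ range (𝓡∂ (2 * n)) := by simp [colMap, inCharts]
  rw [range_modelWithCornersEuclideanHalfSpace] at this
  exact this

theorem colMap_zero (hc : IsCollar n c) (y₀ : Y) :
    colMap n c y₀ (extChartAt (𝓡 (2 * n - 1)) y₀ y₀, 0) 0 = 0 := by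
  have h1 : c (y₀, 0) ∈ (𝓡∂ (2 * n)).boundary S := by
    rw [← hc.boundary_eq]; exact ⟨y₀, rfl⟩
  have h2 : extChartAt (𝓡∂ (2 * n)) (c (y₀, 0)) (c (y₀, 0)) ∈ frontier (range (𝓡∂ (2 * n))) := h1
  rw [frontier_range_modelWithCornersEuclideanHalfSpace] at h2
  have h3 : colMap n c y₀ (extChartAt (𝓡 (2 * n - 1)) y₀ y₀, 0) =
      extChartAt (𝓡∂ (2 * n)) (c (y₀, 0)) (c (y₀, 0)) := by
    simp only [colMap, inCharts, Function.comp_apply, extChartAt_prod_real_symm,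
      extChartAt_to_inv]
  rw [h3]
  exact h2.symm

/-- The coordinate `x 0` of the half space attains its minimum `0` at boundary points. First-order
optimality on the convex set `colDom` makes the derivative vanish along `Y` and nonnegative in the
direction of `t`; if it were zero there too, `colDer` would not be surjective. -/
theorem colDer_coord (hc : IsCollar n c) (y₀ : Y) :
    (∀ v, colDer n c y₀ (v, 0) 0 = 0) ∧ 0 < colDer n c y₀ (0, 1) 0 := by
  let e0 : EuclideanSpace ℝ (Fin (2 * n)) →L[ℝ] ℝ := EuclideanSpace.proj 0
  have hd : HasFDerivWithinAt (fun z => colMap n c y₀ z 0) (e0 ∘L colDer n c y₀) (colDom n)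
      (extChartAt (𝓡 (2 * n - 1)) y₀ y₀, 0) :=
    e0.hasFDerivAt.comp_hasFDerivWithinAt _ (hasFDerivWithinAt_colMap hc y₀)
  have hmin : IsLocalMinOn (fun z => colMap n c y₀ z 0) (colDom n)
      (extChartAt (𝓡 (2 * n - 1)) y₀ y₀, 0) := by
    refine Filter.Eventually.of_forall fun z => ?_
    dsimp only
    rw [colMap_zero hc]
    exact colMap_nonneg y₀ z
  have hconv : Convex ℝ (colDom n) := convex_univ.prod (convex_Ico 0 1)
  have hnn : ∀ w : EuclideanSpace ℝ (Fin (2 * n - 1)) × ℝ, w.2 ∈ Ico (0 : ℝ) 1 →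
      0 ≤ colDer n c y₀ w 0 := by
    intro w hw
    refine hmin.hasFDerivWithinAt_nonneg hd (mem_posTangentConeAt_of_segment_subset ?_)
    exact hconv.segment_subset (mem_colDom _) ⟨mem_univ _, by simpa using hw⟩
  have h0 : ∀ v, colDer n c y₀ (v, 0) 0 = 0 := by
    intro v
    refine le_antisymm ?_ (hnn _ (by simp))
    have := hnn (-v, 0) (by simp)
    rw [show ((-v, (0 : ℝ)) : EuclideanSpace ℝ (Fin (2 * n - 1)) × ℝ) = -(v, 0) by simp,
      map_neg] at this
    simpa using this
  refine ⟨h0, lt_of_le_of_ne ?_ fun hne => ?_⟩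
  -- The direction `(0, 1)` itself would leave the half-open domain, so half of it is tested.
  · have := hnn (0, 1 / 2) (by constructor <;> norm_num)
    rw [show ((0, (1 / 2 : ℝ)) : EuclideanSpace ℝ (Fin (2 * n - 1)) × ℝ) = (1 / 2 : ℝ) • (0, 1) by
      simp, map_smul] at this
    simpa using this
  · obtain ⟨⟨v, s⟩, hv⟩ := (bijective_colDer hc y₀).2 (EuclideanSpace.single 0 1)
    have h1 : ((v, s) : EuclideanSpace ℝ (Fin (2 * n - 1)) × ℝ) = (v, 0) + s • (0, 1) := by simp
    rw [h1, map_add, map_smul] at hv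
    have h2 := congrArg (fun z : EuclideanSpace ℝ (Fin (2 * n)) => z 0) hv
    simp only [PiLp.add_apply, PiLp.smul_apply, h0, ← hne] at h2
    simp at h2

theorem tendsto_compContinuousLinearMap {ι V W : Type*} [NormedAddCommGroup V] [NormedSpace ℝ V]
    [NormedAddCommGroup W] [NormedSpace ℝ W] {k : ℕ} {l : Filter ι} {ξ : ι → V [⋀^Fin k]→L[ℝ] ℝ}
    {ξ₀ : V [⋀^Fin k]→L[ℝ] ℝ} {L : ι → W →L[ℝ] V} {L₀ : W →L[ℝ] V} (hξ : Tendsto ξ l (𝓝 ξ₀))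
    (hL : Tendsto L l (𝓝 L₀)) :
    Tendsto (fun i => (ξ i).compContinuousLinearMap (L i)) l
      (𝓝 (ξ₀.compContinuousLinearMap L₀)) :=
  (isBoundedBilinearMap_apply.continuous.tendsto
    (ContinuousAlternatingMap.compContinuousLinearMapCLM L₀, ξ₀)).comp
    (((ContinuousAlternatingMap.continuous_compContinuousLinearMapCLM.tendsto L₀).comp
      hL).prodMk_nhds hξ)

theorem contMDiffAt_collar (hc : IsCollar n c) (y : Y) {t : ℝ} (ht : t ∈ Ioo (0 : ℝ) 1) :
    ContMDiffAt ((𝓡 (2 * n - 1)).prod 𝓘(ℝ, ℝ)) (𝓡∂ (2 * n)) ∞ c (y, t) :=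
  (hc.smooth (y, t) ⟨mem_univ _, Ioo_subset_Ico_self ht⟩).contMDiffAt
    (prod_mem_nhds univ_mem (Ico_mem_nhds ht.1 ht.2))

/-- The collar map is unconstrained for `t < 0`, so the pullback `c*ζ` has no meaning at `t = 0`.
Its substitute is the limit as `t → 0⁺` in a fixed chart, which is the pullback under the one-sided
derivative `colDer`. -/
theorem tendsto_inChart_pullback_collar (hc : IsCollar n c) (y₀ : Y) {k : ℕ}
    (ζ : DForm (𝓡∂ (2 * n)) S k)
    (hζ : Tendsto (inChart (𝓡∂ (2 * n)) ζ (c (y₀, 0)))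
      (𝓝[range (𝓡∂ (2 * n))] (extChartAt (𝓡∂ (2 * n)) (c (y₀, 0)) (c (y₀, 0))))
      (𝓝 (fval ζ (c (y₀, 0))))) :
    Tendsto (fun z : Y × ℝ => inChart ((𝓡 (2 * n - 1)).prod 𝓘(ℝ, ℝ))
        (pullback (𝓡∂ (2 * n)) ((𝓡 (2 * n - 1)).prod 𝓘(ℝ, ℝ)) c ζ) (y₀, 0)
        (extChartAt (𝓡 (2 * n - 1)) y₀ z.1, z.2)) (𝓝 y₀ ×ˢ 𝓝[>] 0)
      (𝓝 ((fval ζ (c (y₀, 0))).compContinuousLinearMap (colDer n c y₀))) := by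
  have hlim : Tendsto (fun z : Y × ℝ => (extChartAt (𝓡 (2 * n - 1)) y₀ z.1, z.2))
      (𝓝 y₀ ×ˢ 𝓝[>] 0) (𝓝[colDom n] (extChartAt (𝓡 (2 * n - 1)) y₀ y₀, 0)) := by
    refine tendsto_nhdsWithin_iff.2 ⟨?_, ?_⟩
    · exact ((continuousAt_extChartAt y₀).tendsto.comp tendsto_fst).prodMk_nhds
        ((tendsto_id.mono_right nhdsWithin_le_nhds).comp tendsto_snd)
    · have : ∀ᶠ t : ℝ in 𝓝[>] 0, t ∈ Ioo (0 : ℝ) 1 := Ioo_mem_nhdsGT one_pos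
      filter_upwards [this.prod_inr (𝓝 y₀)] with z hz
      exact ⟨mem_univ _, Ioo_subset_Ico_self hz⟩
  have h1 := contDiffWithinAt_colMap hc y₀
  have h2 : Tendsto (fderivWithin ℝ (colMap n c y₀) (colDom n))
      (𝓝[colDom n] (extChartAt (𝓡 (2 * n - 1)) y₀ y₀, 0)) (𝓝 (colDer n c y₀)) :=
    (h1.fderivWithin_right (m := ∞) uniqueDiffOn_colDom (by norm_cast)
      (mem_colDom _)).continuousWithinAt
  have h3 : Tendsto (colMap n c y₀) (𝓝[colDom n] (extChartAt (𝓡 (2 * n - 1)) y₀ y₀, 0))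
      (𝓝[range (𝓡∂ (2 * n))] (extChartAt (𝓡∂ (2 * n)) (c (y₀, 0)) (c (y₀, 0)))) := by
    refine tendsto_nhdsWithin_iff.2 ⟨?_, Filter.Eventually.of_forall fun z => ?_⟩
    · have := h1.continuousWithinAt
      rwa [ContinuousWithinAt, show colMap n c y₀ (extChartAt (𝓡 (2 * n - 1)) y₀ y₀, 0) =
          extChartAt (𝓡∂ (2 * n)) (c (y₀, 0)) (c (y₀, 0)) by
        simp only [colMap, inCharts, Function.comp_apply, extChartAt_prod_real_symm,
          extChartAt_to_inv]] at this
    · simp [colMap, inCharts]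
  refine ((tendsto_compContinuousLinearMap (hζ.comp h3) h2).comp hlim).congr' ?_
  have hsrc : ∀ᶠ z : Y × ℝ in 𝓝 y₀ ×ˢ 𝓝[>] 0,
      c ((extChartAt (𝓡 (2 * n - 1)) y₀).symm (extChartAt (𝓡 (2 * n - 1)) y₀ z.1), z.2) ∈
        (extChartAt (𝓡∂ (2 * n)) (c (y₀, 0))).source := by
    have hcc : ContinuousWithinAt c (univ ×ˢ Ico 0 1) (y₀, 0) :=
      (hc.smooth (y₀, 0) ⟨mem_univ _, by simp⟩).continuousWithinAt
    have hl2 : Tendsto (fun z : Y × ℝ => (z.1, z.2)) (𝓝 y₀ ×ˢ 𝓝[>] 0)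
        (𝓝[univ ×ˢ Ico 0 1] (y₀, 0)) := by
      rw [nhdsWithin_prod_eq, nhdsWithin_univ]
      refine Tendsto.prodMk tendsto_fst (Tendsto.mono_right tendsto_snd ?_)
      rw [nhdsWithin_Ico_eq_nhdsGE one_pos]
      exact nhdsWithin_mono _ Ioi_subset_Ici_self
    filter_upwards [(hcc.tendsto.comp hl2).eventually
      (extChartAt_source_mem_nhds (I := 𝓡∂ (2 * n)) (c (y₀, 0))),
      Filter.Eventually.prod_inl (extChartAt_source_mem_nhds (I := 𝓡 (2 * n - 1)) y₀) _] with z hz hz'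
    rw [(extChartAt (𝓡 (2 * n - 1)) y₀).left_inv hz']
    exact hz
  have ht : ∀ᶠ t : ℝ in 𝓝[>] 0, t ∈ Ioo (0 : ℝ) 1 := Ioo_mem_nhdsGT one_pos
  filter_upwards [hsrc, ht.prod_inr (𝓝 y₀),
    Filter.Eventually.prod_inl (extChartAt_source_mem_nhds (I := 𝓡 (2 * n - 1)) y₀) _] with z hz hz2 hz3
  have hu : (extChartAt (𝓡 (2 * n - 1)) y₀ z.1, z.2) ∈
      (extChartAt ((𝓡 (2 * n - 1)).prod 𝓘(ℝ, ℝ)) (y₀, (0 : ℝ))).target := by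
    rw [extChartAt_prod]
    exact ⟨(extChartAt (𝓡 (2 * n - 1)) y₀).map_source hz3, by rw [extChartAt_model_space_eq_id]; trivial⟩
  have hd : colDom n ∈ 𝓝 (extChartAt (𝓡 (2 * n - 1)) y₀ z.1, z.2) :=
    prod_mem_nhds univ_mem (Ico_mem_nhds hz2.1 hz2.2)
  have hr : range ((𝓡 (2 * n - 1)).prod 𝓘(ℝ, ℝ)) = univ := by simp
  rw [inChart_pullback (q := c (y₀, 0)) ζ hu]
  · simp only [Function.comp_apply]
    rw [hr, fderivWithin_univ, fderivWithin_of_mem_nhds hd]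
  · rw [extChartAt_prod_real_symm]
    exact (contMDiffAt_collar hc _ hz2).mdifferentiableAt (by simp)
  · rw [extChartAt_prod_real_symm]
    exact hz

theorem cder_prod_real (y₀ : Y) {u : EuclideanSpace ℝ (Fin (2 * n - 1))}
    (hu : u ∈ (extChartAt (𝓡 (2 * n - 1)) y₀).target) (t : ℝ)
    (v : EuclideanSpace ℝ (Fin (2 * n - 1)) × ℝ) :
    cder ((𝓡 (2 * n - 1)).prod 𝓘(ℝ, ℝ)) (y₀, (0 : ℝ)) (u, t) v =
      (cder (𝓡 (2 * n - 1)) y₀ u v.1, v.2) := by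
  have hu' : (u, t) ∈ (extChartAt ((𝓡 (2 * n - 1)).prod 𝓘(ℝ, ℝ)) (y₀, (0 : ℝ))).target := by
    rw [extChartAt_prod]
    exact ⟨hu, by rw [extChartAt_model_space_eq_id]; trivial⟩
  have hs := extChartAt_prod_real_symm y₀ 0 t u
  have hr : range ((𝓡 (2 * n - 1)).prod 𝓘(ℝ, ℝ)) = univ := by simp
  have h1 := cder_comp_fderivWithin_inCharts (I := 𝓡 (2 * n - 1)) (F := (Prod.fst : Y × ℝ → Y))
    (q := y₀) hu' mdifferentiableAt_fst (by
      rw [hs]; exact (extChartAt (𝓡 (2 * n - 1)) y₀).map_target hu)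
  have h2 := cder_comp_fderivWithin_inCharts (I := 𝓘(ℝ, ℝ)) (F := (Prod.snd : Y × ℝ → ℝ))
    (q := t) hu' mdifferentiableAt_snd (by rw [extChartAt_model_space_eq_id]; trivial)
  have e1 : inCharts ((𝓡 (2 * n - 1)).prod 𝓘(ℝ, ℝ)) (𝓡 (2 * n - 1)) (y₀, (0 : ℝ)) y₀
      (Prod.fst : Y × ℝ → Y) =ᶠ[𝓝 (u, t)] Prod.fst := by
    have : ∀ᶠ z : EuclideanSpace ℝ (Fin (2 * n - 1)) × ℝ in 𝓝 (u, t),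
        z.1 ∈ (extChartAt (𝓡 (2 * n - 1)) y₀).target :=
      continuousAt_fst.eventually ((isOpen_extChartAt_target y₀).mem_nhds hu)
    filter_upwards [this] with z hz
    obtain ⟨z1, z2⟩ := z
    simp only [inCharts, Function.comp_apply, extChartAt_prod_real_symm]
    exact (extChartAt (𝓡 (2 * n - 1)) y₀).right_inv hz
  have e2 : inCharts ((𝓡 (2 * n - 1)).prod 𝓘(ℝ, ℝ)) 𝓘(ℝ, ℝ) (y₀, (0 : ℝ)) t
      (Prod.snd : Y × ℝ → ℝ) = Prod.snd := by
    funext ⟨z1, z2⟩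
    simp only [inCharts, Function.comp_apply, extChartAt_prod_real_symm,
      extChartAt_model_space_eq_id]
    rfl
  rw [hr, fderivWithin_univ, e1.fderiv_eq, fderiv_fst, hs, tder_fst,
    (extChartAt (𝓡 (2 * n - 1)) y₀).right_inv hu] at h1
  rw [hr, fderivWithin_univ, e2, fderiv_snd, hs, tder_snd] at h2
  have e3 : ∀ r : ℝ, cder 𝓘(ℝ, ℝ) t r = ContinuousLinearMap.id ℝ ℝ := by
    intro r
    rw [cder, extChartAt_model_space_eq_id, modelWithCornersSelf_coe, range_id]
    rw [mfderivWithin_univ]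
    exact mfderiv_id
  rw [e3] at h2
  refine Prod.ext ?_ ?_
  · exact (DFunLike.congr_fun h1 v).symm
  · exact (DFunLike.congr_fun h2 v).symm

end CollarCharts

/-! ### Convexity in the collar: the boundary contact form and the symplectic interpolation. -/

section Side

set_option linter.unusedSectionVars false

open Filter

theorem exists_dual_vector {V : Type*} [NormedAddCommGroup V] [NormedSpace ℝ V]
    [FiniteDimensional ℝ V] {b : V [⋀^Fin 2]→L[ℝ] ℝ} (hb : ∀ v, (∀ w, b ![v, w] = 0) → v = 0)
    (a : V [⋀^Fin 1]→L[ℝ] ℝ) : ∃ X, ∀ w, b ![X, w] = a ![w] := by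
  have hinj : Function.Injective (toBilin b : V →ₗ[ℝ] Module.Dual ℝ V) := by
    rw [← LinearMap.ker_eq_bot, LinearMap.ker_eq_bot']
    intro v hv
    exact hb v fun w => LinearMap.congr_fun hv w
  obtain ⟨X, hX⟩ := (LinearMap.injective_iff_surjective_of_finrank_eq_finrank
    (Subspace.dual_finrank_eq).symm).1 hinj (toLin a)
  exact ⟨X, fun w => LinearMap.congr_fun hX w⟩

variable {n : ℕ} [NeZero n] {S : Type*} [TopologicalSpace S]
  [ChartedSpace (EuclideanHalfSpace (2 * n)) S] [IsManifold (𝓡∂ (2 * n)) ∞ S]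
  {Y : Type*} [TopologicalSpace Y] [ChartedSpace (EuclideanSpace ℝ (Fin (2 * n - 1))) Y]
  [IsManifold (𝓡 (2 * n - 1)) ∞ Y] {c : Y × ℝ → S} {β : DForm (𝓡∂ (2 * n)) S 1}

/-- The form induced on the boundary. -/
abbrev bdryForm (c : Y × ℝ → S) (β : DForm (𝓡∂ (2 * n)) S 1) : DForm (𝓡 (2 * n - 1)) Y 1 :=
  pullback (𝓡∂ (2 * n)) (𝓡 (2 * n - 1)) (fun y => c (y, 0)) β

theorem smoothAt_bdryForm (hβ : IsConvexExactSymplectic n β) (hc : IsCollar n c) (y : Y) :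
    SmoothAt (bdryForm c β) y :=
  SmoothAt.pullback (isSmoothForm_iff.1 hβ.smooth _) (contMDiff_collar_zero hc).contMDiffAt

theorem fval_bdryForm (hc : IsCollar n c) (y : Y) (v : EuclideanSpace ℝ (Fin (2 * n - 1))) :
    (fval β (c (y, 0))).compContinuousLinearMap (colDer n c y) ![(v, 0)] =
      fval (bdryForm c β) y ![v] := by
  rw [comp_apply_one, fval_pullback, comp_apply_one, tder_collar_zero hc]

theorem fval_extD_bdryForm (hβ : IsConvexExactSymplectic n β) (hc : IsCollar n c) (y : Y)
    (v w : EuclideanSpace ℝ (Fin (2 * n - 1))) :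
    (fval (extD (𝓡∂ (2 * n)) β) (c (y, 0))).compContinuousLinearMap (colDer n c y)
        ![(v, 0), (w, 0)] =
      fval (extD (𝓡 (2 * n - 1)) (bdryForm c β)) y ![v, w] := by
  rw [comp_apply_two, fval_extD_pullback (isSmoothForm_iff.1 hβ.smooth _)
    (contMDiff_collar_zero hc).contMDiffAt, comp_apply_two, tder_collar_zero hc,
    tder_collar_zero hc]

theorem collar_nondegenerate (hβ : IsConvexExactSymplectic n β) (hc : IsCollar n c) (y : Y)
    (v : EuclideanSpace ℝ (Fin (2 * n - 1)) × ℝ)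
    (hv : ∀ w, (fval (extD (𝓡∂ (2 * n)) β) (c (y, 0))).compContinuousLinearMap
      (colDer n c y) ![v, w] = 0) : v = 0 := by
  have hb := bijective_colDer hc y
  refine hb.1 ?_
  rw [map_zero]
  refine hβ.nondegenerate (c (y, 0)) _ fun w => ?_
  obtain ⟨w', rfl⟩ := hb.2 w
  have := hv w'
  rw [comp_apply_two] at this
  exact this

/-- The Liouville vector is pulled back by the bijective `colDer`. Outward means that `x 0`
decreases along it, and by `colDer_coord` this coordinate detects exactly the sign of the
`t`-component. -/
theorem exists_collar_liouville (hβ : IsConvexExactSymplectic n β) (hc : IsCollar n c) (y : Y) :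
    ∃ X : EuclideanSpace ℝ (Fin (2 * n - 1)) × ℝ, X.2 < 0 ∧ ∀ w,
      (fval (extD (𝓡∂ (2 * n)) β) (c (y, 0))).compContinuousLinearMap (colDer n c y) ![X, w] =
        (fval β (c (y, 0))).compContinuousLinearMap (colDer n c y) ![w] := by
  obtain ⟨X, hX⟩ := exists_dual_vector (b := fval (extD (𝓡∂ (2 * n)) β) (c (y, 0)))
    (hβ.nondegenerate (c (y, 0))) (fval β (c (y, 0)))
  obtain ⟨⟨v, s⟩, rfl⟩ := (bijective_colDer hc y).2 X
  refine ⟨(v, s), ?_, fun w => ?_⟩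
  · have hbd : c (y, 0) ∈ (𝓡∂ (2 * n)).boundary S := by
      rw [← hc.boundary_eq]; exact ⟨y, rfl⟩
    have : IsManifold (𝓡∂ (2 * n)) 1 S := .of_le (n := ∞) (by simp)
    have h1 := hβ.outward _ hbd _ hX
    have h2 : mvfderiv (𝓡∂ (2 * n)) (extChartAt (𝓡∂ (2 * n)) (c (y, 0))) (c (y, 0))
        (colDer n c y (v, s)) = colDer n c y (v, s) := by
      have h3 := mfderiv_extChartAt_self (I := 𝓡∂ (2 * n)) (x := c (y, 0))
      exact DFunLike.congr_fun h3 (colDer n c y (v, s))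
    rw [h2] at h1
    have h3 : ((v, s) : EuclideanSpace ℝ (Fin (2 * n - 1)) × ℝ) = (v, 0) + s • (0, 1) := by simp
    obtain ⟨h4, h5⟩ := colDer_coord hc y
    rw [h3, map_add, map_smul, PiLp.add_apply, h4, PiLp.smul_apply, zero_add, smul_eq_mul] at h1
    by_contra! hs
    exact absurd h1 (not_lt.2 (mul_nonneg hs h5.le))
  · rw [comp_apply_two, comp_apply_one]
    exact hX _

theorem contactPt_bdryForm (hβ : IsConvexExactSymplectic n β) (hc : IsCollar n c) (y : Y) :
    ContactPt (fval (bdryForm c β) y) (fval (extD (𝓡 (2 * n - 1)) (bdryForm c β)) y) := by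
  obtain ⟨X, hX2, hX⟩ := exists_collar_liouville hβ hc y
  exact boundary_contact (fval_bdryForm hc y) (fval_extD_bdryForm hβ hc y) hX hX2
    (collar_nondegenerate hβ hc y)

/-- The factor `h` is only given pointwise. Locally it is the quotient of the values of the two
forms on a fixed vector of the chart on which `α` does not vanish. -/
theorem contMDiff_ratio {α α' : DForm (𝓡 (2 * n - 1)) Y 1} (hα : ∀ y, SmoothAt α y)
    (hα' : ∀ y, SmoothAt α' y) (h0 : ∀ y, fval α y ≠ 0) {h : Y → ℝ}
    (hh : ∀ y, fval α' y = h y • fval α y) : ContMDiff (𝓡 (2 * n - 1)) 𝓘(ℝ, ℝ) ∞ h := by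
  intro y₀
  obtain ⟨R, hR⟩ : ∃ R, fval α y₀ ![R] ≠ 0 := by
    by_contra! hcon
    exact h0 y₀ (one_ext fun v => hcon v)
  let ev : (EuclideanSpace ℝ (Fin (2 * n - 1)) [⋀^Fin 1]→L[ℝ] ℝ) →L[ℝ] ℝ :=
    ContinuousAlternatingMap.apply ℝ _ ℝ ![R]
  let r : EuclideanSpace ℝ (Fin (2 * n - 1)) → ℝ := fun u =>
    inChart (𝓡 (2 * n - 1)) α' y₀ u ![R] / inChart (𝓡 (2 * n - 1)) α y₀ u ![R]
  have hu : range (𝓡 (2 * n - 1)) = univ := by simp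
  have hden : inChart (𝓡 (2 * n - 1)) α y₀ (extChartAt (𝓡 (2 * n - 1)) y₀ y₀) ![R] ≠ 0 := by
    rwa [inChart_self]
  have h1 := hα y₀
  have h2 := hα' y₀
  rw [SmoothAt, hu, contDiffWithinAt_univ] at h1 h2
  have e1 := ev.contDiff.contDiffAt.comp _ h1
  have e2 := ev.contDiff.contDiffAt.comp _ h2
  have hr : ContDiffAt ℝ ∞ r (extChartAt (𝓡 (2 * n - 1)) y₀ y₀) := e2.div e1 hden
  have hr2 : ContMDiffAt (𝓡 (2 * n - 1)) 𝓘(ℝ, ℝ) ∞ (r ∘ extChartAt (𝓡 (2 * n - 1)) y₀) y₀ :=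
    hr.contMDiffAt.comp y₀ contMDiffAt_extChartAt
  refine hr2.congr_of_eventuallyEq ?_
  have hne : ∀ᶠ y in 𝓝 y₀, inChart (𝓡 (2 * n - 1)) α y₀
      (extChartAt (𝓡 (2 * n - 1)) y₀ y) ![R] ≠ 0 :=
    (e1.continuousAt.comp (continuousAt_extChartAt y₀)).eventually_ne hden
  filter_upwards [hne, extChartAt_source_mem_nhds (I := 𝓡 (2 * n - 1)) y₀] with y hy hys
  simp only [Function.comp_apply, r]
  rw [eq_div_iff hy, inChart_extChartAt _ hys, inChart_extChartAt _ hys, hh, comp_apply_one,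
    comp_apply_one, ContinuousAlternatingMap.smul_apply, smul_eq_mul]

/-- In `d(hα) = dh ∧ α + h dα` the first term dies on `ker α`. -/
theorem fval_extD_ratio {α α' : DForm (𝓡 (2 * n - 1)) Y 1} (hα : ∀ y, SmoothAt α y)
    {h : Y → ℝ} (hh : ∀ y, fval α' y = h y • fval α y)
    (hsm : ContMDiff (𝓡 (2 * n - 1)) 𝓘(ℝ, ℝ) ∞ h) (y : Y)
    {v w : EuclideanSpace ℝ (Fin (2 * n - 1))} (hv : fval α y ![v] = 0) (hw : fval α y ![w] = 0) :
    fval (extD (𝓡 (2 * n - 1)) α') y ![v, w] =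
      h y * fval (extD (𝓡 (2 * n - 1)) α) y ![v, w] := by
  have h1 : α' = fun y => h y • α y := funext fun y => hh y
  rw [h1, fval_extD_fsmul hsm.contMDiffAt (hα y), hv, hw]
  ring

/-- The form `c*β` on the collar. -/
abbrev colForm (c : Y × ℝ → S) (β : DForm (𝓡∂ (2 * n)) S 1) :
    DForm ((𝓡 (2 * n - 1)).prod 𝓘(ℝ, ℝ)) (Y × ℝ) 1 :=
  pullback (𝓡∂ (2 * n)) ((𝓡 (2 * n - 1)).prod 𝓘(ℝ, ℝ)) c β

theorem smoothAt_colForm (hβ : IsConvexExactSymplectic n β) (hc : IsCollar n c) (y : Y) {t : ℝ}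
    (ht : t ∈ Ioo (0 : ℝ) 1) : SmoothAt (colForm c β) (y, t) :=
  SmoothAt.pullback (isSmoothForm_iff.1 hβ.smooth _) (contMDiffAt_collar hc y ht)

theorem interpTwo_comp {E : Type*} [NormedAddCommGroup E] [NormedSpace ℝ E]
    (α : E [⋀^Fin 1]→L[ℝ] ℝ) (A : E [⋀^Fin 2]→L[ℝ] ℝ)
    (b : (E × ℝ) [⋀^Fin 1]→L[ℝ] ℝ) (B : (E × ℝ) [⋀^Fin 2]→L[ℝ] ℝ) (f q ρ p : ℝ)
    (L : E →L[ℝ] E) (L' : E × ℝ →L[ℝ] E × ℝ) (hL : ∀ v, L' v = (L v.1, v.2)) (v w : E × ℝ) :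
    interpTwo (α.compContinuousLinearMap L) (A.compContinuousLinearMap L)
      (b.compContinuousLinearMap L') (B.compContinuousLinearMap L') f q ρ p v w =
      interpTwo α A b B f q ρ p (L' v) (L' w) := by
  simp only [interpTwo, comp_apply_one, comp_apply_two, hL]

/-- The interpolation between `f α` and `c*β` is symplectic near the boundary. -/
theorem eventually_side_nondegenerate [CompactSpace Y] (hβ : IsConvexExactSymplectic n β)
    (hc : IsCollar n c) {α : DForm (𝓡 (2 * n - 1)) Y 1} (hα : ∀ y, SmoothAt α y)
    (hcont : ∀ y, ContactPt (fval α y) (fval (extD (𝓡 (2 * n - 1)) α) y)) {h : Y → ℝ}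
    (hpos : ∀ y, 0 < h y) (hh : ∀ y, fval (bdryForm c β) y = h y • fval α y)
    {C : ℝ} (hC : ∀ y, h y < C) :
    ∀ᶠ z in 𝓝[>] (0 : ℝ) ×ˢ (atTop : Filter ℝ), ∀ y ∈ (univ : Set Y),
      ∀ ρ ∈ Icc (0 : ℝ) 1, ∀ p, 0 ≤ p → (z.2 * ρ ≤ p ∨ 1 - z.2⁻¹ ≤ ρ) → ∀ v,
      (∀ w, interpTwo (fval α y) (fval (extD (𝓡 (2 * n - 1)) α) y)
        (fval (colForm c β) (y, z.1))
        (fval (extD ((𝓡 (2 * n - 1)).prod 𝓘(ℝ, ℝ)) (colForm c β)) (y, z.1))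
        (C - z.1 ^ 2) (2 * z.1) ρ p v w = 0) → v = 0 := by
  have hsmβ := isSmoothForm_iff.1 hβ.smooth
  have hsm : ContMDiff (𝓡 (2 * n - 1)) 𝓘(ℝ, ℝ) ∞ h :=
    contMDiff_ratio hα (smoothAt_bdryForm hβ hc) (fun y => (hcont y).1) hh
  refine eventually_forall_of_isCompact isCompact_univ (p := fun y (z : ℝ × ℝ) =>
    ∀ ρ ∈ Icc (0 : ℝ) 1, ∀ p, 0 ≤ p → (z.2 * ρ ≤ p ∨ 1 - z.2⁻¹ ≤ ρ) → ∀ v,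
      (∀ w, interpTwo (fval α y) (fval (extD (𝓡 (2 * n - 1)) α) y)
        (fval (colForm c β) (y, z.1))
        (fval (extD ((𝓡 (2 * n - 1)).prod 𝓘(ℝ, ℝ)) (colForm c β)) (y, z.1))
        (C - z.1 ^ 2) (2 * z.1) ρ p v w = 0) → v = 0) fun y₀ _ => ?_
  have t1 : Tendsto (fun z : Y × ℝ => inChart (𝓡 (2 * n - 1)) α y₀
      (extChartAt (𝓡 (2 * n - 1)) y₀ z.1)) (𝓝 y₀ ×ˢ 𝓝[>] 0) (𝓝 (fval α y₀)) :=
    (hα y₀).tendsto_inChart.comp ((tendsto_extChartAt_nhdsWithin_range y₀).comp tendsto_fst)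
  have t2 : Tendsto (fun z : Y × ℝ => inChart (𝓡 (2 * n - 1)) (extD (𝓡 (2 * n - 1)) α) y₀
      (extChartAt (𝓡 (2 * n - 1)) y₀ z.1)) (𝓝 y₀ ×ˢ 𝓝[>] 0)
      (𝓝 (fval (extD (𝓡 (2 * n - 1)) α) y₀)) :=
    (tendsto_inChart_extD hα).comp ((tendsto_extChartAt_nhdsWithin_range y₀).comp tendsto_fst)
  have t3 := tendsto_inChart_pullback_collar hc y₀ β (hsmβ _).tendsto_inChart
  have t4 := tendsto_inChart_pullback_collar hc y₀ (extD (𝓡∂ (2 * n)) β)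
    (tendsto_inChart_extD hsmβ)
  have t0 : Tendsto (fun z : Y × ℝ => z.2) (𝓝 y₀ ×ˢ 𝓝[>] 0) (𝓝 0) :=
    (tendsto_id.mono_right nhdsWithin_le_nhds).comp tendsto_snd
  have t5 : Tendsto (fun z : Y × ℝ => C - z.2 ^ 2) (𝓝 y₀ ×ˢ 𝓝[>] 0) (𝓝 C) := by
    simpa using (tendsto_const_nhds (x := C)).sub (t0.pow 2)
  have ht : ∀ᶠ t : ℝ in 𝓝[>] 0, t ∈ Ioo (0 : ℝ) 1 := Ioo_mem_nhdsGT one_pos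
  have t6 : ∀ᶠ z : Y × ℝ in 𝓝 y₀ ×ˢ 𝓝[>] 0, 0 < 2 * z.2 := by
    filter_upwards [ht.prod_inr (𝓝 y₀)] with z hz
    linarith [hz.1]
  -- All data have limits as `(y, t) → (y₀, 0⁺)` in the chart at `y₀`, and the limits satisfy the
  -- boundary relations: the ratio `h`, its effect on `ker α`, and the sign coming from convexity.
  have key := eventually_interpTwo_nondegenerate t1 t2 t3 t4 t5 t6 (hpos y₀) (hC y₀) (hcont y₀)
    (fun v => by
      rw [fval_bdryForm hc, hh, ContinuousAlternatingMap.smul_apply, smul_eq_mul])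
    (fun v w hv hw => by
      rw [fval_extD_bdryForm hβ hc]
      exact fval_extD_ratio hα hh hsm y₀ hv hw)
    (fun R hR hR' => by
      obtain ⟨X, hX2, hX⟩ := exists_collar_liouville hβ hc y₀
      exact boundary_reeb_neg (hpos y₀) (fun v => by
        rw [fval_bdryForm hc, hh, ContinuousAlternatingMap.smul_apply, smul_eq_mul]) hX hX2 hR hR')
  have key2 := (tendsto_prodAssoc_symm (f := 𝓝 y₀) (g := 𝓝[>] (0 : ℝ))
    (h := (atTop : Filter ℝ))).eventually key
  have hsrc : ∀ᶠ y in 𝓝 y₀, y ∈ (extChartAt (𝓡 (2 * n - 1)) y₀).source :=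
    extChartAt_source_mem_nhds y₀
  filter_upwards [key2, hsrc.prod_inl _, (ht.prod_inl _).prod_inr _] with z hz hz1 hz2
  obtain ⟨y, t, L⟩ := z
  intro ρ hρ p hp hor v hv
  have hut := (extChartAt (𝓡 (2 * n - 1)) y₀).map_source hz1
  -- From here on nondegeneracy in the fixed chart is transported back to the tangent space at `(y,
  -- t)`.
  obtain ⟨T, hT⟩ := isInvertible_cder y₀ hut
  have hcd := cder_prod_real y₀ hut t
  have hsrc' : (y, t) ∈ (extChartAt ((𝓡 (2 * n - 1)).prod 𝓘(ℝ, ℝ)) (y₀, (0 : ℝ))).source := by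
    rw [extChartAt_prod]
    exact ⟨hz1, by rw [extChartAt_model_space_eq_id]; trivial⟩
  have hext : fval (pullback (𝓡∂ (2 * n)) ((𝓡 (2 * n - 1)).prod 𝓘(ℝ, ℝ)) c
      (extD (𝓡∂ (2 * n)) β)) (y, t) =
      fval (extD ((𝓡 (2 * n - 1)).prod 𝓘(ℝ, ℝ)) (colForm c β)) (y, t) :=
    (fval_extD_pullback (hsmβ _) (contMDiffAt_collar hc y hz2)).symm
  have hvT : cder ((𝓡 (2 * n - 1)).prod 𝓘(ℝ, ℝ)) (y₀, (0 : ℝ))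
      (extChartAt (𝓡 (2 * n - 1)) y₀ y, t) (T.symm v.1, v.2) = v := by
    rw [hcd]
    refine Prod.ext ?_ rfl
    rw [← hT]
    exact T.apply_symm_apply v.1
  have h0 := hz ρ hρ p hp hor (T.symm v.1, v.2) fun w => by
    simp only [Equiv.prodAssoc_symm_apply]
    rw [inChart_extChartAt _ hz1, inChart_extChartAt _ hz1]
    have e1 := extChartAt_prod_real (n := n) y₀ y 0 t
    rw [← e1, inChart_extChartAt _ hsrc', inChart_extChartAt _ hsrc', hext, interpTwo_comp _ _ _ _ _
      _ _ _ _ _ (by rw [e1]; exact hcd), e1, hvT]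
    exact hv _
  rw [Prod.mk_eq_zero] at h0
  refine Prod.ext ?_ h0.2
  simpa using h0.1

end Side

/-! ### Forms on `M × ℝ` and `M × ℝ × ℝ` and two criteria for contactness. -/

section Total

set_option linter.unusedSectionVars false

open Filter

variable {E : Type*} [NormedAddCommGroup E] [NormedSpace ℝ E]
  {H : Type*} [TopologicalSpace H] {I : ModelWithCorners ℝ E H}
  {M : Type*} [TopologicalSpace M] [ChartedSpace H M] [IsManifold I ∞ M]
  {E' : Type*} [NormedAddCommGroup E'] [NormedSpace ℝ E']
  {H' : Type*} [TopologicalSpace H'] {I' : ModelWithCorners ℝ E' H'}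
  {N : Type*} [TopologicalSpace N] [ChartedSpace H' N]

theorem tder_real_comp {a : ℝ → ℝ} {r : M → ℝ} {x : M} (ha : DifferentiableAt ℝ a (r x))
    (hr : MDifferentiableAt I 𝓘(ℝ, ℝ) r x) (v : E) :
    tder I 𝓘(ℝ, ℝ) (fun y => a (r y)) x v = deriv a (r x) * tder I 𝓘(ℝ, ℝ) r x v := by
  have := tder_comp (I'' := 𝓘(ℝ, ℝ)) (G := a) ha.mdifferentiableAt hr
  rw [tder_real] at this
  have h2 := DFunLike.congr_fun this v
  refine h2.trans ?_
  rw [ContinuousLinearMap.comp_apply, fderiv_eq_smul_deriv, smul_eq_mul, mul_comm]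

theorem tder_prodMk {F : N → M} {r : N → ℝ} {x : N} (hF : MDifferentiableAt I' I F x)
    (hr : MDifferentiableAt I' 𝓘(ℝ, ℝ) r x) (v : E') :
    tder I' (I.prod 𝓘(ℝ, ℝ)) (fun y => (F y, r y)) x v =
      (tder I' I F x v, tder I' 𝓘(ℝ, ℝ) r x v) := by
  have := mfderiv_prodMk hF hr
  exact DFunLike.congr_fun this v

/-! ### Forms on `M × ℝ` -/

theorem fval_extD_snd_smul {a : ℝ → ℝ} (ha : ContDiff ℝ ∞ a)
    {ζ : DForm (I.prod 𝓘(ℝ, ℝ)) (M × ℝ) 1} {p : M × ℝ} (hζ : SmoothAt ζ p) (v w : E × ℝ) :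
    fval (extD (I.prod 𝓘(ℝ, ℝ)) (fun q => a q.2 • ζ q)) p ![v, w] =
      deriv a p.2 * (v.2 * fval ζ p ![w] - w.2 * fval ζ p ![v]) +
        a p.2 * fval (extD (I.prod 𝓘(ℝ, ℝ)) ζ) p ![v, w] := by
  have h1 : ∀ v : E × ℝ, tder (I.prod 𝓘(ℝ, ℝ)) 𝓘(ℝ, ℝ) (fun q : M × ℝ => a q.2) p v =
      deriv a p.2 * v.2 := by
    intro v
    rw [tder_real_comp (r := fun q : M × ℝ => q.2) (ha.differentiable (by simp) _)
      mdifferentiableAt_snd]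
    congr 1
    exact DFunLike.congr_fun (tder_snd (I := I) (I' := 𝓘(ℝ, ℝ)) p) v
  rw [fval_extD_fsmul (f := fun q : M × ℝ => a q.2) (ha.contMDiff.comp contMDiff_snd).contMDiffAt hζ,
    h1, h1]
  ring

theorem smoothAt_snd_smul {a : ℝ → ℝ} (ha : ContDiff ℝ ∞ a)
    {ζ : DForm (I.prod 𝓘(ℝ, ℝ)) (M × ℝ) 1} {p : M × ℝ} (hζ : SmoothAt ζ p) :
    SmoothAt (I := I.prod 𝓘(ℝ, ℝ)) (fun q => a q.2 • ζ q) p :=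
  hζ.fsmul (f := fun q : M × ℝ => a q.2) (ha.contMDiff.comp contMDiff_snd).contMDiffAt

/-- The form `a(t) α + b(t) γ` on `M × ℝ`. -/
def combForm (α : DForm I M 1) (γ : DForm (I.prod 𝓘(ℝ, ℝ)) (M × ℝ) 1) (a b : ℝ → ℝ) :
    DForm (I.prod 𝓘(ℝ, ℝ)) (M × ℝ) 1 := fun q =>
  a q.2 • pullback I (I.prod 𝓘(ℝ, ℝ)) (Prod.fst : M × ℝ → M) α q + b q.2 • γ q

theorem fval_pullback_fst (α : DForm I M 1) (p : M × ℝ) (v : E × ℝ) :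
    fval (pullback I (I.prod 𝓘(ℝ, ℝ)) (Prod.fst : M × ℝ → M) α) p ![v] = fval α p.1 ![v.1] := by
  rw [fval_pullback, comp_apply_one, tder_fst]
  rfl

theorem fval_combForm (α : DForm I M 1) (γ : DForm (I.prod 𝓘(ℝ, ℝ)) (M × ℝ) 1) (a b : ℝ → ℝ)
    (p : M × ℝ) (v : E × ℝ) :
    fval (combForm α γ a b) p ![v] = a p.2 * fval α p.1 ![v.1] + b p.2 * fval γ p ![v] := by
  rw [← fval_pullback_fst (I := I)]
  rfl

theorem smoothAt_combForm {α : DForm I M 1} {γ : DForm (I.prod 𝓘(ℝ, ℝ)) (M × ℝ) 1}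
    {a b : ℝ → ℝ} (ha : ContDiff ℝ ∞ a) (hb : ContDiff ℝ ∞ b) {p : M × ℝ}
    (hα : SmoothAt α p.1) (hγ : SmoothAt γ p) : SmoothAt (combForm α γ a b) p :=
  (smoothAt_snd_smul ha (SmoothAt.pullback hα contMDiffAt_fst)).add (smoothAt_snd_smul hb hγ)

theorem fval_extD_combForm {α : DForm I M 1} {γ : DForm (I.prod 𝓘(ℝ, ℝ)) (M × ℝ) 1}
    {a b : ℝ → ℝ} (ha : ContDiff ℝ ∞ a) (hb : ContDiff ℝ ∞ b) {p : M × ℝ}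
    (hα : SmoothAt α p.1) (hγ : SmoothAt γ p) (v w : E × ℝ) :
    fval (extD (I.prod 𝓘(ℝ, ℝ)) (combForm α γ a b)) p ![v, w] =
      deriv a p.2 * (v.2 * fval α p.1 ![w.1] - w.2 * fval α p.1 ![v.1]) +
        a p.2 * fval (extD I α) p.1 ![v.1, w.1] +
      (deriv b p.2 * (v.2 * fval γ p ![w] - w.2 * fval γ p ![v]) +
        b p.2 * fval (extD (I.prod 𝓘(ℝ, ℝ)) γ) p ![v, w]) := by
  have h1 : SmoothAt (pullback I (I.prod 𝓘(ℝ, ℝ)) (Prod.fst : M × ℝ → M) α) p :=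
    SmoothAt.pullback hα contMDiffAt_fst
  have h2 := fval_extD_add (smoothAt_snd_smul ha h1) (smoothAt_snd_smul hb hγ)
  refine (DFunLike.congr_fun h2 ![v, w]).trans ?_
  rw [ContinuousAlternatingMap.add_apply, fval_extD_snd_smul ha h1, fval_extD_snd_smul hb hγ,
    fval_pullback_fst, fval_pullback_fst, fval_extD_pullback hα contMDiffAt_fst, tder_fst,
    comp_apply_two]
  rfl

/-! ### Forms on `M × ℝ × ℝ` -/

theorem tder_snd_fst (p : M × ℝ × ℝ) (v : E × ℝ × ℝ) :
    tder (I.prod (𝓘(ℝ, ℝ).prod 𝓘(ℝ, ℝ))) 𝓘(ℝ, ℝ) (fun q : M × ℝ × ℝ => q.2.1) p v = v.2.1 := by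
  have h := tder_comp (I'' := 𝓘(ℝ, ℝ)) (G := (Prod.fst : ℝ × ℝ → ℝ))
    (F := (Prod.snd : M × ℝ × ℝ → ℝ × ℝ)) (I' := I.prod (𝓘(ℝ, ℝ).prod 𝓘(ℝ, ℝ)))
    (I := 𝓘(ℝ, ℝ).prod 𝓘(ℝ, ℝ)) (x := p) mdifferentiableAt_fst mdifferentiableAt_snd
  rw [tder_fst, tder_snd] at h
  exact DFunLike.congr_fun h v

theorem tder_snd_snd (p : M × ℝ × ℝ) (v : E × ℝ × ℝ) :
    tder (I.prod (𝓘(ℝ, ℝ).prod 𝓘(ℝ, ℝ))) 𝓘(ℝ, ℝ) (fun q : M × ℝ × ℝ => q.2.2) p v = v.2.2 := by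
  have h := tder_comp (I'' := 𝓘(ℝ, ℝ)) (G := (Prod.snd : ℝ × ℝ → ℝ))
    (F := (Prod.snd : M × ℝ × ℝ → ℝ × ℝ)) (I' := I.prod (𝓘(ℝ, ℝ).prod 𝓘(ℝ, ℝ)))
    (I := 𝓘(ℝ, ℝ).prod 𝓘(ℝ, ℝ)) (x := p) mdifferentiableAt_snd mdifferentiableAt_snd
  rw [tder_snd, tder_snd] at h
  exact DFunLike.congr_fun h v

theorem contMDiff_snd_fst :
    ContMDiff (I.prod (𝓘(ℝ, ℝ).prod 𝓘(ℝ, ℝ))) 𝓘(ℝ, ℝ) ∞ (fun q : M × ℝ × ℝ => q.2.1) :=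
  contMDiff_fst.comp contMDiff_snd

theorem contMDiff_snd_snd :
    ContMDiff (I.prod (𝓘(ℝ, ℝ).prod 𝓘(ℝ, ℝ))) 𝓘(ℝ, ℝ) ∞ (fun q : M × ℝ × ℝ => q.2.2) :=
  contMDiff_snd.comp contMDiff_snd

/-- The map `(y, t, s) ↦ (y, ε t)`. -/
def sideProj (ε : ℝ) (p : M × ℝ × ℝ) : M × ℝ := (p.1, ε * p.2.1)

theorem contMDiff_eps_mul (ε : ℝ) : ContMDiff (I.prod (𝓘(ℝ, ℝ).prod 𝓘(ℝ, ℝ))) 𝓘(ℝ, ℝ) ∞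
    (fun q : M × ℝ × ℝ => ε * q.2.1) := by
  have : ContDiff ℝ ∞ (fun t : ℝ => ε * t) := contDiff_const.mul contDiff_id
  exact this.contMDiff.comp contMDiff_snd_fst

theorem contMDiff_sideProj (ε : ℝ) :
    ContMDiff (I.prod (𝓘(ℝ, ℝ).prod 𝓘(ℝ, ℝ))) (I.prod 𝓘(ℝ, ℝ)) ∞
      (sideProj ε : M × ℝ × ℝ → M × ℝ) :=
  contMDiff_fst.prodMk (contMDiff_eps_mul ε)

theorem tder_sideProj (ε : ℝ) (p : M × ℝ × ℝ) (v : E × ℝ × ℝ) :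
    tder (I.prod (𝓘(ℝ, ℝ).prod 𝓘(ℝ, ℝ))) (I.prod 𝓘(ℝ, ℝ)) (sideProj ε) p v =
      (v.1, ε * v.2.1) := by
  have hd : DifferentiableAt ℝ (fun t : ℝ => ε * t) p.2.1 := by fun_prop
  have h := tder_prodMk (I := I) (I' := I.prod (𝓘(ℝ, ℝ).prod 𝓘(ℝ, ℝ))) (x := p)
    (F := (Prod.fst : M × ℝ × ℝ → M)) (r := fun q => ε * q.2.1) mdifferentiableAt_fst
    ((contMDiff_eps_mul ε).mdifferentiable (by simp) p) v
  rw [tder_real_comp (I := I.prod (𝓘(ℝ, ℝ).prod 𝓘(ℝ, ℝ))) (a := fun t : ℝ => ε * t)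
    (r := fun q : M × ℝ × ℝ => q.2.1) hd (contMDiff_snd_fst.mdifferentiable (by simp) p),
    tder_snd_fst, tder_fst] at h
  simp only [deriv_const_mul_id'] at h
  exact h

/-- The form `τ + g(t) ds` on `M × ℝ × ℝ`, where `τ` is a form on `M × ℝ` that is pulled back under
`(y, t, s) ↦ (y, ε t)`. -/
def totalForm (ε : ℝ) (τ : DForm (I.prod 𝓘(ℝ, ℝ)) (M × ℝ) 1) (g : ℝ → ℝ) :
    DForm (I.prod (𝓘(ℝ, ℝ).prod 𝓘(ℝ, ℝ))) (M × ℝ × ℝ) 1 := fun p =>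
  pullback (I.prod 𝓘(ℝ, ℝ)) (I.prod (𝓘(ℝ, ℝ).prod 𝓘(ℝ, ℝ))) (sideProj ε) τ p +
  g p.2.1 • dFun (I.prod (𝓘(ℝ, ℝ).prod 𝓘(ℝ, ℝ))) (fun q : M × ℝ × ℝ => q.2.2) p

theorem fval_totalForm (ε : ℝ) (τ : DForm (I.prod 𝓘(ℝ, ℝ)) (M × ℝ) 1) (g : ℝ → ℝ)
    (p : M × ℝ × ℝ) (v : E × ℝ × ℝ) :
    fval (totalForm ε τ g) p ![v] =
      fval τ (p.1, ε * p.2.1) ![(v.1, ε * v.2.1)] + g p.2.1 * v.2.2 := by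
  rw [← tder_sideProj (I := I) (M := M) ε p v, ← tder_snd_snd (I := I) (M := M) p v]
  rw [show (p.1, ε * p.2.1) = sideProj ε p from rfl, ← comp_apply_one, ← fval_pullback]
  rfl

theorem smoothAt_g_ds {g : ℝ → ℝ} (hg : ContDiff ℝ ∞ g) (p : M × ℝ × ℝ) :
    SmoothAt (I := I.prod (𝓘(ℝ, ℝ).prod 𝓘(ℝ, ℝ))) (fun p : M × ℝ × ℝ =>
      g p.2.1 • dFun (I.prod (𝓘(ℝ, ℝ).prod 𝓘(ℝ, ℝ))) (fun q : M × ℝ × ℝ => q.2.2) p) p :=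
  (smoothAt_dFun contMDiff_snd_snd.contMDiffAt).fsmul (f := fun p : M × ℝ × ℝ => g p.2.1)
    (hg.contMDiff.comp contMDiff_snd_fst).contMDiffAt

theorem smoothAt_totalForm {ε : ℝ} {τ : DForm (I.prod 𝓘(ℝ, ℝ)) (M × ℝ) 1} {g : ℝ → ℝ}
    (hg : ContDiff ℝ ∞ g) {p : M × ℝ × ℝ} (hτ : SmoothAt τ (p.1, ε * p.2.1)) :
    SmoothAt (totalForm ε τ g) p := by
  have h1 : SmoothAt (pullback (I.prod 𝓘(ℝ, ℝ)) (I.prod (𝓘(ℝ, ℝ).prod 𝓘(ℝ, ℝ))) (sideProj ε) τ) p :=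
    SmoothAt.pullback (F := sideProj ε) hτ (contMDiff_sideProj ε).contMDiffAt
  exact h1.add (smoothAt_g_ds hg p)

theorem fval_extD_totalForm {ε : ℝ} {τ : DForm (I.prod 𝓘(ℝ, ℝ)) (M × ℝ) 1} {g : ℝ → ℝ}
    (hg : ContDiff ℝ ∞ g) {p : M × ℝ × ℝ} (hτ : SmoothAt τ (p.1, ε * p.2.1))
    (v w : E × ℝ × ℝ) :
    fval (extD (I.prod (𝓘(ℝ, ℝ).prod 𝓘(ℝ, ℝ))) (totalForm ε τ g)) p ![v, w] =
      fval (extD (I.prod 𝓘(ℝ, ℝ)) τ) (p.1, ε * p.2.1) ![(v.1, ε * v.2.1), (w.1, ε * w.2.1)] +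
        deriv g p.2.1 * (v.2.1 * w.2.2 - w.2.1 * v.2.2) := by
  have hds : SmoothAt (dFun (I.prod (𝓘(ℝ, ℝ).prod 𝓘(ℝ, ℝ))) (fun q : M × ℝ × ℝ => q.2.2)) p :=
    smoothAt_dFun contMDiff_snd_snd.contMDiffAt
  have hgt : ∀ v : E × ℝ × ℝ, tder (I.prod (𝓘(ℝ, ℝ).prod 𝓘(ℝ, ℝ))) 𝓘(ℝ, ℝ)
      (fun q : M × ℝ × ℝ => g q.2.1) p v = deriv g p.2.1 * v.2.1 := fun v => by
    rw [tder_real_comp (r := fun q : M × ℝ × ℝ => q.2.1) (hg.differentiable (by simp) _)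
      (contMDiff_snd_fst.mdifferentiable (by simp) p), tder_snd_fst]
  have e1 : fval (extD (I.prod (𝓘(ℝ, ℝ).prod 𝓘(ℝ, ℝ))) (fun p : M × ℝ × ℝ =>
      g p.2.1 • dFun (I.prod (𝓘(ℝ, ℝ).prod 𝓘(ℝ, ℝ))) (fun q : M × ℝ × ℝ => q.2.2) p)) p
        ![v, w] = deriv g p.2.1 * (v.2.1 * w.2.2 - w.2.1 * v.2.2) := by
    have h5 : (0 : (E × ℝ × ℝ) [⋀^Fin 2]→L[ℝ] ℝ) ![v, w] = 0 := rfl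
    rw [fval_extD_fsmul (f := fun p : M × ℝ × ℝ => g p.2.1)
      (hg.contMDiff.comp contMDiff_snd_fst).contMDiffAt hds,
      fval_extD_dFun contMDiff_snd_snd.contMDiffAt, fval_dFun, fval_dFun, tder_snd_snd,
      tder_snd_snd, hgt, hgt, h5]
    ring
  have e2 : fval (extD (I.prod (𝓘(ℝ, ℝ).prod 𝓘(ℝ, ℝ))) (pullback (I.prod 𝓘(ℝ, ℝ))
      (I.prod (𝓘(ℝ, ℝ).prod 𝓘(ℝ, ℝ))) (sideProj ε) τ)) p ![v, w] =
      fval (extD (I.prod 𝓘(ℝ, ℝ)) τ) (p.1, ε * p.2.1) ![(v.1, ε * v.2.1), (w.1, ε * w.2.1)] := by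
    rw [fval_extD_pullback (F := sideProj ε) hτ (contMDiff_sideProj ε).contMDiffAt, comp_apply_two,
      tder_sideProj, tder_sideProj]
    rfl
  have h2 := fval_extD_add (SmoothAt.pullback (I' := I.prod (𝓘(ℝ, ℝ).prod 𝓘(ℝ, ℝ)))
    (F := sideProj ε) (x := p) hτ (contMDiff_sideProj ε).contMDiffAt) (smoothAt_g_ds hg p)
  rw [← e1, ← e2, ← ContinuousAlternatingMap.add_apply, ← h2]
  rfl

/-! ### Contact conditions -/

/-- As `G ≠ 0`, the hyperplane `ker a` is a graph over `E × ℝ`, and `Ω` restricted to it is `B` up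
to the rescaling by `ε`. -/
theorem contactPt_of_nondegenerate {a : (E × ℝ × ℝ) [⋀^Fin 1]→L[ℝ] ℝ}
    {Ω : (E × ℝ × ℝ) [⋀^Fin 2]→L[ℝ] ℝ} {b : (E × ℝ) [⋀^Fin 1]→L[ℝ] ℝ}
    {B : (E × ℝ) [⋀^Fin 2]→L[ℝ] ℝ} {ε G : ℝ} (hε : ε ≠ 0) (hG : G ≠ 0)
    (ha : ∀ v, a ![v] = b ![(v.1, ε * v.2.1)] + G * v.2.2)
    (hΩ : ∀ v w, Ω ![v, w] = B ![(v.1, ε * v.2.1), (w.1, ε * w.2.1)])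
    (hB : ∀ v, (∀ w, B ![v, w] = 0) → v = 0) : ContactPt a Ω := by
  have hb0 : b ![(0, 0)] = 0 := (toLin b).map_zero
  constructor
  · intro h
    have h1 := ha (0, 0, 1)
    rw [h, mul_zero, hb0] at h1
    simp only [zero_add, mul_one] at h1
    exact hG h1.symm
  · rintro ⟨x, t, s⟩ hv hw
    have h1 : ((x, ε * t) : E × ℝ) = 0 := by
      refine hB _ fun u => ?_
      have h2 := hw (u.1, ε⁻¹ * u.2, -(b ![u]) / G) (by
        rw [ha]
        dsimp only
        rw [mul_inv_cancel_left₀ hε]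
        field_simp
        ring_nf)
      rw [hΩ] at h2
      dsimp only at h2
      rwa [mul_inv_cancel_left₀ hε] at h2
    rw [Prod.mk_eq_zero] at h1
    obtain ⟨rfl, h3⟩ := h1
    have ht : t = 0 := (mul_eq_zero.1 h3).resolve_left hε
    subst ht
    rw [ha, mul_zero, hb0] at hv
    have : s = 0 := by
      simp only [zero_add, mul_eq_zero] at hv
      exact hv.resolve_left hG
    rw [this]
    rfl

/-- The hyperplane `ker a` contains `∂t`, `ker α` and a combination of a vector transverse to `ker
α` with `∂s`. Pairing with `∂t`, together with `a(v) = 0`, is a linear system for `α(x)` and `s`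
with the determinant `f'g - fg'` up to sign. Pairing with `ker α` then kills `x`, and pairing with
the last vector kills `t`. -/
theorem contactPt_of_wronskian {a : (E × ℝ × ℝ) [⋀^Fin 1]→L[ℝ] ℝ}
    {Ω : (E × ℝ × ℝ) [⋀^Fin 2]→L[ℝ] ℝ} {α : E [⋀^Fin 1]→L[ℝ] ℝ} {A : E [⋀^Fin 2]→L[ℝ] ℝ}
    {f g f' g' : ℝ} (hf : f ≠ 0) (hW : f' * g - f * g' ≠ 0) (hα : ContactPt α A)
    (ha : ∀ v, a ![v] = f * α ![v.1] + g * v.2.2)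
    (hΩ : ∀ v w, Ω ![v, w] = f' * (v.2.1 * α ![w.1] - w.2.1 * α ![v.1]) + f * A ![v.1, w.1] +
      g' * (v.2.1 * w.2.2 - w.2.1 * v.2.2)) : ContactPt a Ω := by
  obtain ⟨R, hR⟩ : ∃ R, α ![R] ≠ 0 := by
    by_contra! h
    exact hα.1 (one_ext fun v => h v)
  have hα0 : α ![(0 : E)] = 0 := (toLin α).map_zero
  constructor
  · intro h
    have h1 := ha (R, 0, 0)
    rw [h] at h1
    have h2 : f * α ![R] = 0 := by simpa using h1.symm
    exact (mul_ne_zero hf hR) h2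
  · rintro ⟨x, t, s⟩ hv hw
    rw [ha] at hv
    dsimp only at hv
    have hA0 : ∀ x, A ![x, 0] = 0 := fun x => (toBilin A x).map_zero
    have hA0' : ∀ x, A ![0, x] = 0 := fun x => by rw [two_swap, hA0, neg_zero]
    have h1 := hw (0, 1, 0) (by rw [ha]; simp [hα0])
    rw [hΩ] at h1
    simp only [hα0, hA0, mul_zero, zero_sub, one_mul, add_zero] at h1
    have hx : α ![x] = 0 := by
      have : (f' * g - f * g') * α ![x] = 0 := by linear_combination -g * h1 - g' * hv
      exact (mul_eq_zero.1 this).resolve_left hW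
    have hs : s = 0 := by
      have : (f' * g - f * g') * s = 0 := by linear_combination f' * hv + f * h1
      exact (mul_eq_zero.1 this).resolve_left hW
    have hx0 : x = 0 := by
      refine hα.2 x hx fun w hw' => ?_
      have h2 := hw (w, 0, 0) (by rw [ha]; simp [hw'])
      rw [hΩ] at h2
      simp only [hw', hx, mul_zero, zero_mul, zero_add, add_zero, sub_self] at h2
      exact (mul_eq_zero.1 h2).resolve_left hf
    -- This vector of `ker a` has pairing `(f'g - fg') α(R)` with `∂t`.
    have h3 := hw (g • R, 0, -f * α ![R]) (by rw [ha]; dsimp only; rw [one_smul']; ring)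
    rw [hΩ, hx0, hs] at h3
    simp only [one_smul', hA0'] at h3
    have ht : t = 0 := by
      have : ((f' * g - f * g') * α ![R]) * t = 0 := by linear_combination h3
      exact (mul_eq_zero.1 this).resolve_left (mul_ne_zero hW hR)
    rw [hx0, ht, hs]
    rfl

end Total

/-! ### The profile functions `f`, `g` and the cutoff. -/

section Profile

open Real

/-- The coefficient of the contact form of the fold. -/
def foldF (C t : ℝ) : ℝ := C - t ^ 2

/-- The coefficient of the angular form. -/
def foldG (K δ t : ℝ) : ℝ := -K * (2 * smoothTransition ((t / δ + 1) / 2) - 1)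

/-- A cutoff function that is `0` up to `δ` and `1` from `2δ` on. -/
def cut (δ t : ℝ) : ℝ := smoothTransition (t / δ - 1)

theorem contDiff_foldF (C : ℝ) : ContDiff ℝ ∞ (foldF C) := by
  unfold foldF
  fun_prop

theorem deriv_foldF (C t : ℝ) : deriv (foldF C) t = -(2 * t) := by
  have : HasDerivAt (foldF C) (-(2 * t)) t := by
    have h := (hasDerivAt_pow 2 t).const_sub C
    norm_num at h
    exact h
  exact this.deriv

theorem contDiff_foldG (K δ : ℝ) : ContDiff ℝ ∞ (foldG K δ) := by
  unfold foldG
  have : ContDiff ℝ ∞ fun t : ℝ => smoothTransition ((t / δ + 1) / 2) :=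
    smoothTransition.contDiff.comp (by fun_prop)
  fun_prop

theorem contDiff_cut (δ : ℝ) : ContDiff ℝ ∞ (cut δ) := by
  unfold cut
  exact smoothTransition.contDiff.comp (by fun_prop)

theorem foldG_neg (K δ t : ℝ) : foldG K δ (-t) = -foldG K δ t := by
  rw [foldG, foldG, show (-t / δ + 1) / 2 = 1 - (t / δ + 1) / 2 by ring, smoothTransition_one_sub]
  ring

theorem foldG_of_le {K δ t : ℝ} (hδ : 0 < δ) (ht : δ ≤ t) : foldG K δ t = -K := by
  have : 1 ≤ t / δ := (one_le_div hδ).2 ht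
  rw [foldG, smoothTransition.one_of_one_le (by linarith)]
  ring

theorem foldG_of_le_neg {K δ t : ℝ} (hδ : 0 < δ) (ht : t ≤ -δ) : foldG K δ t = K := by
  have := foldG_of_le (K := K) hδ (t := -t) (by linarith)
  rw [foldG_neg] at this
  linarith

/-- The endpoint `t = a` is included by using the one-sided derivative. It is needed because the
regions `|t| < δ` and `δ ≤ |t|` are treated by different criteria. -/
theorem deriv_eq_zero_of_eqOn_Ici {g : ℝ → ℝ} {a c t : ℝ} (hg : DifferentiableAt ℝ g t)
    (h : ∀ x, a ≤ x → g x = c) (ht : a ≤ t) : deriv g t = 0 := by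
  have h1 : HasDerivWithinAt g (deriv g t) (Ici t) t := hg.hasDerivAt.hasDerivWithinAt
  have h2 : HasDerivWithinAt g 0 (Ici t) t :=
    (hasDerivWithinAt_const t (Ici t) c).congr (fun x hx => h x (ht.trans hx)) (h t ht)
  exact (uniqueDiffOn_Ici t t self_mem_Ici).eq_deriv _ h1 h2

theorem deriv_foldG_of_le {K δ t : ℝ} (hδ : 0 < δ) (ht : δ ≤ |t|) : deriv (foldG K δ) t = 0 := by
  have hd : ∀ t, DifferentiableAt ℝ (foldG K δ) t :=
    fun t => (contDiff_foldG K δ).differentiable (by simp) t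
  have hpos : ∀ t, δ ≤ t → deriv (foldG K δ) t = 0 := fun t ht =>
    deriv_eq_zero_of_eqOn_Ici (hd t) (fun x hx => foldG_of_le hδ hx) ht
  rcases le_abs.1 ht with h | h
  · exact hpos t h
  · have h1 : (fun x => foldG K δ (-x)) = fun x => -foldG K δ x := funext (foldG_neg K δ)
    have h2 := deriv_comp_neg (foldG K δ) t
    rw [h1, hpos (-t) h, deriv.fun_neg] at h2
    linarith

theorem deriv_smoothTransition_pos {x : ℝ} (h0 : 0 < x) (h1 : x < 1) :
    0 < deriv smoothTransition x := by
  refine lt_of_lt_of_le (mul_pos (smoothTransition.pos_of_pos h0) ?_)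
    (smoothTransition_mul_le_deriv x)
  rw [← smoothTransition_one_sub]
  exact smoothTransition.pos_of_pos (by linarith)

theorem deriv_foldG_neg {K δ t : ℝ} (hK : 0 < K) (hδ : 0 < δ) (ht : |t| < δ) :
    deriv (foldG K δ) t < 0 := by
  have h1 : HasDerivAt (fun t : ℝ => (t / δ + 1) / 2) (1 / δ / 2) t :=
    (((hasDerivAt_id t).div_const δ).add_const 1).div_const 2
  have h2 : HasDerivAt smoothTransition (deriv smoothTransition ((t / δ + 1) / 2))
      ((t / δ + 1) / 2) :=
    (smoothTransition.contDiffAt (n := 1)).differentiableAt (by simp) |>.hasDerivAt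
  have h3 : HasDerivAt (foldG K δ)
      (-K * (2 * (deriv smoothTransition ((t / δ + 1) / 2) * (1 / δ / 2)))) t :=
    ((((h2.comp t h1)).const_mul 2).sub_const 1).const_mul (-K)
  rw [h3.deriv]
  rw [abs_lt] at ht
  have h4 : -1 < t / δ := by rw [lt_div_iff₀ hδ]; linarith [ht.1]
  have h5 : t / δ < 1 := by rw [div_lt_one hδ]; exact ht.2
  have h6 := deriv_smoothTransition_pos (x := (t / δ + 1) / 2) (by linarith) (by linarith)
  have h7 : 0 < 2 * (deriv smoothTransition ((t / δ + 1) / 2) * (1 / δ / 2)) := by positivity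
  nlinarith

theorem mul_foldG_nonpos {K δ : ℝ} (hK : 0 < K) (hδ : 0 < δ) (t : ℝ) : t * foldG K δ t ≤ 0 := by
  have hpos : ∀ t, 0 ≤ t → foldG K δ t ≤ 0 := by
    intro t ht
    have h1 : smoothTransition (1 / 2) ≤ smoothTransition ((t / δ + 1) / 2) := by
      refine smoothTransition.monotone ?_
      have : 0 ≤ t / δ := by positivity
      linarith
    have h2 := smoothTransition_one_sub (1 / 2)
    norm_num at h2
    rw [foldG]
    norm_num at h1
    nlinarith
  rcases le_total 0 t with h | h
  · nlinarith [hpos t h]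
  · have := hpos (-t) (by linarith)
    rw [foldG_neg] at this
    nlinarith

theorem foldF_pos {C t : ℝ} (hC : 1 < C) (ht : |t| ≤ 1) : 0 < foldF C t := by
  have : t ^ 2 ≤ 1 := by rw [← sq_abs]; nlinarith [abs_nonneg t]
  rw [foldF]
  linarith

/-- The summand `f'g = -2 t g(t)` is nonnegative because `g` has the sign opposite to `t`, and `-f
g'` is positive because `g` is strictly decreasing on `(-δ, δ)`. -/
theorem wronskian_pos {C K δ t : ℝ} (hC : 1 < C) (hK : 0 < K) (hδ : 0 < δ) (hδ1 : δ ≤ 1)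
    (ht : |t| < δ) :
    0 < deriv (foldF C) t * foldG K δ t - foldF C t * deriv (foldG K δ) t := by
  have h1 := foldF_pos hC (ht.le.trans hδ1)
  have h2 := deriv_foldG_neg hK hδ ht
  have h3 := mul_foldG_nonpos hK hδ t
  rw [deriv_foldF]
  nlinarith

theorem cut_mem (δ t : ℝ) : cut δ t ∈ Icc (0 : ℝ) 1 :=
  ⟨smoothTransition.nonneg _, smoothTransition.le_one _⟩

theorem cut_of_le {δ t : ℝ} (hδ : 0 < δ) (ht : t ≤ δ) : cut δ t = 0 := by
  have : t / δ ≤ 1 := (div_le_one hδ).2 ht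
  exact smoothTransition.zero_of_nonpos (by linarith)

theorem cut_of_ge {δ t : ℝ} (hδ : 0 < δ) (ht : 2 * δ ≤ t) : cut δ t = 1 := by
  have : 2 ≤ t / δ := (le_div_iff₀ hδ).2 ht
  exact smoothTransition.one_of_one_le (by linarith)

theorem deriv_cut (δ t : ℝ) : deriv (cut δ) t = deriv smoothTransition (t / δ - 1) * (1 / δ) := by
  have h1 : HasDerivAt (fun t : ℝ => t / δ - 1) (1 / δ) t :=
    ((hasDerivAt_id t).div_const δ).sub_const 1
  have h2 : HasDerivAt smoothTransition (deriv smoothTransition (t / δ - 1)) (t / δ - 1) :=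
    (smoothTransition.contDiffAt (n := 1)).differentiableAt (by simp) |>.hasDerivAt
  exact (h2.comp t h1).deriv

theorem deriv_cut_nonneg {δ : ℝ} (hδ : 0 < δ) (t : ℝ) : 0 ≤ deriv (cut δ) t := by
  rw [deriv_cut]
  have : 0 ≤ deriv smoothTransition (t / δ - 1) := smoothTransition.monotone.deriv_nonneg
  positivity

/-- After rescaling, `ρ' ≥ ρ (1 - ρ) / δ`. As long as `ρ < 1 - 1/L` the factor `(1 - ρ) / δ` exceeds
`1 / (L δ)`, which is at least `L`. -/
theorem cut_dichotomy {δ L : ℝ} (hδ : 0 < δ) (hL : 0 < L) (hLδ : L ^ 2 * δ ≤ 1) (t : ℝ) :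
    L * cut δ t ≤ deriv (cut δ) t ∨ 1 - L⁻¹ ≤ cut δ t := by
  rcases le_or_gt (1 - L⁻¹) (cut δ t) with h | h
  · exact Or.inr h
  · refine Or.inl ?_
    have h0 := (cut_mem δ t).1
    have h1 : cut δ t * (1 - cut δ t) ≤ deriv smoothTransition (t / δ - 1) :=
      smoothTransition_mul_le_deriv _
    rw [deriv_cut, mul_one_div, le_div_iff₀ hδ]
    refine le_trans ?_ h1
    have h2 : L * δ ≤ 1 - cut δ t := by
      have : L * δ ≤ L⁻¹ := by
        rw [← one_div, le_div_iff₀ hL]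
        linarith
      linarith
    nlinarith

end Profile

/-! ### The glued form on the two-sided collar. -/

section GlueForm

set_option linter.unusedSectionVars false

open Filter

variable {E : Type*} [NormedAddCommGroup E] [NormedSpace ℝ E]
  {H : Type*} [TopologicalSpace H] {I : ModelWithCorners ℝ E H}
  {M : Type*} [TopologicalSpace M] [ChartedSpace H M] [IsManifold I ∞ M]

/-- The interpolation between `f α` and `γ` on one side of the fold. -/
def sideForm (α : DForm I M 1) (γ : DForm (I.prod 𝓘(ℝ, ℝ)) (M × ℝ) 1) (C δ : ℝ) :
    DForm (I.prod 𝓘(ℝ, ℝ)) (M × ℝ) 1 :=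
  combForm α γ (fun t => (1 - cut δ t) * foldF C t) (cut δ)

theorem contDiff_sideCoeff (C δ : ℝ) : ContDiff ℝ ∞ (fun t => (1 - cut δ t) * foldF C t) :=
  (contDiff_const.sub (contDiff_cut δ)).mul (contDiff_foldF C)

theorem deriv_sideCoeff (C δ t : ℝ) : deriv (fun t => (1 - cut δ t) * foldF C t) t =
    -deriv (cut δ) t * foldF C t - (1 - cut δ t) * (2 * t) := by
  have h1 : HasDerivAt (cut δ) (deriv (cut δ) t) t :=
    ((contDiff_cut δ).differentiable (by simp) t).hasDerivAt
  have h2 : HasDerivAt (foldF C) (deriv (foldF C) t) t :=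
    ((contDiff_foldF C).differentiable (by simp) t).hasDerivAt
  have := ((h1.const_sub 1).mul h2).deriv
  rw [deriv_foldF] at this
  exact this.trans (by ring)

theorem smoothAt_sideForm {α : DForm I M 1} {γ : DForm (I.prod 𝓘(ℝ, ℝ)) (M × ℝ) 1} (C δ : ℝ)
    {p : M × ℝ} (hα : SmoothAt α p.1) (hγ : SmoothAt γ p) : SmoothAt (sideForm α γ C δ) p :=
  smoothAt_combForm (contDiff_sideCoeff C δ) (contDiff_cut δ) hα hγ

theorem fval_extD_sideForm {α : DForm I M 1} {γ : DForm (I.prod 𝓘(ℝ, ℝ)) (M × ℝ) 1} (C δ : ℝ)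
    {p : M × ℝ} (hα : SmoothAt α p.1) (hγ : SmoothAt γ p) (v w : E × ℝ) :
    fval (extD (I.prod 𝓘(ℝ, ℝ)) (sideForm α γ C δ)) p ![v, w] =
      interpTwo (fval α p.1) (fval (extD I α) p.1) (fval γ p) (fval (extD (I.prod 𝓘(ℝ, ℝ)) γ) p)
        (C - p.2 ^ 2) (2 * p.2) (cut δ p.2) (deriv (cut δ) p.2) v w := by
  rw [sideForm, fval_extD_combForm (contDiff_sideCoeff C δ) (contDiff_cut δ) hα hγ,
    deriv_sideCoeff, interpTwo, foldF]
  ring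

/-- The forms on the two sides of the fold. -/
def glueForm (α : DForm I M 1) (γ₁ γ₂ : DForm (I.prod 𝓘(ℝ, ℝ)) (M × ℝ) 1) (C K δ : ℝ) :
    DForm (I.prod (𝓘(ℝ, ℝ).prod 𝓘(ℝ, ℝ))) (M × ℝ × ℝ) 1 := fun p =>
  if p.2.1 ≤ 0 then totalForm (-1) (sideForm α γ₁ C δ) (foldG K δ) p
  else totalForm 1 (sideForm α γ₂ C δ) (foldG K δ) p

variable {α : DForm I M 1} {γ₁ γ₂ : DForm (I.prod 𝓘(ℝ, ℝ)) (M × ℝ) 1} {C K δ : ℝ}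

theorem fval_glueForm_of_nonpos {p : M × ℝ × ℝ} (hp : p.2.1 ≤ 0) :
    fval (glueForm α γ₁ γ₂ C K δ) p =
      fval (totalForm (-1) (sideForm α γ₁ C δ) (foldG K δ)) p := by
  rw [fval, glueForm, if_pos hp]
  rfl

theorem fval_glueForm_of_pos {p : M × ℝ × ℝ} (hp : 0 < p.2.1) :
    fval (glueForm α γ₁ γ₂ C K δ) p =
      fval (totalForm 1 (sideForm α γ₂ C δ) (foldG K δ)) p := by
  rw [fval, glueForm, if_neg (not_le.2 hp)]
  rfl

/-- The form `f α + g ds`. -/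
def foldForm (α : DForm I M 1) (f g : ℝ → ℝ) :
    DForm (I.prod (𝓘(ℝ, ℝ).prod 𝓘(ℝ, ℝ))) (M × ℝ × ℝ) 1 :=
  totalForm 1 (combForm α (fun _ => 0) f (fun _ => 0)) g

theorem fval_foldForm (f g : ℝ → ℝ) (p : M × ℝ × ℝ) (v : E × ℝ × ℝ) :
    fval (foldForm α f g) p ![v] = f p.2.1 * fval α p.1 ![v.1] + g p.2.1 * v.2.2 := by
  rw [foldForm, fval_totalForm, fval_combForm]
  simp

theorem smoothAt_foldForm {f g : ℝ → ℝ} (hf : ContDiff ℝ ∞ f) (hg : ContDiff ℝ ∞ g)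
    (hα : ∀ y, SmoothAt α y) (p : M × ℝ × ℝ) : SmoothAt (foldForm α f g) p :=
  smoothAt_totalForm hg (smoothAt_combForm hf contDiff_const (hα _) (smoothAt_zero _))

theorem fval_extD_foldForm {f g : ℝ → ℝ} (hf : ContDiff ℝ ∞ f) (hg : ContDiff ℝ ∞ g)
    (hα : ∀ y, SmoothAt α y) (p : M × ℝ × ℝ) (v w : E × ℝ × ℝ) :
    fval (extD (I.prod (𝓘(ℝ, ℝ).prod 𝓘(ℝ, ℝ))) (foldForm α f g)) p ![v, w] =
      deriv f p.2.1 * (v.2.1 * fval α p.1 ![w.1] - w.2.1 * fval α p.1 ![v.1]) +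
        f p.2.1 * fval (extD I α) p.1 ![v.1, w.1] +
      deriv g p.2.1 * (v.2.1 * w.2.2 - w.2.1 * v.2.2) := by
  rw [foldForm, fval_extD_totalForm hg
    (smoothAt_combForm hf contDiff_const (hα _) (smoothAt_zero _)),
    fval_extD_combForm hf contDiff_const (hα _) (smoothAt_zero _)]
  simp

theorem fval_glueForm_of_lt (hδ : 0 < δ) {p : M × ℝ × ℝ} (hp : |p.2.1| < δ) :
    fval (glueForm α γ₁ γ₂ C K δ) p = fval (foldForm α (foldF C) (foldG K δ)) p := by
  rw [abs_lt] at hp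
  refine one_ext fun v => ?_
  rw [fval_foldForm]
  by_cases h : p.2.1 ≤ 0
  · rw [fval_glueForm_of_nonpos h, fval_totalForm, sideForm, fval_combForm]
    dsimp only
    rw [cut_of_le hδ (by linarith), foldF, foldF]
    ring
  · rw [fval_glueForm_of_pos (not_le.1 h), fval_totalForm, sideForm, fval_combForm]
    dsimp only
    rw [cut_of_le hδ (by linarith), foldF, foldF]
    ring

theorem fval_glueForm_add (p : M × ℝ × ℝ) (s : ℝ) :
    fval (glueForm α γ₁ γ₂ C K δ) (p.1, p.2.1, p.2.2 + s) = fval (glueForm α γ₁ γ₂ C K δ) p := by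
  refine one_ext fun v => ?_
  by_cases h : p.2.1 ≤ 0
  · rw [fval_glueForm_of_nonpos (p := p) h,
      fval_glueForm_of_nonpos (p := (p.1, p.2.1, p.2.2 + s)) h, fval_totalForm, fval_totalForm]
  · rw [fval_glueForm_of_pos (p := p) (not_le.1 h),
      fval_glueForm_of_pos (p := (p.1, p.2.1, p.2.2 + s)) (not_le.1 h), fval_totalForm,
      fval_totalForm]

/-- The conditions on one side of the fold, up to the distance `r` from it. -/
structure GoodSide (α : DForm I M 1) (γ : DForm (I.prod 𝓘(ℝ, ℝ)) (M × ℝ) 1) (C δ r : ℝ) :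
    Prop where
  smooth : ∀ y, ∀ t ∈ Ioo 0 r, SmoothAt (sideForm α γ C δ) (y, t)
  nondegenerate : ∀ y, ∀ t ∈ Ioo 0 r, ∀ v,
    (∀ w, fval (extD (I.prod 𝓘(ℝ, ℝ)) (sideForm α γ C δ)) (y, t) ![v, w] = 0) → v = 0

/-- Off the fold, `dζ` is nondegenerate on the level sets of `s`. -/
def FiberNondeg (Ω : (E × ℝ × ℝ) [⋀^Fin 2]→L[ℝ] ℝ) : Prop :=
  ∀ v : E × ℝ × ℝ, v.2.2 = 0 → (∀ w : E × ℝ × ℝ, w.2.2 = 0 → Ω ![v, w] = 0) → v = 0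

/-- The differential is that of `τ` plus `g' dt ∧ ds`. The extra term vanishes on level sets of `s`,
and it vanishes altogether where `g' = 0`, so in both cases nondegeneracy of `dτ` decides. -/
theorem totalForm_props {τ : DForm (I.prod 𝓘(ℝ, ℝ)) (M × ℝ) 1} {ε : ℝ} (hε : ε ≠ 0) {g : ℝ → ℝ}
    (hg : ContDiff ℝ ∞ g) {p : M × ℝ × ℝ} (hτ : SmoothAt τ (p.1, ε * p.2.1))
    (hnd : ∀ v, (∀ w, fval (extD (I.prod 𝓘(ℝ, ℝ)) τ) (p.1, ε * p.2.1) ![v, w] = 0) → v = 0) :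
    FiberNondeg (fval (extD (I.prod (𝓘(ℝ, ℝ).prod 𝓘(ℝ, ℝ))) (totalForm ε τ g)) p) ∧
    (g p.2.1 ≠ 0 → deriv g p.2.1 = 0 → ContactPt (fval (totalForm ε τ g) p)
      (fval (extD (I.prod (𝓘(ℝ, ℝ).prod 𝓘(ℝ, ℝ))) (totalForm ε τ g)) p)) := by
  constructor
  · rintro ⟨x, t, s⟩ hs hw
    have hs' : s = 0 := hs
    subst hs'
    have h1 : ((x, ε * t) : E × ℝ) = 0 := by
      refine hnd _ fun u => ?_
      have h2 := hw (u.1, ε⁻¹ * u.2, 0) rfl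
      rw [fval_extD_totalForm hg hτ] at h2
      dsimp only at h2
      rwa [mul_inv_cancel_left₀ hε, mul_zero, mul_zero, sub_zero, mul_zero, add_zero] at h2
    rw [Prod.mk_eq_zero] at h1
    obtain ⟨rfl, h3⟩ := h1
    have ht : t = 0 := (mul_eq_zero.1 h3).resolve_left hε
    subst ht
    rfl
  · intro h1 h2
    refine contactPt_of_nondegenerate hε h1 (fval_totalForm ε τ g p) (fun v w => ?_) hnd
    rw [fval_extD_totalForm hg hτ, h2]
    ring

/-- Two overlapping descriptions. For `|t| < δ` the cutoff vanishes on both sides, the form is `f α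
+ g ds` across `t = 0`, and the Wronskian criterion applies. For `t ≠ 0` it is the form of one side,
whose differential is nondegenerate on fibers; once `|t| ≥ δ`, `g` is locally a nonzero constant to
first order and this implies contactness. -/
theorem glueForm_props (hα : ∀ y, SmoothAt α y)
    (hcont : ∀ y, ContactPt (fval α y) (fval (extD I α) y)) {r : ℝ}
    (h₁ : GoodSide α γ₁ C δ r) (h₂ : GoodSide α γ₂ C δ r) (hC : 1 < C) (hK : 0 < K) (hδ : 0 < δ)
    (hδ1 : δ ≤ 1) {p : M × ℝ × ℝ} (hp : |p.2.1| < r) :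
    SmoothAt (glueForm α γ₁ γ₂ C K δ) p ∧
    ContactPt (fval (glueForm α γ₁ γ₂ C K δ) p)
      (fval (extD (I.prod (𝓘(ℝ, ℝ).prod 𝓘(ℝ, ℝ))) (glueForm α γ₁ γ₂ C K δ)) p) ∧
    (p.2.1 ≠ 0 → FiberNondeg
      (fval (extD (I.prod (𝓘(ℝ, ℝ).prod 𝓘(ℝ, ℝ))) (glueForm α γ₁ γ₂ C K δ)) p)) := by
  have hcts : ContinuousAt (fun q : M × ℝ × ℝ => q.2.1) p := by fun_prop
  have hside : ∀ {ε : ℝ} {γ : DForm (I.prod 𝓘(ℝ, ℝ)) (M × ℝ) 1} (_ : GoodSide α γ C δ r)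
      (_ : ε ≠ 0) (_ : 0 < ε * p.2.1) (_ : ε * p.2.1 < r)
      (_ : ∀ᶠ q in 𝓝 p, fval (glueForm α γ₁ γ₂ C K δ) q =
        fval (totalForm ε (sideForm α γ C δ) (foldG K δ)) q),
      SmoothAt (glueForm α γ₁ γ₂ C K δ) p ∧
      FiberNondeg
        (fval (extD (I.prod (𝓘(ℝ, ℝ).prod 𝓘(ℝ, ℝ))) (glueForm α γ₁ γ₂ C K δ)) p) ∧
      (δ ≤ |p.2.1| → ContactPt (fval (glueForm α γ₁ γ₂ C K δ) p)
      (fval (extD (I.prod (𝓘(ℝ, ℝ).prod 𝓘(ℝ, ℝ))) (glueForm α γ₁ γ₂ C K δ)) p)) := by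
    intro ε γ hγ hε h0 hr heq
    have hs := hγ.smooth p.1 _ ⟨h0, hr⟩
    have hn := hγ.nondegenerate p.1 _ ⟨h0, hr⟩
    obtain ⟨e1, e2⟩ := totalForm_props hε (contDiff_foldG K δ) hs hn
    refine ⟨(smoothAt_totalForm (contDiff_foldG K δ) hs).congr heq, ?_, fun hd => ?_⟩
    · rwa [fval_extD_congr heq]
    · rw [fval_extD_congr heq, heq.self_of_nhds]
      refine e2 ?_ (deriv_foldG_of_le hδ hd)
      rcases le_abs.1 hd with h | h
      · rw [foldG_of_le hδ h]
        exact neg_ne_zero.2 hK.ne'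
      · rw [foldG_of_le_neg hδ (by linarith)]
        exact hK.ne'
  have hmid : |p.2.1| < δ → SmoothAt (glueForm α γ₁ γ₂ C K δ) p ∧
      ContactPt (fval (glueForm α γ₁ γ₂ C K δ) p)
      (fval (extD (I.prod (𝓘(ℝ, ℝ).prod 𝓘(ℝ, ℝ))) (glueForm α γ₁ γ₂ C K δ)) p) := by
    intro hlt
    have heq : ∀ᶠ q in 𝓝 p, fval (glueForm α γ₁ γ₂ C K δ) q =
        fval (foldForm α (foldF C) (foldG K δ)) q := by
      filter_upwards [hcts.abs.eventually (Iio_mem_nhds hlt)] with q hq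
      exact fval_glueForm_of_lt hδ hq
    refine ⟨(smoothAt_foldForm (contDiff_foldF C) (contDiff_foldG K δ) hα p).congr heq, ?_⟩
    rw [fval_extD_congr heq, heq.self_of_nhds]
    exact contactPt_of_wronskian (foldF_pos hC (hlt.le.trans hδ1)).ne'
      (wronskian_pos hC hK hδ hδ1 hlt).ne' (hcont p.1) (fval_foldForm _ _ p)
      (fval_extD_foldForm (contDiff_foldF C) (contDiff_foldG K δ) hα p)
  rcases lt_trichotomy p.2.1 0 with h | h | h
  · have heq : ∀ᶠ q in 𝓝 p, fval (glueForm α γ₁ γ₂ C K δ) q =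
        fval (totalForm (-1) (sideForm α γ₁ C δ) (foldG K δ)) q := by
      filter_upwards [hcts.eventually (Iio_mem_nhds h)] with q hq
      exact fval_glueForm_of_nonpos (le_of_lt hq)
    obtain ⟨a1, a2, a3⟩ := hside h₁ (by norm_num) (by linarith)
      (by rw [abs_of_neg h] at hp; linarith) heq
    exact ⟨a1, (lt_or_ge |p.2.1| δ).elim (fun h => (hmid h).2) a3, fun _ => a2⟩
  · have hlt : |p.2.1| < δ := by rw [h, abs_zero]; exact hδ
    exact ⟨(hmid hlt).1, (hmid hlt).2, fun h' => absurd h h'⟩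
  · have heq : ∀ᶠ q in 𝓝 p, fval (glueForm α γ₁ γ₂ C K δ) q =
        fval (totalForm 1 (sideForm α γ₂ C δ) (foldG K δ)) q := by
      filter_upwards [hcts.eventually (Ioi_mem_nhds h)] with q hq
      exact fval_glueForm_of_pos hq
    obtain ⟨a1, a2, a3⟩ := hside h₂ (by norm_num) (by linarith)
      (by rw [abs_of_pos h] at hp; linarith) heq
    exact ⟨a1, (lt_or_ge |p.2.1| δ).elim (fun h => (hmid h).2) a3, fun _ => a2⟩

end GlueForm

/-! ### The equivalence relation of the folded sum. -/

section Quotient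

variable {S₁ S₂ Y : Type*} {φ₁ : Equiv.Perm S₁} {φ₂ : Equiv.Perm S₂} {j₁ : Y → S₁} {j₂ : Y → S₂}

/-- An explicit description of the equivalence relation that defines the folded sum. -/
def SumEqv (φ₁ : Equiv.Perm S₁) (φ₂ : Equiv.Perm S₂) (j₁ : Y → S₁) (j₂ : Y → S₂) :
    (S₁ × ℝ) ⊕ (S₂ × ℝ) → (S₁ × ℝ) ⊕ (S₂ × ℝ) → Prop
  | .inl p, .inl q => ∃ k : ℤ, q.1 = (φ₁ ^ k) p.1 ∧ q.2 = p.2 + k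
  | .inl p, .inr q => ∃ (y : Y) (k : ℤ), p.1 = j₁ y ∧ q.1 = j₂ y ∧ q.2 = p.2 + k
  | .inr p, .inl q => ∃ (y : Y) (k : ℤ), p.1 = j₂ y ∧ q.1 = j₁ y ∧ q.2 = p.2 + k
  | .inr p, .inr q => ∃ k : ℤ, q.1 = (φ₂ ^ k) p.1 ∧ q.2 = p.2 + k

theorem perm_zpow_fixed {S : Type*} {φ : Equiv.Perm S} {x : S} (hx : φ x = x) (k : ℤ) :
    (φ ^ k) x = x := by
  have h : φ ∈ MulAction.stabilizer (Equiv.Perm S) x := hx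
  exact (MulAction.stabilizer (Equiv.Perm S) x).zpow_mem h k

theorem shift_iff {S : Type*} {φ : Equiv.Perm S} {x x' : S} {t t' : ℝ} :
    (∃ k : ℤ, x' = (φ ^ k) x ∧ t' = t + k) ↔
      ∃ k : ℤ, x' = (φ ^ k) (φ x) ∧ t' = t + 1 + k := by
  constructor
  · rintro ⟨k, h, h'⟩
    refine ⟨k - 1, ?_, ?_⟩
    · rw [h, ← Equiv.Perm.mul_apply, ← zpow_add_one, sub_add_cancel]
    · rw [h']; push_cast; ring
  · rintro ⟨k, h, h'⟩
    refine ⟨k + 1, ?_, ?_⟩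
    · rw [h, zpow_add_one, Equiv.Perm.mul_apply]
    · rw [h']; push_cast; ring

theorem glue_shift_iff {S S' : Type*} {φ : Equiv.Perm S} {j : Y → S} {j' : Y → S'}
    (hj : ∀ y, φ (j y) = j y) {x : S} {x' : S'} {t t' : ℝ} :
    (∃ (y : Y) (k : ℤ), x = j y ∧ x' = j' y ∧ t' = t + k) ↔
      ∃ (y : Y) (k : ℤ), φ x = j y ∧ x' = j' y ∧ t' = t + 1 + k := by
  constructor
  · rintro ⟨y, k, rfl, rfl, rfl⟩
    exact ⟨y, k - 1, hj y, rfl, by push_cast; ring⟩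
  · rintro ⟨y, k, h, rfl, rfl⟩
    refine ⟨y, k + 1, φ.injective (h.trans (hj y).symm), rfl, by push_cast; ring⟩

theorem glue_pow_iff {S S' : Type*} {φ : Equiv.Perm S} {j : Y → S} {j' : Y → S'}
    (hj : ∀ y, φ (j y) = j y) (hj' : Function.Injective j') {y : Y} {x : S} {t t' : ℝ} :
    (∃ k : ℤ, x = (φ ^ k) (j y) ∧ t' = t + k) ↔
      ∃ (z : Y) (k : ℤ), j' y = j' z ∧ x = j z ∧ t' = t + k := by
  constructor
  · rintro ⟨k, h, h'⟩
    exact ⟨y, k, rfl, by rw [h, perm_zpow_fixed (hj y)], h'⟩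
  · rintro ⟨z, k, h, h', h''⟩
    rw [← hj' h] at h'
    exact ⟨k, by rw [perm_zpow_fixed (hj y), h'], h''⟩

/-- Boundary points are fixed by the monodromies, so the gluing along `Y` commutes with the shifts,
and injectivity of `j₁`, `j₂` prevents it from creating further identifications on one side. -/
theorem sumEqv_iff_of_rel (hj₁ : Function.Injective j₁) (hj₂ : Function.Injective j₂)
    (hφ₁ : ∀ y, φ₁ (j₁ y) = j₁ y) (hφ₂ : ∀ y, φ₂ (j₂ y) = j₂ y)
    {a b : (S₁ × ℝ) ⊕ (S₂ × ℝ)} (h : FoldedSumRel φ₁ φ₂ j₁ j₂ a b)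
    (c : (S₁ × ℝ) ⊕ (S₂ × ℝ)) : SumEqv φ₁ φ₂ j₁ j₂ a c ↔ SumEqv φ₁ φ₂ j₁ j₂ b c := by
  rcases h with ⟨x, t⟩ | ⟨x, t⟩ | ⟨y, t⟩ <;> rcases c with ⟨x', t'⟩ | ⟨x', t'⟩
  · exact shift_iff
  · exact glue_shift_iff hφ₁
  · exact glue_shift_iff hφ₂
  · exact shift_iff
  · exact glue_pow_iff hφ₁ hj₂
  · exact (glue_pow_iff hφ₂ hj₁).symm

/-- The set of points related to `a` depends only on the class of `a` and contains `a`. This yields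
the description of the classes without a proof that `SumEqv` is transitive. -/
theorem sumEqv_of_mk_eq (hj₁ : Function.Injective j₁) (hj₂ : Function.Injective j₂)
    (hφ₁ : ∀ y, φ₁ (j₁ y) = j₁ y) (hφ₂ : ∀ y, φ₂ (j₂ y) = j₂ y)
    {a b : (S₁ × ℝ) ⊕ (S₂ × ℝ)}
    (h : Quot.mk (FoldedSumRel φ₁ φ₂ j₁ j₂) a = Quot.mk (FoldedSumRel φ₁ φ₂ j₁ j₂) b) :
    SumEqv φ₁ φ₂ j₁ j₂ a b := by
  let F : Quot (FoldedSumRel φ₁ φ₂ j₁ j₂) → Set ((S₁ × ℝ) ⊕ (S₂ × ℝ)) :=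
    Quot.lift (fun a => {c | SumEqv φ₁ φ₂ j₁ j₂ a c})
      fun a b hab => Set.ext fun c => sumEqv_iff_of_rel hj₁ hj₂ hφ₁ hφ₂ hab c
  have h1 : F (Quot.mk _ a) = F (Quot.mk _ b) := congrArg F h
  have h2 : b ∈ F (Quot.mk _ b) := by
    rcases b with b | b
    · exact ⟨0, by simp, by simp⟩
    · exact ⟨0, by simp, by simp⟩
  rw [← h1] at h2
  exact h2

end Quotient

/-! ### Deck transformations act trivially on the quotient. -/

section Deck

variable {S₁ S₂ Y : Type*} {φ₁ : Equiv.Perm S₁} {φ₂ : Equiv.Perm S₂} {j₁ : Y → S₁} {j₂ : Y → S₂}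

theorem incl₁_deck (k : ℤ) (x : S₁) (t : ℝ) :
    FoldedSum.incl₁ φ₁ φ₂ j₁ j₂ ((φ₁ ^ k) x, t + k) = FoldedSum.incl₁ φ₁ φ₂ j₁ j₂ (x, t) := by
  have step : ∀ x t, FoldedSum.incl₁ φ₁ φ₂ j₁ j₂ (φ₁ x, t + 1) =
      FoldedSum.incl₁ φ₁ φ₂ j₁ j₂ (x, t) := fun x t =>
    (Quot.sound (FoldedSumRel.monodromy₁ x t)).symm
  induction k using Int.induction_on generalizing x t with
  | zero => simp
  | succ k ih =>
    rw [zpow_add_one, Equiv.Perm.mul_apply, ← step x t, ← ih (φ₁ x) (t + 1)]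
    congr 2
    push_cast
    ring
  | pred k ih =>
    have h1 := step ((φ₁⁻¹) x) (t - 1)
    rw [show φ₁ (φ₁⁻¹ x) = x from φ₁.apply_symm_apply x, sub_add_cancel] at h1
    rw [zpow_sub_one, Equiv.Perm.mul_apply, h1, ← ih (φ₁⁻¹ x) (t - 1)]
    congr 2
    push_cast
    ring

theorem incl₂_deck (k : ℤ) (x : S₂) (t : ℝ) :
    FoldedSum.incl₂ φ₁ φ₂ j₁ j₂ ((φ₂ ^ k) x, t + k) = FoldedSum.incl₂ φ₁ φ₂ j₁ j₂ (x, t) := by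
  have step : ∀ x t, FoldedSum.incl₂ φ₁ φ₂ j₁ j₂ (φ₂ x, t + 1) =
      FoldedSum.incl₂ φ₁ φ₂ j₁ j₂ (x, t) := fun x t =>
    (Quot.sound (FoldedSumRel.monodromy₂ x t)).symm
  induction k using Int.induction_on generalizing x t with
  | zero => simp
  | succ k ih =>
    rw [zpow_add_one, Equiv.Perm.mul_apply, ← step x t, ← ih (φ₂ x) (t + 1)]
    congr 2
    push_cast
    ring
  | pred k ih =>
    have h1 := step ((φ₂⁻¹) x) (t - 1)
    rw [show φ₂ (φ₂⁻¹ x) = x from φ₂.apply_symm_apply x, sub_add_cancel] at h1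
    rw [zpow_sub_one, Equiv.Perm.mul_apply, h1, ← ih (φ₂⁻¹ x) (t - 1)]
    congr 2
    push_cast
    ring

theorem incl_glue (y : Y) (t : ℝ) :
    FoldedSum.incl₁ φ₁ φ₂ j₁ j₂ (j₁ y, t) = FoldedSum.incl₂ φ₁ φ₂ j₁ j₂ (j₂ y, t) :=
  Quot.sound (FoldedSumRel.glue y t)

end Deck

/-! ### Pushing covectors forward under local diffeomorphisms. -/

section Compat

variable {E : Type*} [NormedAddCommGroup E] [NormedSpace ℝ E]
  {H : Type*} [TopologicalSpace H] {I : ModelWithCorners ℝ E H}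
  {M : Type*} [TopologicalSpace M] [ChartedSpace H M]
  {E' : Type*} [NormedAddCommGroup E'] [NormedSpace ℝ E']
  {H' : Type*} [TopologicalSpace H'] {I' : ModelWithCorners ℝ E' H'}
  {N : Type*} [TopologicalSpace N] [ChartedSpace H' N]
  {E'' : Type*} [NormedAddCommGroup E''] [NormedSpace ℝ E'']
  {H'' : Type*} [TopologicalSpace H''] {I'' : ModelWithCorners ℝ E'' H''}
  {P : Type*} [TopologicalSpace P] [ChartedSpace H'' P]

theorem comp_injective_of_surjective {k : ℕ} {L : E' →L[ℝ] E} (hL : Function.Surjective L)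
    {a b : E [⋀^Fin k]→L[ℝ] ℝ}
    (h : a.compContinuousLinearMap L = b.compContinuousLinearMap L) : a = b := by
  ext v
  choose u hu using fun i => hL (v i)
  have h1 := DFunLike.congr_fun h u
  rw [ContinuousAlternatingMap.compContinuousLinearMap_apply,
    ContinuousAlternatingMap.compContinuousLinearMap_apply] at h1
  have h2 : (L ∘ u : Fin k → E) = v := funext hu
  rw [h2] at h1
  exact h1

/-- Two local diffeomorphisms that differ by a map `T` push corresponding forms to the same form. -/
theorem push_iff {Ψ : N → M} {Ψ' : P → M} {T : N → P} {p : N}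
    (hΨ : IsLocalDiffeomorphAt I' I ∞ Ψ p) (hΨ' : IsLocalDiffeomorphAt I'' I ∞ Ψ' (T p))
    (hT : MDifferentiableAt I' I'' T p) (hcomp : Ψ =ᶠ[𝓝 p] Ψ' ∘ T)
    {a : E' [⋀^Fin 1]→L[ℝ] ℝ} {a' : E'' [⋀^Fin 1]→L[ℝ] ℝ}
    (ha : a = a'.compContinuousLinearMap (tder I' I'' T p)) (η : E [⋀^Fin 1]→L[ℝ] ℝ) :
    η.compContinuousLinearMap (tder I' I Ψ p) = a ↔
      η.compContinuousLinearMap (tder I'' I Ψ' (T p)) = a' := by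
  have h1 : tder I' I Ψ p = tder I'' I Ψ' (T p) ∘L tder I' I'' T p := by
    rw [tder_congr hcomp, tder_comp (hΨ'.contMDiffAt.mdifferentiableAt (by simp)) hT]
  -- `T` is not assumed to be a local diffeomorphism; surjectivity of its derivative follows from
  -- the bijectivity of the other two derivatives.
  have hsurj : Function.Surjective (tder I' I'' T p) := by
    intro u
    obtain ⟨v, hv⟩ := hΨ.tder_bijective.2 (tder I'' I Ψ' (T p) u)
    rw [h1] at hv
    exact ⟨v, hΨ'.tder_bijective.1 hv⟩
  have h2 : η.compContinuousLinearMap (tder I' I Ψ p) =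
      (η.compContinuousLinearMap (tder I'' I Ψ' (T p))).compContinuousLinearMap
        (tder I' I'' T p) := by
    rw [h1]
    rfl
  rw [h2, ha]
  exact ⟨comp_injective_of_surjective hsurj, fun h => by rw [h]⟩

theorem exists_push {Ψ : N → M} {p : N} (hΨ : IsLocalDiffeomorphAt I' I ∞ Ψ p)
    (a : E' [⋀^Fin 1]→L[ℝ] ℝ) :
    ∃ η : E [⋀^Fin 1]→L[ℝ] ℝ, η.compContinuousLinearMap (tder I' I Ψ p) = a := by
  let e := hΨ.mfderivToContinuousLinearEquiv (by simp)
  let L : E →L[ℝ] E' := e.symm.toContinuousLinearMap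
  refine ⟨a.compContinuousLinearMap L, one_ext fun v => ?_⟩
  rw [comp_apply_one, comp_apply_one]
  congr 2
  have : L (tder I' I Ψ p v) = v := e.symm_apply_apply v
  rw [this]

theorem tder_prodMk_gen {F : N → M} {G : N → P} {x : N} (hF : MDifferentiableAt I' I F x)
    (hG : MDifferentiableAt I' I'' G x) (v : E') :
    tder I' (I.prod I'') (fun y => (F y, G y)) x v = (tder I' I F x v, tder I' I'' G x v) := by
  have := mfderiv_prodMk hF hG
  exact DFunLike.congr_fun this v

end Compat

/-! ### One side: the collar, the far part of the fiber and their overlap. -/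

section SideGluing

set_option linter.unusedSectionVars false

open Filter

variable {n : ℕ} [NeZero n] {S : Type*} [TopologicalSpace S]
  [ChartedSpace (EuclideanHalfSpace (2 * n)) S] [IsManifold (𝓡∂ (2 * n)) ∞ S]
  {Y : Type*} [TopologicalSpace Y] [ChartedSpace (EuclideanSpace ℝ (Fin (2 * n - 1))) Y]
  [IsManifold (𝓡 (2 * n - 1)) ∞ Y] {c : Y × ℝ → S} {β : DForm (𝓡∂ (2 * n)) S 1}
  {φ : S ≃ₘ^∞⟮𝓡∂ (2 * n), 𝓡∂ (2 * n)⟯ S} {a : ℝ → ℝ} {r : ℝ}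

/-- The data of a fiber, its monodromy and its collar; the monodromy is the identity near the
collar of size `r`. -/
structure SideData (β : DForm (𝓡∂ (2 * n)) S 1) (φ : S ≃ₘ^∞⟮𝓡∂ (2 * n), 𝓡∂ (2 * n)⟯ S)
    (c : Y × ℝ → S) (a : ℝ → ℝ) (r : ℝ) : Prop where
  smooth : ∀ x, SmoothAt β x
  preserves : ∀ k, PreservesD β (dpow φ k)
  isCollar : IsCollar n c
  weight : IsPeriodicWeight a
  pos : 0 < r
  le_one : r ≤ 1
  fixed : ∀ y, ∀ t ∈ Ico 0 r, ∀ᶠ x in 𝓝 (c (y, t)), φ x = x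

theorem SideData.apply_eq (h : SideData β φ c a r) {y : Y} {t : ℝ} (ht : t ∈ Ico 0 r) :
    φ (c (y, t)) = c (y, t) := (h.fixed y t ht).self_of_nhds

theorem SideData.dpow_eq (h : SideData β φ c a r) {y : Y} {t : ℝ} (ht : t ∈ Ico 0 r) (k : ℤ) :
    dpow φ k (c (y, t)) = c (y, t) := dpow_eq_self (h.apply_eq ht) k

theorem SideData.collar_inj (h : SideData β φ c a r) {y y' : Y} {t t' : ℝ} (ht : t ∈ Ico 0 r)
    (ht' : t' ∈ Ico 0 r) (heq : c (y, t) = c (y', t')) : y = y' ∧ t = t' :=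
  Prod.mk.inj (h.isCollar.injOn ⟨mem_univ _, ht.1, ht.2.trans_le h.le_one⟩
    ⟨mem_univ _, ht'.1, ht'.2.trans_le h.le_one⟩ heq)

theorem SideData.zero_mem (h : SideData β φ c a r) : (0 : ℝ) ∈ Ico 0 r := ⟨le_rfl, h.pos⟩

theorem SideData.injective_zero (h : SideData β φ c a r) :
    Function.Injective fun y => c (y, (0 : ℝ)) :=
  fun _ _ heq => (h.collar_inj h.zero_mem h.zero_mem heq).1

/-- The complement of the closed collar of size `2δ`. -/
def farSet (c : Y × ℝ → S) (δ : ℝ) : Set S := (c '' (univ ×ˢ Icc 0 (2 * δ)))ᶜ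

theorem isOpen_farSet [CompactSpace Y] [T2Space S] (hc : IsCollar n c) {δ : ℝ} (hδ : 2 * δ < 1) :
    IsOpen (farSet c δ) := by
  refine (IsCompact.isClosed ?_).isOpen_compl
  refine (isCompact_univ.prod isCompact_Icc).image_of_continuousOn
    (hc.smooth.continuousOn.mono ?_)
  exact prod_mono subset_rfl fun t ht => ⟨ht.1, ht.2.trans_lt hδ⟩

theorem interior_of_notMem (hc : IsCollar n c) {x : S} (hx : ∀ y, x ≠ c (y, 0)) :
    x ∈ (𝓡∂ (2 * n)).interior S := by
  rw [← ModelWithCorners.compl_boundary, ← hc.boundary_eq]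
  rintro ⟨y, hy⟩
  exact hx y hy.symm

theorem farSet_ne (c : Y × ℝ → S) {δ : ℝ} (hδ : 0 < δ) {x : S} (hx : x ∈ farSet c δ) (y : Y) :
    x ≠ c (y, 0) := by
  rintro rfl
  exact hx ⟨(y, 0), ⟨mem_univ _, le_rfl, by positivity⟩, rfl⟩

theorem farSet_interior (hc : IsCollar n c) {δ : ℝ} (hδ : 0 < δ) {x : S} (hx : x ∈ farSet c δ) :
    x ∈ (𝓡∂ (2 * n)).interior S :=
  interior_of_notMem hc (farSet_ne c hδ hx)

/-- The map `(y, t, s) ↦ (c(y, ε t), s + k)`. -/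
def sideMap (c : Y × ℝ → S) (ε : ℝ) (k : ℤ) (q : Y × ℝ × ℝ) : S × ℝ :=
  (c (sideProj ε q), q.2.2 + k)

theorem SideData.contMDiffAt_collar_sideProj (h : SideData β φ c a r) {ε : ℝ} {p : Y × ℝ × ℝ}
    (hp : ε * p.2.1 ∈ Ioo 0 r) :
    ContMDiffAt ((𝓡 (2 * n - 1)).prod (𝓘(ℝ, ℝ).prod 𝓘(ℝ, ℝ))) (𝓡∂ (2 * n)) ∞
      (fun q => c (sideProj ε q)) p :=
  (contMDiffAt_collar h.isCollar p.1 ⟨hp.1, hp.2.trans_le h.le_one⟩).comp p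
    (contMDiff_sideProj ε).contMDiffAt

theorem contMDiff_snd_snd_add (k : ℤ) :
    ContMDiff ((𝓡 (2 * n - 1)).prod (𝓘(ℝ, ℝ).prod 𝓘(ℝ, ℝ))) 𝓘(ℝ, ℝ) ∞
      (fun q : Y × ℝ × ℝ => q.2.2 + k) := by
  have : ContDiff ℝ ∞ (fun t : ℝ => t + k) := contDiff_id.add contDiff_const
  exact this.contMDiff.comp contMDiff_snd_snd

theorem tder_snd_snd_add (k : ℤ) (p : Y × ℝ × ℝ)
    (v : EuclideanSpace ℝ (Fin (2 * n - 1)) × ℝ × ℝ) :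
    tder ((𝓡 (2 * n - 1)).prod (𝓘(ℝ, ℝ).prod 𝓘(ℝ, ℝ))) 𝓘(ℝ, ℝ)
      (fun q : Y × ℝ × ℝ => q.2.2 + k) p v = v.2.2 := by
  have hd : DifferentiableAt ℝ (fun t : ℝ => t + k) p.2.2 := by fun_prop
  rw [tder_real_comp (a := fun t : ℝ => t + k) (r := fun q : Y × ℝ × ℝ => q.2.2) hd
    (contMDiff_snd_snd.mdifferentiable (by simp) p), tder_snd_snd]
  simp

theorem SideData.contMDiffAt_sideMap (h : SideData β φ c a r) {ε : ℝ} {p : Y × ℝ × ℝ}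
    (hp : ε * p.2.1 ∈ Ioo 0 r) (k : ℤ) :
    ContMDiffAt ((𝓡 (2 * n - 1)).prod (𝓘(ℝ, ℝ).prod 𝓘(ℝ, ℝ))) ((𝓡∂ (2 * n)).prod 𝓘(ℝ, ℝ)) ∞
      (sideMap c ε k) p :=
  (h.contMDiffAt_collar_sideProj hp).prodMk (contMDiff_snd_snd_add k).contMDiffAt

theorem SideData.tder_sideMap (h : SideData β φ c a r) {ε : ℝ} {p : Y × ℝ × ℝ}
    (hp : ε * p.2.1 ∈ Ioo 0 r) (k : ℤ) (v : EuclideanSpace ℝ (Fin (2 * n - 1)) × ℝ × ℝ) :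
    tder ((𝓡 (2 * n - 1)).prod (𝓘(ℝ, ℝ).prod 𝓘(ℝ, ℝ))) ((𝓡∂ (2 * n)).prod 𝓘(ℝ, ℝ))
      (sideMap c ε k) p v =
      (tder ((𝓡 (2 * n - 1)).prod 𝓘(ℝ, ℝ)) (𝓡∂ (2 * n)) c (p.1, ε * p.2.1) (v.1, ε * v.2.1),
        v.2.2) := by
  have h1 := tder_prodMk_gen (I'' := 𝓘(ℝ, ℝ))
    ((h.contMDiffAt_collar_sideProj hp).mdifferentiableAt (by simp))
    ((contMDiff_snd_snd_add (Y := Y) (n := n) k).mdifferentiable (by simp) p) v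
  have h2 := tder_comp (I'' := 𝓡∂ (2 * n)) (G := c) (F := sideProj ε) (x := p)
    ((contMDiffAt_collar h.isCollar p.1 ⟨hp.1, hp.2.trans_le h.le_one⟩).mdifferentiableAt (by simp))
    ((contMDiff_sideProj (I := 𝓡 (2 * n - 1)) ε).mdifferentiable (by simp) p)
  have h3 := DFunLike.congr_fun h2 v
  rw [ContinuousLinearMap.comp_apply, tder_sideProj] at h3
  rw [tder_snd_snd_add] at h1
  refine h1.trans (Prod.ext ?_ rfl)
  exact h3

/-- Outside the collar of size `2δ` the glued form is a bundle form. -/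
theorem SideData.fval_totalForm_eq (h : SideData β φ c a r) (α : DForm (𝓡 (2 * n - 1)) Y 1)
    {C δ ε κ : ℝ} {g : ℝ → ℝ} (hδ : 0 < δ) {p : Y × ℝ × ℝ} (hp : ε * p.2.1 ∈ Ioo 0 r)
    (hp2 : 2 * δ ≤ ε * p.2.1) (hg : g p.2.1 = κ) (k : ℤ) :
    fval (totalForm ε (sideForm α (colForm c β) C δ) g) p =
      (fval (bundleForm n β φ a κ) (sideMap c ε k p)).compContinuousLinearMap
        (tder ((𝓡 (2 * n - 1)).prod (𝓘(ℝ, ℝ).prod 𝓘(ℝ, ℝ))) ((𝓡∂ (2 * n)).prod 𝓘(ℝ, ℝ))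
          (sideMap c ε k) p) := by
  refine one_ext fun v => ?_
  rw [comp_apply_one, fval_bundleForm_of_id h.preserves h.weight κ
    (h.fixed p.1 _ (Ioo_subset_Ico_self hp)), h.tder_sideMap hp, fval_totalForm, hg, sideForm,
    fval_combForm]
  dsimp only
  -- From distance `2δ` on the cutoff is `1`, so the term in `α` drops out and `c*β + κ ds` remains.
  rw [cut_of_ge hδ hp2, fval_pullback, comp_apply_one]
  simp only [sub_self, zero_mul, one_mul, zero_add]
  rfl

end SideGluing

/-! ### Coincidences between points of the collar and of the two covers. -/

section Gluing

set_option linter.unusedSectionVars false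

open Filter

variable {n : ℕ} [NeZero n]
  {S₁ : Type*} [TopologicalSpace S₁] [ChartedSpace (EuclideanHalfSpace (2 * n)) S₁]
  [IsManifold (𝓡∂ (2 * n)) ∞ S₁]
  {S₂ : Type*} [TopologicalSpace S₂] [ChartedSpace (EuclideanHalfSpace (2 * n)) S₂]
  [IsManifold (𝓡∂ (2 * n)) ∞ S₂]
  {Y : Type*} [TopologicalSpace Y] [ChartedSpace (EuclideanSpace ℝ (Fin (2 * n - 1))) Y]
  [IsManifold (𝓡 (2 * n - 1)) ∞ Y]
  {β₁ : DForm (𝓡∂ (2 * n)) S₁ 1} {β₂ : DForm (𝓡∂ (2 * n)) S₂ 1}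
  {φ₁ : S₁ ≃ₘ^∞⟮𝓡∂ (2 * n), 𝓡∂ (2 * n)⟯ S₁} {φ₂ : S₂ ≃ₘ^∞⟮𝓡∂ (2 * n), 𝓡∂ (2 * n)⟯ S₂}
  {c₁ : Y × ℝ → S₁} {c₂ : Y × ℝ → S₂} {a₁ a₂ : ℝ → ℝ} {r : ℝ}

/-- The map to the folded sum from the cover of the first mapping torus. -/
abbrev inc₁ (φ₁ : S₁ ≃ₘ^∞⟮𝓡∂ (2 * n), 𝓡∂ (2 * n)⟯ S₁) (φ₂ : S₂ ≃ₘ^∞⟮𝓡∂ (2 * n), 𝓡∂ (2 * n)⟯ S₂)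
    (c₁ : Y × ℝ → S₁) (c₂ : Y × ℝ → S₂) : S₁ × ℝ → FoldedSumC φ₁ φ₂ c₁ c₂ :=
  FoldedSum.incl₁ φ₁ φ₂ (fun y => c₁ (y, 0)) (fun y => c₂ (y, 0))

/-- The map to the folded sum from the cover of the second mapping torus. -/
abbrev inc₂ (φ₁ : S₁ ≃ₘ^∞⟮𝓡∂ (2 * n), 𝓡∂ (2 * n)⟯ S₁) (φ₂ : S₂ ≃ₘ^∞⟮𝓡∂ (2 * n), 𝓡∂ (2 * n)⟯ S₂)
    (c₁ : Y × ℝ → S₁) (c₂ : Y × ℝ → S₂) : S₂ × ℝ → FoldedSumC φ₁ φ₂ c₁ c₂ :=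
  FoldedSum.incl₂ φ₁ φ₂ (fun y => c₁ (y, 0)) (fun y => c₂ (y, 0))

theorem inc₁_deck (k : ℤ) (x : S₁) (t : ℝ) :
    inc₁ φ₁ φ₂ c₁ c₂ (dpow φ₁ k x, t + k) = inc₁ φ₁ φ₂ c₁ c₂ (x, t) :=
  incl₁_deck (φ₁ := φ₁.toEquiv) (φ₂ := φ₂.toEquiv) k x t

theorem inc₂_deck (k : ℤ) (x : S₂) (t : ℝ) :
    inc₂ φ₁ φ₂ c₁ c₂ (dpow φ₂ k x, t + k) = inc₂ φ₁ φ₂ c₁ c₂ (x, t) :=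
  incl₂_deck (φ₁ := φ₁.toEquiv) (φ₂ := φ₂.toEquiv) k x t

theorem sumEqv_of_inc (h₁ : SideData β₁ φ₁ c₁ a₁ r) (h₂ : SideData β₂ φ₂ c₂ a₂ r)
    {p q : (S₁ × ℝ) ⊕ (S₂ × ℝ)}
    (h : (Quot.mk _ p : FoldedSumC φ₁ φ₂ c₁ c₂) = Quot.mk _ q) :
    SumEqv φ₁.toEquiv φ₂.toEquiv (fun y => c₁ (y, 0)) (fun y => c₂ (y, 0)) p q :=
  sumEqv_of_mk_eq (φ₁ := φ₁.toEquiv) (φ₂ := φ₂.toEquiv) h₁.injective_zero h₂.injective_zero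
    (fun _ => h₁.apply_eq h₁.zero_mem) (fun _ => h₂.apply_eq h₂.zero_mem) h

theorem collar_of_nonpos {p : Y × ℝ × ℝ} (hp : p.2.1 ≤ 0) :
    collar φ₁ φ₂ c₁ c₂ p = inc₁ φ₁ φ₂ c₁ c₂ (sideMap c₁ (-1) 0 p) := by
  rw [collar, if_pos hp, sideMap, sideProj, neg_one_mul, Int.cast_zero, add_zero]

theorem collar_of_nonneg {p : Y × ℝ × ℝ} (hp : 0 ≤ p.2.1) :
    collar φ₁ φ₂ c₁ c₂ p = inc₂ φ₁ φ₂ c₁ c₂ (sideMap c₂ 1 0 p) := by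
  rcases hp.eq_or_lt with h | h
  · rw [collar, if_pos h.symm.le, sideMap, sideProj, one_mul, Int.cast_zero, add_zero, ← h, neg_zero]
    exact incl_glue (φ₁ := φ₁.toEquiv) (φ₂ := φ₂.toEquiv) p.1 p.2.2
  · rw [collar, if_neg (not_le.2 h), sideMap, sideProj, one_mul, Int.cast_zero, add_zero]

theorem inc₁_sideMap (h₁ : SideData β₁ φ₁ c₁ a₁ r) {p : Y × ℝ × ℝ} (hp : p.2.1 ≤ 0)
    (hp' : |p.2.1| < r) (k : ℤ) :
    inc₁ φ₁ φ₂ c₁ c₂ (sideMap c₁ (-1) k p) = collar φ₁ φ₂ c₁ c₂ p := by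
  rw [collar_of_nonpos hp]
  rw [abs_of_nonpos hp] at hp'
  have h1 := h₁.dpow_eq (y := p.1) (t := -1 * p.2.1) ⟨by linarith, by linarith⟩ k
  have h2 := inc₁_deck (φ₁ := φ₁) (φ₂ := φ₂) (c₁ := c₁) (c₂ := c₂) k (c₁ (p.1, -1 * p.2.1)) p.2.2
  rw [h1] at h2
  simp only [sideMap, sideProj, Int.cast_zero, add_zero]
  exact h2

theorem inc₂_sideMap (h₂ : SideData β₂ φ₂ c₂ a₂ r) {p : Y × ℝ × ℝ} (hp : 0 ≤ p.2.1)
    (hp' : |p.2.1| < r) (k : ℤ) :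
    inc₂ φ₁ φ₂ c₁ c₂ (sideMap c₂ 1 k p) = collar φ₁ φ₂ c₁ c₂ p := by
  rw [collar_of_nonneg hp]
  rw [abs_of_nonneg hp] at hp'
  have h1 := h₂.dpow_eq (y := p.1) (t := 1 * p.2.1) ⟨by linarith, by linarith⟩ k
  have h2 := inc₂_deck (φ₁ := φ₁) (φ₂ := φ₂) (c₁ := c₁) (c₂ := c₂) k (c₂ (p.1, 1 * p.2.1)) p.2.2
  rw [h1] at h2
  simp only [sideMap, sideProj, Int.cast_zero, add_zero]
  exact h2

/-- The translation `(y, t, s) ↦ (y, t, s + k)`. -/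
def shiftMap (k : ℤ) (q : Y × ℝ × ℝ) : Y × ℝ × ℝ := (q.1, q.2.1, q.2.2 + k)

theorem contMDiff_shiftMap (k : ℤ) :
    ContMDiff ((𝓡 (2 * n - 1)).prod (𝓘(ℝ, ℝ).prod 𝓘(ℝ, ℝ)))
      ((𝓡 (2 * n - 1)).prod (𝓘(ℝ, ℝ).prod 𝓘(ℝ, ℝ))) ∞ (shiftMap k : Y × ℝ × ℝ → Y × ℝ × ℝ) :=
  contMDiff_fst.prodMk (contMDiff_snd_fst.prodMk (contMDiff_snd_snd_add k))

theorem tder_shiftMap (k : ℤ) (p : Y × ℝ × ℝ) :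
    tder ((𝓡 (2 * n - 1)).prod (𝓘(ℝ, ℝ).prod 𝓘(ℝ, ℝ)))
      ((𝓡 (2 * n - 1)).prod (𝓘(ℝ, ℝ).prod 𝓘(ℝ, ℝ))) (shiftMap k) p =
      ContinuousLinearMap.id ℝ _ := by
  refine ContinuousLinearMap.ext fun v => ?_
  have h1 := tder_prodMk_gen (I := 𝓘(ℝ, ℝ)) (I'' := 𝓘(ℝ, ℝ))
    ((contMDiff_snd_fst (I := 𝓡 (2 * n - 1)) (M := Y)).mdifferentiable (by simp) p)
    ((contMDiff_snd_snd_add (Y := Y) (n := n) k).mdifferentiable (by simp) p) v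
  rw [tder_snd_snd_add, tder_snd_fst] at h1
  have h2 := tder_prodMk_gen (I := 𝓡 (2 * n - 1)) (F := (Prod.fst : Y × ℝ × ℝ → Y))
    (I'' := 𝓘(ℝ, ℝ).prod 𝓘(ℝ, ℝ)) (x := p) mdifferentiableAt_fst
    ((contMDiff_snd_fst.prodMk (contMDiff_snd_snd_add (Y := Y) (n := n) k)).mdifferentiable
      (by simp) p) v
  rw [tder_fst, h1] at h2
  exact h2

/-- The monodromy fixes the collar of size `r` pointwise, so there a deck transformation is a mere
translation of `s`. -/
theorem collar_shiftMap (h₁ : SideData β₁ φ₁ c₁ a₁ r) (h₂ : SideData β₂ φ₂ c₂ a₂ r)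
    {p : Y × ℝ × ℝ} (hp : |p.2.1| < r) (k : ℤ) :
    collar φ₁ φ₂ c₁ c₂ (shiftMap k p) = collar φ₁ φ₂ c₁ c₂ p := by
  rcases le_total p.2.1 0 with h | h
  · rw [← inc₁_sideMap h₁ h hp k, collar_of_nonpos (p := shiftMap k p) h]
    simp [sideMap, shiftMap, sideProj]
  · rw [← inc₂_sideMap h₂ h hp k, collar_of_nonneg (p := shiftMap k p) h]
    simp [sideMap, shiftMap, sideProj]

theorem eq_deck_of_inc₁_eq (h₁ : SideData β₁ φ₁ c₁ a₁ r) (h₂ : SideData β₂ φ₂ c₂ a₂ r)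
    {p q : S₁ × ℝ} (h : inc₁ φ₁ φ₂ c₁ c₂ p = inc₁ φ₁ φ₂ c₁ c₂ q) :
    ∃ k : ℤ, q.1 = dpow φ₁ k p.1 ∧ q.2 = p.2 + k := sumEqv_of_inc h₁ h₂ h

theorem eq_deck_of_inc₂_eq (h₁ : SideData β₁ φ₁ c₁ a₁ r) (h₂ : SideData β₂ φ₂ c₂ a₂ r)
    {p q : S₂ × ℝ} (h : inc₂ φ₁ φ₂ c₁ c₂ p = inc₂ φ₁ φ₂ c₁ c₂ q) :
    ∃ k : ℤ, q.1 = dpow φ₂ k p.1 ∧ q.2 = p.2 + k := sumEqv_of_inc h₁ h₂ h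

theorem boundary_of_inc_eq (h₁ : SideData β₁ φ₁ c₁ a₁ r) (h₂ : SideData β₂ φ₂ c₂ a₂ r)
    {p : S₁ × ℝ} {q : S₂ × ℝ} (h : inc₁ φ₁ φ₂ c₁ c₂ p = inc₂ φ₁ φ₂ c₁ c₂ q) :
    ∃ (y : Y) (k : ℤ), p.1 = c₁ (y, 0) ∧ q.1 = c₂ (y, 0) ∧ q.2 = p.2 + k := sumEqv_of_inc h₁ h₂ h

/-- Points on the same side can only differ by a deck transformation, which fixes the collar. Points
on opposite sides can only be glued along the boundary, which is impossible for the one with `t >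
0`. -/
theorem eq_shiftMap_of_collar_eq (h₁ : SideData β₁ φ₁ c₁ a₁ r) (h₂ : SideData β₂ φ₂ c₂ a₂ r)
    {p q : Y × ℝ × ℝ} (hp : |p.2.1| < r) (hq : |q.2.1| < r)
    (h : collar φ₁ φ₂ c₁ c₂ p = collar φ₁ φ₂ c₁ c₂ q) : ∃ k : ℤ, q = shiftMap k p := by
  rcases le_or_gt p.2.1 0 with hp0 | hp0 <;> rcases le_or_gt q.2.1 0 with hq0 | hq0
  · rw [abs_of_nonpos hp0] at hp
    rw [abs_of_nonpos hq0] at hq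
    rw [collar_of_nonpos hp0, collar_of_nonpos hq0] at h
    obtain ⟨k, e1, e2⟩ := eq_deck_of_inc₁_eq h₁ h₂ h
    have m1 : -1 * p.2.1 ∈ Ico 0 r := ⟨by linarith, by linarith⟩
    have m2 : -1 * q.2.1 ∈ Ico 0 r := ⟨by linarith, by linarith⟩
    simp only [sideMap, sideProj, Int.cast_zero, add_zero] at e1 e2
    rw [h₁.dpow_eq m1] at e1
    obtain ⟨e3, e4⟩ := h₁.collar_inj m2 m1 e1
    exact ⟨k, Prod.ext e3 (Prod.ext (by simp only [shiftMap]; linarith) e2)⟩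
  · rw [collar_of_nonpos hp0, collar_of_nonneg hq0.le] at h
    obtain ⟨y, k, _, e2, _⟩ := boundary_of_inc_eq h₁ h₂ h
    rw [abs_of_pos hq0] at hq
    have := (h₂.collar_inj (t := 1 * q.2.1) ⟨by linarith, by linarith⟩ h₂.zero_mem e2).2
    linarith
  · rw [collar_of_nonneg hp0.le, collar_of_nonpos hq0] at h
    obtain ⟨y, k, _, e2, _⟩ := boundary_of_inc_eq h₁ h₂ h.symm
    rw [abs_of_pos hp0] at hp
    have := (h₂.collar_inj (t := 1 * p.2.1) ⟨by linarith, by linarith⟩ h₂.zero_mem e2).2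
    linarith
  · rw [abs_of_pos hp0] at hp
    rw [abs_of_pos hq0] at hq
    rw [collar_of_nonneg hp0.le, collar_of_nonneg hq0.le] at h
    obtain ⟨k, e1, e2⟩ := eq_deck_of_inc₂_eq h₁ h₂ h
    have m1 : 1 * p.2.1 ∈ Ico 0 r := ⟨by linarith, by linarith⟩
    have m2 : 1 * q.2.1 ∈ Ico 0 r := ⟨by linarith, by linarith⟩
    simp only [sideMap, sideProj, Int.cast_zero, add_zero] at e1 e2
    rw [h₂.dpow_eq m1] at e1
    obtain ⟨e3, e4⟩ := h₂.collar_inj m2 m1 e1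
    exact ⟨k, Prod.ext e3 (Prod.ext (by simp only [shiftMap]; linarith) e2)⟩

/-- Besides relating the two points this locates the overlap beyond distance `2δ`, where the cutoff
is `1` and the two prescribed forms can be compared. -/
theorem eq_sideMap₁_of_collar_eq (h₁ : SideData β₁ φ₁ c₁ a₁ r) (h₂ : SideData β₂ φ₂ c₂ a₂ r)
    {δ : ℝ} (hδ : 0 < δ) {p : Y × ℝ × ℝ} {q : S₁ × ℝ} (hp : |p.2.1| < r) (hq : q.1 ∈ farSet c₁ δ)
    (h : collar φ₁ φ₂ c₁ c₂ p = inc₁ φ₁ φ₂ c₁ c₂ q) :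
    p.2.1 < -(2 * δ) ∧ ∃ k : ℤ, q = sideMap c₁ (-1) k p := by
  rcases le_or_gt p.2.1 0 with hp0 | hp0
  · rw [abs_of_nonpos hp0] at hp
    rw [collar_of_nonpos hp0] at h
    obtain ⟨k, e1, e2⟩ := eq_deck_of_inc₁_eq h₁ h₂ h
    have m1 : -1 * p.2.1 ∈ Ico 0 r := ⟨by linarith, by linarith⟩
    simp only [sideMap, sideProj, Int.cast_zero, add_zero] at e1 e2
    rw [h₁.dpow_eq m1] at e1
    refine ⟨?_, k, Prod.ext e1 e2⟩
    by_contra! hcon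
    rw [e1] at hq
    exact hq ⟨(p.1, -1 * p.2.1), ⟨mem_univ _, m1.1, by simp only; linarith⟩, rfl⟩
  · rw [collar_of_nonneg hp0.le] at h
    obtain ⟨y, k, e1, _⟩ := boundary_of_inc_eq h₁ h₂ h.symm
    exact absurd e1 (farSet_ne c₁ hδ hq y)

theorem eq_sideMap₂_of_collar_eq (h₁ : SideData β₁ φ₁ c₁ a₁ r) (h₂ : SideData β₂ φ₂ c₂ a₂ r)
    {δ : ℝ} (hδ : 0 < δ) {p : Y × ℝ × ℝ} {q : S₂ × ℝ} (hp : |p.2.1| < r) (hq : q.1 ∈ farSet c₂ δ)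
    (h : collar φ₁ φ₂ c₁ c₂ p = inc₂ φ₁ φ₂ c₁ c₂ q) :
    2 * δ < p.2.1 ∧ ∃ k : ℤ, q = sideMap c₂ 1 k p := by
  rcases le_or_gt p.2.1 0 with hp0 | hp0
  · rw [collar_of_nonpos hp0] at h
    obtain ⟨y, k, _, e1, _⟩ := boundary_of_inc_eq h₁ h₂ h
    exact absurd e1 (farSet_ne c₂ hδ hq y)
  · rw [abs_of_pos hp0] at hp
    rw [collar_of_nonneg hp0.le] at h
    obtain ⟨k, e1, e2⟩ := eq_deck_of_inc₂_eq h₁ h₂ h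
    have m1 : 1 * p.2.1 ∈ Ico 0 r := ⟨by linarith, by linarith⟩
    simp only [sideMap, sideProj, Int.cast_zero, add_zero] at e1 e2
    rw [h₂.dpow_eq m1] at e1
    refine ⟨?_, k, Prod.ext e1 e2⟩
    by_contra! hcon
    rw [e1] at hq
    exact hq ⟨(p.1, 1 * p.2.1), ⟨mem_univ _, m1.1, by simp only; linarith⟩, rfl⟩

end Gluing

/-! ### The form on the folded sum and its contactness. -/

section GluedForm

set_option linter.unusedSectionVars false

open Filter

/-- Gluing by choice: for each point any index over it may be used to choose the value, since the
requirements of all indices over the same point are equivalent. -/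
theorem exists_of_compatible {ι M V : Type*} [Nonempty V] {pt : ι → M} {R : ι → V → Prop}
    (hex : ∀ i, ∃ v, R i v) (hcomp : ∀ i j, pt i = pt j → ∀ v, R i v → R j v) :
    ∃ σ : M → V, ∀ i, R i (σ (pt i)) := by
  classical
  refine ⟨fun m => if h : ∃ i, pt i = m then (hex h.choose).choose else Classical.arbitrary V,
    fun i => ?_⟩
  have h : ∃ j, pt j = pt i := ⟨i, rfl⟩
  simp only [dif_pos h]
  exact hcomp _ _ h.choose_spec _ (hex h.choose).choose_spec

variable {n : ℕ} [NeZero n]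
  {S₁ : Type*} [TopologicalSpace S₁] [ChartedSpace (EuclideanHalfSpace (2 * n)) S₁]
  [IsManifold (𝓡∂ (2 * n)) ∞ S₁]
  {S₂ : Type*} [TopologicalSpace S₂] [ChartedSpace (EuclideanHalfSpace (2 * n)) S₂]
  [IsManifold (𝓡∂ (2 * n)) ∞ S₂]
  {Y : Type*} [TopologicalSpace Y] [ChartedSpace (EuclideanSpace ℝ (Fin (2 * n - 1))) Y]
  [IsManifold (𝓡 (2 * n - 1)) ∞ Y]
  {β₁ : DForm (𝓡∂ (2 * n)) S₁ 1} {β₂ : DForm (𝓡∂ (2 * n)) S₂ 1}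
  {φ₁ : S₁ ≃ₘ^∞⟮𝓡∂ (2 * n), 𝓡∂ (2 * n)⟯ S₁} {φ₂ : S₂ ≃ₘ^∞⟮𝓡∂ (2 * n), 𝓡∂ (2 * n)⟯ S₂}
  {c₁ : Y × ℝ → S₁} {c₂ : Y × ℝ → S₂} {a₁ a₂ : ℝ → ℝ} {r : ℝ}
  [ChartedSpace (EuclideanSpace ℝ (Fin (2 * n + 1))) (FoldedSumC φ₁ φ₂ c₁ c₂)]
  [IsManifold (𝓡 (2 * n + 1)) ∞ (FoldedSumC φ₁ φ₂ c₁ c₂)]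

theorem collar_localDiffeo (hM : IsCollarGluing n φ₁ φ₂ c₁ c₂) (hr : r ≤ 1) {p : Y × ℝ × ℝ}
    (hp : |p.2.1| < r) :
    IsLocalDiffeomorphAt ((𝓡 (2 * n - 1)).prod (𝓘(ℝ, ℝ).prod 𝓘(ℝ, ℝ))) (𝓡 (2 * n + 1)) ∞
      (collar φ₁ φ₂ c₁ c₂) p :=
  hM.collar p.1 p.2.1 (abs_lt.1 (hp.trans_le hr)) p.2.2

theorem inc₁_localDiffeo (hM : IsCollarGluing n φ₁ φ₂ c₁ c₂) (hc : IsCollar n c₁) {δ : ℝ}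
    (hδ : 0 < δ) {q : S₁ × ℝ} (hq : q.1 ∈ farSet c₁ δ) :
    IsLocalDiffeomorphAt ((𝓡∂ (2 * n)).prod 𝓘(ℝ, ℝ)) (𝓡 (2 * n + 1)) ∞ (inc₁ φ₁ φ₂ c₁ c₂) q :=
  hM.incl₁ q.1 (farSet_interior hc hδ hq) q.2

theorem inc₂_localDiffeo (hM : IsCollarGluing n φ₁ φ₂ c₁ c₂) (hc : IsCollar n c₂) {δ : ℝ}
    (hδ : 0 < δ) {q : S₂ × ℝ} (hq : q.1 ∈ farSet c₂ δ) :
    IsLocalDiffeomorphAt ((𝓡∂ (2 * n)).prod 𝓘(ℝ, ℝ)) (𝓡 (2 * n + 1)) ∞ (inc₂ φ₁ φ₂ c₁ c₂) q :=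
  hM.incl₂ q.1 (farSet_interior hc hδ hq) q.2

theorem continuous_snd_fst_abs : Continuous fun q : Y × ℝ × ℝ => |q.2.1| := by fun_prop

/-- Two parameters of one point differ by an integer translation of `s`, and the glued form does not
depend on `s`. -/
theorem push_collar_iff (h₁ : SideData β₁ φ₁ c₁ a₁ r) (h₂ : SideData β₂ φ₂ c₂ a₂ r)
    (hM : IsCollarGluing n φ₁ φ₂ c₁ c₂) (α : DForm (𝓡 (2 * n - 1)) Y 1) (C K δ : ℝ)
    {p q : Y × ℝ × ℝ} (hp : |p.2.1| < r) (hq : |q.2.1| < r)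
    (h : collar φ₁ φ₂ c₁ c₂ p = collar φ₁ φ₂ c₁ c₂ q)
    (η : EuclideanSpace ℝ (Fin (2 * n + 1)) [⋀^Fin 1]→L[ℝ] ℝ) :
    η.compContinuousLinearMap (tder ((𝓡 (2 * n - 1)).prod (𝓘(ℝ, ℝ).prod 𝓘(ℝ, ℝ))) (𝓡 (2 * n + 1))
        (collar φ₁ φ₂ c₁ c₂) p) =
      fval (glueForm α (colForm c₁ β₁) (colForm c₂ β₂) C K δ) p ↔
    η.compContinuousLinearMap (tder ((𝓡 (2 * n - 1)).prod (𝓘(ℝ, ℝ).prod 𝓘(ℝ, ℝ))) (𝓡 (2 * n + 1))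
        (collar φ₁ φ₂ c₁ c₂) q) =
      fval (glueForm α (colForm c₁ β₁) (colForm c₂ β₂) C K δ) q := by
  obtain ⟨k, rfl⟩ := eq_shiftMap_of_collar_eq h₁ h₂ hp hq h
  refine push_iff (T := shiftMap k) (collar_localDiffeo hM h₁.le_one hp)
    (collar_localDiffeo hM h₁.le_one hq) ((contMDiff_shiftMap k).mdifferentiable (by simp) p)
    ?_ ?_ η
  · filter_upwards [continuous_snd_fst_abs.continuousAt.eventually (Iio_mem_nhds hp)] with z hz
    exact (collar_shiftMap h₁ h₂ hz k).symm
  · rw [tder_shiftMap]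
    exact (fval_glueForm_add p k).symm

theorem push_inc₁_iff (h₁ : SideData β₁ φ₁ c₁ a₁ r) (h₂ : SideData β₂ φ₂ c₂ a₂ r)
    (hM : IsCollarGluing n φ₁ φ₂ c₁ c₂) (K : ℝ) {δ : ℝ} (hδ : 0 < δ)
    {p q : S₁ × ℝ} (hp : p.1 ∈ farSet c₁ δ) (hq : q.1 ∈ farSet c₁ δ)
    (h : inc₁ φ₁ φ₂ c₁ c₂ p = inc₁ φ₁ φ₂ c₁ c₂ q)
    (η : EuclideanSpace ℝ (Fin (2 * n + 1)) [⋀^Fin 1]→L[ℝ] ℝ) :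
    η.compContinuousLinearMap (tder ((𝓡∂ (2 * n)).prod 𝓘(ℝ, ℝ)) (𝓡 (2 * n + 1))
        (inc₁ φ₁ φ₂ c₁ c₂) p) = fval (bundleForm n β₁ φ₁ a₁ K) p ↔
    η.compContinuousLinearMap (tder ((𝓡∂ (2 * n)).prod 𝓘(ℝ, ℝ)) (𝓡 (2 * n + 1))
        (inc₁ φ₁ φ₂ c₁ c₂) q) = fval (bundleForm n β₁ φ₁ a₁ K) q := by
  obtain ⟨k, e1, e2⟩ := eq_deck_of_inc₁_eq h₁ h₂ h
  obtain rfl : q = deck h₁.preserves k p := Prod.ext e1 e2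
  refine push_iff (T := deck h₁.preserves k) (inc₁_localDiffeo hM h₁.isCollar hδ hp)
    (inc₁_localDiffeo hM h₁.isCollar hδ hq)
    ((deck h₁.preserves k).contMDiff.mdifferentiable (by simp) p)
    (Eventually.of_forall fun z => (inc₁_deck k z.1 z.2).symm) ?_ η
  exact (fval_pullback_deck h₁.preserves h₁.weight.compact K k p).symm

theorem push_inc₂_iff (h₁ : SideData β₁ φ₁ c₁ a₁ r) (h₂ : SideData β₂ φ₂ c₂ a₂ r)
    (hM : IsCollarGluing n φ₁ φ₂ c₁ c₂) (K : ℝ) {δ : ℝ} (hδ : 0 < δ)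
    {p q : S₂ × ℝ} (hp : p.1 ∈ farSet c₂ δ) (hq : q.1 ∈ farSet c₂ δ)
    (h : inc₂ φ₁ φ₂ c₁ c₂ p = inc₂ φ₁ φ₂ c₁ c₂ q)
    (η : EuclideanSpace ℝ (Fin (2 * n + 1)) [⋀^Fin 1]→L[ℝ] ℝ) :
    η.compContinuousLinearMap (tder ((𝓡∂ (2 * n)).prod 𝓘(ℝ, ℝ)) (𝓡 (2 * n + 1))
        (inc₂ φ₁ φ₂ c₁ c₂) p) = fval (bundleForm n β₂ φ₂ a₂ K) p ↔
    η.compContinuousLinearMap (tder ((𝓡∂ (2 * n)).prod 𝓘(ℝ, ℝ)) (𝓡 (2 * n + 1))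
        (inc₂ φ₁ φ₂ c₁ c₂) q) = fval (bundleForm n β₂ φ₂ a₂ K) q := by
  obtain ⟨k, e1, e2⟩ := eq_deck_of_inc₂_eq h₁ h₂ h
  obtain rfl : q = deck h₂.preserves k p := Prod.ext e1 e2
  refine push_iff (T := deck h₂.preserves k) (inc₂_localDiffeo hM h₂.isCollar hδ hp)
    (inc₂_localDiffeo hM h₂.isCollar hδ hq)
    ((deck h₂.preserves k).contMDiff.mdifferentiable (by simp) p)
    (Eventually.of_forall fun z => (inc₂_deck k z.1 z.2).symm) ?_ η
  exact (fval_pullback_deck h₂.preserves h₂.weight.compact K k p).symm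

/-- The parameters of the common point differ by `sideMap`, and in the overlap, at distance more
than `2δ` from the fold, the glued form is the pullback of the bundle form under `sideMap`. -/
theorem push_collar_inc₁_iff (h₁ : SideData β₁ φ₁ c₁ a₁ r) (h₂ : SideData β₂ φ₂ c₂ a₂ r)
    (hM : IsCollarGluing n φ₁ φ₂ c₁ c₂) (α : DForm (𝓡 (2 * n - 1)) Y 1) (C K : ℝ) {δ : ℝ}
    (hδ : 0 < δ) {p : Y × ℝ × ℝ} {q : S₁ × ℝ} (hp : |p.2.1| < r) (hq : q.1 ∈ farSet c₁ δ)
    (h : collar φ₁ φ₂ c₁ c₂ p = inc₁ φ₁ φ₂ c₁ c₂ q)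
    (η : EuclideanSpace ℝ (Fin (2 * n + 1)) [⋀^Fin 1]→L[ℝ] ℝ) :
    η.compContinuousLinearMap (tder ((𝓡 (2 * n - 1)).prod (𝓘(ℝ, ℝ).prod 𝓘(ℝ, ℝ))) (𝓡 (2 * n + 1))
        (collar φ₁ φ₂ c₁ c₂) p) =
      fval (glueForm α (colForm c₁ β₁) (colForm c₂ β₂) C K δ) p ↔
    η.compContinuousLinearMap (tder ((𝓡∂ (2 * n)).prod 𝓘(ℝ, ℝ)) (𝓡 (2 * n + 1))
        (inc₁ φ₁ φ₂ c₁ c₂) q) = fval (bundleForm n β₁ φ₁ a₁ K) q := by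
  obtain ⟨hlt, k, rfl⟩ := eq_sideMap₁_of_collar_eq h₁ h₂ hδ hp hq h
  have hp' := abs_lt.1 hp
  have hm : -1 * p.2.1 ∈ Ioo 0 r := ⟨by linarith, by linarith⟩
  refine push_iff (T := sideMap c₁ (-1) k) (collar_localDiffeo hM h₁.le_one hp)
    (inc₁_localDiffeo hM h₁.isCollar hδ hq)
    ((h₁.contMDiffAt_sideMap hm k).mdifferentiableAt (by simp)) ?_ ?_ η
  · have hcts : ContinuousAt (fun q : Y × ℝ × ℝ => q.2.1) p := by fun_prop
    filter_upwards [continuous_snd_fst_abs.continuousAt.eventually (Iio_mem_nhds hp),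
      hcts.eventually (Iio_mem_nhds (show p.2.1 < 0 by linarith))] with z hz hz'
    exact (inc₁_sideMap h₁ (le_of_lt hz') hz k).symm
  · rw [fval_glueForm_of_nonpos (by linarith)]
    exact h₁.fval_totalForm_eq α hδ hm (by linarith) (foldG_of_le_neg hδ (by linarith)) k

theorem push_collar_inc₂_iff (h₁ : SideData β₁ φ₁ c₁ a₁ r) (h₂ : SideData β₂ φ₂ c₂ a₂ r)
    (hM : IsCollarGluing n φ₁ φ₂ c₁ c₂) (α : DForm (𝓡 (2 * n - 1)) Y 1) (C K : ℝ) {δ : ℝ}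
    (hδ : 0 < δ) {p : Y × ℝ × ℝ} {q : S₂ × ℝ} (hp : |p.2.1| < r) (hq : q.1 ∈ farSet c₂ δ)
    (h : collar φ₁ φ₂ c₁ c₂ p = inc₂ φ₁ φ₂ c₁ c₂ q)
    (η : EuclideanSpace ℝ (Fin (2 * n + 1)) [⋀^Fin 1]→L[ℝ] ℝ) :
    η.compContinuousLinearMap (tder ((𝓡 (2 * n - 1)).prod (𝓘(ℝ, ℝ).prod 𝓘(ℝ, ℝ))) (𝓡 (2 * n + 1))
        (collar φ₁ φ₂ c₁ c₂) p) =
      fval (glueForm α (colForm c₁ β₁) (colForm c₂ β₂) C K δ) p ↔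
    η.compContinuousLinearMap (tder ((𝓡∂ (2 * n)).prod 𝓘(ℝ, ℝ)) (𝓡 (2 * n + 1))
        (inc₂ φ₁ φ₂ c₁ c₂) q) = fval (bundleForm n β₂ φ₂ a₂ (-K)) q := by
  obtain ⟨hlt, k, rfl⟩ := eq_sideMap₂_of_collar_eq h₁ h₂ hδ hp hq h
  have hp' := abs_lt.1 hp
  have hm : 1 * p.2.1 ∈ Ioo 0 r := ⟨by linarith, by linarith⟩
  refine push_iff (T := sideMap c₂ 1 k) (collar_localDiffeo hM h₁.le_one hp)
    (inc₂_localDiffeo hM h₂.isCollar hδ hq)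
    ((h₂.contMDiffAt_sideMap hm k).mdifferentiableAt (by simp)) ?_ ?_ η
  · have hcts : ContinuousAt (fun q : Y × ℝ × ℝ => q.2.1) p := by fun_prop
    filter_upwards [continuous_snd_fst_abs.continuousAt.eventually (Iio_mem_nhds hp),
      hcts.eventually (Ioi_mem_nhds (show 0 < p.2.1 by linarith))] with z hz hz'
    exact (inc₂_sideMap h₂ (le_of_lt hz') hz k).symm
  · rw [fval_glueForm_of_pos (by linarith)]
    exact h₂.fval_totalForm_eq α hδ hm (by linarith) (foldG_of_le hδ (by linarith)) k

/-- The form on the folded sum is given by the glued form on the collar and by the bundle forms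
on the rest of the mapping tori. -/
structure IsGlued (σ : DForm (𝓡 (2 * n + 1)) (FoldedSumC φ₁ φ₂ c₁ c₂) 1)
    (α : DForm (𝓡 (2 * n - 1)) Y 1) (β₁ : DForm (𝓡∂ (2 * n)) S₁ 1) (β₂ : DForm (𝓡∂ (2 * n)) S₂ 1)
    (a₁ a₂ : ℝ → ℝ) (C K δ r : ℝ) : Prop where
  collar : ∀ p, |p.2.1| < r → fval (pullback (𝓡 (2 * n + 1))
      ((𝓡 (2 * n - 1)).prod (𝓘(ℝ, ℝ).prod 𝓘(ℝ, ℝ))) (collar φ₁ φ₂ c₁ c₂) σ) p =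
    fval (glueForm α (colForm c₁ β₁) (colForm c₂ β₂) C K δ) p
  inc₁ : ∀ p, p.1 ∈ farSet c₁ δ → fval (pullback (𝓡 (2 * n + 1)) ((𝓡∂ (2 * n)).prod 𝓘(ℝ, ℝ))
    (inc₁ φ₁ φ₂ c₁ c₂) σ) p = fval (bundleForm n β₁ φ₁ a₁ K) p
  inc₂ : ∀ p, p.1 ∈ farSet c₂ δ → fval (pullback (𝓡 (2 * n + 1)) ((𝓡∂ (2 * n)).prod 𝓘(ℝ, ℝ))
    (inc₂ φ₁ φ₂ c₁ c₂) σ) p = fval (bundleForm n β₂ φ₂ a₂ (-K)) p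

theorem exists_isGlued (h₁ : SideData β₁ φ₁ c₁ a₁ r) (h₂ : SideData β₂ φ₂ c₂ a₂ r)
    (hM : IsCollarGluing n φ₁ φ₂ c₁ c₂) (α : DForm (𝓡 (2 * n - 1)) Y 1) (C K : ℝ) {δ : ℝ}
    (hδ : 0 < δ) :
    ∃ σ : DForm (𝓡 (2 * n + 1)) (FoldedSumC φ₁ φ₂ c₁ c₂) 1,
      IsGlued σ α β₁ β₂ a₁ a₂ C K δ r := by
  let ι := {p : Y × ℝ × ℝ // |p.2.1| < r} ⊕
    ({q : S₁ × ℝ // q.1 ∈ farSet c₁ δ} ⊕ {q : S₂ × ℝ // q.1 ∈ farSet c₂ δ})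
  let V := EuclideanSpace ℝ (Fin (2 * n + 1)) [⋀^Fin 1]→L[ℝ] ℝ
  let pt : ι → FoldedSumC φ₁ φ₂ c₁ c₂ :=
    Sum.elim (fun p => FoldedContact.collar φ₁ φ₂ c₁ c₂ p.1)
      (Sum.elim (fun q => FoldedContact.inc₁ φ₁ φ₂ c₁ c₂ q.1)
        (fun q => FoldedContact.inc₂ φ₁ φ₂ c₁ c₂ q.1))
  let R₀ : Y × ℝ × ℝ → V → Prop := fun p η => η.compContinuousLinearMap
    (tder ((𝓡 (2 * n - 1)).prod (𝓘(ℝ, ℝ).prod 𝓘(ℝ, ℝ))) (𝓡 (2 * n + 1))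
        (collar φ₁ φ₂ c₁ c₂) p) = fval (glueForm α (colForm c₁ β₁) (colForm c₂ β₂) C K δ) p
  let R₁ : S₁ × ℝ → V → Prop := fun q η => η.compContinuousLinearMap
    (tder ((𝓡∂ (2 * n)).prod 𝓘(ℝ, ℝ)) (𝓡 (2 * n + 1)) (inc₁ φ₁ φ₂ c₁ c₂) q) =
      fval (bundleForm n β₁ φ₁ a₁ K) q
  let R₂ : S₂ × ℝ → V → Prop := fun q η => η.compContinuousLinearMap
    (tder ((𝓡∂ (2 * n)).prod 𝓘(ℝ, ℝ)) (𝓡 (2 * n + 1)) (inc₂ φ₁ φ₂ c₁ c₂) q) =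
      fval (bundleForm n β₂ φ₂ a₂ (-K)) q
  let R : ι → V → Prop :=
    Sum.elim (fun p => R₀ p.1) (Sum.elim (fun q => R₁ q.1) (fun q => R₂ q.1))
  have hex : ∀ i, ∃ v, R i v := by
    rintro (⟨p, hp⟩ | ⟨q, hq⟩ | ⟨q, hq⟩)
    · exact exists_push (collar_localDiffeo hM h₁.le_one hp) _
    · exact exists_push (inc₁_localDiffeo hM h₁.isCollar hδ hq) _
    · exact exists_push (inc₂_localDiffeo hM h₂.isCollar hδ hq) _
  have hcomp : ∀ i j, pt i = pt j → ∀ v, R i v → R j v := by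
    rintro (⟨p, hp⟩ | ⟨p, hp⟩ | ⟨p, hp⟩) (⟨q, hq⟩ | ⟨q, hq⟩ | ⟨q, hq⟩) h v
    · exact (push_collar_iff h₁ h₂ hM α C K δ hp hq h v).1
    · exact (push_collar_inc₁_iff h₁ h₂ hM α C K hδ hp hq h v).1
    · exact (push_collar_inc₂_iff h₁ h₂ hM α C K hδ hp hq h v).1
    · exact (push_collar_inc₁_iff h₁ h₂ hM α C K hδ hq hp h.symm v).2
    · exact (push_inc₁_iff h₁ h₂ hM K hδ hp hq h v).1
    -- The two covers meet only along the boundary, which the far parts avoid.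
    · obtain ⟨y, k, e, _⟩ := boundary_of_inc_eq h₁ h₂ h
      exact absurd e (farSet_ne c₁ hδ hp y)
    · exact (push_collar_inc₂_iff h₁ h₂ hM α C K hδ hq hp h.symm v).2
    · obtain ⟨y, k, e, _⟩ := boundary_of_inc_eq h₁ h₂ h.symm
      exact absurd e (farSet_ne c₁ hδ hq y)
    · exact (push_inc₂_iff h₁ h₂ hM (-K) hδ hp hq h v).1
  obtain ⟨σ, hσ⟩ := exists_of_compatible hex hcomp
  exact ⟨σ, fun p hp => hσ (.inl ⟨p, hp⟩), fun p hp => hσ (.inr (.inl ⟨p, hp⟩)),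
    fun p hp => hσ (.inr (.inr ⟨p, hp⟩))⟩

/-- Every point of the folded sum lies on the collar or on the rest of one of the mapping tori. -/
theorem exists_chart_point {δ : ℝ} (hδr : 2 * δ < r) (m : FoldedSumC φ₁ φ₂ c₁ c₂) :
    (∃ p : Y × ℝ × ℝ, |p.2.1| < r ∧ collar φ₁ φ₂ c₁ c₂ p = m) ∨
    (∃ q : S₁ × ℝ, q.1 ∈ farSet c₁ δ ∧ inc₁ φ₁ φ₂ c₁ c₂ q = m) ∨
    (∃ q : S₂ × ℝ, q.1 ∈ farSet c₂ δ ∧ inc₂ φ₁ φ₂ c₁ c₂ q = m) := by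
  obtain ⟨⟨x, s⟩ | ⟨x, s⟩, rfl⟩ := Quot.exists_rep m
  · by_cases hx : x ∈ farSet c₁ δ
    · exact .inr (.inl ⟨(x, s), hx, rfl⟩)
    · rw [farSet, notMem_compl_iff] at hx
      obtain ⟨⟨y, t⟩, ⟨-, ht⟩, rfl⟩ := hx
      dsimp only at ht
      refine .inl ⟨(y, -t, s), ?_, ?_⟩
      · rw [abs_neg, abs_of_nonneg ht.1]
        exact ht.2.trans_lt hδr
      · rw [collar_of_nonpos (neg_nonpos.2 ht.1)]
        simp only [sideMap, sideProj, Int.cast_zero, add_zero, neg_mul, one_mul, neg_neg]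
        rfl
  · by_cases hx : x ∈ farSet c₂ δ
    · exact .inr (.inr ⟨(x, s), hx, rfl⟩)
    · rw [farSet, notMem_compl_iff] at hx
      obtain ⟨⟨y, t⟩, ⟨-, ht⟩, rfl⟩ := hx
      dsimp only at ht
      refine .inl ⟨(y, t, s), ?_, ?_⟩
      · rw [abs_of_nonneg ht.1]
        exact ht.2.trans_lt hδr
      · rw [collar_of_nonneg ht.1]
        simp only [sideMap, sideProj, Int.cast_zero, add_zero, one_mul]
        rfl

variable {σ : DForm (𝓡 (2 * n + 1)) (FoldedSumC φ₁ φ₂ c₁ c₂) 1} {α : DForm (𝓡 (2 * n - 1)) Y 1}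
  {C K δ : ℝ}

theorem IsGlued.eventually_collar (hσ : IsGlued σ α β₁ β₂ a₁ a₂ C K δ r) {p : Y × ℝ × ℝ}
    (hp : |p.2.1| < r) : ∀ᶠ z in 𝓝 p, fval (pullback (𝓡 (2 * n + 1))
      ((𝓡 (2 * n - 1)).prod (𝓘(ℝ, ℝ).prod 𝓘(ℝ, ℝ))) (FoldedContact.collar φ₁ φ₂ c₁ c₂) σ) z =
    fval (glueForm α (colForm c₁ β₁) (colForm c₂ β₂) C K δ) z := by
  filter_upwards [continuous_snd_fst_abs.continuousAt.eventually (Iio_mem_nhds hp)] with z hz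
  exact hσ.collar z hz

theorem IsGlued.eventually_inc₁ [CompactSpace Y] [T2Space S₁]
    (hσ : IsGlued σ α β₁ β₂ a₁ a₂ C K δ r) (hc : IsCollar n c₁) (hδ : 2 * δ < 1)
    {q : S₁ × ℝ} (hq : q.1 ∈ farSet c₁ δ) :
    ∀ᶠ z in 𝓝 q, fval (pullback (𝓡 (2 * n + 1)) ((𝓡∂ (2 * n)).prod 𝓘(ℝ, ℝ))
      (FoldedContact.inc₁ φ₁ φ₂ c₁ c₂) σ) z = fval (bundleForm n β₁ φ₁ a₁ K) z := by
  filter_upwards [continuous_fst.continuousAt.eventually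
    ((isOpen_farSet hc hδ).mem_nhds hq)] with z hz
  exact hσ.inc₁ z hz

theorem IsGlued.eventually_inc₂ [CompactSpace Y] [T2Space S₂]
    (hσ : IsGlued σ α β₁ β₂ a₁ a₂ C K δ r) (hc : IsCollar n c₂) (hδ : 2 * δ < 1)
    {q : S₂ × ℝ} (hq : q.1 ∈ farSet c₂ δ) :
    ∀ᶠ z in 𝓝 q, fval (pullback (𝓡 (2 * n + 1)) ((𝓡∂ (2 * n)).prod 𝓘(ℝ, ℝ))
      (FoldedContact.inc₂ φ₁ φ₂ c₁ c₂) σ) z = fval (bundleForm n β₂ φ₂ a₂ (-K)) z := by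
  filter_upwards [continuous_fst.continuousAt.eventually
    ((isOpen_farSet hc hδ).mem_nhds hq)] with z hz
  exact hσ.inc₂ z hz

/-- Smoothness and the contact condition are local, and each point has a local diffeomorphism onto a
neighbourhood that pulls `σ` back to a form already known to be contact. -/
theorem IsGlued.isContactForm [CompactSpace Y] [T2Space S₁] [T2Space S₂]
    (hσ : IsGlued σ α β₁ β₂ a₁ a₂ C K δ r) (h₁ : SideData β₁ φ₁ c₁ a₁ r)
    (h₂ : SideData β₂ φ₂ c₂ a₂ r) (hM : IsCollarGluing n φ₁ φ₂ c₁ c₂) (hα : ∀ y, SmoothAt α y)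
    (hcont : ∀ y, ContactPt (fval α y) (fval (extD (𝓡 (2 * n - 1)) α) y))
    (hg₁ : GoodSide α (colForm c₁ β₁) C δ r) (hg₂ : GoodSide α (colForm c₂ β₂) C δ r)
    (hC : 1 < C) (hK : 0 < K) (hδ : 0 < δ) (hδr : 2 * δ < r)
    (hb₁ : IsContactForm ((𝓡∂ (2 * n)).prod 𝓘(ℝ, ℝ)) (bundleForm n β₁ φ₁ a₁ K))
    (hb₂ : IsContactForm ((𝓡∂ (2 * n)).prod 𝓘(ℝ, ℝ)) (bundleForm n β₂ φ₂ a₂ (-K))) :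
    IsContactForm (𝓡 (2 * n + 1)) σ := by
  rw [isContactForm_iff] at hb₁ hb₂ ⊢
  have hδ1 : 2 * δ < 1 := hδr.trans_le h₁.le_one
  intro m
  rcases exists_chart_point hδr m with ⟨p, hp, rfl⟩ | ⟨q, hq, rfl⟩ | ⟨q, hq, rfl⟩
  · have hd := collar_localDiffeo hM h₁.le_one hp
    obtain ⟨e1, e2, -⟩ := glueForm_props hα hcont hg₁ hg₂ hC hK hδ (by linarith) hp
    have hs := smoothAt_of_pullback hd (hσ.eventually_collar hp) e1
    exact ⟨hs, (contactPt_iff_of_pullback hd (hσ.eventually_collar hp) hs).1 e2⟩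
  · have hd := inc₁_localDiffeo hM h₁.isCollar hδ hq
    have he := hσ.eventually_inc₁ h₁.isCollar hδ1 hq
    have hs := smoothAt_of_pullback hd he (hb₁ q).1
    exact ⟨hs, (contactPt_iff_of_pullback hd he hs).1 (hb₁ q).2⟩
  · have hd := inc₂_localDiffeo hM h₂.isCollar hδ hq
    have he := hσ.eventually_inc₂ h₂.isCollar hδ1 hq
    have hs := smoothAt_of_pullback hd he (hb₂ q).1
    exact ⟨hs, (contactPt_iff_of_pullback hd he hs).1 (hb₂ q).2⟩

end GluedForm

/-! ### Linear algebra at the fold. -/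

section FoldTwo

open Filter

variable {V : Type*} [NormedAddCommGroup V] [NormedSpace ℝ V]

/-- Continuity of `D` is enough at a zero of `h`: the error `(D w - D x) h w` is a null function
times `O(w - x)`. -/
theorem hasFDerivAt_mul_of_eq_zero {D h : V → ℝ} {h' : V →L[ℝ] ℝ} {x : V} (hD : ContinuousAt D x)
    (hh : HasFDerivAt h h' x) (h0 : h x = 0) :
    HasFDerivAt (fun w => D w * h w) (D x • h') x := by
  have h1 : (fun w => (D w - D x) * h w) =o[𝓝 x] fun w => w - x := by
    have e1 : (fun w => D w - D x) =o[𝓝 x] fun _ => (1 : ℝ) := by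
      rw [Asymptotics.isLittleO_one_iff]
      have := hD.tendsto.sub_const (D x)
      rwa [sub_self] at this
    have e2 : h =O[𝓝 x] fun w => w - x := by
      have := hh.isBigO_sub
      simpa only [h0, sub_zero] using this
    have e3 := e1.mul_isBigO e2.norm_right
    simp only [one_mul] at e3
    exact e3.of_norm_right
  have h2 : HasFDerivAt (fun w => (D w - D x) * h w) (0 : V →L[ℝ] ℝ) x := by
    refine HasFDerivAt.of_isLittleO ?_
    simpa [h0] using h1
  have h3 := h2.add (hh.const_mul (D x))
  rw [zero_add] at h3
  refine h3.congr_of_eventuallyEq (Eventually.of_forall fun w => ?_)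
  simp only [Pi.add_apply]
  ring

/-- The `2`-form `c dt ∧ a + f b` on `V × ℝ`. -/
def foldTwo (a : V [⋀^Fin 1]→L[ℝ] ℝ) (b : V [⋀^Fin 2]→L[ℝ] ℝ) (f c : ℝ) :
    (V × ℝ) [⋀^Fin 2]→L[ℝ] ℝ :=
  c • ContinuousAlternatingMap.alternatizeUncurryFin ((ContinuousLinearMap.snd ℝ V ℝ).smulRight
    (a.compContinuousLinearMap (ContinuousLinearMap.fst ℝ V ℝ))) +
  f • b.compContinuousLinearMap (ContinuousLinearMap.fst ℝ V ℝ)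

theorem foldTwo_apply (a : V [⋀^Fin 1]→L[ℝ] ℝ) (b : V [⋀^Fin 2]→L[ℝ] ℝ) (f c : ℝ) (v w : V × ℝ) :
    foldTwo a b f c ![v, w] = c * (v.2 * a ![w.1] - w.2 * a ![v.1]) + f * b ![v.1, w.1] := by
  rw [foldTwo, ContinuousAlternatingMap.add_apply, ContinuousAlternatingMap.smul_apply,
    ContinuousAlternatingMap.smul_apply, comp_apply_two,
    ContinuousAlternatingMap.alternatizeUncurryFin_apply, Fin.sum_univ_two]
  have h1 : Fin.removeNth (α := fun _ => V × ℝ) 0 ![v, w] = ![w] := by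
    ext i <;> fin_cases i <;> rfl
  have h2 : Fin.removeNth (α := fun _ => V × ℝ) 1 ![v, w] = ![v] := by
    ext i <;> fin_cases i <;> rfl
  rw [h1, h2]
  simp only [ContinuousLinearMap.smulRight_apply, ContinuousAlternatingMap.smul_apply,
    comp_apply_one]
  simp [← sub_eq_add_neg]

/-- Stretching the last coordinate by `c` turns `dt ∧ a + f b` into `c dt ∧ a + f b` and has
determinant `c`. This isolates the factor `f'` of the top power without expanding it. -/
theorem wedgePow_foldTwo [FiniteDimensional ℝ V] {n : ℕ} (hV : Module.finrank ℝ (V × ℝ) = 2 * n)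
    (a : V [⋀^Fin 1]→L[ℝ] ℝ) (b : V [⋀^Fin 2]→L[ℝ] ℝ) (f c : ℝ) (v : Fin n × Fin 2 → V × ℝ) :
    wedgePow n (foldTwo a b f c) v = wedgePow n (foldTwo a b f 1) v * c := by
  let L : V × ℝ →ₗ[ℝ] V × ℝ := LinearMap.prodMap LinearMap.id (c • LinearMap.id)
  have hL : LinearMap.det L = c := by
    rw [LinearMap.det_prodMap, LinearMap.det_id, LinearMap.det_smul, LinearMap.det_id]
    simp
  have h := wedgePow_comp_det hV (foldTwo a b f 1) L v
  rw [hL, mul_comm] at h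
  rw [← h]
  simp only [wedgePow, foldTwo_apply, L]
  congr 1
  refine Finset.sum_congr rfl fun τ _ => ?_
  congr 1
  refine Finset.prod_congr rfl fun i _ => ?_
  simp
  ring

theorem foldTwo_nondegenerate {a : V [⋀^Fin 1]→L[ℝ] ℝ} {b : V [⋀^Fin 2]→L[ℝ] ℝ}
    (h : ContactPt a b) {f : ℝ} (hf : f ≠ 0) (v : V × ℝ)
    (hv : ∀ w, foldTwo a b f 1 ![v, w] = 0) : v = 0 := by
  obtain ⟨x, s⟩ := v
  simp only [foldTwo_apply] at hv
  have h1 : a ![x] = 0 := by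
    have := hv (0, 1)
    have e1 : a ![(0 : V)] = 0 := (toLin a).map_zero
    have e2 : b ![x, (0 : V)] = 0 := (toBilin b x).map_zero
    simp only [e1, e2] at this
    linarith
  have h2 : x = 0 := by
    refine h.2 x h1 fun w hw => ?_
    have := hv (w, 0)
    simp only [hw] at this
    simpa [hf] using this
  subst h2
  have h3 : s = 0 := by
    by_contra hs
    refine h.1 (one_ext fun w => ?_)
    have := hv (w, 0)
    have e2 : b ![(0 : V), w] = 0 := by rw [two_swap, show b ![w, (0 : V)] = 0 from
      (toBilin b w).map_zero, neg_zero]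
    simp only [e2] at this
    simpa [hs] using this
  subst h3
  rfl

theorem continuousAt_wedgePow {X : Type*} [TopologicalSpace X] {b : X → V [⋀^Fin 2]→L[ℝ] ℝ} {x : X}
    (hb : ∀ v w, ContinuousAt (fun y => b y ![v, w]) x) {n : ℕ} (v : Fin n × Fin 2 → V) :
    ContinuousAt (fun y => wedgePow n (b y) v) x := by
  unfold wedgePow
  refine continuousAt_const.mul (tendsto_finsetSum _ fun τ _ => ?_)
  exact continuousAt_const.mul (tendsto_finsetProd _ fun i _ => hb _ _)

theorem differentiableAt_wedgePow {X : Type*} [NormedAddCommGroup X] [NormedSpace ℝ X]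
    {b : X → V [⋀^Fin 2]→L[ℝ] ℝ} {x : X}
    (hb : ∀ v w, DifferentiableAt ℝ (fun y => b y ![v, w]) x) {n : ℕ} (v : Fin n × Fin 2 → V) :
    DifferentiableAt ℝ (fun y => wedgePow n (b y) v) x := by
  unfold wedgePow
  refine (DifferentiableAt.fun_sum fun τ _ => ?_).const_mul _
  exact (HasFDerivAt.finsetProd fun i _ => (hb _ _).hasFDerivAt).differentiableAt.const_mul _

/-- The contact condition says that `b` is nondegenerate on `ker a`, which has dimension `2m`. This
gives the maximal rank of the form along the fold. -/
theorem exists_wedgePow_ker_ne_zero [FiniteDimensional ℝ V] {m : ℕ}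
    (hV : Module.finrank ℝ V = 2 * m + 1) {a : V [⋀^Fin 1]→L[ℝ] ℝ} {b : V [⋀^Fin 2]→L[ℝ] ℝ}
    (h : ContactPt a b) {f : ℝ} (hf : f ≠ 0) :
    ∃ z : Fin m × Fin 2 → V, wedgePow m (foldTwo a b f 0) (fun i => (z i, 0)) ≠ 0 := by
  have ha : toLin a ≠ 0 := fun h0 => h.1 (one_ext fun v => LinearMap.congr_fun h0 v)
  have hker : Module.finrank ℝ (LinearMap.ker (toLin a)) = 2 * m := by
    have h1 := LinearMap.finrank_range_add_finrank_ker (toLin a)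
    rw [LinearMap.range_eq_top.2 (LinearMap.surjective ha), finrank_top, Module.finrank_self,
      hV] at h1
    omega
  obtain ⟨z, -, hz⟩ := exists_wedgePow_ne_zero_of_subspace (LinearMap.ker (toLin a)) hker
    ((foldTwo a b f 0).compContinuousLinearMap (ContinuousLinearMap.inl ℝ V ℝ)) (by
      intro v hv hw
      refine h.2 v hv fun w hw' => ?_
      have := hw w hw'
      rw [comp_apply_two, foldTwo_apply] at this
      simpa [hf] using this)
  rw [wedgePow_comp] at hz
  exact ⟨z, hz⟩

end FoldTwo

/-! ### The derivative of the top power at the fold. -/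

section FoldPoint

set_option linter.unusedSectionVars false

open Filter

variable {n : ℕ} [NeZero n]
  {N : Type*} [TopologicalSpace N] [ChartedSpace (EuclideanSpace ℝ (Fin (2 * n))) N]
  [IsManifold (𝓡 (2 * n)) ∞ N]
  {Y : Type*} [TopologicalSpace Y] [ChartedSpace (EuclideanSpace ℝ (Fin (2 * n - 1))) Y]
  [IsManifold (𝓡 (2 * n - 1)) ∞ Y]

theorem differentiableAt_wedgePow_inChart_extD {lam : DForm (𝓡 (2 * n)) N 1}
    (hlam : ∀ x, SmoothAt lam x) (q : N) {m : ℕ}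
    (v : Fin m × Fin 2 → EuclideanSpace ℝ (Fin (2 * n))) :
    DifferentiableAt ℝ (fun u => wedgePow m (inChart (𝓡 (2 * n)) (extD (𝓡 (2 * n)) lam) q u) v)
      (extChartAt (𝓡 (2 * n)) q q) := by
  have hr : range (𝓡 (2 * n)) = univ := by simp
  have h0 := hlam q
  rw [SmoothAt, hr, contDiffWithinAt_univ] at h0
  have h1 : DifferentiableAt ℝ (fderiv ℝ (inChart (𝓡 (2 * n)) lam q))
      (extChartAt (𝓡 (2 * n)) q q) :=
    (h0.fderiv_right (m := 1) (by norm_cast)).differentiableAt (by simp)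
  refine differentiableAt_wedgePow (fun v w => ?_) v
  have h2 : (fun u => inChart (𝓡 (2 * n)) (extD (𝓡 (2 * n)) lam) q u ![v, w]) =ᶠ[
      𝓝 (extChartAt (𝓡 (2 * n)) q q)] fun u => fderiv ℝ (inChart (𝓡 (2 * n)) lam q) u v ![w] -
        fderiv ℝ (inChart (𝓡 (2 * n)) lam q) u w ![v] := by
    filter_upwards [(isOpen_extChartAt_target q).mem_nhds (mem_extChartAt_target q)] with u hu
    rw [inChart_extD hu (hlam _), extDerivWithin_apply_two, hr, fderivWithin_univ]
  refine DifferentiableAt.congr_of_eventuallyEq ?_ h2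
  have h3 : ∀ v w : EuclideanSpace ℝ (Fin (2 * n)), DifferentiableAt ℝ
      (fun u => fderiv ℝ (inChart (𝓡 (2 * n)) lam q) u v ![w]) (extChartAt (𝓡 (2 * n)) q q) := by
    intro v w
    exact ((ContinuousAlternatingMap.apply ℝ _ ℝ ![w]).differentiableAt).comp _
      (h1.clm_apply (differentiableAt_const v))
  exact (h3 v w).sub (h3 w v)

/-- The form `f(t) α` on `Y × ℝ`. -/
abbrev warpForm (α : DForm (𝓡 (2 * n - 1)) Y 1) (f : ℝ → ℝ) :
    DForm ((𝓡 (2 * n - 1)).prod 𝓘(ℝ, ℝ)) (Y × ℝ) 1 :=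
  combForm α (fun _ => 0) f (fun _ => 0)

theorem inChart_extD_warpForm {α : DForm (𝓡 (2 * n - 1)) Y 1} (hα : ∀ y, SmoothAt α y)
    {f : ℝ → ℝ} (hf : ContDiff ℝ ∞ f) (y : Y) {w : EuclideanSpace ℝ (Fin (2 * n - 1)) × ℝ}
    (hw : w.1 ∈ (extChartAt (𝓡 (2 * n - 1)) y).target) :
    inChart ((𝓡 (2 * n - 1)).prod 𝓘(ℝ, ℝ)) (extD _ (warpForm α f)) (y, (0 : ℝ)) w =
      foldTwo (inChart (𝓡 (2 * n - 1)) α y w.1) (inChart (𝓡 (2 * n - 1)) (extD _ α) y w.1)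
        (f w.2) (deriv f w.2) := by
  refine two_ext fun v v' => ?_
  obtain ⟨u, t⟩ := w
  rw [inChart_eq, comp_apply_two, cder_prod_real y hw, cder_prod_real y hw,
    extChartAt_prod_real_symm, fval_extD_combForm hf contDiff_const (hα _) (smoothAt_zero _),
    foldTwo_apply, inChart_eq, inChart_eq, comp_apply_one, comp_apply_one, comp_apply_two]
  simp

variable {lam : DForm (𝓡 (2 * n)) N 1} {G : Y × ℝ → N} {y : Y} {α : DForm (𝓡 (2 * n - 1)) Y 1}
  {f : ℝ → ℝ}

/-- The expression of `dλ` in charts near a point where a map pulls `λ` back to `f(t) α`. -/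
theorem eventually_inChart_extD_warp (hlam : ∀ x, SmoothAt lam x)
    (hG : ∀ᶠ z in 𝓝 (y, (0 : ℝ)), ContMDiffAt ((𝓡 (2 * n - 1)).prod 𝓘(ℝ, ℝ)) (𝓡 (2 * n)) ∞ G z)
    (hα : ∀ y, SmoothAt α y) (hf : ContDiff ℝ ∞ f)
    (hpull : ∀ᶠ z in 𝓝 (y, (0 : ℝ)),
      fval (pullback (𝓡 (2 * n)) ((𝓡 (2 * n - 1)).prod 𝓘(ℝ, ℝ)) G lam) z =
        fval (warpForm α f) z) :
    ∀ᶠ w in 𝓝 (extChartAt (𝓡 (2 * n - 1)) y y, (0 : ℝ)),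
      (inChart (𝓡 (2 * n)) (extD _ lam) (G (y, 0)) (inCharts ((𝓡 (2 * n - 1)).prod 𝓘(ℝ, ℝ))
          (𝓡 (2 * n)) (y, (0 : ℝ)) (G (y, 0)) G w)).compContinuousLinearMap
        (fderiv ℝ (inCharts ((𝓡 (2 * n - 1)).prod 𝓘(ℝ, ℝ)) (𝓡 (2 * n)) (y, (0 : ℝ))
          (G (y, 0)) G) w) =
      foldTwo (inChart (𝓡 (2 * n - 1)) α y w.1) (inChart (𝓡 (2 * n - 1)) (extD _ α) y w.1)
        (f w.2) (deriv f w.2) := by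
  have hr : range ((𝓡 (2 * n - 1)).prod 𝓘(ℝ, ℝ)) = univ := by simp
  have hz0 : extChartAt ((𝓡 (2 * n - 1)).prod 𝓘(ℝ, ℝ)) (y, (0 : ℝ)) (y, (0 : ℝ)) =
      (extChartAt (𝓡 (2 * n - 1)) y y, (0 : ℝ)) := by
    rw [extChartAt_prod]
    rfl
  have h1 : ∀ᶠ z in 𝓝 (y, (0 : ℝ)), fval (pullback (𝓡 (2 * n)) ((𝓡 (2 * n - 1)).prod 𝓘(ℝ, ℝ)) G
      (extD _ lam)) z = fval (extD _ (warpForm α f)) z := by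
    filter_upwards [hG, hpull.eventually_nhds] with z hz hz'
    rw [fval_pullback, fval_extD_of_pullback hz hz' (hlam _)]
  have h2 := eventually_inChart_congr h1
  have h3 := eventually_inChart_pullback (F := G) (p := (y, (0 : ℝ))) (q := G (y, 0))
    (extD _ lam) (mem_extChartAt_target (I := (𝓡 (2 * n - 1)).prod 𝓘(ℝ, ℝ)) (y, (0 : ℝ)))
    (by rw [extChartAt_to_inv]; exact hG.self_of_nhds)
    (by rw [extChartAt_to_inv]; exact mem_extChartAt_source _)
  rw [hr, nhdsWithin_univ, hz0] at h2 h3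
  have h4 : ∀ᶠ w : EuclideanSpace ℝ (Fin (2 * n - 1)) × ℝ in
      𝓝 (extChartAt (𝓡 (2 * n - 1)) y y, (0 : ℝ)),
      w.1 ∈ (extChartAt (𝓡 (2 * n - 1)) y).target :=
    continuousAt_fst.eventually
      ((isOpen_extChartAt_target y).mem_nhds (mem_extChartAt_target y))
  filter_upwards [h2, h3, h4] with w e2 e3 e4
  rw [fderivWithin_univ] at e3
  rw [← e3, e2, inChart_extD_warpForm hα hf y e4]

theorem contDiffAt_inCharts
    (hG : ContMDiffAt ((𝓡 (2 * n - 1)).prod 𝓘(ℝ, ℝ)) (𝓡 (2 * n)) ∞ G (y, (0 : ℝ))) :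
    ContDiffAt ℝ ∞ (inCharts ((𝓡 (2 * n - 1)).prod 𝓘(ℝ, ℝ)) (𝓡 (2 * n)) (y, (0 : ℝ))
      (G (y, 0)) G) (extChartAt (𝓡 (2 * n - 1)) y y, (0 : ℝ)) := by
  have hr : range ((𝓡 (2 * n - 1)).prod 𝓘(ℝ, ℝ)) = univ := by simp
  have h := contDiffWithinAt_inCharts (F := G) (p := (y, (0 : ℝ))) (q := G (y, 0))
    (mem_extChartAt_target (I := (𝓡 (2 * n - 1)).prod 𝓘(ℝ, ℝ)) (y, (0 : ℝ)))
    (by rw [extChartAt_to_inv]; exact hG)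
    (by rw [extChartAt_to_inv]; exact mem_extChartAt_source _)
  rw [hr, contDiffWithinAt_univ, extChartAt_prod] at h
  exact h

theorem fderiv_inCharts_self
    (hG : ContMDiffAt ((𝓡 (2 * n - 1)).prod 𝓘(ℝ, ℝ)) (𝓡 (2 * n)) ∞ G (y, (0 : ℝ))) :
    fderiv ℝ (inCharts ((𝓡 (2 * n - 1)).prod 𝓘(ℝ, ℝ)) (𝓡 (2 * n)) (y, (0 : ℝ))
      (G (y, 0)) G) (extChartAt (𝓡 (2 * n - 1)) y y, (0 : ℝ)) =
    tder ((𝓡 (2 * n - 1)).prod 𝓘(ℝ, ℝ)) (𝓡 (2 * n)) G (y, (0 : ℝ)) := by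
  have hr : range ((𝓡 (2 * n - 1)).prod 𝓘(ℝ, ℝ)) = univ := by simp
  have hz0 : extChartAt ((𝓡 (2 * n - 1)).prod 𝓘(ℝ, ℝ)) (y, (0 : ℝ)) (y, (0 : ℝ)) =
      (extChartAt (𝓡 (2 * n - 1)) y y, (0 : ℝ)) := by
    rw [extChartAt_prod]
    rfl
  have h := cder_comp_fderivWithin_inCharts (F := G) (p := (y, (0 : ℝ))) (q := G (y, 0))
    (mem_extChartAt_target (I := (𝓡 (2 * n - 1)).prod 𝓘(ℝ, ℝ)) (y, (0 : ℝ)))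
    (by rw [extChartAt_to_inv]; exact hG.mdifferentiableAt (by simp))
    (by rw [extChartAt_to_inv]; exact mem_extChartAt_source _)
  rw [hr, fderivWithin_univ, cder_self, extChartAt_to_inv, cder_self, hz0] at h
  exact h

theorem finrank_prod_real :
    Module.finrank ℝ (EuclideanSpace ℝ (Fin (2 * n - 1)) × ℝ) = 2 * n := by
  have := NeZero.pos n
  simp
  omega

/-- The derivative of the top power of `dλ` at a point of the fold. -/
theorem topPowDeriv_fold {C : ℝ} (hlam : ∀ x, SmoothAt lam x)
    (hG : ∀ᶠ z in 𝓝 (y, (0 : ℝ)), ContMDiffAt ((𝓡 (2 * n - 1)).prod 𝓘(ℝ, ℝ)) (𝓡 (2 * n)) ∞ G z)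
    (hbij : Function.Bijective (tder ((𝓡 (2 * n - 1)).prod 𝓘(ℝ, ℝ)) (𝓡 (2 * n)) G (y, (0 : ℝ))))
    (hα : ∀ y, SmoothAt α y)
    (hpull : ∀ᶠ z in 𝓝 (y, (0 : ℝ)),
      fval (pullback (𝓡 (2 * n)) ((𝓡 (2 * n - 1)).prod 𝓘(ℝ, ℝ)) G lam) z =
        fval (warpForm α (foldF C)) z)
    (v : Fin n × Fin 2 → EuclideanSpace ℝ (Fin (2 * n - 1)) × ℝ)
    (w : EuclideanSpace ℝ (Fin (2 * n - 1)) × ℝ) :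
    topPowDeriv n (extD _ lam) (G (y, 0))
      (tder ((𝓡 (2 * n - 1)).prod 𝓘(ℝ, ℝ)) (𝓡 (2 * n)) G (y, (0 : ℝ)) w)
      (fun i => tder ((𝓡 (2 * n - 1)).prod 𝓘(ℝ, ℝ)) (𝓡 (2 * n)) G (y, (0 : ℝ)) (v i)) =
    wedgePow n (foldTwo (fval α y) (fval (extD _ α) y) C 1) v * (-2 * w.2) := by
  set A := tder ((𝓡 (2 * n - 1)).prod 𝓘(ℝ, ℝ)) (𝓡 (2 * n)) G (y, (0 : ℝ)) with hA
  set g := inCharts ((𝓡 (2 * n - 1)).prod 𝓘(ℝ, ℝ)) (𝓡 (2 * n)) (y, (0 : ℝ)) (G (y, 0)) G with hg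
  set z₀ : EuclideanSpace ℝ (Fin (2 * n - 1)) × ℝ := (extChartAt (𝓡 (2 * n - 1)) y y, 0) with hz₀
  set P : EuclideanSpace ℝ (Fin (2 * n)) → ℝ := fun u =>
    wedgePow n (inChart (𝓡 (2 * n)) (extD _ lam) (G (y, 0)) u) (fun i => A (v i)) with hP
  have hgc : ContDiffAt ℝ ∞ g z₀ := contDiffAt_inCharts hG.self_of_nhds
  have hgA : fderiv ℝ g z₀ = A := fderiv_inCharts_self hG.self_of_nhds
  have hgz : g z₀ = extChartAt (𝓡 (2 * n)) (G (y, 0)) (G (y, 0)) := by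
    rw [hg, hz₀, inCharts, Function.comp_apply, Function.comp_apply, extChartAt_prod_real_symm,
      extChartAt_to_inv]
  let B : EuclideanSpace ℝ (Fin (2 * n)) →L[ℝ] EuclideanSpace ℝ (Fin (2 * n - 1)) × ℝ :=
    (LinearEquiv.ofBijective A.toLinearMap hbij).toContinuousLinearEquiv.symm.toContinuousLinearMap
  have hBA : ∀ x, B (A x) = x := fun x =>
    (LinearEquiv.ofBijective A.toLinearMap hbij).symm_apply_apply x
  have hAB : A ∘L B = ContinuousLinearMap.id ℝ _ := ContinuousLinearMap.ext fun x =>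
    (LinearEquiv.ofBijective A.toLinearMap hbij).apply_symm_apply x
  -- The Jacobian of the coordinate change, normalized to be `1` at the base point by the inverse
  -- `B` of its derivative `A`.
  let D : EuclideanSpace ℝ (Fin (2 * n - 1)) × ℝ → ℝ := fun u => (fderiv ℝ g u ∘L B).det
  have hDc : ContinuousAt D z₀ := by
    have h1 : ContinuousAt (fderiv ℝ g) z₀ :=
      (hgc.fderiv_right (m := 0) (by norm_cast)).continuousAt
    exact ContinuousLinearMap.continuous_det.continuousAt.comp
      (h1.clm_comp continuousAt_const)
  have hD0 : D z₀ = 1 := by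
    simp only [D, hgA, hAB]
    exact LinearMap.det_id
  let Q : EuclideanSpace ℝ (Fin (2 * n - 1)) × ℝ → ℝ := fun u =>
    wedgePow n (foldTwo (inChart (𝓡 (2 * n - 1)) α y u.1)
      (inChart (𝓡 (2 * n - 1)) (extD _ α) y u.1) (foldF C u.2) 1) v
  have hQ0 : Q z₀ = wedgePow n (foldTwo (fval α y) (fval (extD _ α) y) C 1) v := by
    simp only [Q, hz₀, inChart_self, foldF]
    norm_num
  -- The same top power in two coordinate systems: in the chart of `N`, corrected by the Jacobian,
  -- and in the coordinates `(y, t)`, where it has the factor `f' = -2t`.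
  have hRQ : (fun u => D u * P (g u)) =ᶠ[𝓝 z₀] fun u => Q u * (-2 * u.2) := by
    filter_upwards [eventually_inChart_extD_warp hlam hG hα (contDiff_foldF C) hpull] with u hu
    have e1 := wedgePow_comp_det (n := n) (by simp)
      (inChart (𝓡 (2 * n)) (extD _ lam) (G (y, 0)) (g u))
      (fderiv ℝ g u ∘L B).toLinearMap (fun i => A (v i))
    have e2 : (fun i => (fderiv ℝ g u ∘L B).toLinearMap (A (v i))) =
        fun i => fderiv ℝ g u (v i) := by
      funext i
      change fderiv ℝ g u (B (A (v i))) = _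
      rw [hBA]
    rw [e2, ← wedgePow_comp, hu, deriv_foldF, wedgePow_foldTwo finrank_prod_real, ← neg_mul] at e1
    exact e1.symm
  have hr : range (𝓡 (2 * n - 1)) = univ := by simp
  have hQc : ContinuousAt Q z₀ := by
    have t1 : ContinuousAt (inChart (𝓡 (2 * n - 1)) α y) (extChartAt (𝓡 (2 * n - 1)) y y) := by
      have := (hα y).tendsto_inChart
      rwa [hr, nhdsWithin_univ, ← inChart_self] at this
    have t2 : ContinuousAt (inChart (𝓡 (2 * n - 1)) (extD _ α) y)
        (extChartAt (𝓡 (2 * n - 1)) y y) := by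
      have := tendsto_inChart_extD hα (x := y)
      rwa [hr, nhdsWithin_univ, ← inChart_self] at this
    have t1' : ContinuousAt (fun u : EuclideanSpace ℝ (Fin (2 * n - 1)) × ℝ =>
      inChart (𝓡 (2 * n - 1)) α y u.1) z₀ :=
      ContinuousAt.comp (f := Prod.fst) (g := inChart (𝓡 (2 * n - 1)) α y) t1 continuousAt_fst
    have t2' : ContinuousAt (fun u : EuclideanSpace ℝ (Fin (2 * n - 1)) × ℝ =>
      inChart (𝓡 (2 * n - 1)) (extD _ α) y u.1) z₀ :=
      ContinuousAt.comp (f := Prod.fst) (g := inChart (𝓡 (2 * n - 1)) (extD _ α) y) t2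
        continuousAt_fst
    have t3 : ContinuousAt (fun u : EuclideanSpace ℝ (Fin (2 * n - 1)) × ℝ => foldF C u.2) z₀ :=
      (contDiff_foldF C).continuous.continuousAt.comp continuousAt_snd
    refine continuousAt_wedgePow (fun x x' => ?_) v
    simp only [foldTwo_apply]
    have ev1 : ∀ x, ContinuousAt (fun u : EuclideanSpace ℝ (Fin (2 * n - 1)) × ℝ =>
        inChart (𝓡 (2 * n - 1)) α y u.1 ![x]) z₀ := fun x =>
      (ContinuousAlternatingMap.apply ℝ _ ℝ ![x]).continuous.continuousAt.comp t1'
    have ev2 : ContinuousAt (fun u : EuclideanSpace ℝ (Fin (2 * n - 1)) × ℝ =>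
        inChart (𝓡 (2 * n - 1)) (extD _ α) y u.1 ![x.1, x'.1]) z₀ :=
      (ContinuousAlternatingMap.apply ℝ _ ℝ ![x.1, x'.1]).continuous.continuousAt.comp t2'
    exact (continuousAt_const.mul ((continuousAt_const.mul (ev1 _)).sub
      (continuousAt_const.mul (ev1 _)))).add (t3.mul ev2)
  have hPd : HasFDerivAt P (fderiv ℝ P (g z₀)) (g z₀) := by
    rw [hgz]
    exact (differentiableAt_wedgePow_inChart_extD hlam _ _).hasFDerivAt
  have hgd : HasFDerivAt g A z₀ := by
    rw [← hgA]
    exact (hgc.differentiableAt (by simp)).hasFDerivAt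
  have hP0 : P (g z₀) = 0 := by
    have := hRQ.self_of_nhds
    dsimp only at this
    rwa [hD0, one_mul, show z₀.2 = 0 from rfl, mul_zero, mul_zero] at this
  -- Both sides are products with a factor that vanishes at `z₀`, so only continuity of `D` and `Q`
  -- is needed in order to compare derivatives.
  have d1 : HasFDerivAt (fun u => D u * P (g u)) (D z₀ • (fderiv ℝ P (g z₀) ∘L A)) z₀ :=
    hasFDerivAt_mul_of_eq_zero hDc (hPd.comp z₀ hgd) hP0
  have d2 : HasFDerivAt (fun u : EuclideanSpace ℝ (Fin (2 * n - 1)) × ℝ => Q u * (-2 * u.2))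
      (Q z₀ • ((-2 : ℝ) • ContinuousLinearMap.snd ℝ _ ℝ)) z₀ :=
    hasFDerivAt_mul_of_eq_zero hQc (hasFDerivAt_snd.const_mul (-2)) (by simp [hz₀])
  have d3 := DFunLike.congr_fun (d1.unique (d2.congr_of_eventuallyEq hRQ)) w
  rw [hD0, one_smul, hQ0, hgz] at d3
  exact d3

/-- At the points that are parametrized by `t = 0`, a form that is pulled back to `f(t) α` has a
fold. -/
theorem fold_point {C : ℝ} (hC : C ≠ 0) (hlam : ∀ x, SmoothAt lam x)
    (hG : ∀ᶠ z in 𝓝 (y, (0 : ℝ)), ContMDiffAt ((𝓡 (2 * n - 1)).prod 𝓘(ℝ, ℝ)) (𝓡 (2 * n)) ∞ G z)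
    (hbij : Function.Bijective (tder ((𝓡 (2 * n - 1)).prod 𝓘(ℝ, ℝ)) (𝓡 (2 * n)) G (y, (0 : ℝ))))
    (hα : ∀ y, SmoothAt α y) (hcont : ContactPt (fval α y) (fval (extD _ α) y))
    (hpull : ∀ᶠ z in 𝓝 (y, (0 : ℝ)),
      fval (pullback (𝓡 (2 * n)) ((𝓡 (2 * n - 1)).prod 𝓘(ℝ, ℝ)) G lam) z =
        fval (warpForm α (foldF C)) z) :
    G (y, 0) ∈ foldLocus n (extD _ lam) ∧
    (∃ w v, topPowDeriv n (extD _ lam) (G (y, 0)) w v ≠ 0) ∧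
    ∃ z : Fin (n - 1) × Fin 2 → EuclideanSpace ℝ (Fin (2 * n)),
      (∀ i v, topPowDeriv n (extD _ lam) (G (y, 0)) (z i) v = 0) ∧
      wedgePow (n - 1) (inChart (𝓡 (2 * n)) (extD _ lam) (G (y, 0))
        (extChartAt (𝓡 (2 * n)) (G (y, 0)) (G (y, 0)))) z ≠ 0 := by
  have hn := NeZero.pos n
  have htop := topPowDeriv_fold hlam hG hbij hα hpull
  set A := tder ((𝓡 (2 * n - 1)).prod 𝓘(ℝ, ℝ)) (𝓡 (2 * n)) G (y, (0 : ℝ)) with hA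
  have hlin : (fval (extD _ lam) (G (y, 0))).compContinuousLinearMap A =
      foldTwo (fval α y) (fval (extD _ α) y) C 0 := by
    rw [hA, ← fval_extD_of_pullback hG.self_of_nhds hpull (hlam _)]
    refine two_ext fun v v' => ?_
    rw [fval_extD_combForm (contDiff_foldF C) contDiff_const (hα _) (smoothAt_zero _),
      foldTwo_apply, deriv_foldF, foldF]
    simp
  refine ⟨fun v => ?_, ?_, ?_⟩
  · choose u hu using fun i => hbij.2 (v i)
    have hv : v = fun i => A (u i) := funext fun i => (hu i).symm
    have h := wedgePow_comp n (fval (extD _ lam) (G (y, 0))) A u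
    rw [hlin, wedgePow_foldTwo finrank_prod_real, mul_zero, ← hv] at h
    exact h.symm
  · obtain ⟨v, hv⟩ := exists_wedgePow_ne_zero finrank_prod_real
      (foldTwo (fval α y) (fval (extD _ α) y) C 1) (foldTwo_nondegenerate hcont hC)
    refine ⟨A (0, 1), fun i => A (v i), ?_⟩
    rw [htop]
    exact mul_ne_zero hv (by norm_num)
  -- Vectors with vanishing `t`-component are tangent to the fold by the derivative formula; among
  -- them a family on which `C dα` has nonzero power is taken.
  · obtain ⟨z, hz⟩ := exists_wedgePow_ker_ne_zero (m := n - 1) (by simp; omega) hcont hC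
    refine ⟨fun i => A (z i, 0), fun i v => ?_, ?_⟩
    · choose u hu using fun i => hbij.2 (v i)
      have hv : v = fun i => A (u i) := funext fun i => (hu i).symm
      rw [hv, htop]
      simp
    · rw [inChart_self, ← wedgePow_comp _ _ A, hlin]
      exact hz

end FoldPoint

/-! ### Slices with constant circle coordinate. -/

section Slice

set_option linter.unusedSectionVars false

open Filter

variable {E : Type*} [NormedAddCommGroup E] [NormedSpace ℝ E]
  {H : Type*} [TopologicalSpace H] {I : ModelWithCorners ℝ E H}
  {M : Type*} [TopologicalSpace M] [ChartedSpace H M] [IsManifold I ∞ M]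

theorem contMDiff_prodMk_const (s : ℝ) :
    ContMDiff I (I.prod 𝓘(ℝ, ℝ)) ∞ (fun x : M => (x, s)) :=
  contMDiff_id.prodMk contMDiff_const

theorem tder_prodMk_const (s : ℝ) (x : M) (v : E) :
    tder I (I.prod 𝓘(ℝ, ℝ)) (fun x : M => (x, s)) x v = (v, 0) := by
  have h := tder_prodMk_gen (I' := I) (I := I) (I'' := 𝓘(ℝ, ℝ)) (F := (id : M → M))
    (G := fun _ : M => s) (x := x) mdifferentiableAt_id mdifferentiableAt_const v
  rw [tder_id, tder_const] at h
  exact h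

/-- The slice `(y, t) ↦ (y, t, s)`. -/
def slice (s : ℝ) (z : M × ℝ) : M × ℝ × ℝ := (z.1, z.2, s)

theorem contMDiff_slice (s : ℝ) :
    ContMDiff (I.prod 𝓘(ℝ, ℝ)) (I.prod (𝓘(ℝ, ℝ).prod 𝓘(ℝ, ℝ))) ∞ (slice s : M × ℝ → M × ℝ × ℝ) :=
  contMDiff_fst.prodMk (contMDiff_snd.prodMk contMDiff_const)

theorem tder_slice (s : ℝ) (z : M × ℝ) (v : E × ℝ) :
    tder (I.prod 𝓘(ℝ, ℝ)) (I.prod (𝓘(ℝ, ℝ).prod 𝓘(ℝ, ℝ))) (slice s) z v = (v.1, v.2, 0) := by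
  have h1 := tder_prodMk_gen (I' := I.prod 𝓘(ℝ, ℝ)) (I := 𝓘(ℝ, ℝ)) (I'' := 𝓘(ℝ, ℝ))
    (F := (Prod.snd : M × ℝ → ℝ)) (G := fun _ => s) (x := z) mdifferentiableAt_snd
    mdifferentiableAt_const v
  rw [tder_snd, tder_const] at h1
  have h2 := tder_prodMk_gen (I' := I.prod 𝓘(ℝ, ℝ)) (I := I) (I'' := 𝓘(ℝ, ℝ).prod 𝓘(ℝ, ℝ))
    (F := (Prod.fst : M × ℝ → M)) (G := fun q : M × ℝ => (q.2, s)) (x := z) mdifferentiableAt_fst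
    (mdifferentiableAt_snd.prodMk mdifferentiableAt_const) v
  rw [tder_fst, h1] at h2
  exact h2

end Slice

/-! ### Lifting maps to an embedded fiber. -/

section Lift

open Filter

variable {n : ℕ}
  {M : Type*} [TopologicalSpace M] [ChartedSpace (EuclideanSpace ℝ (Fin (2 * n + 1))) M] {F : Set M}
  [ChartedSpace (EuclideanSpace ℝ (Fin (2 * n))) F]
  {E : Type*} [NormedAddCommGroup E] [NormedSpace ℝ E]
  {H : Type*} [TopologicalSpace H] {I : ModelWithCorners ℝ E H}
  {P : Type*} [TopologicalSpace P] [ChartedSpace H P]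

theorem contMDiff_val
    (hF : IsSmoothEmbedding (𝓡 (2 * n)) (𝓡 (2 * n + 1)) ∞ (Subtype.val : F → M)) :
    ContMDiff (𝓡 (2 * n)) (𝓡 (2 * n + 1)) ∞ (Subtype.val : F → M) :=
  hF.isImmersion.contMDiff

/-- The smooth structure on `F` is arbitrary subject to the embedding property, so smoothness into
`F` is tested through the inclusion: an immersion detects it for continuous maps, and continuity
comes from the induced topology. -/
theorem contMDiffAt_lift
    (hF : IsSmoothEmbedding (𝓡 (2 * n)) (𝓡 (2 * n + 1)) ∞ (Subtype.val : F → M)) {ι : P → M}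
    (hι : ∀ x, ι x ∈ F) {x : P} (hs : ContMDiffAt I (𝓡 (2 * n + 1)) ∞ ι x) :
    ContMDiffAt I (𝓡 (2 * n)) ∞ (fun z => (⟨ι z, hι z⟩ : F)) x :=
  (ContMDiffAt.iff_comp_isImmersionAt (hF.isImmersion.isImmersionAt _)).2
    ⟨IsInducing.subtypeVal.continuousAt_iff.2 hs.continuousAt, hs⟩

theorem tder_lift
    (hF : IsSmoothEmbedding (𝓡 (2 * n)) (𝓡 (2 * n + 1)) ∞ (Subtype.val : F → M)) {ι : P → M}
    (hι : ∀ x, ι x ∈ F) {x : P} (hs : ContMDiffAt I (𝓡 (2 * n + 1)) ∞ ι x) :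
    tder I (𝓡 (2 * n + 1)) ι x =
      tder (𝓡 (2 * n)) (𝓡 (2 * n + 1)) (Subtype.val : F → M) ⟨ι x, hι x⟩ ∘L
        tder I (𝓡 (2 * n)) (fun z => (⟨ι z, hι z⟩ : F)) x :=
  tder_comp (G := (Subtype.val : F → M)) (F := fun z => (⟨ι z, hι z⟩ : F))
    ((contMDiff_val hF).mdifferentiable (by simp) _)
    ((contMDiffAt_lift hF hι hs).mdifferentiableAt (by simp))

/-- Injectivity is inherited from the composition with the inclusion, and the dimensions agree. -/
theorem bijective_tder_lift [FiniteDimensional ℝ E] (hE : Module.finrank ℝ E = 2 * n)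
    (hF : IsSmoothEmbedding (𝓡 (2 * n)) (𝓡 (2 * n + 1)) ∞ (Subtype.val : F → M)) {ι : P → M}
    (hι : ∀ x, ι x ∈ F) {x : P} (hs : ContMDiffAt I (𝓡 (2 * n + 1)) ∞ ι x)
    (hinj : Function.Injective (tder I (𝓡 (2 * n + 1)) ι x)) :
    Function.Bijective (tder I (𝓡 (2 * n)) (fun z => (⟨ι z, hι z⟩ : F)) x) := by
  have h1 : Function.Injective (tder I (𝓡 (2 * n)) (fun z => (⟨ι z, hι z⟩ : F)) x) := by
    rw [tder_lift hF hι hs] at hinj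
    exact Function.Injective.of_comp (f := tder (𝓡 (2 * n)) (𝓡 (2 * n + 1)) _ _) hinj
  refine ⟨h1, ?_⟩
  exact (LinearMap.injective_iff_surjective_of_finrank_eq_finrank
    (f := (tder I (𝓡 (2 * n)) (fun z => (⟨ι z, hι z⟩ : F)) x).toLinearMap) (by simp [hE])).1 h1

/-- The pullback under `ι` factors through the restriction to `F`. Vectors on which its top power is
nonzero are mapped to vectors of `F` with the same value. -/
theorem notMem_foldLocus_lift [FiniteDimensional ℝ E] (hE : Module.finrank ℝ E = 2 * n)
    (hF : IsSmoothEmbedding (𝓡 (2 * n)) (𝓡 (2 * n + 1)) ∞ (Subtype.val : F → M)) {ι : P → M}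
    (hι : ∀ x, ι x ∈ F) {x : P} (hs : ContMDiffAt I (𝓡 (2 * n + 1)) ∞ ι x)
    (ζ : DForm (𝓡 (2 * n + 1)) M 2)
    (hnd : ∀ v, (∀ w, fval (pullback (𝓡 (2 * n + 1)) I ι ζ) x ![v, w] = 0) → v = 0) :
    (⟨ι x, hι x⟩ : F) ∉
      foldLocus n (pullback (𝓡 (2 * n + 1)) (𝓡 (2 * n)) (Subtype.val : F → M) ζ) := by
  intro h
  obtain ⟨v, hv⟩ := exists_wedgePow_ne_zero hE (fval (pullback (𝓡 (2 * n + 1)) I ι ζ) x) hnd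
  refine hv ?_
  have h1 := h (fun i => tder I (𝓡 (2 * n)) (fun z => (⟨ι z, hι z⟩ : F)) x (v i))
  rw [fval_pullback, tder_lift hF hι hs]
  rw [wedgePow_comp]
  have h2 := wedgePow_comp n (fval ζ (ι x))
    (tder (𝓡 (2 * n)) (𝓡 (2 * n + 1)) (Subtype.val : F → M) ⟨ι x, hι x⟩)
    (fun i => tder I (𝓡 (2 * n)) (fun z => (⟨ι z, hι z⟩ : F)) x (v i))
  exact h2.symm.trans h1

end Lift

/-! ### Restriction to the fibers of the projection. -/

section Restriction

set_option linter.unusedSectionVars false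

open Filter

variable {n : ℕ} [NeZero n]
  {S₁ : Type*} [TopologicalSpace S₁] [ChartedSpace (EuclideanHalfSpace (2 * n)) S₁]
  [IsManifold (𝓡∂ (2 * n)) ∞ S₁]
  {S₂ : Type*} [TopologicalSpace S₂] [ChartedSpace (EuclideanHalfSpace (2 * n)) S₂]
  [IsManifold (𝓡∂ (2 * n)) ∞ S₂]
  {Y : Type*} [TopologicalSpace Y] [ChartedSpace (EuclideanSpace ℝ (Fin (2 * n - 1))) Y]
  [IsManifold (𝓡 (2 * n - 1)) ∞ Y]
  {β₁ : DForm (𝓡∂ (2 * n)) S₁ 1} {β₂ : DForm (𝓡∂ (2 * n)) S₂ 1}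
  {φ₁ : S₁ ≃ₘ^∞⟮𝓡∂ (2 * n), 𝓡∂ (2 * n)⟯ S₁} {φ₂ : S₂ ≃ₘ^∞⟮𝓡∂ (2 * n), 𝓡∂ (2 * n)⟯ S₂}
  {c₁ : Y × ℝ → S₁} {c₂ : Y × ℝ → S₂} {a₁ a₂ : ℝ → ℝ} {r : ℝ}
  [ChartedSpace (EuclideanSpace ℝ (Fin (2 * n + 1))) (FoldedSumC φ₁ φ₂ c₁ c₂)]
  [IsManifold (𝓡 (2 * n + 1)) ∞ (FoldedSumC φ₁ φ₂ c₁ c₂)]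

/-- The restriction of the differential of a bundle form to the fibers is `dβ`. -/
theorem fval_extD_bundleForm_fiber (h₁ : SideData β₁ φ₁ c₁ a₁ r) (K : ℝ) (p : S₁ × ℝ)
    (v w : EuclideanSpace ℝ (Fin (2 * n))) :
    fval (extD ((𝓡∂ (2 * n)).prod 𝓘(ℝ, ℝ)) (bundleForm n β₁ φ₁ a₁ K)) p ![(v, 0), (w, 0)] =
      fval (extD (𝓡∂ (2 * n)) β₁) p.1 ![v, w] := by
  obtain ⟨F, hF⟩ := exists_finset_weight h₁.weight.compact p.2
  rw [(bundleForm_local h₁.smooth h₁.preserves h₁.weight hF).2]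
  simp

/-- The projection of the folded sum of the two mapping tori. -/
abbrev circleProj (φ₁ : S₁ ≃ₘ^∞⟮𝓡∂ (2 * n), 𝓡∂ (2 * n)⟯ S₁)
    (φ₂ : S₂ ≃ₘ^∞⟮𝓡∂ (2 * n), 𝓡∂ (2 * n)⟯ S₂) (c₁ : Y × ℝ → S₁) (c₂ : Y × ℝ → S₂) :
    FoldedSumC φ₁ φ₂ c₁ c₂ → AddCircle (1 : ℝ) :=
  FoldedSum.proj φ₁ φ₂ (fun y => c₁ (y, 0)) (fun y => c₂ (y, 0))

theorem circleProj_collar (p : Y × ℝ × ℝ) :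
    circleProj φ₁ φ₂ c₁ c₂ (collar φ₁ φ₂ c₁ c₂ p) = (p.2.2 : AddCircle (1 : ℝ)) := by
  rw [collar]
  split_ifs <;> rfl

theorem circleProj_inc₁ (p : S₁ × ℝ) :
    circleProj φ₁ φ₂ c₁ c₂ (inc₁ φ₁ φ₂ c₁ c₂ p) = (p.2 : AddCircle (1 : ℝ)) := rfl

theorem circleProj_inc₂ (p : S₂ × ℝ) :
    circleProj φ₁ φ₂ c₁ c₂ (inc₂ φ₁ φ₂ c₁ c₂ p) = (p.2 : AddCircle (1 : ℝ)) := rfl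

/-- The fold of the folded sum of the two mapping tori. -/
abbrev foldSet (φ₁ : S₁ ≃ₘ^∞⟮𝓡∂ (2 * n), 𝓡∂ (2 * n)⟯ S₁)
    (φ₂ : S₂ ≃ₘ^∞⟮𝓡∂ (2 * n), 𝓡∂ (2 * n)⟯ S₂) (c₁ : Y × ℝ → S₁) (c₂ : Y × ℝ → S₂) :
    Set (FoldedSumC φ₁ φ₂ c₁ c₂) :=
  FoldedSum.fold φ₁ φ₂ (fun y => c₁ (y, 0)) (fun y => c₂ (y, 0))

theorem mem_foldSet {m : FoldedSumC φ₁ φ₂ c₁ c₂} :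
    m ∈ foldSet φ₁ φ₂ c₁ c₂ ↔ ∃ (y : Y) (s : ℝ), m = collar φ₁ φ₂ c₁ c₂ (y, 0, s) := by
  have h : ∀ (y : Y) (s : ℝ), collar φ₁ φ₂ c₁ c₂ (y, 0, s) =
      FoldedSum.incl₁ φ₁ φ₂ (fun y => c₁ (y, 0)) (fun y => c₂ (y, 0)) (c₁ (y, 0), s) := by
    intro y s
    rw [collar, if_pos le_rfl]
    simp only [neg_zero]
  simp only [h]
  rfl

theorem collar_mem_foldSet_iff (h₁ : SideData β₁ φ₁ c₁ a₁ r) (h₂ : SideData β₂ φ₂ c₂ a₂ r)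
    {p : Y × ℝ × ℝ} (hp : |p.2.1| < r) :
    collar φ₁ φ₂ c₁ c₂ p ∈ foldSet φ₁ φ₂ c₁ c₂ ↔ p.2.1 = 0 := by
  rw [mem_foldSet]
  constructor
  · rintro ⟨y, s, h⟩
    obtain ⟨k, hk⟩ := eq_shiftMap_of_collar_eq h₁ h₂ hp (q := (y, 0, s)) (by simpa using h₁.pos) h
    exact (congrArg (fun q : Y × ℝ × ℝ => q.2.1) hk).symm
  · intro h
    exact ⟨p.1, p.2.2, by rw [← h]⟩

variable {σ : DForm (𝓡 (2 * n + 1)) (FoldedSumC φ₁ φ₂ c₁ c₂) 1} {α : DForm (𝓡 (2 * n - 1)) Y 1}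
  {C K δ : ℝ}

/-- The slice of the collar over the parameter `s`. -/
def collarSlice (φ₁ : S₁ ≃ₘ^∞⟮𝓡∂ (2 * n), 𝓡∂ (2 * n)⟯ S₁)
    (φ₂ : S₂ ≃ₘ^∞⟮𝓡∂ (2 * n), 𝓡∂ (2 * n)⟯ S₂) (c₁ : Y × ℝ → S₁) (c₂ : Y × ℝ → S₂) (s : ℝ) :
    Y × ℝ → FoldedSumC φ₁ φ₂ c₁ c₂ :=
  collar φ₁ φ₂ c₁ c₂ ∘ slice s

theorem contMDiffAt_collarSlice (hM : IsCollarGluing n φ₁ φ₂ c₁ c₂) (hr : r ≤ 1) (s : ℝ)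
    {z : Y × ℝ} (hz : |z.2| < r) :
    ContMDiffAt ((𝓡 (2 * n - 1)).prod 𝓘(ℝ, ℝ)) (𝓡 (2 * n + 1)) ∞ (collarSlice φ₁ φ₂ c₁ c₂ s) z :=
  (collar_localDiffeo hM hr (p := slice s z) hz).contMDiffAt.comp z (contMDiff_slice s).contMDiffAt

theorem tder_collarSlice (hM : IsCollarGluing n φ₁ φ₂ c₁ c₂) (hr : r ≤ 1) (s : ℝ)
    {z : Y × ℝ} (hz : |z.2| < r) :
    tder ((𝓡 (2 * n - 1)).prod 𝓘(ℝ, ℝ)) (𝓡 (2 * n + 1)) (collarSlice φ₁ φ₂ c₁ c₂ s) z =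
      tder ((𝓡 (2 * n - 1)).prod (𝓘(ℝ, ℝ).prod 𝓘(ℝ, ℝ))) (𝓡 (2 * n + 1)) (collar φ₁ φ₂ c₁ c₂)
        (slice s z) ∘L
      tder ((𝓡 (2 * n - 1)).prod 𝓘(ℝ, ℝ)) ((𝓡 (2 * n - 1)).prod (𝓘(ℝ, ℝ).prod 𝓘(ℝ, ℝ)))
        (slice s) z :=
  tder_comp ((collar_localDiffeo hM hr (p := slice s z) hz).contMDiffAt.mdifferentiableAt (by simp))
    ((contMDiff_slice s).mdifferentiable (by simp) z)

theorem injective_tder_collarSlice (hM : IsCollarGluing n φ₁ φ₂ c₁ c₂) (hr : r ≤ 1) (s : ℝ)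
    {z : Y × ℝ} (hz : |z.2| < r) :
    Function.Injective (tder ((𝓡 (2 * n - 1)).prod 𝓘(ℝ, ℝ)) (𝓡 (2 * n + 1))
      (collarSlice φ₁ φ₂ c₁ c₂ s) z) := by
  rw [tder_collarSlice hM hr s hz, ContinuousLinearMap.coe_comp]
  refine (collar_localDiffeo hM hr (p := slice s z) hz).tder_bijective.1.comp ?_
  intro v w hvw
  have hvw' := ((tder_slice s z v).symm.trans hvw).trans (tder_slice s z w)
  rw [Prod.mk.injEq, Prod.mk.injEq] at hvw'
  exact Prod.ext hvw'.1 hvw'.2.1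

theorem IsGlued.extD_collarSlice (hσ : IsGlued σ α β₁ β₂ a₁ a₂ C K δ r)
    (hM : IsCollarGluing n φ₁ φ₂ c₁ c₂) (hr : r ≤ 1) (hs : ∀ m, SmoothAt σ m) (s : ℝ) {z : Y × ℝ}
    (hz : |z.2| < r) (v w : EuclideanSpace ℝ (Fin (2 * n - 1)) × ℝ) :
    fval (pullback (𝓡 (2 * n + 1)) ((𝓡 (2 * n - 1)).prod 𝓘(ℝ, ℝ)) (collarSlice φ₁ φ₂ c₁ c₂ s)
      (extD _ σ)) z ![v, w] =
    fval (extD _ (glueForm α (colForm c₁ β₁) (colForm c₂ β₂) C K δ)) (slice s z)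
      ![(v.1, v.2, 0), (w.1, w.2, 0)] := by
  have hd := collar_localDiffeo hM hr (p := slice s z) hz
  rw [fval_extD_of_pullback hd.contMDiffAt (hσ.eventually_collar (p := slice s z) hz) (hs _),
    fval_pullback, tder_collarSlice hM hr s hz, comp_apply_two, comp_apply_two]
  simp only [ContinuousLinearMap.comp_apply, tder_slice]
  rfl

theorem IsGlued.pullback_collarSlice (hσ : IsGlued σ α β₁ β₂ a₁ a₂ C K δ r)
    (hM : IsCollarGluing n φ₁ φ₂ c₁ c₂) (hr : r ≤ 1) (hδ : 0 < δ) (hδr : δ ≤ r) (s : ℝ)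
    {z : Y × ℝ} (hz : |z.2| < δ) :
    fval (pullback (𝓡 (2 * n + 1)) ((𝓡 (2 * n - 1)).prod 𝓘(ℝ, ℝ)) (collarSlice φ₁ φ₂ c₁ c₂ s)
      σ) z = fval (warpForm α (foldF C)) z := by
  refine one_ext fun v => ?_
  have h1 := hσ.collar (slice s z) (hz.trans_le hδr)
  rw [fval_pullback, fval_glueForm_of_lt hδ (p := slice s z) hz] at h1
  have h2 := DFunLike.congr_fun h1 ![((v.1, v.2, 0) :
    EuclideanSpace ℝ (Fin (2 * n - 1)) × ℝ × ℝ)]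
  rw [comp_apply_one, fval_foldForm] at h2
  rw [fval_pullback, tder_collarSlice hM hr s (hz.trans_le hδr), comp_apply_one, fval_combForm,
    ContinuousLinearMap.comp_apply, tder_slice]
  refine h2.trans ?_
  simp [slice]

/-- Each point of the fiber lies on a slice that maps into the fiber: a slice of the collar, or a
copy of `S₁` or `S₂`. Off the fold the pullback of `dσ` to the slice is nondegenerate, being the
differential of the side form or `dβ`. At the fold the collar slice gives `(C - t²) α`, and
`fold_point` applies. -/
theorem IsGlued.restrictsToFolded [CompactSpace Y] [T2Space S₁] [T2Space S₂]
    (hσ : IsGlued σ α β₁ β₂ a₁ a₂ C K δ r) (h₁ : SideData β₁ φ₁ c₁ a₁ r)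
    (h₂ : SideData β₂ φ₂ c₂ a₂ r) (hM : IsCollarGluing n φ₁ φ₂ c₁ c₂) (hα : ∀ y, SmoothAt α y)
    (hcont : ∀ y, ContactPt (fval α y) (fval (extD (𝓡 (2 * n - 1)) α) y))
    (hg₁ : GoodSide α (colForm c₁ β₁) C δ r) (hg₂ : GoodSide α (colForm c₂ β₂) C δ r)
    (hC : 1 < C) (hK : 0 < K) (hδ : 0 < δ) (hδr : 2 * δ < r)
    (hn₁ : ∀ (x : S₁) v, (∀ w, fval (extD (𝓡∂ (2 * n)) β₁) x ![v, w] = 0) → v = 0)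
    (hn₂ : ∀ (x : S₂) v, (∀ w, fval (extD (𝓡∂ (2 * n)) β₂) x ![v, w] = 0) → v = 0)
    (hs : ∀ m, SmoothAt σ m) (θ : AddCircle (1 : ℝ)) :
    RestrictsToFolded n σ (circleProj φ₁ φ₂ c₁ c₂ ⁻¹' {θ}) (foldSet φ₁ φ₂ c₁ c₂) := by
  have hδ1 : 2 * δ < 1 := hδr.trans_le h₁.le_one
  generalize hFdef : circleProj φ₁ φ₂ c₁ c₂ ⁻¹' {θ} = F
  have hmem : ∀ m, m ∈ F ↔ circleProj φ₁ φ₂ c₁ c₂ m = θ := fun m => by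
    rw [← hFdef]
    rfl
  intro _ _ hF
  set lam := pullback (𝓡 (2 * n + 1)) (𝓡 (2 * n)) (Subtype.val : F → FoldedSumC φ₁ φ₂ c₁ c₂) σ
    with hlam
  have hval := contMDiff_val hF
  have hlams : ∀ x, SmoothAt lam x := fun x =>
    SmoothAt.pullback (F := (Subtype.val : F → FoldedSumC φ₁ φ₂ c₁ c₂)) (hs _) (hval x)
  -- The restriction of `dσ` is the differential of the restriction of `σ`, which is the required
  -- primitive.
  have hζ : pullback (𝓡 (2 * n + 1)) (𝓡 (2 * n)) (Subtype.val : F → FoldedSumC φ₁ φ₂ c₁ c₂)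
      (extD _ σ) = extD _ lam := by
    funext x
    exact (fval_extD_pullback (hs _) (hval x)).symm
  have hoff : ∀ q : F, q.1 ∉ foldSet φ₁ φ₂ c₁ c₂ → q ∉ foldLocus n (extD _ lam) := by
    rw [← hζ]
    rintro ⟨m, hm⟩ hq
    rcases exists_chart_point (φ₁ := φ₁) (φ₂ := φ₂) (c₁ := c₁) (c₂ := c₂) hδr m with
      ⟨p, hp, rfl⟩ | ⟨p, hp, rfl⟩ | ⟨p, hp, rfl⟩
    · have hp0 : p.2.1 ≠ 0 := fun h => hq ((collar_mem_foldSet_iff h₁ h₂ hp).2 h)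
      have hι : ∀ z, collarSlice φ₁ φ₂ c₁ c₂ p.2.2 z ∈ F := by
        intro z
        rw [hmem, collarSlice, Function.comp_apply, circleProj_collar]
        exact (circleProj_collar p).symm.trans ((hmem _).1 hm)
      refine notMem_foldLocus_lift finrank_prod_real hF hι (x := (p.1, p.2.1))
        (contMDiffAt_collarSlice hM h₁.le_one _ hp) (extD _ σ) ?_
      intro v hv
      have hnd := (glueForm_props hα hcont hg₁ hg₂ hC hK hδ (by linarith) hp).2.2 hp0
      have h0 := hnd (v.1, v.2, 0) rfl (fun w hw => by
        have := hv (w.1, w.2.1)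
        rw [hσ.extD_collarSlice hM h₁.le_one hs p.2.2 (z := (p.1, p.2.1)) hp] at this
        rw [show w = (w.1, w.2.1, 0) from Prod.ext rfl (Prod.ext rfl hw)]
        exact this)
      rw [Prod.mk_eq_zero, Prod.mk_eq_zero] at h0
      exact Prod.ext h0.1 h0.2.1
    · have hι : ∀ x, (FoldedContact.inc₁ φ₁ φ₂ c₁ c₂ ∘ fun x => (x, p.2)) x ∈ F := fun x =>
        (hmem _).2 ((circleProj_inc₁ p).symm.trans ((hmem _).1 hm))
      have hd := inc₁_localDiffeo hM h₁.isCollar hδ hp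
      have hsl : ContMDiffAt (𝓡∂ (2 * n)) ((𝓡∂ (2 * n)).prod 𝓘(ℝ, ℝ)) ∞ (fun x : S₁ => (x, p.2))
        p.1 := (contMDiff_prodMk_const p.2).contMDiffAt
      have hιs := ContMDiffAt.comp (g := FoldedContact.inc₁ φ₁ φ₂ c₁ c₂) p.1 hd.contMDiffAt hsl
      refine notMem_foldLocus_lift (by simp) hF hι (x := p.1) hιs (extD _ σ) ?_
      intro v hv
      refine hn₁ p.1 v fun w => ?_
      have h1 := hv w
      rw [fval_pullback, tder_comp (hd.contMDiffAt.mdifferentiableAt (by simp))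
        (hsl.mdifferentiableAt (by simp)), comp_apply_two] at h1
      simp only [ContinuousLinearMap.comp_apply, tder_prodMk_const] at h1
      rw [← fval_extD_bundleForm_fiber h₁ K p, fval_extD_of_pullback hd.contMDiffAt
        (hσ.eventually_inc₁ h₁.isCollar hδ1 hp) (hs _), comp_apply_two]
      exact h1
    · have hι : ∀ x, (FoldedContact.inc₂ φ₁ φ₂ c₁ c₂ ∘ fun x => (x, p.2)) x ∈ F := fun x =>
        (hmem _).2 ((circleProj_inc₂ p).symm.trans ((hmem _).1 hm))
      have hd := inc₂_localDiffeo hM h₂.isCollar hδ hp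
      have hsl : ContMDiffAt (𝓡∂ (2 * n)) ((𝓡∂ (2 * n)).prod 𝓘(ℝ, ℝ)) ∞ (fun x : S₂ => (x, p.2))
        p.1 := (contMDiff_prodMk_const p.2).contMDiffAt
      have hιs := ContMDiffAt.comp (g := FoldedContact.inc₂ φ₁ φ₂ c₁ c₂) p.1 hd.contMDiffAt hsl
      refine notMem_foldLocus_lift (by simp) hF hι (x := p.1) hιs (extD _ σ) ?_
      intro v hv
      refine hn₂ p.1 v fun w => ?_
      have h1 := hv w
      rw [fval_pullback, tder_comp (hd.contMDiffAt.mdifferentiableAt (by simp))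
        (hsl.mdifferentiableAt (by simp)), comp_apply_two] at h1
      simp only [ContinuousLinearMap.comp_apply, tder_prodMk_const] at h1
      rw [← fval_extD_bundleForm_fiber h₂ (-K) p, fval_extD_of_pullback hd.contMDiffAt
        (hσ.eventually_inc₂ h₂.isCollar hδ1 hp) (hs _), comp_apply_two]
      exact h1
  have hon : ∀ q : F, q.1 ∈ foldSet φ₁ φ₂ c₁ c₂ → q ∈ foldLocus n (extD _ lam) ∧
      (∃ w v, topPowDeriv n (extD _ lam) q w v ≠ 0) ∧
      ∃ z : Fin (n - 1) × Fin 2 → EuclideanSpace ℝ (Fin (2 * n)),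
        (∀ i v, topPowDeriv n (extD _ lam) q (z i) v = 0) ∧
        wedgePow (n - 1) (inChart (𝓡 (2 * n)) (extD _ lam) q (extChartAt (𝓡 (2 * n)) q q)) z ≠ 0 := by
    rintro ⟨m, hm⟩ hq
    obtain ⟨y, s, rfl⟩ := mem_foldSet.1 hq
    have hι : ∀ z, collarSlice φ₁ φ₂ c₁ c₂ s z ∈ F := by
      intro z
      rw [hmem, collarSlice, Function.comp_apply, circleProj_collar]
      exact (circleProj_collar (y, 0, s)).symm.trans ((hmem _).1 hm)
    have hnear : ∀ ε > 0, ∀ᶠ z : Y × ℝ in 𝓝 (y, (0 : ℝ)), |z.2| < ε := by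
      intro ε hε
      have : ContinuousAt (fun z : Y × ℝ => |z.2|) (y, 0) := by fun_prop
      exact this.eventually (Iio_mem_nhds (by simpa using hε))
    have h0r : |((y, (0 : ℝ)) : Y × ℝ).2| < r := by simpa using h₁.pos
    refine fold_point (G := fun z => (⟨collarSlice φ₁ φ₂ c₁ c₂ s z, hι z⟩ : F)) (y := y) (α := α)
      (C := C) (by linarith) hlams ?_ ?_ hα (hcont y) ?_
    · filter_upwards [hnear r h₁.pos] with z hz
      exact contMDiffAt_lift hF hι (contMDiffAt_collarSlice hM h₁.le_one s hz)
    · exact bijective_tder_lift finrank_prod_real hF hι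
        (contMDiffAt_collarSlice hM h₁.le_one s h0r)
        (injective_tder_collarSlice hM h₁.le_one s h0r)
    · filter_upwards [hnear δ hδ] with z hz
      have hz' : |z.2| < r := hz.trans (by linarith)
      rw [← hσ.pullback_collarSlice hM h₁.le_one hδ (by linarith) s hz, hlam]
      exact (fval_pullback_comp (G := (Subtype.val : F → FoldedSumC φ₁ φ₂ c₁ c₂))
        (F := fun z => (⟨collarSlice φ₁ φ₂ c₁ c₂ s z, hι z⟩ : F)) σ
        (hval.mdifferentiable (by simp) _)
        ((contMDiffAt_lift hF hι
          (contMDiffAt_collarSlice hM h₁.le_one s hz')).mdifferentiableAt (by simp))).symm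
  have hlocus : ∀ q : F, q ∈ foldLocus n (extD _ lam) → q.1 ∈ foldSet φ₁ φ₂ c₁ c₂ := fun q hq => by
    by_contra h
    exact hoff q h hq
  rw [hζ]
  refine ⟨⟨⟨lam, isSmoothForm_iff.2 hlams, fun _ => rfl⟩, fun q hq => (hon q (hlocus q hq)).2.1,
    fun q hq => (hon q (hlocus q hq)).2.2⟩, ?_⟩
  ext q
  exact ⟨hlocus q, fun h => (hon q h).1⟩

end Restriction

/-! ### Existence of the collar size and of the cutoff scale. -/

section Parameters

set_option linter.unusedSectionVars false

open Filter

variable {n : ℕ} [NeZero n] {S : Type*} [TopologicalSpace S]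
  [ChartedSpace (EuclideanHalfSpace (2 * n)) S] [IsManifold (𝓡∂ (2 * n)) ∞ S]
  {Y : Type*} [TopologicalSpace Y] [ChartedSpace (EuclideanSpace ℝ (Fin (2 * n - 1))) Y]
  [IsManifold (𝓡 (2 * n - 1)) ∞ Y] {c : Y × ℝ → S} {β : DForm (𝓡∂ (2 * n)) S 1}
  {φ : S ≃ₘ^∞⟮𝓡∂ (2 * n), 𝓡∂ (2 * n)⟯ S}

theorem exists_fixed_collar [CompactSpace Y] (hc : IsCollar n c) (hφ : IsExactMonodromy n β φ) :
    ∃ κ > 0, ∀ y, ∀ t ∈ Ico 0 κ, ∀ᶠ x in 𝓝 (c (y, t)), φ x = x := by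
  have h : ∀ᶠ t in 𝓝[≥] (0 : ℝ), ∀ y ∈ (univ : Set Y), ∀ᶠ x in 𝓝 (c (y, t)), φ x = x := by
    refine eventually_forall_of_isCompact isCompact_univ
      (p := fun y t => ∀ᶠ x in 𝓝 (c (y, t)), φ x = x) fun y _ => ?_
    have h1 : ∀ᶠ x in 𝓝 (c (y, 0)), φ x = x := by
      have hy : c (y, 0) ∈ (𝓡∂ (2 * n)).boundary S := hc.boundary_eq ▸ mem_range_self y
      exact hφ.id_near_boundary.filter_mono (nhds_le_nhdsSet hy)
    have h2 : Tendsto c (𝓝 y ×ˢ 𝓝[≥] (0 : ℝ)) (𝓝 (c (y, 0))) := by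
      have := hc.smooth.continuousOn (y, 0) ⟨mem_univ _, by simp⟩
      rwa [ContinuousWithinAt, nhdsWithin_prod_eq, nhdsWithin_univ,
        nhdsWithin_Ico_eq_nhdsGE one_pos] at this
    exact h2.eventually h1.eventually_nhds
  obtain ⟨κ, hκ, hsub⟩ := mem_nhdsGE_iff_exists_Ico_subset.1 h
  exact ⟨κ, hκ, fun y t ht => hsub ht y (mem_univ y)⟩

/-- One large `L` is fixed from the eventual statement, and the scale `δ₀ = 1/L²` is what
`cut_dichotomy` requires. The bound `r₀` does not depend on `δ`, so the collar size can be fixed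
before the cutoff scale. -/
theorem exists_goodSide [CompactSpace Y] (hβ : IsConvexExactSymplectic n β)
    (hc : IsCollar n c) {α : DForm (𝓡 (2 * n - 1)) Y 1} (hα : ∀ y, SmoothAt α y)
    (hcont : ∀ y, ContactPt (fval α y) (fval (extD (𝓡 (2 * n - 1)) α) y)) {h : Y → ℝ}
    (hpos : ∀ y, 0 < h y) (hh : ∀ y, fval (bdryForm c β) y = h y • fval α y)
    {C : ℝ} (hC : ∀ y, h y < C) :
    ∃ r₀ > 0, ∃ δ₀ > 0, ∀ r ≤ r₀, r ≤ 1 → ∀ δ ≤ δ₀, 0 < δ → GoodSide α (colForm c β) C δ r := by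
  obtain ⟨U, hU, V, hV, hUV⟩ :=
    mem_prod_iff.1 (eventually_side_nondegenerate hβ hc hα hcont hpos hh hC)
  obtain ⟨r₀, hr₀, hsub⟩ := mem_nhdsGT_iff_exists_Ioo_subset.1 hU
  obtain ⟨L, hL⟩ := ((eventually_gt_atTop (0 : ℝ)).and hV).exists
  have hLpos : 0 < L := hL.1
  refine ⟨r₀, hr₀, (L ^ 2)⁻¹, by positivity, fun r hr hr1 δ hδ hδ0 => ?_⟩
  have hLδ : L ^ 2 * δ ≤ 1 := by
    calc L ^ 2 * δ ≤ L ^ 2 * (L ^ 2)⁻¹ := by gcongr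
      _ = 1 := mul_inv_cancel₀ (by positivity)
  have hmem : ∀ t ∈ Ioo 0 r, t ∈ Ioo (0 : ℝ) 1 := fun t ht => ⟨ht.1, ht.2.trans_le hr1⟩
  refine ⟨fun y t ht => smoothAt_sideForm C δ (hα y) (smoothAt_colForm hβ hc y (hmem t ht)),
    fun y t ht v hv => ?_⟩
  have hz : ((t, L) : ℝ × ℝ) ∈ U ×ˢ V := ⟨hsub ⟨ht.1, ht.2.trans_le hr⟩, hL.2⟩
  refine hUV hz y (mem_univ y) (cut δ t) (cut_mem δ t) (deriv (cut δ) t) (deriv_cut_nonneg hδ0 t)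
    (cut_dichotomy hδ0 hLpos hLδ t) v fun w => ?_
  rw [← hv w, fval_extD_sideForm C δ (p := (y, t)) (hα y) (smoothAt_colForm hβ hc y (hmem t ht))]

theorem fval_interpForm (α : DForm (𝓡 (2 * n - 1)) Y 1) (f g : ℝ → ℝ) (p : Y × ℝ × ℝ) :
    fval (interpForm n α f g) p = fval (foldForm α f g) p := by
  refine one_ext fun v => ?_
  have h : fval (interpForm n α f g) p ![v] =
      f p.2.1 * fval (pullback (𝓡 (2 * n - 1)) ((𝓡 (2 * n - 1)).prod (𝓘(ℝ, ℝ).prod 𝓘(ℝ, ℝ)))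
        (Prod.fst : Y × ℝ × ℝ → Y) α) p ![v] +
      g p.2.1 * fval (dFun ((𝓡 (2 * n - 1)).prod (𝓘(ℝ, ℝ).prod 𝓘(ℝ, ℝ)))
        (fun q : Y × ℝ × ℝ => q.2.2)) p ![v] := rfl
  rw [h, fval_foldForm, fval_pullback, comp_apply_one, tder_fst, fval_dFun, tder_snd_snd]
  rfl

theorem mem_farSet {δ κ : ℝ} (hδ : 2 * δ < κ) {x : S} (hx : x ∉ c '' (univ ×ˢ Ico 0 κ)) :
    x ∈ farSet c δ := by
  rintro ⟨z, hz, rfl⟩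
  exact hx ⟨z, ⟨mem_univ _, hz.2.1, hz.2.2.trans_lt hδ⟩, rfl⟩

end Parameters

end FoldedContact

end

/-! ### The theorem: choice of the constants. -/

open FoldedContact in
theorem mainTheorem3 (n : ℕ) [NeZero n]
    {S₁ : Type*} [TopologicalSpace S₁] [T2Space S₁] [CompactSpace S₁]
    [ChartedSpace (EuclideanHalfSpace (2 * n)) S₁] [IsManifold (𝓡∂ (2 * n)) ∞ S₁]
    {S₂ : Type*} [TopologicalSpace S₂] [T2Space S₂] [CompactSpace S₂]
    [ChartedSpace (EuclideanHalfSpace (2 * n)) S₂] [IsManifold (𝓡∂ (2 * n)) ∞ S₂]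
    {Y : Type*} [TopologicalSpace Y] [T2Space Y] [CompactSpace Y]
    [ChartedSpace (EuclideanSpace ℝ (Fin (2 * n - 1))) Y] [IsManifold (𝓡 (2 * n - 1)) ∞ Y]
    -- the fibers and the monodromies
    (β₁ : DForm (𝓡∂ (2 * n)) S₁ 1) (hβ₁ : IsConvexExactSymplectic n β₁)
    (β₂ : DForm (𝓡∂ (2 * n)) S₂ 1) (hβ₂ : IsConvexExactSymplectic n β₂)
    (φ₁ : S₁ ≃ₘ^∞⟮𝓡∂ (2 * n), 𝓡∂ (2 * n)⟯ S₁) (hφ₁ : IsExactMonodromy n β₁ φ₁)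
    (φ₂ : S₂ ≃ₘ^∞⟮𝓡∂ (2 * n), 𝓡∂ (2 * n)⟯ S₂) (hφ₂ : IsExactMonodromy n β₂ φ₂)
    -- the collars of the common boundary
    (c₁ : Y × ℝ → S₁) (hc₁ : IsCollar n c₁) (c₂ : Y × ℝ → S₂) (hc₂ : IsCollar n c₂)
    -- the induced co-oriented contact structures on the common boundary coincide
    (hY : ∀ y : Y, ∃ h : ℝ, 0 < h ∧
      pullback (𝓡∂ (2 * n)) (𝓡 (2 * n - 1)) (fun y => c₂ (y, 0)) β₂ y =
        h • pullback (𝓡∂ (2 * n)) (𝓡 (2 * n - 1)) (fun y => c₁ (y, 0)) β₁ y)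
    -- the smooth structure of the folded sum
    [ChartedSpace (EuclideanSpace ℝ (Fin (2 * n + 1))) (FoldedSumC φ₁ φ₂ c₁ c₂)]
    [IsManifold (𝓡 (2 * n + 1)) ∞ (FoldedSumC φ₁ φ₂ c₁ c₂)]
    (hM : IsCollarGluing n φ₁ φ₂ c₁ c₂)
    (κ : ℝ) (hκ : κ ∈ Set.Ioo (0 : ℝ) 1) :
    ∃ σ : DForm (𝓡 (2 * n + 1)) (FoldedSumC φ₁ φ₂ c₁ c₂) 1,
      IsContactForm (𝓡 (2 * n + 1)) σ ∧
      -- compatibility with the projection, the fold of each fiber being the copy of `Y`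
      (∀ θ : AddCircle (1 : ℝ), RestrictsToFolded n σ
        (FoldedSum.proj φ₁ φ₂ (fun y => c₁ (y, 0)) (fun y => c₂ (y, 0)) ⁻¹' {θ})
        (FoldedSum.fold φ₁ φ₂ (fun y => c₁ (y, 0)) (fun y => c₂ (y, 0)))) ∧
      -- away from the collar, `σ` is given by bundle contact forms of the two mapping tori
      (∃ (K : ℝ) (a₁ a₂ : ℝ → ℝ), 0 < K ∧ IsPeriodicWeight a₁ ∧ IsPeriodicWeight a₂ ∧
        IsContactForm ((𝓡∂ (2 * n)).prod 𝓘(ℝ, ℝ)) (bundleForm n β₁ φ₁ a₁ K) ∧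
        IsContactForm ((𝓡∂ (2 * n)).prod 𝓘(ℝ, ℝ)) (bundleForm n β₂ φ₂ a₂ (-K)) ∧
        (∀ x ∉ c₁ '' (Set.univ ×ˢ Set.Ico 0 κ), ∀ t : ℝ,
          pullback (𝓡 (2 * n + 1)) ((𝓡∂ (2 * n)).prod 𝓘(ℝ, ℝ))
            (FoldedSum.incl₁ φ₁ φ₂ (fun y => c₁ (y, 0)) (fun y => c₂ (y, 0))) σ (x, t) =
          bundleForm n β₁ φ₁ a₁ K (x, t)) ∧
        (∀ x ∉ c₂ '' (Set.univ ×ˢ Set.Ico 0 κ), ∀ t : ℝ,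
          pullback (𝓡 (2 * n + 1)) ((𝓡∂ (2 * n)).prod 𝓘(ℝ, ℝ))
            (FoldedSum.incl₂ φ₁ φ₂ (fun y => c₁ (y, 0)) (fun y => c₂ (y, 0))) σ (x, t) =
          bundleForm n β₂ φ₂ a₂ (-K) (x, t))) ∧
      -- near the fold, `σ = f α + g dθ`, where `α` is the contact form on `Y` induced by `β₁`
      (∃ (δ : ℝ) (f g : ℝ → ℝ), 0 < δ ∧ δ < κ ∧ ContDiff ℝ ∞ f ∧ ContDiff ℝ ∞ g ∧
        (∀ t, f (-t) = f t) ∧ (∀ t, g (-t) = -g t) ∧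
        (∀ t, |t| < δ → 0 < f t ∧ 0 < deriv f t * g t - f t * deriv g t ∧
          (deriv f t = 0 ↔ t = 0)) ∧
        (∀ (y : Y) (t s : ℝ), |t| < δ →
          pullback (𝓡 (2 * n + 1)) ((𝓡 (2 * n - 1)).prod (𝓘(ℝ, ℝ).prod 𝓘(ℝ, ℝ)))
            (collar φ₁ φ₂ c₁ c₂) σ (y, t, s) =
          interpForm n (pullback (𝓡∂ (2 * n)) (𝓡 (2 * n - 1)) (fun y => c₁ (y, 0)) β₁) f g
            (y, t, s))) := by
  have hβs₁ := isSmoothForm_iff.1 hβ₁.smooth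
  have hβs₂ := isSmoothForm_iff.1 hβ₂.smooth
  set α : DForm (𝓡 (2 * n - 1)) Y 1 := bdryForm c₁ β₁ with hαdef
  have hα : ∀ y, SmoothAt α y := smoothAt_bdryForm hβ₁ hc₁
  have hcont : ∀ y, ContactPt (fval α y) (fval (extD (𝓡 (2 * n - 1)) α) y) :=
    contactPt_bdryForm hβ₁ hc₁
  choose h hpos hh using hY
  have hh' : ∀ y, fval (bdryForm c₂ β₂) y = h y • fval α y := hh
  have hhc : Continuous h :=
    (contMDiff_ratio hα (smoothAt_bdryForm hβ₂ hc₂) (fun y => (hcont y).1) hh').continuous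
  obtain ⟨B, hB⟩ := (isCompact_range hhc).bddAbove
  -- `C` must exceed the ratio of the boundary form to `α` on both sides, which is `1` on the first
  -- and `h` on the second. That `C > 1` also keeps `C - t²` positive for `|t| ≤ 1`.
  set C : ℝ := max B 1 + 1 with hCdef
  have hC1 : 1 < C := by
    have := le_max_right B 1
    linarith
  have hCh : ∀ y, h y < C := fun y => by
    have h1 := hB (Set.mem_range_self y)
    have h2 := le_max_left B 1
    linarith
  obtain ⟨κ₁, hκ₁, hfix₁⟩ := exists_fixed_collar hc₁ hφ₁
  obtain ⟨κ₂, hκ₂, hfix₂⟩ := exists_fixed_collar hc₂ hφ₂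
  obtain ⟨r₁, hr₁, δ₁, hδ₁, hgood₁⟩ := exists_goodSide hβ₁ hc₁ hα hcont (h := fun _ => 1)
    (fun _ => one_pos) (fun y => (one_smul ℝ (fval α y)).symm) (fun _ => hC1)
  obtain ⟨r₂, hr₂, δ₂, hδ₂, hgood₂⟩ := exists_goodSide hβ₂ hc₂ hα hcont hpos hh' hCh
  -- On the collar of size `r` the monodromies are trivial and the interpolations are symplectic.
  set r : ℝ := min (min κ₁ κ₂) (min (min r₁ r₂) 1) with hrdef
  have hr0 : 0 < r := lt_min (lt_min hκ₁ hκ₂) (lt_min (lt_min hr₁ hr₂) one_pos)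
  have hrκ₁ : r ≤ κ₁ := (min_le_left _ _).trans (min_le_left _ _)
  have hrκ₂ : r ≤ κ₂ := (min_le_left _ _).trans (min_le_right _ _)
  have hrr₁ : r ≤ r₁ := (min_le_right _ _).trans ((min_le_left _ _).trans (min_le_left _ _))
  have hrr₂ : r ≤ r₂ := (min_le_right _ _).trans ((min_le_left _ _).trans (min_le_right _ _))
  have hr1 : r ≤ 1 := (min_le_right _ _).trans (min_le_right _ _)
  -- The interpolation ends at distance `2δ`, which has to lie inside the collar of size `r` and
  -- inside the prescribed one of size `κ`.
  set δ : ℝ := min (min δ₁ δ₂) (min (r / 4) (κ / 4)) with hδdef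
  have hδ0 : 0 < δ := lt_min (lt_min hδ₁ hδ₂) (lt_min (by linarith) (by linarith [hκ.1]))
  have hδδ₁ : δ ≤ δ₁ := (min_le_left _ _).trans (min_le_left _ _)
  have hδδ₂ : δ ≤ δ₂ := (min_le_left _ _).trans (min_le_right _ _)
  have hδr : 2 * δ < r := by
    have : δ ≤ r / 4 := (min_le_right _ _).trans (min_le_left _ _)
    linarith
  have hδκ : 2 * δ < κ := by
    have : δ ≤ κ / 4 := (min_le_right _ _).trans (min_le_right _ _)
    linarith [hκ.1]
  have hg₁ := hgood₁ r hrr₁ hr1 δ hδδ₁ hδ0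
  have hg₂ := hgood₂ r hrr₂ hr1 δ hδδ₂ hδ0
  have hs₁ : SideData β₁ φ₁ c₁ stepWeight r := ⟨hβs₁, preservesD_dpow hβs₁ hφ₁, hc₁,
    isPeriodicWeight_stepWeight, hr0, hr1, fun y t ht => hfix₁ y t ⟨ht.1, ht.2.trans_le hrκ₁⟩⟩
  have hs₂ : SideData β₂ φ₂ c₂ stepWeight r := ⟨hβs₂, preservesD_dpow hβs₂ hφ₂, hc₂,
    isPeriodicWeight_stepWeight, hr0, hr1, fun y t ht => hfix₂ y t ⟨ht.1, ht.2.trans_le hrκ₂⟩⟩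
  -- `K` can be chosen independently of `r` and `δ`: the interpolated forms on the sides do not
  -- involve it, and `g` works for every `K > 0`.
  obtain ⟨K, hK0, hK₁, hK₂⟩ := ((Filter.eventually_gt_atTop (0 : ℝ)).and
    ((eventually_isContactForm_bundleForm hβs₁ hs₁.preserves hβ₁.nondegenerate hs₁.weight).and
      (eventually_isContactForm_bundleForm hβs₂ hs₂.preserves hβ₂.nondegenerate
        hs₂.weight))).exists
  obtain ⟨σ, hσ⟩ := exists_isGlued hs₁ hs₂ hM α C K hδ0
  have hσc := hσ.isContactForm hs₁ hs₂ hM hα hcont hg₁ hg₂ hC1 hK0 hδ0 hδr hK₁.1 hK₂.2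
  refine ⟨σ, hσc, fun θ => hσ.restrictsToFolded hs₁ hs₂ hM hα hcont hg₁ hg₂ hC1 hK0 hδ0 hδr
    hβ₁.nondegenerate hβ₂.nondegenerate (isSmoothForm_iff.1 hσc.smooth) θ,
    ⟨K, stepWeight, stepWeight, hK0, hs₁.weight, hs₂.weight, hK₁.1, hK₂.2,
      fun x hx t => hσ.inc₁ (x, t) (mem_farSet hδκ hx),
      fun x hx t => hσ.inc₂ (x, t) (mem_farSet hδκ hx)⟩,
    ⟨δ, foldF C, foldG K δ, hδ0, by linarith, contDiff_foldF C, contDiff_foldG K δ,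
      fun t => by simp [foldF], foldG_neg K δ, fun t ht => ⟨foldF_pos hC1 (by linarith),
        wronskian_pos hC1 hK0 hδ0 (by linarith) ht, by simp [deriv_foldF]⟩, fun y t s ht => ?_⟩⟩
  refine fval_ext ?_
  rw [fval_interpForm, hσ.collar (y, t, s) (ht.trans (by linarith)),
    fval_glueForm_of_lt hδ0 (p := (y, t, s)) ht]
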